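/- Let $H=\mathbb Z_3^{1}\times\mathbb Z_2^{7}$ be the set of words with one ternary coordinate (written first) and seven binary coordinates. For $w,x\in H$ let $d(w,x)$ be the Hamming distance, i.e. the number of coordinates in which $w$ and $x$ differ, and let $d^b(w,x)$ be the number of binary coordinates in which they differ. The minimum distance of a code $C\subseteq H$ is $d(C)=\min\{d(w,x): w,x\in C,\ w\ne x\}$ (with $d(C)=\infty$ if $|C|\le 1$). Let $N(7,1;3)$ be the maximal cardinality of a code $C\subseteq H$ with $d(C)\ge 3$, and call a code with $d(C)\ge 3$ and $|C|=N(7,1;3)$ optimal. Then: 1. $N(7,1;3)=26$. 2. Every optimal code $C$ has exactly $26$ codewords and minimum distance exactly $3$, and it contains two codewords $w,w'$ with $d(w,w')=3$ and $d^b(w,w')=3$, that is, two codewords at distance $3$ that differ only in binary coordinates. 3. There is an optimal code that contains both words $00000000$ and $00000111$. -/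

import Mathlib

/-- The words with `b` binary and `t` ternary coordinates; the ternary part is written first. -/
abbrev BTWord (b t : ℕ) : Type := (Fin t → ZMod 3) × (Fin b → ZMod 2)

namespace BTWord

variable {b t : ℕ}

/-- The number of binary coordinates in which two words differ. -/
def binDist (w x : BTWord b t) : ℕ := hammingDist w.2 x.2

/-- The number of ternary coordinates in which two words differ. -/
def terDist (w x : BTWord b t) : ℕ := hammingDist w.1 x.1

/-- The Hamming distance: the number of all coordinates in which two words differ. -/
def dist (w x : BTWord b t) : ℕ := binDist w x + terDist w x

/-- The minimum distance of a code: the minimum of the distances of two distinct codewords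
(`⊤` for a code with at most one word). -/
noncomputable def minDist (C : Finset (BTWord b t)) : ℕ∞ :=
  ⨅ w ∈ C, ⨅ x ∈ C, ⨅ _ : w ≠ x, (dist w x : ℕ∞)

/-- `C` is a Hamming packing for the distance `d`: its minimum distance is at least `d`, and no
code with this property has more words. -/
def IsHammingPacking (d : ℕ) (C : Finset (BTWord b t)) : Prop :=
  (d : ℕ∞) ≤ minDist C ∧
    ∀ C' : Finset (BTWord b t), (d : ℕ∞) ≤ minDist C' → C'.card ≤ C.card

/-- `maxCard b t d` is `N(b, t; d)`, the largest cardinality of a code with `b` binary and `t`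
ternary coordinates whose minimum distance is at least `d`. -/
noncomputable def maxCard (b t d : ℕ) : ℕ :=
  sSup {m : ℕ | ∃ C : Finset (BTWord b t), (d : ℕ∞) ≤ minDist C ∧ C.card = m}

/-- The supremum in `maxCard` is a maximum. -/
theorem isGreatest_maxCard (b t d : ℕ) :
    IsGreatest {m : ℕ | ∃ C : Finset (BTWord b t), (d : ℕ∞) ≤ minDist C ∧ C.card = m}
      (maxCard b t d) := by
  have hb : BddAbove {m : ℕ | ∃ C : Finset (BTWord b t), (d : ℕ∞) ≤ minDist C ∧ C.card = m} := by
    refine ⟨Fintype.card (BTWord b t), ?_⟩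
    rintro m ⟨C, -, rfl⟩
    exact C.card_le_univ
  have hne : {m : ℕ | ∃ C : Finset (BTWord b t),
      (d : ℕ∞) ≤ minDist C ∧ C.card = m}.Nonempty := ⟨0, ∅, by simp [minDist], rfl⟩
  exact ⟨Nat.sSup_mem hne hb, fun m hm => le_csSup hb hm⟩

end BTWord

namespace CliqueSearch

/-- The lowest binary digit of `U`, as a power of two. -/
def low (U : ℕ) : ℕ := Nat.sub U (Nat.land U (Nat.sub U 1))

/-- The row of the adjacency table `T` belonging to the vertex `i` with `b = 2 ^ i`. Two is a
primitive root modulo `197`, so the rows of the vertices below `196` do not overlap. -/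
def row (n T b : ℕ) : ℕ := Nat.shiftRight T (Nat.mul n (Nat.mod b 197))

/-- One step of the greedy choice of a clique: move the first vertex of `Q` from `U` to the
clique and continue with its neighbours in `Q`. -/
noncomputable def step (n T : ℕ) (next : ℕ → ℕ → ℕ) (U Q : ℕ) : ℕ :=
  Bool.rec ((fun b => next (Nat.sub U b)
    (Nat.land Q (Nat.shiftRight T (Nat.mul n (Nat.mod b 197)))))
      (Nat.sub Q (Nat.land Q (Nat.sub Q 1)))) U (Nat.beq Q 0)

/-- Remove from `U` a clique of at most `f` vertices that is chosen greedily from `Q`. -/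
noncomputable def clique (n T f : ℕ) : ℕ → ℕ → ℕ :=
  Nat.rec (fun U _ => U) (fun _ ih => step n T ih) f

/-- Four steps of the greedy choice of a clique. -/
noncomputable def steps (n T : ℕ) (next : ℕ → ℕ → ℕ) : ℕ → ℕ → ℕ :=
  step n T (step n T (step n T (step n T next)))

/-- Remove from `U` up to `k` cliques of at most twelve vertices. -/
noncomputable def peel (n T k : ℕ) : ℕ → ℕ :=
  Nat.rec (fun U => U) (fun _ ih U => Bool.rec
    (ih (steps n T (steps n T (steps n T fun U _ => U)) U U)) U (Nat.beq U 0)) k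

/-- Branch on the vertices of `U`, removing each from `P` afterwards. -/
noncomputable def branch (n T f : ℕ) (rec : ℕ → Bool) : ℕ → ℕ → Bool :=
  Nat.rec (fun _ _ => false) (fun _ ih U P => Bool.rec
    ((fun b => Bool.rec false (ih (Nat.sub U b) (Nat.sub P b))
      (rec (Nat.sub (Nat.sub P (Nat.land P (row n T b))) b))) (low U))
    true (Nat.beq U 0)) f

/-- `search n T k P` certifies that the vertices in `P` contain no independent set of size `k`. -/
noncomputable def search (n T k : ℕ) : ℕ → Bool :=
  Nat.rec (fun _ => false) (fun k ih P => branch n T 200 ih (peel n T k P) P) k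

/-- The adjacency relation stored in the table. -/
def Adj (n T i j : ℕ) : Prop := (row n T (2 ^ i)).testBit j = true

theorem low_spec {U : ℕ} (hU : U ≠ 0) : ∃ i, U.testBit i = true ∧ low U = 2 ^ i := by
  induction U using Nat.binaryRec with
  | zero => exact absurd rfl hU
  | bit b n ih =>
    cases b with
    | true =>
      refine ⟨0, by simp, ?_⟩
      have h : Nat.land (Nat.bit true n) (Nat.sub (Nat.bit true n) 1) = Nat.bit false n := by
        have h1 : Nat.sub (Nat.bit true n) 1 = Nat.bit false n := by
          simp [Nat.bit]
        rw [h1]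
        exact (Nat.land_bit true n false n).trans (by simp)
      unfold low
      rw [h]
      show Nat.bit true n - Nat.bit false n = 2 ^ 0
      simp only [Nat.bit, cond_true, cond_false]
      omega
    | false =>
      have hn : n ≠ 0 := by rintro rfl; exact hU rfl
      obtain ⟨i, hi, hl⟩ := ih hn
      refine ⟨i + 1, by rw [Nat.testBit_bit_succ]; exact hi, ?_⟩
      have h : Nat.land (Nat.bit false n) (Nat.sub (Nat.bit false n) 1)
          = Nat.bit false (Nat.land n (Nat.sub n 1)) := by
        have h1 : Nat.sub (Nat.bit false n) 1 = Nat.bit true (Nat.sub n 1) := by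
          show Nat.bit false n - 1 = Nat.bit true (n - 1)
          simp only [Nat.bit, cond_true, cond_false]
          omega
        rw [h1]
        exact (Nat.land_bit false n true (n - 1)).trans (by simp)
      have hl' : n - Nat.land n (Nat.sub n 1) = 2 ^ i := hl
      unfold low
      rw [h]
      show Nat.bit false n - Nat.bit false (Nat.land n (Nat.sub n 1)) = 2 ^ (i + 1)
      simp only [Nat.bit, cond_false, pow_succ]
      omega

theorem le_of_testBit_imp {P Q : ℕ} (h : ∀ i, Q.testBit i = true → P.testBit i = true) :
    Q ≤ P := by
  have hQ : Q = P &&& Q := by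
    apply Nat.eq_of_testBit_eq
    intro i
    rw [Nat.testBit_and]
    cases hq : Q.testBit i with
    | false => simp
    | true => simp [h i hq]
  rw [hQ]
  exact Nat.and_le_left

theorem testBit_sub_of_subset {P Q : ℕ} (h : ∀ i, Q.testBit i = true → P.testBit i = true)
    (j : ℕ) : (P - Q).testBit j = (P.testBit j && !Q.testBit j) := by
  induction j generalizing P Q with
  | zero =>
    have h0 := h 0
    have hle := le_of_testBit_imp h
    simp only [Nat.testBit_zero, decide_eq_true_eq] at h0 ⊢
    rcases Nat.mod_two_eq_zero_or_one P with hp | hp <;>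
      rcases Nat.mod_two_eq_zero_or_one Q with hq | hq
    · simp [hp, hq]; omega
    · exact absurd (h0 hq) (by omega)
    · simp [hp, hq]; omega
    · simp [hp, hq]; omega
  | succ j ih =>
    have h0 := h 0
    have hle := le_of_testBit_imp h
    simp only [Nat.testBit_zero, decide_eq_true_eq] at h0
    have h2 : (P - Q) / 2 = P / 2 - Q / 2 := by omega
    simp only [Nat.testBit_succ]
    rw [h2]
    apply ih
    intro i
    rw [← Nat.testBit_succ, ← Nat.testBit_succ]
    exact h (i + 1)

theorem testBit_sub_two_pow {P i : ℕ} (h : P.testBit i = true) (j : ℕ) :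
    (P - 2 ^ i).testBit j = (P.testBit j && !decide (i = j)) := by
  rw [testBit_sub_of_subset, Nat.testBit_two_pow]
  intro k hk
  rw [Nat.testBit_two_pow] at hk
  simp at hk
  exact hk ▸ h

/-- The finite set `X` is contained in the set of binary digits of `P`. -/
def Sub (X : Finset ℕ) (P : ℕ) : Prop := ∀ i ∈ X, P.testBit i = true

/-- No two elements of `X` are adjacent. -/
def Indep (n T : ℕ) (X : Finset ℕ) : Prop := ∀ i ∈ X, ∀ j ∈ X, ¬ Adj n T i j

theorem Indep.mono {n T : ℕ} {X Y : Finset ℕ} (h : Indep n T X) (hY : Y ⊆ X) : Indep n T Y :=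
  fun i hi j hj => h i (hY hi) j (hY hj)

/-- The table has no loops at the vertices of `P`. -/
def Loopless (n T P : ℕ) : Prop := ∀ i, P.testBit i = true → ¬ Adj n T i i

theorem Loopless.mono {n T P Q : ℕ} (h : Loopless n T P)
    (hQ : ∀ i, Q.testBit i = true → P.testBit i = true) : Loopless n T Q :=
  fun i hi => h i (hQ i hi)

theorem testBit_and_row {n T P i j : ℕ} :
    (Nat.land P (row n T (2 ^ i))).testBit j = true ↔ P.testBit j = true ∧ Adj n T i j := by
  have : Nat.land P (row n T (2 ^ i)) = P &&& row n T (2 ^ i) := rfl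
  rw [this, Nat.testBit_and, Bool.and_eq_true, Adj]

/-- The vertices removed by `clique` are in `Q`, and at most one of them is in an independent
set. -/
theorem clique_spec {n T : ℕ} (f : ℕ) (U Q : ℕ) (hl : Loopless n T U)
    (hQU : ∀ i, Q.testBit i = true → U.testBit i = true) :
    (∀ i, (clique n T f U Q).testBit i = true → U.testBit i = true) ∧
    (∀ i, U.testBit i = true → (clique n T f U Q).testBit i = false → Q.testBit i = true) ∧
    ∀ X, Indep n T X → Sub X U → (X.filter fun i => (clique n T f U Q).testBit i = false).card ≤ 1
    := by
  induction f generalizing U Q with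
  | zero =>
    have : clique n T 0 U Q = U := rfl
    rw [this]
    refine ⟨fun i h => h, fun i h h' => by simp [h] at h', fun X _ hX => ?_⟩
    rw [Finset.filter_false_of_mem]
    · simp
    · intro i hi
      simp [hX i hi]
  | succ f ih =>
    by_cases hQ : Q = 0
    · have : clique n T (f + 1) U Q = U := by subst hQ; rfl
      rw [this]
      refine ⟨fun i h => h, fun i h h' => by simp [h] at h', fun X _ hX => ?_⟩
      rw [Finset.filter_false_of_mem]
      · simp
      · intro i hi
        simp [hX i hi]
    · obtain ⟨v, hv, hlow⟩ := low_spec hQ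
      have hstep : clique n T (f + 1) U Q
          = clique n T f (U - 2 ^ v) (Nat.land Q (row n T (2 ^ v))) := by
        have hb : Nat.beq Q 0 = false := by
          cases Q with
          | zero => exact absurd rfl hQ
          | succ k => rfl
        have : clique n T (f + 1) U Q = Bool.rec (motive := fun _ => ℕ)
          (clique n T f (Nat.sub U (low Q)) (Nat.land Q (row n T (low Q)))) U (Nat.beq Q 0) := rfl
        rw [this, hb, hlow]
        rfl
      have hvU := hQU v hv
      have hbit := testBit_sub_two_pow hvU
      have hsub : ∀ i, (Nat.land Q (row n T (2 ^ v))).testBit i = true →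
          (U - 2 ^ v).testBit i = true := by
        intro i hi
        rw [testBit_and_row] at hi
        rw [hbit, hQU i hi.1]
        have : v ≠ i := by
          rintro rfl
          exact hl v hvU hi.2
        simp [this]
      have hl' : Loopless n T (U - 2 ^ v) := hl.mono fun i hi => by
        rw [hbit] at hi; simp at hi; exact hi.1
      obtain ⟨h1, h2, h3⟩ := ih (U - 2 ^ v) (Nat.land Q (row n T (2 ^ v))) hl' hsub
      rw [hstep]
      refine ⟨fun i hi => ?_, fun i hi hi' => ?_, fun X hX hXU => ?_⟩
      · have := h1 i hi
        rw [hbit] at this; simp at this; exact this.1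
      · by_cases hiv : v = i
        · exact hiv ▸ hv
        · have := h2 i (by rw [hbit]; simp [hi, hiv]) hi'
          rw [testBit_and_row] at this
          exact this.1
      · by_cases hvX : v ∈ X
        · have : (X.filter fun i => (clique n T f (U - 2 ^ v)
              (Nat.land Q (row n T (2 ^ v)))).testBit i = false) ⊆ {v} := by
            intro i hi
            rw [Finset.mem_filter] at hi
            rw [Finset.mem_singleton]
            by_contra hne
            have hiU : (U - 2 ^ v).testBit i = true := by
              rw [hbit, hXU i hi.1]; simp [Ne.symm hne]
            have := h2 i hiU hi.2
            rw [testBit_and_row] at this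
            exact hX v hvX i hi.1 this.2
          exact (Finset.card_le_card this).trans (by simp)
        · refine h3 X hX fun i hi => ?_
          rw [hbit, hXU i hi]
          have : v ≠ i := by rintro rfl; exact hvX hi
          simp [this]

theorem peel_spec {n T : ℕ} (k U : ℕ) (hl : Loopless n T U) :
    (∀ i, (peel n T k U).testBit i = true → U.testBit i = true) ∧
    ∀ X, Indep n T X → Sub X U → (X.filter fun i => (peel n T k U).testBit i = false).card ≤ k
    := by
  induction k generalizing U with
  | zero =>
    have : peel n T 0 U = U := rfl
    rw [this]
    refine ⟨fun i h => h, fun X _ hX => ?_⟩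
    rw [Finset.filter_false_of_mem]
    · simp
    · intro i hi
      simp [hX i hi]
  | succ k ih =>
    by_cases hU : U = 0
    · have : peel n T (k + 1) U = U := by subst hU; rfl
      rw [this]
      refine ⟨fun i h => h, fun X _ hX => ?_⟩
      rw [Finset.filter_false_of_mem]
      · simp
      · intro i hi
        simp [hX i hi]
    · have hstep : peel n T (k + 1) U = peel n T k (clique n T 12 U U) := by
        have hb : Nat.beq U 0 = false := by
          cases U with
          | zero => exact absurd rfl hU
          | succ k => rfl
        have : peel n T (k + 1) U = Bool.rec (motive := fun _ => ℕ)
          (peel n T k (clique n T 12 U U)) U (Nat.beq U 0) := rfl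
        rw [this, hb]
      obtain ⟨h1, -, h3⟩ := clique_spec 12 U U hl fun i h => h
      obtain ⟨h4, h5⟩ := ih (clique n T 12 U U) (hl.mono h1)
      rw [hstep]
      refine ⟨fun i hi => h1 i (h4 i hi), fun X hX hXU => ?_⟩
      have hA := h3 X hX hXU
      have hB := h5 (X.filter fun i => (clique n T 12 U U).testBit i = true)
        (hX.mono (Finset.filter_subset _ _)) fun i hi => (Finset.mem_filter.1 hi).2
      have : (X.filter fun i => (peel n T k (clique n T 12 U U)).testBit i = false) ⊆
          (X.filter fun i => (clique n T 12 U U).testBit i = false) ∪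
          ((X.filter fun i => (clique n T 12 U U).testBit i = true).filter
            fun i => (peel n T k (clique n T 12 U U)).testBit i = false) := by
        intro i hi
        rw [Finset.mem_filter] at hi
        rw [Finset.mem_union, Finset.mem_filter, Finset.mem_filter, Finset.mem_filter]
        cases hc : (clique n T 12 U U).testBit i with
        | false => exact Or.inl ⟨hi.1, rfl⟩
        | true => exact Or.inr ⟨⟨hi.1, rfl⟩, hi.2⟩
      have := (Finset.card_le_card this).trans (Finset.card_union_le _ _)
      omega

/-- What remains of `P` after the choice of the vertex `v`. -/
theorem testBit_delete {n T P v : ℕ} (hv : P.testBit v = true) (hl : ¬ Adj n T v v) (j : ℕ) :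
    (Nat.sub (Nat.sub P (Nat.land P (row n T (2 ^ v)))) (2 ^ v)).testBit j = true ↔
      P.testBit j = true ∧ ¬ Adj n T v j ∧ v ≠ j := by
  have h1 : ∀ i, (P - Nat.land P (row n T (2 ^ v))).testBit i
      = (P.testBit i && !(Nat.land P (row n T (2 ^ v))).testBit i) :=
    testBit_sub_of_subset fun i hi => (testBit_and_row.1 hi).1
  have hv' : (P - Nat.land P (row n T (2 ^ v))).testBit v = true := by
    rw [h1, hv]
    have : (Nat.land P (row n T (2 ^ v))).testBit v = false :=
      Bool.eq_false_iff.2 fun h => hl (testBit_and_row.1 h).2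
    rw [this]
    rfl
  show (P - Nat.land P (row n T (2 ^ v)) - 2 ^ v).testBit j = true ↔ _
  rw [testBit_sub_two_pow hv', h1]
  have := @testBit_and_row n T P v j
  cases hj : (Nat.land P (row n T (2 ^ v))).testBit j with
  | false =>
    rw [hj] at this
    simp at this
    simp
    tauto
  | true =>
    rw [hj] at this
    simp at this
    simp
    tauto

theorem branch_spec {n T k : ℕ} {rec : ℕ → Bool}
    (hrec : ∀ P, rec P = true → Loopless n T P → ∀ X, Indep n T X → Sub X P → X.card < k)
    (f : ℕ) (U P : ℕ) (h : branch n T f rec U P = true) (hl : Loopless n T P)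
    (hUP : ∀ i, U.testBit i = true → P.testBit i = true)
    (X : Finset ℕ) (hX : Indep n T X) (hXP : Sub X P)
    (hXU : ∀ Y ⊆ X, (∀ i ∈ Y, U.testBit i = false) → Y.card < k + 1) : X.card < k + 1 := by
  induction f generalizing U P with
  | zero => exact absurd h (by simp [branch])
  | succ f ih =>
    by_cases hU : U = 0
    · subst hU
      exact hXU X (le_refl _) (by simp)
    · obtain ⟨v, hv, hlow⟩ := low_spec hU
      have hb : Nat.beq U 0 = false := by
        cases U with
        | zero => exact absurd rfl hU
        | succ k => rfl
      have hstep : branch n T (f + 1) rec U P = Bool.rec (motive := fun _ => Bool)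
        (Bool.rec (motive := fun _ => Bool) false
          (branch n T f rec (Nat.sub U (low U)) (Nat.sub P (low U)))
          (rec (Nat.sub (Nat.sub P (Nat.land P (row n T (low U)))) (low U)))) true
          (Nat.beq U 0) := rfl
      rw [hstep, hb, hlow] at h
      have hvP := hUP v hv
      have hP' := testBit_sub_two_pow hvP
      have hU' := testBit_sub_two_pow hv
      cases hr : rec (Nat.sub (Nat.sub P (Nat.land P (row n T (2 ^ v)))) (2 ^ v)) with
      | false => rw [hr] at h; exact absurd h (by simp)
      | true =>
        rw [hr] at h
        have h' : branch n T f rec (U - 2 ^ v) (P - 2 ^ v) = true := h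
        have hdel := fun j => @testBit_delete n T P v hvP (hl v hvP) j
        by_cases hvX : v ∈ X
        · have hc := hrec _ hr (hl.mono fun i hi => ((hdel i).1 hi).1) (X.erase v)
            (hX.mono (Finset.erase_subset _ _)) (fun i hi => by
              rw [Finset.mem_erase] at hi
              exact (hdel i).2 ⟨hXP i hi.2, hX v hvX i hi.2, Ne.symm hi.1⟩)
          rw [Finset.card_erase_of_mem hvX] at hc
          omega
        · have hne : ∀ i ∈ X, v ≠ i := fun i hi h => hvX (h ▸ hi)
          refine ih (U - 2 ^ v) (P - 2 ^ v) h' (hl.mono fun i hi => ?_) (fun i hi => ?_)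
            (fun i hi => ?_) fun Y hY hYU => hXU Y hY fun i hi => ?_
          · rw [hP'] at hi; simp at hi; exact hi.1
          · rw [hU'] at hi; simp at hi
            rw [hP', hUP i hi.1]; simp [hi.2]
          · rw [hP', hXP i hi]; simp [hne i hi]
          · have := hYU i hi
            rw [hU'] at this
            simpa [hne i (hY hi)] using this

/-- A successful search certifies that no independent subset of `P` has `k` elements. -/
theorem search_spec {n T : ℕ} (k P : ℕ) (h : search n T k P = true) (hl : Loopless n T P)
    (X : Finset ℕ) (hX : Indep n T X) (hXP : Sub X P) : X.card < k := by
  induction k generalizing P X with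
  | zero => exact absurd h (by simp [search])
  | succ k ih =>
    obtain ⟨h1, h2⟩ := peel_spec (n := n) (T := T) k P hl
    refine branch_spec (fun P hP hl X hX hXP => ih P hP hl X hX hXP) 200 (peel n T k P) P h hl h1
      X hX hXP fun Y hY hYU => ?_
    have := h2 Y (hX.mono hY) fun i hi => hXP i (hY hi)
    rw [Finset.filter_true_of_mem hYU] at this
    omega

open BTWord

/-- The word with number `128 * c + x`: its ternary coordinate is `c`, and its binary coordinates
are the binary digits of `x`. -/
def dec (a : ℕ) : BTWord 7 1 :=
  (fun _ => ((a / 128 : ℕ) : ZMod 3), fun i => ((a / 2 ^ (i : ℕ) : ℕ) : ZMod 2))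

/-- The binary digit `a ^^^ b` of this number tells whether the words `a` and `b` are different
and have distance at most two. -/
def nearTable : ℕ := 726838724464839811802665264922344209357190924871750481383047438503172166885656387125853758822433674428902661291014524580417291890923390

/-- `near a b` is `1` if the words `a` and `b` are different and have distance at most two, and
`0` otherwise. -/
def near (a b : ℕ) : ℕ := Nat.mod (Nat.shiftRight nearTable (Nat.xor a b)) 2

/-- The distance of two words in terms of the bitwise difference of their numbers. -/
def weight (z : ℕ) : ℕ :=
  ((Finset.range 7).filter fun i => z.testBit i = true).card + if z / 128 = 0 then 0 else 1

theorem testBit_eq_iff_cast (a b i : ℕ) :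
    ((a / 2 ^ i : ℕ) : ZMod 2) ≠ ((b / 2 ^ i : ℕ) : ZMod 2) ↔ (a ^^^ b).testBit i = true := by
  rw [Ne, ZMod.natCast_eq_natCast_iff', Nat.testBit_xor, Nat.testBit_eq_decide_div_mod_eq,
    Nat.testBit_eq_decide_div_mod_eq]
  rcases Nat.mod_two_eq_zero_or_one (a / 2 ^ i) with h | h <;>
    rcases Nat.mod_two_eq_zero_or_one (b / 2 ^ i) with h' | h' <;> simp [h, h']

theorem dist_dec {a b : ℕ} (ha : a < 384) (hb : b < 384) :
    dist (dec a) (dec b) = weight (a ^^^ b) := by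
  have h1 : binDist (dec a) (dec b)
      = ((Finset.range 7).filter fun i => (a ^^^ b).testBit i = true).card := by
    unfold binDist hammingDist
    rw [← Finset.card_map (Fin.valEmbedding (n := 7))]
    congr 1
    ext i
    rw [Finset.mem_map, Finset.mem_filter, Finset.mem_range]
    constructor
    · rintro ⟨j, hj, rfl⟩
      exact ⟨j.2, (testBit_eq_iff_cast a b j).1 (Finset.mem_filter.1 hj).2⟩
    · rintro ⟨hi, h⟩
      exact ⟨⟨i, hi⟩, Finset.mem_filter.2
        ⟨Finset.mem_univ _, (testBit_eq_iff_cast a b i).2 h⟩, rfl⟩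
  have h2 : terDist (dec a) (dec b) = if (a ^^^ b) / 128 = 0 then 0 else 1 := by
    have hz : (a ^^^ b) / 128 = 0 ↔ a / 128 = b / 128 := by
      have : (a ^^^ b) / 128 = (a / 128) ^^^ (b / 128) := by
        have := Nat.shiftRight_xor_distrib (a := a) (b := b) (i := 7)
        simpa [Nat.shiftRight_eq_div_pow] using this
      rw [this, Nat.xor_eq_zero_iff]
    have hc : ((a / 128 : ℕ) : ZMod 3) = ((b / 128 : ℕ) : ZMod 3) ↔ a / 128 = b / 128 := by
      rw [ZMod.natCast_eq_natCast_iff']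
      omega
    unfold terDist hammingDist
    by_cases h : a / 128 = b / 128
    · rw [if_pos (hz.2 h), Finset.card_eq_zero, Finset.filter_eq_empty_iff]
      intro i _
      simp [dec, h]
    · rw [if_neg (mt hz.1 h), Finset.filter_true_of_mem]
      · simp
      · intro i _
        exact mt hc.1 h
  rw [BTWord.dist, h1, h2, weight]

theorem xor_lt {a b : ℕ} (ha : a < 384) (hb : b < 384) : a ^^^ b < 512 :=
  Nat.xor_lt_two_pow (n := 9) (by omega) (by omega)

theorem near_spec {a b : ℕ} (ha : a < 384) (hb : b < 384) (h : near a b = 1) :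
    dec a ≠ dec b ∧ dist (dec a) (dec b) < 3 := by
  have key : ∀ z < 512, Nat.mod (Nat.shiftRight nearTable z) 2 = 1 →
      0 < weight z ∧ weight z < 3 := by decide +kernel
  have := key (a ^^^ b) (xor_lt ha hb) h
  rw [dist_dec ha hb]
  refine ⟨fun he => ?_, this.2⟩
  have h0 := dist_dec ha hb
  rw [he] at h0
  have : dist (dec b) (dec b) = 0 := by simp [BTWord.dist, binDist, terDist]
  omega

theorem dec_injOn {a b : ℕ} (ha : a < 384) (hb : b < 384) (h : dec a = dec b) : a = b := by
  have key : ∀ z < 512, weight z = 0 → z = 0 := by decide +kernel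
  have h0 := dist_dec ha hb
  have h1 : dist (dec b) (dec b) = 0 := by simp [BTWord.dist, binDist, terDist]
  rw [h, h1] at h0
  exact Nat.xor_eq_zero_iff.1 (key _ (xor_lt ha hb) h0.symm)

theorem exists_dec (w : BTWord 7 1) : ∃ a < 384, dec a = w := by
  have hc : ((Finset.range 384).image dec).card = 384 := by
    rw [Finset.card_image_of_injOn, Finset.card_range]
    intro a ha b hb h
    simp at ha hb
    exact dec_injOn ha hb h
  have hu : (Finset.range 384).image dec = Finset.univ := by
    rw [← Finset.card_eq_iff_eq_univ, hc]
    simp [ZMod.card]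
  have := Finset.mem_univ w
  rw [← hu, Finset.mem_image] at this
  simpa using this

/-! ### Isometries -/

/-- A permutation of the words that preserves the distance. -/
def IsIsometry (e : Equiv.Perm (BTWord 7 1)) : Prop := ∀ x y, dist (e x) (e y) = dist x y

/-- The `i`-th octal digit of `p`. -/
def digit (p i : ℕ) : ℕ := Nat.mod (Nat.shiftRight p (Nat.mul 3 i)) 8

/-- The coordinate map with the octal digits of `p`. -/
def coord (p : ℕ) (i : Fin 7) : Fin 7 := Fin.ofNat 7 (digit p i)

/-- The map of the words that permutes the binary coordinates by `p`, adds the word `t` to them,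
and applies `c ↦ m * c + k` to the ternary coordinate. -/
def act (p t m k : ℕ) (w : BTWord 7 1) : BTWord 7 1 :=
  (fun _ => m * w.1 0 + k, fun i => w.2 (coord p i) + ((t / 2 ^ (i : ℕ) : ℕ) : ZMod 2))

/-- The `i`-th binary digit of the image of the word `a` under `act p t m k`. -/
def bit (p t a i : ℕ) : ℕ :=
  Nat.mod (Nat.add (Nat.shiftRight a (digit p i)) (Nat.shiftRight t i)) 2

/-- The number of the image of the word `a` under `act p t m k`. -/
def actNum (p t m k a : ℕ) : ℕ :=
  Nat.add (bit p t a 0) (Nat.mul 2 (Nat.add (bit p t a 1) (Nat.mul 2 (Nat.add (bit p t a 2)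
    (Nat.mul 2 (Nat.add (bit p t a 3) (Nat.mul 2 (Nat.add (bit p t a 4) (Nat.mul 2
    (Nat.add (bit p t a 5) (Nat.mul 2 (Nat.add (bit p t a 6)
    (Nat.mul 2 (Nat.mod (Nat.add (Nat.mul m (Nat.shiftRight a 7)) k) 3))))))))))))))

/-- The parameters describe an isometry. -/
def isMove (p m : ℕ) : Bool :=
  Nat.beq (Nat.lor (Nat.shiftLeft 1 (digit p 0)) (Nat.lor (Nat.shiftLeft 1 (digit p 1))
    (Nat.lor (Nat.shiftLeft 1 (digit p 2)) (Nat.lor (Nat.shiftLeft 1 (digit p 3))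
    (Nat.lor (Nat.shiftLeft 1 (digit p 4)) (Nat.lor (Nat.shiftLeft 1 (digit p 5))
    (Nat.shiftLeft 1 (digit p 6)))))))) 127 && Nat.ble 1 (Nat.mod m 3)

theorem exists_digit {p m : ℕ} (h : isMove p m = true) (j : Fin 7) :
    ∃ i : Fin 7, digit p i = j := by
  rw [isMove, Bool.and_eq_true] at h
  have h1 := Nat.eq_of_beq_eq_true h.1
  have h2 : (1 <<< digit p 0 ||| (1 <<< digit p 1 ||| (1 <<< digit p 2 ||| (1 <<< digit p 3 |||
    (1 <<< digit p 4 ||| (1 <<< digit p 5 ||| 1 <<< digit p 6)))))).testBit j = true := by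
    have h3 : (127 : ℕ).testBit j = true := by fin_cases j <;> rfl
    rw [← h3, ← h1]
    rfl
  simp only [Nat.testBit_or, Nat.one_shiftLeft, Nat.testBit_two_pow, Bool.or_eq_true,
    decide_eq_true_eq] at h2
  rcases h2 with h | h | h | h | h | h | h
  exacts [⟨0, h⟩, ⟨1, h⟩, ⟨2, h⟩, ⟨3, h⟩, ⟨4, h⟩, ⟨5, h⟩, ⟨6, h⟩]

theorem coord_bijective {p m : ℕ} (h : isMove p m = true) : Function.Bijective (coord p) := by
  refine Finite.surjective_iff_bijective.1 fun j => ?_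
  obtain ⟨i, hi⟩ := exists_digit h j
  refine ⟨i, Fin.ext ?_⟩
  show digit p i % 7 = j
  rw [hi]
  exact Nat.mod_eq_of_lt j.2

theorem digit_lt {p m : ℕ} (h : isMove p m = true) (i : Fin 7) : digit p i < 7 := by
  choose f hf using exists_digit h
  have hinj : Function.Injective f := fun a b hab => Fin.ext (by rw [← hf a, ← hf b, hab])
  obtain ⟨j, rfl⟩ := Finite.surjective_of_injective hinj i
  rw [hf]
  exact j.2

theorem dist_act {p m : ℕ} (h : isMove p m = true) (t k : ℕ) (x y : BTWord 7 1) :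
    dist (act p t m k x) (act p t m k y) = dist x y := by
  have hb := coord_bijective h
  have h1 : binDist (act p t m k x) (act p t m k y) = binDist x y := by
    unfold binDist hammingDist
    refine Finset.card_bij (fun i _ => coord p i) ?_ ?_ ?_
    · intro i hi
      simpa [act] using hi
    · intro i _ j _ hij
      exact hb.1 hij
    · intro j hj
      obtain ⟨i, rfl⟩ := hb.2 j
      exact ⟨i, by simpa [act] using hj, rfl⟩
  have h2 : terDist (act p t m k x) (act p t m k y) = terDist x y := by
    have hm : (m : ZMod 3) ≠ 0 := by
      rw [isMove, Bool.and_eq_true] at h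
      have h2 := Nat.le_of_ble_eq_true h.2
      have h3 : 1 ≤ m % 3 := h2
      rw [Ne, ZMod.natCast_eq_zero_iff]
      omega
    have : Fact (Nat.Prime 3) := ⟨Nat.prime_three⟩
    unfold terDist hammingDist
    congr 1
    ext i
    have hi : i = 0 := Subsingleton.elim _ _
    subst hi
    rw [Finset.mem_filter, Finset.mem_filter]
    simp [act, hm]
  rw [BTWord.dist, BTWord.dist, h1, h2]

theorem eq_of_dist_eq_zero {x y : BTWord 7 1} (h : dist x y = 0) : x = y := by
  simp only [BTWord.dist, binDist, terDist, Nat.add_eq_zero_iff, hammingDist_eq_zero] at h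
  exact Prod.ext h.2 h.1

/-- The isometry with the given parameters. -/
noncomputable def move (p t m k : ℕ) (h : isMove p m = true) : Equiv.Perm (BTWord 7 1) :=
  Equiv.ofBijective (act p t m k) (Finite.injective_iff_bijective.1 fun x y hxy =>
    eq_of_dist_eq_zero (by
      rw [← dist_act h t k, hxy]
      simp [BTWord.dist, binDist, terDist]))

theorem isIsometry_move {p t m k : ℕ} (h : isMove p m = true) : IsIsometry (move p t m k h) :=
  fun x y => dist_act h t k x y

theorem dec_actNum {p t m k : ℕ} (h : isMove p m = true) (a : ℕ) :
    dec (actNum p t m k a) = move p t m k h (dec a) := by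
  have hbit : ∀ i, bit p t a i < 2 := fun i => Nat.mod_lt _ (by norm_num)
  have hb0 := hbit 0
  have hb1 := hbit 1
  have hb2 := hbit 2
  have hb3 := hbit 3
  have hb4 := hbit 4
  have hb5 := hbit 5
  have hb6 := hbit 6
  have hnum : actNum p t m k a = bit p t a 0 + 2 * (bit p t a 1 + 2 * (bit p t a 2 + 2 *
    (bit p t a 3 + 2 * (bit p t a 4 + 2 * (bit p t a 5 + 2 * (bit p t a 6 + 2 *
    ((m * (a / 128) + k) % 3))))))) := by
    have : a >>> 7 = a / 128 := by rw [Nat.shiftRight_eq_div_pow]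
    rw [← this]
    rfl
  show dec _ = act p t m k (dec a)
  refine Prod.ext ?_ ?_
  · funext i
    have : actNum p t m k a / 128 = (m * (a / 128) + k) % 3 := by omega
    show ((actNum p t m k a / 128 : ℕ) : ZMod 3) = m * ((a / 128 : ℕ) : ZMod 3) + k
    rw [this, ZMod.natCast_mod]
    push_cast
    rfl
  · funext i
    show ((actNum p t m k a / 2 ^ (i : ℕ) : ℕ) : ZMod 2)
      = ((a / 2 ^ (coord p i : ℕ) : ℕ) : ZMod 2) + ((t / 2 ^ (i : ℕ) : ℕ) : ZMod 2)
    have hc : (coord p i : ℕ) = digit p i := Nat.mod_eq_of_lt (digit_lt h i)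
    have hbi : bit p t a i = (a / 2 ^ digit p i + t / 2 ^ (i : ℕ)) % 2 := by
      rw [← Nat.shiftRight_eq_div_pow, ← Nat.shiftRight_eq_div_pow]
      rfl
    have : actNum p t m k a / 2 ^ (i : ℕ) % 2 = bit p t a i := by
      fin_cases i <;> simp only [] <;> norm_num <;> omega
    rw [hc, ← Nat.cast_add, ZMod.natCast_eq_natCast_iff', this, hbi]

/-- Certificates that a set of words is not contained in a code: `leaf` calls for a search, `iso`
gives an isometry from an excluded set to a subset of the chosen words, `split` asks for some of
the words of a block by which `cons` and `nil` branch. -/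
inductive Tree : Type
  | leaf : Tree
  | iso (i p t m k : ℕ) : Tree
  | split (s : Tree) : Tree
  | cons (s s' : Tree) : Tree
  | nil : Tree

/-- The word of the vertex `i` with `b = 2 ^ i`. -/
def word (W b : ℕ) : ℕ := Nat.mod (Nat.shiftRight W (Nat.mul 9 (Nat.mod b 197))) 512

/-- The isometry with the parameters `p` and `t` does not change the coordinates `5` and `6`. -/
def isFix (p t : ℕ) : Bool :=
  Nat.beq (digit p 5) 5 && (Nat.beq (digit p 6) 6 && Nat.blt t 32)

/-- The set of the numbers in a list, given by binary digits. -/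
def maskSet (l : List ℕ) : ℕ := l.foldr (fun a s => Nat.lor (Nat.shiftLeft 1 a) s) 0

theorem testBit_lor_shiftLeft {S a b : ℕ}
    (h : (Nat.lor (Nat.shiftLeft 1 b) S).testBit a = true) : a = b ∨ S.testBit a = true := by
  have h' : ((1 <<< b) ||| S).testBit a = true := h
  rw [Nat.testBit_or, Nat.one_shiftLeft, Nat.testBit_two_pow, Bool.or_eq_true] at h'
  rcases h' with h' | h'
  · simp at h'
    exact Or.inl h'.symm
  · exact Or.inr h'

theorem mem_of_testBit_maskSet {l : List ℕ} {a : ℕ} (h : (maskSet l).testBit a = true) :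
    a ∈ l := by
  induction l with
  | nil => simp [maskSet] at h
  | cons b l ih =>
    rcases testBit_lor_shiftLeft h with rfl | h
    · exact List.mem_cons_self
    · exact List.mem_cons_of_mem _ (ih h)

theorem testBit_of_beq {S a : ℕ} (h : Nat.beq (Nat.mod (Nat.shiftRight S a) 2) 1 = true) :
    S.testBit a = true := by
  rw [Nat.testBit_eq_decide_div_mod_eq, decide_eq_true_eq, ← Nat.shiftRight_eq_div_pow]
  exact Nat.eq_of_beq_eq_true h

/-- The image of the words `A` is contained in the set `S`. -/
def mapsInto (p t m k : ℕ) (A : List ℕ) (S : ℕ) : Bool :=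
  A.all fun a => Nat.beq (Nat.mod (Nat.shiftRight S (actNum p t m k a)) 2) 1

/-- What remains of `P` after the choice of the vertex with the binary digit `b`. -/
def delete (n T P b : ℕ) : ℕ := Nat.sub (Nat.sub P (Nat.land P (row n T b))) b

/-- Check a certificate. The set `S` consists of the chosen words, `P` of the vertices that
are still available, at least `k` of which are needed, and at least `q` from `M`. Fewer than `q`
vertices are in `M` and outside of `U`. -/
noncomputable def run (strict : Bool) (n T W M : ℕ) (DB : List (List ℕ)) :
    Tree → ℕ → ℕ → ℕ → ℕ → ℕ → Bool
  | .leaf, _, _, P, _, k => search n T k P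
  | .iso i p t m k, S, _, _, _, _ => isMove p m && ((!strict || isFix p t) &&
      ((DB.drop i).take 1).any fun A => mapsInto p t m k A S)
  | .split s, S, _, P, q, k =>
      run strict n T W M DB s S (peel n T (Nat.sub q 1) (Nat.land P M)) P q k
  | .cons s s', S, U, P, q, k => Nat.blt 0 q && (Nat.blt 0 U && (fun b =>
      (fun P' => run strict n T W M DB s (Nat.lor (Nat.shiftLeft 1 (word W b)) S) P' P'
        (Nat.sub q 1) (Nat.sub k 1))
        (delete n T P b) &&
      run strict n T W M DB s' S (Nat.sub U b) (Nat.sub P b) q k) (low U))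
  | .nil, _, U, _, q, _ => Nat.blt 0 q && Nat.beq U 0

/-- No two words of `C` have distance less than three. -/
def IsCode (C : Finset (BTWord 7 1)) : Prop := ∀ w ∈ C, ∀ x ∈ C, w ≠ x → 3 ≤ dist w x

/-- The preimage of a code under an isometry. -/
noncomputable def pull (p t m k : ℕ) (h : isMove p m = true) (C : Finset (BTWord 7 1)) :
    Finset (BTWord 7 1) := C.map (move p t m k h).symm.toEmbedding

theorem mem_pull {p t m k : ℕ} {h : isMove p m = true} {C : Finset (BTWord 7 1)}
    {w : BTWord 7 1} : w ∈ pull p t m k h C ↔ move p t m k h w ∈ C := by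
  simp [pull, Finset.mem_map_equiv]

theorem dec_mem_pull {p t m k : ℕ} {h : isMove p m = true} {C : Finset (BTWord 7 1)}
    {a : ℕ} : dec a ∈ pull p t m k h C ↔ dec (actNum p t m k a) ∈ C := by
  rw [mem_pull, dec_actNum h]

theorem IsCode.pull {p t m k : ℕ} {h : isMove p m = true} {C : Finset (BTWord 7 1)}
    (hC : IsCode C) : IsCode (pull p t m k h C) := by
  intro w hw x hx hne
  rw [mem_pull] at hw hx
  rw [← isIsometry_move (t := t) (k := k) h]
  exact hC _ hw _ hx fun he => hne ((move p t m k h).injective he)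

theorem card_pull {p t m k : ℕ} {h : isMove p m = true} {C : Finset (BTWord 7 1)} :
    (CliqueSearch.pull p t m k h C).card = C.card := Finset.card_map _

theorem testBit_of_mapsInto {p t m k S : ℕ} {A : List ℕ} (h : mapsInto p t m k A S = true) :
    ∀ a ∈ A, S.testBit (actNum p t m k a) = true :=
  fun a ha => testBit_of_beq (List.all_eq_true.1 h a ha)

theorem low_of_blt {U : ℕ} (h : Nat.blt 0 U = true) :
    ∃ i, U.testBit i = true ∧ low U = 2 ^ i := by
  apply low_spec
  rintro rfl
  exact absurd h (by decide)

/-- The property of the predicate `K` of codes that makes `run` sound. -/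
def Closed (strict : Bool) (K : Finset (BTWord 7 1) → Prop) : Prop :=
  ∀ p t m k (h : isMove p m = true), (strict = true → isFix p t = true) →
    ∀ C, K C → K (pull p t m k h C)

theorem run_spec {strict : Bool} {n T W M : ℕ} {DB : List (List ℕ)}
    {K : Finset (BTWord 7 1) → Prop} (hK : Closed strict K)
    (hDB : ∀ A ∈ DB, ∀ C, K C → ¬ ∀ a ∈ A, dec a ∈ C) {C : Finset (BTWord 7 1)} (hC : K C)
    (s : Tree) (S U P q k : ℕ) (h : run strict n T W M DB s S U P q k = true)
    (hS : ∀ a, S.testBit a = true → dec a ∈ C) (hl : Loopless n T P)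
    (hUP : ∀ i, U.testBit i = true → P.testBit i = true)
    (X : Finset ℕ) (hXC : ∀ i ∈ X, dec (word W (2 ^ i)) ∈ C) (hX : Indep n T X) (hXP : Sub X P)
    (hk : k ≤ X.card) (hq : q ≤ (X.filter fun i => M.testBit i = true).card)
    (hU : q = 0 ∨ (X.filter fun i => M.testBit i = true ∧ U.testBit i = false).card < q) :
    False := by
  induction s generalizing S U P q k X with
  | leaf => exact absurd (search_spec k P h hl X hX hXP) (by omega)
  | iso i p t m k' =>
    simp only [run, Bool.and_eq_true, Bool.or_eq_true, Bool.not_eq_true'] at h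
    obtain ⟨hm, hf, hA⟩ := h
    obtain ⟨A, hA, hAS⟩ := List.any_eq_true.1 hA
    refine hDB A (List.mem_of_mem_drop (List.mem_of_mem_take hA)) (pull p t m k' hm C)
      (hK p t m k' hm (fun hs => ?_) C hC) fun a ha => ?_
    · rcases hf with hf | hf
      · rw [hs] at hf; exact absurd hf (by decide)
      · exact hf
    · rw [dec_mem_pull]
      exact hS _ (testBit_of_mapsInto hAS a ha)
  | split s ih =>
    have h' : run strict n T W M DB s S (peel n T (q - 1) (P &&& M)) P q k = true := h
    have hsub : ∀ i, (P &&& M).testBit i = true → P.testBit i = true := by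
      intro i hi
      rw [Nat.testBit_and, Bool.and_eq_true] at hi
      exact hi.1
    obtain ⟨h1, h2⟩ := peel_spec (n := n) (T := T) (q - 1) (P &&& M) (hl.mono hsub)
    refine ih S _ P q k h' hS hl (fun i hi => hsub i (h1 i hi)) X hXC hX hXP hk hq ?_
    by_cases hq0 : q = 0
    · exact Or.inl hq0
    · right
      have := h2 (X.filter fun i => M.testBit i = true) (hX.mono (Finset.filter_subset _ _))
        fun i hi => by
          rw [Finset.mem_filter] at hi
          rw [Nat.testBit_and, hXP i hi.1, hi.2]
          rfl
      rw [Finset.filter_filter] at this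
      omega
  | cons s s' ih ih' =>
    have h' : (Nat.blt 0 q && (Nat.blt 0 U &&
        (run strict n T W M DB s (Nat.lor (Nat.shiftLeft 1 (word W (low U))) S)
          (delete n T P (low U))
          (delete n T P (low U)) (q - 1) (k - 1) &&
        run strict n T W M DB s' S (U - low U) (P - low U) q k))) = true := h
    simp only [Bool.and_eq_true] at h'
    obtain ⟨hq0, hU0, h1, h2⟩ := h'
    have hq0 : 0 < q := Nat.le_of_ble_eq_true hq0
    obtain ⟨v, hv, hlow⟩ := low_of_blt hU0
    rw [hlow] at h1 h2
    have hvP := hUP v hv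
    have hdel : ∀ j, (delete n T P (2 ^ v)).testBit j = true ↔
        P.testBit j = true ∧ ¬ Adj n T v j ∧ v ≠ j := testBit_delete hvP (hl v hvP)
    by_cases hvX : v ∈ X
    · refine ih _ _ _ _ _ h1 ?_ (hl.mono fun i hi => ((hdel i).1 hi).1) (fun _ h => h)
        (X.erase v) (fun i hi => hXC i (Finset.mem_of_mem_erase hi))
        (hX.mono (Finset.erase_subset _ _)) (fun i hi => ?_) ?_ ?_ ?_
      · intro a ha
        rcases testBit_lor_shiftLeft ha with rfl | ha
        · exact hXC v hvX
        · exact hS a ha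
      · rw [Finset.mem_erase] at hi
        exact (hdel i).2 ⟨hXP i hi.2, hX v hvX i hi.2, Ne.symm hi.1⟩
      · rw [Finset.card_erase_of_mem hvX]
        omega
      · rw [Finset.filter_erase]
        have := Finset.pred_card_le_card_erase (s := X.filter fun i => M.testBit i = true) (a := v)
        omega
      · rcases Nat.eq_zero_or_pos (q - 1) with h0 | h0
        · exact Or.inl h0
        · right
          rw [Finset.filter_false_of_mem, Finset.card_empty]
          · exact h0
          · rintro i hi ⟨-, hi'⟩
            rw [Finset.mem_erase] at hi
            rw [(hdel i).2 ⟨hXP i hi.2, hX v hvX i hi.2, Ne.symm hi.1⟩] at hi'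
            exact absurd hi' (by decide)
    · have hne : ∀ i ∈ X, v ≠ i := fun i hi h => hvX (h ▸ hi)
      have hP' := testBit_sub_two_pow hvP
      have hU' := testBit_sub_two_pow hv
      refine ih' S _ _ q k h2 hS (hl.mono fun i hi => ?_) (fun i hi => ?_) X hXC hX
        (fun i hi => ?_) hk hq (Or.inr ?_)
      · rw [hP'] at hi; simp at hi; exact hi.1
      · rw [hU'] at hi; simp at hi
        rw [hP', hUP i hi.1]; simp [hi.2]
      · rw [hP', hXP i hi]; simp [hne i hi]
      · have : (X.filter fun i => M.testBit i = true ∧ (U - 2 ^ v).testBit i = false)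
            = X.filter fun i => M.testBit i = true ∧ U.testBit i = false := by
          apply Finset.filter_congr
          intro i hi
          rw [hU']
          simp [hne i hi]
        rw [this]
        rcases hU with h | h
        · omega
        · exact h
  | nil =>
    simp only [run, Bool.and_eq_true] at h
    have hq0 : 0 < q := Nat.le_of_ble_eq_true h.1
    have hU0 : U = 0 := Nat.eq_of_beq_eq_true h.2
    subst hU0
    simp only [Nat.zero_testBit, and_true] at hU
    omega

/-! ### Tables -/

/-- Write the numbers of a list, which have `w` binary digits, into a table. The powers of two
modulo `197` serve as the positions. -/
noncomputable def pack (w b : ℕ) (l : List ℕ) : ℕ :=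
  List.rec (fun _ => 0) (fun v _ ih b =>
    Nat.lor (Nat.shiftLeft v (Nat.mul w (Nat.mod b 197))) (ih (Nat.mul 2 b))) l b

theorem two_pow_mod_injOn : ∀ i < 196, ∀ j < 196, 2 ^ i % 197 = 2 ^ j % 197 → i = j := by
  have key : ∀ i < 196, 2 ^ i % 197 = 1 → i = 0 := by decide +kernel
  have main : ∀ i j, i ≤ j → j < 196 → 2 ^ i % 197 = 2 ^ j % 197 → i = j := by
    intro i j hij hj h
    have hd : 197 ∣ 2 ^ i * (2 ^ (j - i) - 1) := by
      rw [Nat.mul_sub, mul_one, ← pow_add, Nat.add_sub_cancel' hij]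
      exact (Nat.modEq_iff_dvd' (Nat.pow_le_pow_right (by norm_num) hij)).1 h
    have hc : Nat.Coprime 197 (2 ^ i) := Nat.Coprime.pow_right i (by norm_num)
    have hd' := hc.dvd_of_dvd_mul_left hd
    have h1 : 1 ≤ 2 ^ (j - i) := Nat.one_le_two_pow
    have := key (j - i) (by omega) ((Nat.modEq_iff_dvd' h1).2 hd').symm
    omega
  intro i hi j hj h
  rcases le_total i j with hij | hij
  · exact main i j hij hj h
  · exact (main j i hij hi h.symm).symm

theorem testBit_pack {w : ℕ} (l : List ℕ) (s : ℕ) (hs : s + l.length ≤ 196)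
    (hl : ∀ v ∈ l, v < 2 ^ w) (r j : ℕ) (hr : r < 196) (hj : j < w) :
    (pack w (2 ^ s) l).testBit (w * (2 ^ r % 197) + j)
      = (decide (s ≤ r) && (l.getD (r - s) 0).testBit j) := by
  induction l generalizing s with
  | nil => simp [pack]
  | cons v l ih =>
    rw [List.length_cons] at hs
    have hih := ih (s + 1) (by omega) fun v hv => hl v (List.mem_cons_of_mem _ hv)
    have hstep : pack w (2 ^ s) (v :: l) =
        v <<< (w * (2 ^ s % 197)) ||| pack w (2 ^ (s + 1)) l := by
      rw [pow_succ, mul_comm (2 ^ s) 2]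
      rfl
    rw [hstep, Nat.testBit_or, hih, Nat.testBit_shiftLeft]
    by_cases hrs : r = s
    · subst hrs
      simp
    · have hne : 2 ^ r % 197 ≠ 2 ^ s % 197 := fun h =>
        hrs (two_pow_mod_injOn r hr s (by omega) h)
      have h0 : (decide (w * (2 ^ r % 197) + j ≥ w * (2 ^ s % 197)) &&
          v.testBit (w * (2 ^ r % 197) + j - w * (2 ^ s % 197))) = false := by
        rcases lt_or_gt_of_ne hne with hlt | hlt
        · have : w * (2 ^ r % 197 + 1) ≤ w * (2 ^ s % 197) := Nat.mul_le_mul_left w hlt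
          rw [mul_add, mul_one] at this
          simp
          omega
        · have : w * (2 ^ s % 197 + 1) ≤ w * (2 ^ r % 197) := Nat.mul_le_mul_left w hlt
          rw [mul_add, mul_one] at this
          rw [Nat.testBit_lt_two_pow, Bool.and_false]
          exact lt_of_lt_of_le (hl v List.mem_cons_self)
            (Nat.pow_le_pow_right (by norm_num) (by omega))
      rw [h0, Bool.false_or]
      by_cases hsr : s ≤ r
      · have h1 : s + 1 ≤ r := by omega
        have h2 : r - s = (r - (s + 1)) + 1 := by omega
        rw [h2, List.getD_cons_succ]
        simp [hsr, h1]
      · have h1 : ¬ s + 1 ≤ r := by omega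
        simp [hsr, h1]

/-- The number whose binary digits are the values of `f` at the elements of the list. -/
noncomputable def maskOf (f : ℕ → Bool) (l : List ℕ) : ℕ :=
  List.rec 0 (fun a _ ih => Bool.rec (Nat.mul 2 ih) (Nat.add (Nat.mul 2 ih) 1) (f a)) l

theorem maskOf_cons (f : ℕ → Bool) (a : ℕ) (l : List ℕ) :
    maskOf f (a :: l) = Nat.bit (f a) (maskOf f l) := by
  have h : maskOf f (a :: l) = Bool.rec (motive := fun _ => ℕ) (Nat.mul 2 (maskOf f l))
    (Nat.add (Nat.mul 2 (maskOf f l)) 1) (f a) := rfl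
  rw [h]
  cases f a <;> rfl

theorem testBit_maskOf {f : ℕ → Bool} (l : List ℕ) (i : ℕ) :
    (maskOf f l).testBit i = true ↔ i < l.length ∧ f (l.getD i 0) = true := by
  induction l generalizing i with
  | nil => simp [maskOf]
  | cons a l ih =>
    cases i with
    | zero => simp [maskOf_cons]
    | succ i => rw [maskOf_cons, Nat.testBit_bit_succ, ih]; simp

theorem maskOf_lt (f : ℕ → Bool) (l : List ℕ) : maskOf f l < 2 ^ l.length := by
  apply Nat.lt_pow_two_of_testBit
  intro i hi
  rw [Bool.eq_false_iff, Ne, testBit_maskOf]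
  omega

/-- The adjacency table of the words in `o`. -/
noncomputable def table (n : ℕ) (o : List ℕ) : ℕ :=
  pack n 1 (o.map fun a => maskOf (fun b => Nat.beq (near a b) 1) o)

theorem near_of_adj {o : List ℕ} (ho : o.length ≤ 196) {i j : ℕ} (hi : i < o.length)
    (hj : j < o.length) (h : Adj o.length (table o.length o) i j) :
    near (o.getD i 0) (o.getD j 0) = 1 := by
  have h1 : ((table o.length o) >>> (o.length * (2 ^ i % 197))).testBit j = true := h
  rw [Nat.testBit_shiftRight] at h1
  have h2 := testBit_pack (w := o.length)
    (o.map fun a => maskOf (fun b => Nat.beq (near a b) 1) o) 0 (by simpa using ho) (by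
      intro v hv
      obtain ⟨a, -, rfl⟩ := List.mem_map.1 hv
      exact maskOf_lt _ _) i j (by omega) hj
  rw [pow_zero] at h2
  have h1' := h2.symm.trans h1
  have h3 : (o.map fun a => maskOf (fun b => Nat.beq (near a b) 1) o).getD i 0
      = maskOf (fun b => Nat.beq (near (o.getD i 0) b) 1) o := by
    rw [List.getD_eq_getElem _ _ (by simpa using hi), List.getElem_map,
      List.getD_eq_getElem _ _ hi]
  rw [Nat.sub_zero, h3, Bool.and_eq_true, testBit_maskOf] at h1'
  exact Nat.eq_of_beq_eq_true h1'.2.2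

theorem word_pack {o : List ℕ} (ho : o.length ≤ 196) (h9 : ∀ a ∈ o, a < 384) {i : ℕ}
    (hi : i < o.length) : word (pack 9 1 o) (2 ^ i) = o.getD i 0 := by
  have hlt : o.getD i 0 < 2 ^ 9 := by
    rw [List.getD_eq_getElem _ _ hi]
    exact (h9 _ (List.getElem_mem hi)).trans (by norm_num)
  show ((pack 9 1 o) >>> (9 * (2 ^ i % 197))) % 2 ^ 9 = o.getD i 0
  apply Nat.eq_of_testBit_eq
  intro j
  rw [Nat.testBit_mod_two_pow]
  by_cases hj : j < 9
  · have h2 := testBit_pack (w := 9) o 0 (by simpa using ho)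
      (fun v hv => (h9 v hv).trans (by norm_num)) i j (by omega) hj
    rw [pow_zero] at h2
    rw [Nat.testBit_shiftRight, h2]
    simp [hj]
  · rw [Nat.testBit_lt_two_pow (hlt.trans_le (Nat.pow_le_pow_right (by norm_num) (by omega)))]
    simp [hj]

/-- The positions of the words in the list `o`. -/
def inverse : ℕ → List ℕ → ℕ
  | _, [] => 0
  | i, a :: l => Nat.lor (Nat.shiftLeft i (Nat.mul 8 a)) (inverse (Nat.succ i) l)

/-! ### The first level of the search -/

/-- Remove the images of the word `a` under the isometries in the list from `P`. -/
def prune (W V a : ℕ) : List (ℕ × ℕ × ℕ × ℕ) → ℕ → ℕ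
  | [], P => P
  | (p, t, m, k) :: G, P => prune W V a G ((fun a' => (fun b =>
      cond (Nat.beq (word W b) a' && Nat.beq (Nat.land P b) b) (Nat.sub P b) P)
        (Nat.pow 2 (Nat.mod (Nat.shiftRight V (Nat.mul 8 a')) 256))) (actNum p t m k a))

/-- Branch on vertices up to the isometries in `G`. Only the selected branches are checked. -/
noncomputable def roots (sel : ℕ → Bool) (strict : Bool) (n T W V M : ℕ) (DB : List (List ℕ))
    (R : ℕ) (G : List (ℕ × ℕ × ℕ × ℕ)) (s : Tree) (q k : ℕ) : ℕ → List (ℕ × Tree) → ℕ → Bool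
  | j, [], P => !sel j || run strict n T W M DB s R P P q k
  | j, (i, s') :: l, P => (fun b => (Nat.blt i n && Nat.beq (Nat.land P b) b) && (Nat.blt 0 q &&
      ((!sel j || (fun P' => run strict n T W M DB s' (Nat.lor (Nat.shiftLeft 1 (word W b)) R)
        P' P' (Nat.sub q 1) (Nat.sub k 1)) (delete n T P b)) &&
      roots sel strict n T W V M DB R G s q k (Nat.succ j) l
        (prune W V (word W b) G (Nat.sub P b)))))
        (Nat.pow 2 i)

/-- The vertices that belong to words of `C`. -/
noncomputable def vertices (n W : ℕ) (C : Finset (BTWord 7 1)) : Finset ℕ := by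
  classical exact (Finset.range n).filter fun i => dec (word W (2 ^ i)) ∈ C

theorem mem_vertices {n W : ℕ} {C : Finset (BTWord 7 1)} {i : ℕ} :
    i ∈ vertices n W C ↔ i < n ∧ dec (word W (2 ^ i)) ∈ C := by
  simp [vertices]

theorem testBit_of_land {P i : ℕ} (h : Nat.land P (2 ^ i) = 2 ^ i) : P.testBit i = true := by
  have h1 : (P &&& 2 ^ i).testBit i = true := by
    have h2 : P &&& 2 ^ i = 2 ^ i := h
    rw [h2, Nat.testBit_two_pow]
    simp
  rw [Nat.testBit_and, Bool.and_eq_true] at h1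
  exact h1.1

theorem prune_spec {n W V a : ℕ} {L : Finset (BTWord 7 1) → Prop}
    (G : List (ℕ × ℕ × ℕ × ℕ))
    (hG : ∀ g ∈ G, ∃ h : isMove g.1 g.2.2.1 = true,
      ∀ C, L C → L (pull g.1 g.2.1 g.2.2.1 g.2.2.2 h C))
    (ha : ∀ C, L C → dec a ∉ C) (P : ℕ) (hP : ∀ C, L C → Sub (vertices n W C) P) :
    (∀ i, (prune W V a G P).testBit i = true → P.testBit i = true) ∧
      ∀ C, L C → Sub (vertices n W C) (prune W V a G P) := by
  induction G generalizing P with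
  | nil => exact ⟨fun i h => h, hP⟩
  | cons g G ih =>
    obtain ⟨p, t, m, k⟩ := g
    obtain ⟨hm, hL⟩ := hG (p, t, m, k) List.mem_cons_self
    have ih' := ih fun g hg => hG g (List.mem_cons_of_mem _ hg)
    set a' := actNum p t m k a with ha'
    set i := Nat.mod (Nat.shiftRight V (Nat.mul 8 a')) 256 with hi
    have hstep : prune W V a ((p, t, m, k) :: G) P = prune W V a G
      (cond (Nat.beq (word W (2 ^ i)) a' && Nat.beq (Nat.land P (2 ^ i)) (2 ^ i)) (P - 2 ^ i) P) :=
      rfl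
    rw [hstep]
    cases hc : Nat.beq (word W (2 ^ i)) a' && Nat.beq (Nat.land P (2 ^ i)) (2 ^ i) with
    | false => exact ih' P hP
    | true =>
      rw [Bool.and_eq_true] at hc
      have h1 := Nat.eq_of_beq_eq_true hc.1
      have h2 := testBit_sub_two_pow (testBit_of_land (Nat.eq_of_beq_eq_true hc.2))
      obtain ⟨h3, h4⟩ := ih' (P - 2 ^ i) fun C hC j hj => by
        rw [h2, hP C hC j hj]
        have : i ≠ j := by
          rintro rfl
          rw [mem_vertices, h1, ha'] at hj
          exact ha _ (hL C hC) (dec_mem_pull.2 hj.2)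
        simp [this]
      refine ⟨fun j hj => ?_, h4⟩
      have := h3 j hj
      rw [h2] at this
      simp at this
      exact this.1

theorem roots_spec {strict : Bool} {n T W V M : ℕ} {DB : List (List ℕ)}
    {K L : Finset (BTWord 7 1) → Prop} (hK : Closed strict K)
    (hDB : ∀ A ∈ DB, ∀ C, K C → ¬ ∀ a ∈ A, dec a ∈ C) (hLK : ∀ C, L C → K C)
    {R : ℕ} (hR : ∀ C, L C → ∀ a, R.testBit a = true → dec a ∈ C) {G : List (ℕ × ℕ × ℕ × ℕ)}
    (hG : ∀ g ∈ G, ∃ h : isMove g.1 g.2.2.1 = true,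
      ∀ C, L C → L (pull g.1 g.2.1 g.2.2.1 g.2.2.2 h C)) {s : Tree} {q k : ℕ}
    (hX : ∀ C, L C → Indep n T (vertices n W C) ∧ k ≤ (vertices n W C).card ∧
      q ≤ ((vertices n W C).filter fun i => M.testBit i = true).card)
    (j : ℕ) (l : List (ℕ × Tree)) (P : ℕ)
    (h : roots (fun _ => true) strict n T W V M DB R G s q k j l P = true)
    (hl : Loopless n T P) (hP : ∀ C, L C → Sub (vertices n W C) P) : ∀ C, ¬ L C := by
  induction l generalizing P j with
  | nil =>
    intro C hC
    obtain ⟨h1, h2, h3⟩ := hX C hC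
    refine run_spec hK hDB (hLK C hC) s R P P q k h (hR C hC) hl (fun _ h => h) (vertices n W C)
      (fun i hi => (mem_vertices.1 hi).2) h1 (hP C hC) h2 h3 ?_
    rcases Nat.eq_zero_or_pos q with h0 | h0
    · exact Or.inl h0
    · right
      rw [Finset.filter_false_of_mem, Finset.card_empty]
      · exact h0
      · rintro i hi ⟨-, hi'⟩
        rw [hP C hC i hi] at hi'
        exact absurd hi' (by decide)
  | cons r l ih =>
    obtain ⟨v, s'⟩ := r
    have h' : ((Nat.blt v n && Nat.beq (Nat.land P (2 ^ v)) (2 ^ v)) && (Nat.blt 0 q &&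
      (run strict n T W M DB s' (Nat.lor (Nat.shiftLeft 1 (word W (2 ^ v))) R)
        (delete n T P (2 ^ v)) (delete n T P (2 ^ v)) (q - 1) (k - 1) &&
      roots (fun _ => true) strict n T W V M DB R G s q k (j + 1) l
        (prune W V (word W (2 ^ v)) G (P - 2 ^ v))))) = true :=
      h
    simp only [Bool.and_eq_true] at h'
    obtain ⟨⟨hvn, hvP⟩, hq0, hrun, hrest⟩ := h'
    have hvn : v < n := Nat.le_of_ble_eq_true hvn
    have hvP := testBit_of_land (Nat.eq_of_beq_eq_true hvP)
    have hdel : ∀ j, (delete n T P (2 ^ v)).testBit j = true ↔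
        P.testBit j = true ∧ ¬ Adj n T v j ∧ v ≠ j := testBit_delete hvP (hl v hvP)
    have ha : ∀ C, L C → dec (word W (2 ^ v)) ∉ C := by
      intro C hC hvC
      have hvX := mem_vertices.2 ⟨hvn, hvC⟩
      obtain ⟨h1, h2, h3⟩ := hX C hC
      have hsub : Sub ((vertices n W C).erase v) (delete n T P (2 ^ v)) := by
        intro i hi
        rw [Finset.mem_erase] at hi
        exact (hdel i).2 ⟨hP C hC i hi.2, h1 v hvX i hi.2, Ne.symm hi.1⟩
      refine run_spec hK hDB (hLK C hC) s' _ _ _ (q - 1) (k - 1) hrun ?_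
        (hl.mono fun i hi => ((hdel i).1 hi).1) (fun _ h => h) ((vertices n W C).erase v)
        (fun i hi => (mem_vertices.1 (Finset.mem_of_mem_erase hi)).2)
        (h1.mono (Finset.erase_subset _ _)) hsub ?_ ?_ ?_
      · intro a ha
        rcases testBit_lor_shiftLeft ha with rfl | ha
        · exact hvC
        · exact hR C hC a ha
      · rw [Finset.card_erase_of_mem hvX]
        omega
      · rw [Finset.filter_erase]
        have := Finset.pred_card_le_card_erase
          (s := (vertices n W C).filter fun i => M.testBit i = true) (a := v)
        omega
      · rcases Nat.eq_zero_or_pos (q - 1) with h0 | h0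
        · exact Or.inl h0
        · right
          rw [Finset.filter_false_of_mem, Finset.card_empty]
          · exact h0
          · rintro i hi ⟨-, hi'⟩
            rw [hsub i hi] at hi'
            exact absurd hi' (by decide)
    have hP' := testBit_sub_two_pow hvP
    obtain ⟨h1, h2⟩ := prune_spec (n := n) (W := W) (V := V) G hG ha (P - 2 ^ v) fun C hC i hi => by
      rw [hP', hP C hC i hi]
      have : v ≠ i := by
        rintro rfl
        exact ha C hC (mem_vertices.1 hi).2
      simp [this]
    refine ih _ _ hrest (hl.mono fun i hi => ?_) h2
    have := h1 i hi
    rw [hP'] at this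
    simp at this
    exact this.1

theorem roots_of_parts {strict : Bool} {n T W V M : ℕ} {DB : List (List ℕ)} {R : ℕ}
    {G : List (ℕ × ℕ × ℕ × ℕ)} {s : Tree} {q k : ℕ} (j : ℕ) (l : List (ℕ × Tree)) (P : ℕ)
    (h : ∀ i ≤ l.length, roots (Nat.beq (j + i)) strict n T W V M DB R G s q k j l P = true) :
    roots (fun _ => true) strict n T W V M DB R G s q k j l P = true := by
  induction l generalizing j P with
  | nil =>
    have h0 := h 0 le_rfl
    simpa [roots] using h0
  | cons r l ih =>
    obtain ⟨v, s'⟩ := r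
    have h0 := h 0 (Nat.zero_le _)
    simp only [roots, Bool.and_eq_true] at h0 ⊢
    refine ⟨h0.1, h0.2.1, by simpa using h0.2.2.1, ih _ _ fun i hi => ?_⟩
    have h1 := h (i + 1) (Nat.succ_le_succ hi)
    simp only [roots, Bool.and_eq_true] at h1
    have h2 : j + (i + 1) = Nat.succ j + i := by omega
    rw [← h2]
    exact h1.2.2.2

/-! ### The complete check -/

/-- Every word that satisfies `dom` is near a word in `R` or is in `o`. -/
def covers (dom : ℕ → Bool) (R o : List ℕ) : Bool :=
  (fun s => (List.range 384).all fun a => !dom a || (Nat.beq (Nat.mod (Nat.shiftRight s a) 2) 1 ||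
    R.any fun r => Nat.beq (near r a) 1)) (maskSet o)

theorem covers_spec {dom : ℕ → Bool} {R o : List ℕ} (h : covers dom R o = true) {a : ℕ}
    (ha : a < 384) (hd : dom a = true) : a ∈ o ∨ ∃ r ∈ R, near r a = 1 := by
  have h1 := List.all_eq_true.1 h a (List.mem_range.2 ha)
  simp only [Bool.or_eq_true, Bool.not_eq_true'] at h1
  rcases h1 with h1 | h1 | h1
  · rw [hd] at h1
    exact absurd h1 (by decide)
  · left
    exact mem_of_testBit_maskSet (testBit_of_beq h1)
  · right
    obtain ⟨r, hr, hb⟩ := List.any_eq_true.1 h1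
    exact ⟨r, hr, Nat.eq_of_beq_eq_true hb⟩

/-- Evaluate a number before it is used. -/
noncomputable def force {α : Type} (m : ℕ) (f : ℕ → α) : α :=
  Nat.rec (f 0) (fun m _ => f m) (Nat.add m 1)

theorem force_eq {α : Type} (m : ℕ) (f : ℕ → α) : force m f = f m := rfl

/-- The complete check: no code that contains the words in `R` has `k` words with the property
`dom` and `q` words with the property `blk`. The list `o` determines the order of the words.
Only the selected branches are checked. -/
noncomputable def check (sel : ℕ → Bool) (strict : Bool) (dom blk : ℕ → Bool)
    (DB : List (List ℕ)) (q k : ℕ)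
    (R o : List ℕ) (G : List (ℕ × ℕ × ℕ × ℕ)) (l : List (ℕ × Tree)) (s : Tree) : Bool :=
  Nat.ble o.length 196 && (o.all (fun a => Nat.blt a 384) && (R.all (fun a => Nat.blt a 384) &&
  (G.all (fun g => isMove g.1 g.2.2.1 && (isFix g.1 g.2.1 &&
    mapsInto g.1 g.2.1 g.2.2.1 g.2.2.2 R (maskSet R))) && (covers dom R o &&
  force o.length fun n => force (table n o) fun T => force (pack 9 1 o) fun W =>
    force (inverse 0 o) fun V => force (maskOf blk o) fun M =>
      force (maskSet R) fun S =>
        roots sel strict n T W V M DB S G s q k 0 l (Nat.sub (Nat.pow 2 n) 1)))))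

theorem check_of_parts {strict : Bool} {dom blk : ℕ → Bool} {DB : List (List ℕ)} {q k : ℕ}
    {R o : List ℕ} {G : List (ℕ × ℕ × ℕ × ℕ)} {l : List (ℕ × Tree)} {s : Tree}
    (h : ∀ i ≤ l.length, check (Nat.beq i) strict dom blk DB q k R o G l s = true) :
    check (fun _ => true) strict dom blk DB q k R o G l s = true := by
  have h0 := h 0 (Nat.zero_le _)
  simp only [check, force_eq, Bool.and_eq_true] at h0 h ⊢
  refine ⟨h0.1, h0.2.1, h0.2.2.1, h0.2.2.2.1, h0.2.2.2.2.1, roots_of_parts 0 l _ fun i hi => ?_⟩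
  rw [Nat.zero_add]
  exact (h i hi).2.2.2.2.2

/-- The numbers of the words of `C` with the property `f`. -/
noncomputable def numbers (f : ℕ → Bool) (C : Finset (BTWord 7 1)) : Finset ℕ := by
  classical exact (Finset.range 384).filter fun a => f a = true ∧ dec a ∈ C

theorem mem_numbers {f : ℕ → Bool} {C : Finset (BTWord 7 1)} {a : ℕ} :
    a ∈ numbers f C ↔ a < 384 ∧ f a = true ∧ dec a ∈ C := by
  simp [numbers]

theorem check_spec {strict : Bool} {dom blk : ℕ → Bool} {DB : List (List ℕ)} {q k : ℕ}
    {R o : List ℕ} {G : List (ℕ × ℕ × ℕ × ℕ)} {l : List (ℕ × Tree)} {s : Tree}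
    (h : check (fun _ => true) strict dom blk DB q k R o G l s = true)
    {K L : Finset (BTWord 7 1) → Prop} (hK : Closed strict K) (hL : G ≠ [] → Closed true L)
    (hDB : ∀ A ∈ DB, ∀ C, K C → ¬ ∀ a ∈ A, dec a ∈ C) (hLK : ∀ C, L C → K C)
    (hcode : ∀ C, L C → IsCode C) (hb : ∀ a, blk a = true → dom a = true)
    (hk : ∀ C, L C → (∀ a ∈ R, dec a ∈ C) → k ≤ (numbers dom C).card)
    (hq : ∀ C, L C → (∀ a ∈ R, dec a ∈ C) → q ≤ (numbers blk C).card)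
    (C : Finset (BTWord 7 1)) (hC : L C) : ¬ ∀ a ∈ R, dec a ∈ C := by
  simp only [check, force_eq, Bool.and_eq_true] at h
  obtain ⟨ho, h9, hR9, hG, hcov, hroots⟩ := h
  have ho : o.length ≤ 196 := Nat.le_of_ble_eq_true ho
  have h9 : ∀ a ∈ o, a < 384 := fun a ha => Nat.le_of_ble_eq_true (List.all_eq_true.1 h9 a ha)
  have hR9 : ∀ a ∈ R, a < 384 := fun a ha => Nat.le_of_ble_eq_true (List.all_eq_true.1 hR9 a ha)
  have hword := fun i (hi : i < o.length) => word_pack ho h9 hi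
  have hget : ∀ i, i < o.length → o.getD i 0 < 384 := fun i hi => by
    rw [List.getD_eq_getElem _ _ hi]
    exact h9 _ (List.getElem_mem hi)
  have hnear : ∀ D, IsCode D → ∀ a < 384, ∀ b < 384, dec a ∈ D → dec b ∈ D → near a b ≠ 1 := by
    intro D hD a ha b hb haD hbD h1
    obtain ⟨hne, hlt⟩ := near_spec ha hb h1
    have := hD _ haD _ hbD hne
    omega
  have hsurj : ∀ D, IsCode D → (∀ a ∈ R, dec a ∈ D) →
      ∀ f : ℕ → Bool, (∀ a, f a = true → dom a = true) →
      (numbers f D) ⊆ ((vertices o.length (pack 9 1 o) D).filter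
        fun i => (maskOf f o).testBit i = true).image fun i => o.getD i 0 := by
    intro D hD hRD f hf a ha
    rw [mem_numbers] at ha
    obtain ⟨ha, hfa, haD⟩ := ha
    rcases covers_spec hcov ha (hf a hfa) with hao | ⟨r, hr, hra⟩
    · obtain ⟨i, hi, rfl⟩ := List.mem_iff_getElem.1 hao
      have hg : o.getD i 0 = o[i] := List.getD_eq_getElem _ _ hi
      refine Finset.mem_image.2 ⟨i, Finset.mem_filter.2 ⟨mem_vertices.2 ⟨hi, ?_⟩, ?_⟩, hg⟩
      · rw [hword i hi, hg]
        exact haD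
      · rw [testBit_maskOf, hg]
        exact ⟨hi, hfa⟩
    · exact absurd hra (hnear D hD r (hR9 r hr) a ha (hRD r hr) haD)
  intro hRC
  refine roots_spec (L := fun C => L C ∧ ∀ a ∈ R, dec a ∈ C) hK hDB (fun C h => hLK C h.1)
    
    (fun C h a ha => h.2 a (mem_of_testBit_maskSet ha)) (fun g hg => ?_)
    (fun D hD => ⟨fun i hi j hj hadj => ?_, ?_, ?_⟩) 0 l _ hroots
    (fun i hi hadj => ?_) (fun D hD i hi => ?_) C ⟨hC, hRC⟩
  · have := List.all_eq_true.1 hG g hg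
    simp only [Bool.and_eq_true] at this
    obtain ⟨h1, h2, h3⟩ := this
    refine ⟨h1, fun D hD => ⟨hL (List.ne_nil_of_mem hg) _ _ _ _ h1 (fun _ => h2) D hD.1,
      fun a ha => ?_⟩⟩
    rw [dec_mem_pull]
    exact hD.2 _ (mem_of_testBit_maskSet (testBit_of_mapsInto h3 a ha))
  · rw [mem_vertices] at hi hj
    have := near_of_adj ho hi.1 hj.1 hadj
    refine hnear D (hcode D hD.1) _ (hget i hi.1) _ (hget j hj.1) ?_ ?_ this
    · rw [← hword i hi.1]; exact hi.2
    · rw [← hword j hj.1]; exact hj.2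
  · have hsub := hsurj D (hcode D hD.1) hD.2 dom fun _ h => h
    exact (hk D hD.1 hD.2).trans ((Finset.card_le_card hsub).trans
      (Finset.card_image_le.trans (Finset.card_le_card (Finset.filter_subset _ _))))
  · exact (hq D hD.1 hD.2).trans ((Finset.card_le_card (hsurj D (hcode D hD.1) hD.2 blk hb)).trans
      Finset.card_image_le)
  · have hi' : i < o.length := by
      have hi2 : (2 ^ o.length - 1).testBit i = true := hi
      rw [Nat.testBit_two_pow_sub_one] at hi2
      simpa using hi2
    have := near_of_adj ho hi' hi' hadj
    exact absurd this (by
      rw [near]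
      have : Nat.xor (o.getD i 0) (o.getD i 0) = 0 := Nat.xor_self _
      rw [this]
      decide +kernel)
  · show (2 ^ o.length - 1).testBit i = true
    rw [Nat.testBit_two_pow_sub_one]
    simpa using (mem_vertices.1 hi).1

/-- Combine the first `c` trees of the list. -/
def collect : ℕ → Tree → List Tree → List Tree
  | 0, s, l => .split s :: l
  | _ + 1, s, [] => [.split s]
  | c + 1, s, s' :: l => collect c (.cons s' s) l

/-- Read an entry of the code of a tree. -/
def readEntry (a : ℕ) (l : List Tree) : List Tree :=
  cond (Nat.beq a 0) (.leaf :: l) (cond (Nat.blt a 200) (collect (Nat.pred a) .nil l)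
    ((fun x => (fun y => .iso (Nat.div y 262144) (Nat.add 1572864 (Nat.mod y 262144))
      (Nat.mod (Nat.div x 6) 64) (Nat.succ (Nat.mod (Nat.div x 3) 2)) (Nat.mod x 3) :: l)
        (Nat.div x 384)) (Nat.sub a 200)))

/-- Decode trees: `0` stands for a leaf, the numbers below `200` combine the preceding trees, and
the other numbers describe isometries. -/
def decode : List ℕ → List Tree → Tree
  | [], l => l.headD .leaf
  | a :: c, [] => decode c (readEntry a [])
  | a :: c, s :: l => decode c (readEntry a (s :: l))

/-- The data for a check whose first step is up to isometries. -/
structure Certificate : Type where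
  /-- The words that are contained in the code. -/
  core : List ℕ
  /-- The order of the other words. -/
  order : List ℕ
  /-- The isometries that preserve the core. -/
  symmetries : List (ℕ × ℕ × ℕ × ℕ)
  /-- The branches. -/
  branches : List (ℕ × List ℕ)

/-- The word has a nonzero coordinate `5` or `6`. -/
def isOuter (a : ℕ) : Bool := Nat.blt 31 (Nat.mod a 128)

/-- The word has the coordinates `5` and `6` equal to `1` and `0`. -/
def isSide (a : ℕ) : Bool := isOuter a && Nat.blt (Nat.mod a 128) 64

/-- The check that no code with at least `27` words contains the core of the certificate. -/
noncomputable def Certificate.check (c : Certificate) (DB : List (List ℕ)) (q k : ℕ)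
    (sel : ℕ → Bool := fun _ => true) : Bool :=
  c.core.all (fun a => Nat.blt a 384 && Nat.blt (Nat.mod a 128) 32) &&
    CliqueSearch.check sel false isOuter isSide DB q k c.core c.order c.symmetries
      (c.branches.map fun b => (b.1, decode b.2 [])) (.split .nil)

theorem Certificate.check_of_parts {c : Certificate} {DB : List (List ℕ)} {q k : ℕ}
    (h : ∀ i, i < c.branches.length + 1 → c.check DB q k (Nat.beq i) = true) :
    c.check DB q k = true := by
  simp only [Certificate.check, Bool.and_eq_true] at h ⊢
  refine ⟨(h 0 (Nat.succ_pos _)).1, CliqueSearch.check_of_parts fun i hi => (h i ?_).2⟩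
  rw [List.length_map] at hi
  omega

/-! ### Counting the words in subcubes -/

theorem card_numbers {f : ℕ → Bool} {p : BTWord 7 1 → Prop} [DecidablePred p]
    (h : ∀ a < 384, f a = true ↔ p (dec a)) (C : Finset (BTWord 7 1)) :
    (numbers f C).card = (C.filter p).card := by
  refine Finset.card_bij (fun a _ => dec a) ?_ ?_ ?_
  · intro a ha
    rw [mem_numbers] at ha
    exact Finset.mem_filter.2 ⟨ha.2.2, (h a ha.1).1 ha.2.1⟩
  · intro a ha b hb hab
    exact dec_injOn (mem_numbers.1 ha).1 (mem_numbers.1 hb).1 hab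
  · intro w hw
    obtain ⟨a, ha, rfl⟩ := exists_dec w
    rw [Finset.mem_filter] at hw
    exact ⟨a, mem_numbers.2 ⟨ha, (h a ha).2 hw.2, hw.1⟩, rfl⟩

theorem card_filter_pull {p t m k : ℕ} {h : isMove p m = true} {P Q : BTWord 7 1 → Prop}
    [DecidablePred P] [DecidablePred Q] (hPQ : ∀ w, P w ↔ Q (act p t m k w))
    (C : Finset (BTWord 7 1)) : ((pull p t m k h C).filter P).card = (C.filter Q).card := by
  refine Finset.card_bij (fun w _ => move p t m k h w) ?_ ?_ ?_
  · intro w hw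
    rw [Finset.mem_filter, mem_pull] at hw
    exact Finset.mem_filter.2 ⟨hw.1, (hPQ w).1 hw.2⟩
  · intro w _ x _ hwx
    exact (move p t m k h).injective hwx
  · intro w hw
    obtain ⟨x, rfl⟩ := (move p t m k h).surjective w
    rw [Finset.mem_filter] at hw
    exact ⟨x, Finset.mem_filter.2 ⟨mem_pull.2 hw.1, (hPQ x).2 hw.2⟩, rfl⟩

/-- The number of the words of `C` with the values `u` and `v` at the coordinates `5` and `6`. -/
def count (C : Finset (BTWord 7 1)) (u v : ZMod 2) : ℕ :=
  (C.filter fun w => w.2 5 = u ∧ w.2 6 = v).card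

theorem card_eq_sum_count (C : Finset (BTWord 7 1)) :
    C.card = count C 0 0 + count C 1 0 + count C 0 1 + count C 1 1 := by
  have h2 : ∀ z : ZMod 2, z = 0 ∨ z = 1 := by decide
  have h01 : (0 : ZMod 2) ≠ 1 := by decide
  have hs : ∀ D : Finset (BTWord 7 1), ∀ i : Fin 7,
      D.card = (D.filter fun w => w.2 i = 0).card + (D.filter fun w => w.2 i = 1).card := by
    intro D i
    rw [← Finset.card_filter_add_card_filter_not (s := D) fun w => w.2 i = 0]
    congr 2
    apply Finset.filter_congr
    intro w _
    rcases h2 (w.2 i) with h | h <;> simp [h, h01, h01.symm]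
  have h6 : ∀ u, (C.filter fun w => w.2 5 = u).card = count C u 0 + count C u 1 := by
    intro u
    rw [hs _ 6, Finset.filter_filter, Finset.filter_filter]
    rfl
  rw [hs C 5, h6, h6]
  omega

theorem count_pull {p t m k : ℕ} {h : isMove p m = true} {u v u' v' : ZMod 2}
    (huv : ∀ w, (w.2 5 = u ∧ w.2 6 = v) ↔
      ((act p t m k w).2 5 = u' ∧ (act p t m k w).2 6 = v')) (C : Finset (BTWord 7 1)) :
    count (pull p t m k h C) u v = count C u' v' :=
  card_filter_pull huv C

theorem act_of_isFix {p t : ℕ} (h : isFix p t = true) (m k : ℕ) (w : BTWord 7 1) :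
    (act p t m k w).2 5 = w.2 5 ∧ (act p t m k w).2 6 = w.2 6 := by
  simp only [isFix, Bool.and_eq_true] at h
  have h5 := Nat.eq_of_beq_eq_true h.1
  have h6 := Nat.eq_of_beq_eq_true h.2.1
  have ht : t < 32 := Nat.le_of_ble_eq_true h.2.2
  have c5 : coord p 5 = 5 := by
    show Fin.ofNat 7 (digit p 5) = 5
    rw [h5]; rfl
  have c6 : coord p 6 = 6 := by
    show Fin.ofNat 7 (digit p 6) = 6
    rw [h6]; rfl
  constructor
  · show w.2 (coord p 5) + ((t / 2 ^ 5 : ℕ) : ZMod 2) = w.2 5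
    rw [c5, Nat.div_eq_of_lt (b := 2 ^ 5) ht]; simp
  · show w.2 (coord p 6) + ((t / 2 ^ 6 : ℕ) : ZMod 2) = w.2 6
    rw [c6, Nat.div_eq_of_lt (ht.trans (by norm_num))]; simp

theorem count_pull_of_isFix {p t m k : ℕ} {h : isMove p m = true} (hf : isFix p t = true)
    (C : Finset (BTWord 7 1)) (u v : ZMod 2) : count (pull p t m k h C) u v = count C u v :=
  count_pull (fun w => by rw [(act_of_isFix hf m k w).1, (act_of_isFix hf m k w).2]) C

theorem dec_snd_eq_zero (a : ℕ) (i : Fin 7) : (dec a).2 i = 0 ↔ a / 2 ^ (i : ℕ) % 2 = 0 := by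
  show ((a / 2 ^ (i : ℕ) : ℕ) : ZMod 2) = 0 ↔ _
  rw [ZMod.natCast_eq_zero_iff, Nat.dvd_iff_mod_eq_zero]

theorem dec_snd_eq_one (a : ℕ) (i : Fin 7) : (dec a).2 i = 1 ↔ a / 2 ^ (i : ℕ) % 2 = 1 := by
  have h2 : ∀ z : ZMod 2, z = 1 ↔ ¬ z = 0 := by decide
  rw [h2, dec_snd_eq_zero]
  omega

theorem dec_mem_corner (a : ℕ) :
    ((dec a).2 5 = 0 ∧ (dec a).2 6 = 0) ↔ a % 128 < 32 := by
  rw [dec_snd_eq_zero, dec_snd_eq_zero]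
  show a / 32 % 2 = 0 ∧ a / 64 % 2 = 0 ↔ _
  omega

theorem isOuter_iff (a : ℕ) : isOuter a = true ↔ ¬ ((dec a).2 5 = 0 ∧ (dec a).2 6 = 0) := by
  rw [dec_mem_corner]
  show Nat.ble 32 (a % 128) = true ↔ _
  rw [Nat.ble_eq]
  omega

theorem isSide_iff (a : ℕ) : isSide a = true ↔ (dec a).2 5 = 1 ∧ (dec a).2 6 = 0 := by
  rw [isSide, Bool.and_eq_true, isOuter_iff, dec_mem_corner, dec_snd_eq_one, dec_snd_eq_zero]
  show _ ∧ Nat.ble (a % 128 + 1) 64 = true ↔ a / 32 % 2 = 1 ∧ a / 64 % 2 = 0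
  rw [Nat.ble_eq]
  omega

/-! ### Excluding the certificates -/

/-- The codes of which we want to show that they do not exist. -/
def IsBig (C : Finset (BTWord 7 1)) : Prop := IsCode C ∧ 27 ≤ C.card

theorem closed_isBig (strict : Bool) : Closed strict IsBig :=
  fun _ _ _ _ _ _ _ hC => ⟨hC.1.pull, card_pull.symm ▸ hC.2⟩

/-- Every subcube that arises by fixing two binary coordinates has at most `r` words of `C`. -/
theorem count_le_of_corner {r : ℕ} {L : Finset (BTWord 7 1) → Prop} (hL : Closed false L)
    (h : ∀ C, L C → count C 0 0 ≤ r) (C : Finset (BTWord 7 1)) (hC : L C) (u v : ZMod 2) :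
    count C u v ≤ r := by
  have hm : isMove 0o6543210 1 = true := by decide +kernel
  have h2 : ∀ z : ZMod 2, z = 0 ∨ z = 1 := by decide
  have hz : ∀ z a : ZMod 2, z = 0 ↔ z + a = a := by decide
  have key : ∀ t, count (pull 0o6543210 t 1 0 hm C) 0 0
      = count C ((t / 2 ^ 5 : ℕ) : ZMod 2) ((t / 2 ^ 6 : ℕ) : ZMod 2) := by
    intro t
    refine count_pull (fun w => ?_) C
    rw [hz (w.2 5) ((t / 2 ^ 5 : ℕ) : ZMod 2), hz (w.2 6) ((t / 2 ^ 6 : ℕ) : ZMod 2)]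
    rfl
  have key' : ∀ t, count C ((t / 2 ^ 5 : ℕ) : ZMod 2) ((t / 2 ^ 6 : ℕ) : ZMod 2) ≤ r := fun t =>
    key t ▸ h _ (hL _ _ _ _ hm (by simp) C hC)
  rcases h2 u with rfl | rfl <;> rcases h2 v with rfl | rfl
  · exact key' 0
  · exact key' 64
  · exact key' 32
  · exact key' 96

/-- The exchange of the coordinates `5` and `6`. -/
theorem count_swap (h : isMove 0o5643210 1 = true) (C : Finset (BTWord 7 1)) :
    count (pull 0o5643210 0 1 0 h C) 1 0 = count C 0 1 := by
  refine count_pull (fun w => ?_) C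
  have h5 : (act 0o5643210 0 1 0 w).2 5 = w.2 6 + ((0 : ℕ) : ZMod 2) := rfl
  have h6 : (act 0o5643210 0 1 0 w).2 6 = w.2 5 + ((0 : ℕ) : ZMod 2) := rfl
  rw [h5, h6, Nat.cast_zero, add_zero, add_zero, and_comm]

theorem Certificate.excluded {c : Certificate} {DB : List (List ℕ)} {q k r : ℕ}
    (h : c.check DB q k = true) (hDB : ∀ A ∈ DB, ∀ C, IsBig C → ¬ ∀ a ∈ A, dec a ∈ C)
    (hr : ∀ C, IsBig C → count C 0 0 ≤ r) (hk : k + r ≤ 27) (hq : 2 * q + 2 * r ≤ 28)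
    (C : Finset (BTWord 7 1)) (hC : IsBig C) : ¬ ∀ a ∈ c.core, dec a ∈ C := by
  rw [Certificate.check, Bool.and_eq_true] at h
  obtain ⟨hcore, hcheck⟩ := h
  have main : ∀ C, IsBig C → q ≤ count C 1 0 → ¬ ∀ a ∈ c.core, dec a ∈ C := by
    intro C hC hqC
    refine check_spec (K := IsBig) (L := fun C => IsBig C ∧ q ≤ count C 1 0) hcheck
      (closed_isBig _) (fun _ => ?_) hDB (fun C h => h.1) (fun C h => h.1.1) (fun a ha => ?_)
      (fun C hC _ => ?_) (fun C hC _ => ?_) C ⟨hC, hqC⟩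
    · intro p t m k' h' hf C hC
      exact ⟨closed_isBig true p t m k' h' hf C hC.1,
        by rw [count_pull_of_isFix (hf rfl)]; exact hC.2⟩
    · rw [isSide, Bool.and_eq_true] at ha
      exact ha.1
    · rw [card_numbers (p := fun w => ¬ (w.2 5 = 0 ∧ w.2 6 = 0)) (fun a _ => isOuter_iff a)]
      have h1 := Finset.card_filter_add_card_filter_not (s := C) fun w => w.2 5 = 0 ∧ w.2 6 = 0
      have h2 : (C.filter fun w => w.2 5 = 0 ∧ w.2 6 = 0).card ≤ r := hr C hC.1
      have h3 := hC.1.2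
      omega
    · rw [card_numbers (p := fun w => w.2 5 = 1 ∧ w.2 6 = 0) (fun a _ => isSide_iff a)]
      exact hC.2
  by_cases hside : q ≤ count C 1 0
  · exact main C hC hside
  · intro hcC
    have h1 := card_eq_sum_count C
    have h2 := count_le_of_corner (closed_isBig false) hr C hC 0 0
    have h3 := count_le_of_corner (closed_isBig false) hr C hC 1 1
    have h4 := hC.2
    have hm : isMove 0o5643210 1 = true := by decide +kernel
    refine main (pull 0o5643210 0 1 0 hm C) (closed_isBig false _ _ _ _ hm (by simp) C hC) ?_ ?_
    · rw [count_swap]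
      omega
    · intro a ha
      have key : ∀ a < 384, a % 128 < 32 → actNum 0o5643210 0 1 0 a = a := by decide +kernel
      have h5 := List.all_eq_true.1 hcore a ha
      rw [Bool.and_eq_true] at h5
      rw [dec_mem_pull, key a (Nat.le_of_ble_eq_true h5.1) (Nat.le_of_ble_eq_true h5.2)]
      exact hcC a ha

theorem excluded_of_checks {certs : List Certificate} {DB : List (List ℕ)} {q k r : ℕ}
    (h : ∀ i (hi : i < certs.length),
      (certs[i]).check (DB ++ (certs.take i).map Certificate.core) q k = true)
    (hDB : ∀ A ∈ DB, ∀ C, IsBig C → ¬ ∀ a ∈ A, dec a ∈ C)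
    (hr : ∀ C, IsBig C → count C 0 0 ≤ r) (hk : k + r ≤ 27) (hq : 2 * q + 2 * r ≤ 28) :
    ∀ A ∈ DB ++ certs.map Certificate.core, ∀ C, IsBig C → ¬ ∀ a ∈ A, dec a ∈ C := by
  have main : ∀ i ≤ certs.length, ∀ A ∈ DB ++ (certs.take i).map Certificate.core,
      ∀ C, IsBig C → ¬ ∀ a ∈ A, dec a ∈ C := by
    intro i
    induction i with
    | zero => simpa using hDB
    | succ i ih =>
      intro hi A hA
      have hlt : i < certs.length := hi
      rw [List.take_succ_eq_append_getElem hlt, List.map_append, ← List.append_assoc,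
        List.mem_append] at hA
      rcases hA with hA | hA
      · exact ih hlt.le A hA
      · rw [List.map_singleton, List.mem_singleton] at hA
        subst hA
        exact (certs[i]).excluded (h i hlt) (ih hlt.le) hr hk hq
  simpa using main certs.length le_rfl

/-! ### Codes in a subcube -/

/-- Codes with at least `N` words in the corner and at least `M` words. -/
def IsDense (N M : ℕ) (C : Finset (BTWord 7 1)) : Prop :=
  IsCode C ∧ N ≤ count C 0 0 ∧ M ≤ C.card

theorem closed_isDense (N M : ℕ) : Closed true (IsDense N M) := fun _ _ _ _ _ hf _ hC =>
  ⟨hC.1.pull, by rw [count_pull_of_isFix (hf rfl)]; exact hC.2.1, card_pull.symm ▸ hC.2.2⟩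

/-- The words `1`, ..., `31`. -/
def isSmall (a : ℕ) : Bool := Nat.blt 0 a && Nat.blt a 32

/-- The words in the corner except for `0`, `7` and `25`. -/
def isInner (a : ℕ) : Bool :=
  Nat.blt (Nat.mod a 128) 32 && !(Nat.beq a 0 || (Nat.beq a 7 || Nat.beq a 25))

/-- A dense code contains three words of the same colour in the corner. We can assume that one
of them is the word `0`. -/
theorem exists_dense_zero {N M : ℕ} (hN : 7 ≤ N) {C : Finset (BTWord 7 1)} (hC : IsDense N M C) :
    ∃ D, IsDense N M D ∧ dec 0 ∈ D ∧
      3 ≤ (D.filter fun w => (w.2 5 = 0 ∧ w.2 6 = 0) ∧ w.1 0 = 0).card := by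
  set S := C.filter fun w => w.2 5 = 0 ∧ w.2 6 = 0 with hS
  have hSc : 7 ≤ S.card := hN.trans hC.2.1
  obtain ⟨c, -, hc⟩ := Finset.exists_lt_card_fiber_of_mul_lt_card_of_maps_to
    (s := S) (t := (Finset.univ : Finset (ZMod 3))) (f := fun w => w.1 0) (n := 2)
    (fun _ _ => Finset.mem_univ _) (by rw [Finset.card_univ, ZMod.card]; omega)
  have hc' : 3 ≤ (S.filter fun w => w.1 0 = c).card := hc
  obtain ⟨w, hw⟩ := Finset.card_pos.1 (lt_of_lt_of_le (by norm_num) hc')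
  obtain ⟨a, ha, rfl⟩ := exists_dec w
  rw [Finset.mem_filter, hS, Finset.mem_filter] at hw
  have ha32 := (dec_mem_corner a).1 hw.1.2
  have hm : isMove 0o6543210 1 = true := by decide +kernel
  have hf : isFix 0o6543210 (a % 128) = true := by
    rw [isFix, Bool.and_eq_true, Bool.and_eq_true]
    refine ⟨by decide +kernel, by decide +kernel, ?_⟩
    exact Nat.ble_eq ▸ ha32
  refine ⟨pull 0o6543210 (a % 128) 1 (a / 128) hm C,
    closed_isDense N M _ _ _ _ hm (fun _ => hf) C hC, ?_, ?_⟩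
  · rw [dec_mem_pull]
    have key : ∀ a < 384, actNum 0o6543210 (a % 128) 1 (a / 128) 0 = a := by decide +kernel
    rw [key a ha]
    exact hw.1.1
  · have hcard := card_filter_pull (h := hm) (p := 0o6543210) (t := a % 128) (m := 1) (k := a / 128)
      (P := fun w => (w.2 5 = 0 ∧ w.2 6 = 0) ∧ w.1 0 = 0)
      (Q := fun w => (w.2 5 = 0 ∧ w.2 6 = 0) ∧ w.1 0 = c) (fun w => by
        have h5 := act_of_isFix hf 1 (a / 128) w
        rw [h5.1, h5.2, ← hw.2]
        have : (act 0o6543210 (a % 128) 1 (a / 128) w).1 0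
          = ((1 : ℕ) : ZMod 3) * w.1 0 + ((a / 128 : ℕ) : ZMod 3) := rfl
        rw [this]
        show _ ↔ _ ∧ _ = ((a / 128 : ℕ) : ZMod 3)
        rw [Nat.cast_one, one_mul, add_eq_right]) C
    rw [hcard, ← Finset.filter_filter]
    exact hc'

theorem isDense_excluded {N M : ℕ} (hN : 7 ≤ N) {o : List ℕ} {s : Tree}
    (h : check (fun _ => true) true isSmall isSmall [[0, 7, 25]] 2 2 [0] o [] [] s = true)
    (hR : ∀ C, IsDense N M C → ¬ ∀ a ∈ [0, 7, 25], dec a ∈ C) (C : Finset (BTWord 7 1)) :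
    ¬ IsDense N M C := by
  intro hC
  obtain ⟨D, hD, h0, h3⟩ := exists_dense_zero hN hC
  have hnum : ∀ D : Finset (BTWord 7 1),
      3 ≤ (D.filter fun w => (w.2 5 = 0 ∧ w.2 6 = 0) ∧ w.1 0 = 0).card →
      2 ≤ (numbers isSmall D).card := by
    intro D h3
    have hiff : ∀ a < 384, isSmall a = true ↔
        (((dec a).2 5 = 0 ∧ (dec a).2 6 = 0) ∧ (dec a).1 0 = 0) ∧ dec a ≠ dec 0 := by
      intro a ha
      have h1 : (dec a).1 0 = 0 ↔ a / 128 % 3 = 0 := by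
        show ((a / 128 : ℕ) : ZMod 3) = 0 ↔ _
        rw [ZMod.natCast_eq_zero_iff, Nat.dvd_iff_mod_eq_zero]
      have h2 : dec a ≠ dec 0 ↔ a ≠ 0 :=
        not_congr ⟨fun h => dec_injOn ha (by norm_num) h, fun h => h ▸ rfl⟩
      rw [dec_mem_corner, h1, h2]
      show (Nat.ble 1 a && Nat.ble (a + 1) 32) = true ↔ _
      rw [Bool.and_eq_true, Nat.ble_eq, Nat.ble_eq]
      omega
    rw [card_numbers (p := fun w => ((w.2 5 = 0 ∧ w.2 6 = 0) ∧ w.1 0 = 0) ∧ w ≠ dec 0) hiff,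
      ← Finset.filter_filter, Finset.filter_ne']
    have := Finset.pred_card_le_card_erase
      (s := D.filter fun w => (w.2 5 = 0 ∧ w.2 6 = 0) ∧ w.1 0 = 0) (a := dec 0)
    omega
  refine check_spec (K := IsDense N M) (L := fun D => IsDense N M D ∧
    3 ≤ (D.filter fun w => (w.2 5 = 0 ∧ w.2 6 = 0) ∧ w.1 0 = 0).card) h (closed_isDense N M)
    (fun h => absurd rfl h) (fun A hA C hC => ?_) (fun C h => h.1) (fun C h => h.1.1)
    (fun a h => h) (fun C hC _ => hnum C hC.2) (fun C hC _ => hnum C hC.2) D ⟨hD, h3⟩ (by simpa)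
  rw [List.mem_singleton] at hA
  subst hA
  exact hR C hC

/-- The check for a code that contains the words `0`, `7` and `25`. -/
theorem triple_excluded {N M r : ℕ} {DB : List (List ℕ)} {K : Finset (BTWord 7 1) → Prop}
    {o : List ℕ} {s : Tree} (h : check (fun _ => true) false isInner isInner DB r r [0, 7, 25] o [] []
      s = true)
    (hK : Closed false K) (hDK : ∀ C, IsDense N M C → K C)
    (hDB : ∀ A ∈ DB, ∀ C, K C → ¬ ∀ a ∈ A, dec a ∈ C) (hr : r + 3 ≤ N)
    (C : Finset (BTWord 7 1)) (hC : IsDense N M C) : ¬ ∀ a ∈ [0, 7, 25], dec a ∈ C := by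
  have hnum : ∀ C, IsDense N M C → r ≤ (numbers isInner C).card := by
    intro C hC
    have h1 : (numbers (fun a => Nat.blt (Nat.mod a 128) 32) C).card = count C 0 0 :=
      card_numbers (fun a _ => by rw [dec_mem_corner]; exact iff_of_eq Nat.ble_eq) C
    have h2 : numbers (fun a => Nat.blt (Nat.mod a 128) 32) C \ {0, 7, 25} ⊆ numbers isInner C := by
      intro a ha
      rw [Finset.mem_sdiff, mem_numbers] at ha
      rw [mem_numbers]
      refine ⟨ha.1.1, ?_, ha.1.2.2⟩
      have h3 := ha.2
      simp only [Finset.mem_insert, Finset.mem_singleton, not_or] at h3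
      have hb : ∀ b, a ≠ b → Nat.beq a b = false := fun b hab =>
        Bool.eq_false_iff.2 fun h => hab (Nat.eq_of_beq_eq_true h)
      rw [isInner, ha.1.2.1, hb _ h3.1, hb _ h3.2.1, hb _ h3.2.2]
      rfl
    have h3 := Finset.card_le_card h2
    have h4 := Finset.le_card_sdiff ({0, 7, 25} : Finset ℕ)
      (numbers (fun a => Nat.blt (Nat.mod a 128) 32) C)
    have h5 : ({0, 7, 25} : Finset ℕ).card = 3 := by decide
    have h6 := hC.2.1
    omega
  exact check_spec (K := K) (L := IsDense N M) h hK (fun h => absurd rfl h) hDB hDK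
    (fun C h => h.1) (fun a h => h) (fun C hC _ => hnum C hC) (fun C hC _ => hnum C hC) C hC

theorem le_minDist_iff (C : Finset (BTWord 7 1)) : (3 : ℕ∞) ≤ minDist C ↔ IsCode C := by
  unfold minDist IsCode
  simp only [le_iInf_iff]
  refine forall₅_congr fun w _ x _ _ => ?_
  exact_mod_cast Iff.rfl

/-! ### Nine binary words of length seven -/

theorem sum_ne_le (S : Finset (Fin 7 → ZMod 2)) (hS : S.card = 9) (i : Fin 7) :
    ∑ w ∈ S, ∑ x ∈ S, (if w i ≠ x i then 1 else 0) ≤ 40 := by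
  have h2 : ∀ y z : ZMod 2, y ≠ 0 → (z ≠ 0 ↔ ¬ y ≠ z) := by decide
  have hin : ∀ w ∈ S, ∑ x ∈ S, (if w i ≠ x i then 1 else 0) =
      if w i = 0 then (S.filter fun x => x i ≠ 0).card else (S.filter fun x => x i = 0).card := by
    intro w _
    rw [← Finset.card_filter]
    split_ifs with h
    · rw [h]
      congr 1
      exact Finset.filter_congr fun x _ => by rw [ne_comm]
    · congr 1
      refine Finset.filter_congr fun x _ => ?_
      have := h2 (w i) (x i) h
      tauto
  rw [Finset.sum_congr rfl hin, Finset.sum_ite, Finset.sum_const, Finset.sum_const, smul_eq_mul,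
    smul_eq_mul]
  have h9 := Finset.card_filter_add_card_filter_not (s := S) fun x => x i = 0
  rw [hS] at h9
  have ha : (S.filter fun x => x i = 0).card ≤ 9 := by omega
  have hb : (S.filter fun x => ¬ x i = 0).card = 9 - (S.filter fun x => x i = 0).card := by omega
  show (S.filter fun x => x i = 0).card * (S.filter fun x => ¬ x i = 0).card
    + (S.filter fun x => ¬ x i = 0).card * (S.filter fun x => x i = 0).card ≤ 40
  rw [hb]
  generalize (S.filter fun x => x i = 0).card = a at ha
  interval_cases a <;> norm_num

/-- The binary words of length seven contain no nine words with mutual distance four. -/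
theorem exists_hammingDist_lt (S : Finset (Fin 7 → ZMod 2)) (hS : 9 ≤ S.card) :
    ∃ w ∈ S, ∃ x ∈ S, w ≠ x ∧ hammingDist w x < 4 := by
  obtain ⟨S', hS', hc⟩ := Finset.exists_subset_card_eq hS
  by_contra! hcon
  have h1 : ∑ w ∈ S', ∑ x ∈ S', hammingDist w x ≤ 280 := by
    calc ∑ w ∈ S', ∑ x ∈ S', hammingDist w x
        = ∑ i : Fin 7, ∑ w ∈ S', ∑ x ∈ S', (if w i ≠ x i then 1 else 0) := by
          rw [Finset.sum_comm (s := Finset.univ)]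
          refine Finset.sum_congr rfl fun w _ => ?_
          rw [Finset.sum_comm (s := Finset.univ)]
          refine Finset.sum_congr rfl fun x _ => ?_
          rw [hammingDist, Finset.card_filter]
      _ ≤ ∑ i : Fin 7, 40 := Finset.sum_le_sum fun i _ => sum_ne_le S' hc i
      _ = 280 := by simp
  have h2 : ∑ w ∈ S', 32 ≤ ∑ w ∈ S', ∑ x ∈ S', hammingDist w x := by
    refine Finset.sum_le_sum fun w hw => ?_
    calc 32 = ∑ x ∈ S'.erase w, 4 := by
          rw [Finset.sum_const, Finset.card_erase_of_mem hw, hc]; rfl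
      _ ≤ ∑ x ∈ S'.erase w, hammingDist w x := Finset.sum_le_sum fun x hx => by
          rw [Finset.mem_erase] at hx
          exact hcon w (hS' hw) x (hS' hx.2) (Ne.symm hx.1)
      _ ≤ ∑ x ∈ S', hammingDist w x :=
          Finset.sum_le_sum_of_subset (Finset.erase_subset _ _)
  rw [Finset.sum_const, hc] at h2
  norm_num at h2
  omega

theorem exists_binDist_eq {C : Finset (BTWord 7 1)} (hC : IsCode C) (h : 25 ≤ C.card) :
    ∃ w ∈ C, ∃ x ∈ C, dist w x = 3 ∧ binDist w x = 3 := by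
  obtain ⟨c, -, hc⟩ := Finset.exists_lt_card_fiber_of_mul_lt_card_of_maps_to
    (s := C) (t := (Finset.univ : Finset (ZMod 3))) (f := fun w => w.1 0) (n := 8)
    (fun _ _ => Finset.mem_univ _) (by rw [Finset.card_univ, ZMod.card]; omega)
  have hfst : ∀ w ∈ C.filter (fun w => w.1 0 = c), w.1 = fun _ => c := by
    intro w hw
    funext i
    rw [Subsingleton.elim i 0]
    exact (Finset.mem_filter.1 hw).2
  have hinj : Set.InjOn Prod.snd (C.filter fun w => w.1 0 = c : Set (BTWord 7 1)) := by
    intro w hw x hx hwx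
    exact Prod.ext ((hfst w hw).trans (hfst x hx).symm) hwx
  obtain ⟨w, hw, x, hx, hne, hlt⟩ := exists_hammingDist_lt
    ((C.filter fun w => w.1 0 = c).image Prod.snd)
    (by rw [Finset.card_image_of_injOn hinj]; exact hc)
  obtain ⟨w, hw', rfl⟩ := Finset.mem_image.1 hw
  obtain ⟨x, hx', rfl⟩ := Finset.mem_image.1 hx
  have hter : terDist w x = 0 := by
    rw [terDist, hfst w hw', hfst x hx', hammingDist_self]
  have hwC := (Finset.mem_filter.1 hw').1
  have hxC := (Finset.mem_filter.1 hx').1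
  have h3 := hC w hwC x hxC fun h => hne (congrArg Prod.snd h)
  have hb : binDist w x < 4 := hlt
  refine ⟨w, hwC, x, hxC, ?_, ?_⟩ <;> rw [BTWord.dist] at * <;> omega

/-! ### A code with 26 words -/

/-- The words of a code with minimum distance three. -/
def optimalWords : List ℕ :=
  [0, 27, 62, 69, 78, 105, 112, 119, 141, 166, 168, 179, 195, 214, 239, 252, 263, 274, 284, 299,
    309, 328, 337, 351, 356, 378]

/-- A code with `26` words. -/
noncomputable def optimalCode : Finset (BTWord 7 1) := by
  classical exact optimalWords.toFinset.image dec

theorem isCode_optimalCode : IsCode optimalCode := by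
  intro w hw x hx hne
  obtain ⟨a, ha, rfl⟩ := Finset.mem_image.1 hw
  obtain ⟨b, hb, rfl⟩ := Finset.mem_image.1 hx
  rw [List.mem_toFinset] at ha hb
  have key : ∀ a ∈ optimalWords, a < 384 ∧
      ∀ b ∈ optimalWords, a ≠ b → 3 ≤ weight (a ^^^ b) := by decide +kernel
  rw [dist_dec (key a ha).1 (key b hb).1]
  exact (key a ha).2 b hb fun h => hne (h ▸ rfl)

theorem card_optimalCode : optimalCode.card = 26 := by
  have key : ∀ a ∈ optimalWords, a < 384 := by decide +kernel
  have h : optimalCode.card = optimalWords.toFinset.card := by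
    refine Finset.card_image_of_injOn fun a ha b hb hab => ?_
    rw [Finset.mem_coe, List.mem_toFinset] at ha hb
    exact dec_injOn (key a ha) (key b hb) hab
  rw [h]
  decide +kernel

theorem dec_mem_optimalCode {a : ℕ} (h : a ∈ optimalWords) : dec a ∈ optimalCode :=
  Finset.mem_image_of_mem _ (List.mem_toFinset.2 h)

theorem dec_zero : dec 0 = (![0], ![0, 0, 0, 0, 0, 0, 0]) := by
  refine Prod.ext ?_ ?_ <;> funext i <;> fin_cases i <;> decide +kernel

theorem dec_one_hundred_twelve : dec 112 = (![0], ![0, 0, 0, 0, 1, 1, 1]) := by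
  refine Prod.ext ?_ ?_ <;> funext i <;> fin_cases i <;> decide +kernel

theorem main_of_not_isBig (hbig : ∀ C, ¬ IsBig C) :
    BTWord.maxCard 7 1 3 = 26 ∧
    (∀ C : Finset (BTWord 7 1), BTWord.IsHammingPacking 3 C →
      C.card = 26 ∧ BTWord.minDist C = 3 ∧
      ∃ w ∈ C, ∃ x ∈ C, BTWord.dist w x = 3 ∧ BTWord.binDist w x = 3) ∧
    (∃ C : Finset (BTWord 7 1), BTWord.IsHammingPacking 3 C ∧
      ((![0], ![0, 0, 0, 0, 0, 0, 0]) : BTWord 7 1) ∈ C ∧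
      ((![0], ![0, 0, 0, 0, 1, 1, 1]) : BTWord 7 1) ∈ C) := by
  have hle : ∀ C : Finset (BTWord 7 1), ((3 : ℕ) : ℕ∞) ≤ minDist C → C.card ≤ 26 := by
    intro C hC
    by_contra! h
    exact hbig C ⟨(le_minDist_iff C).1 hC, h⟩
  have hopt : ((3 : ℕ) : ℕ∞) ≤ minDist optimalCode := (le_minDist_iff _).2 isCode_optimalCode
  refine ⟨?_, fun C hC => ?_, optimalCode, ⟨hopt, fun C hC => ?_⟩, ?_, ?_⟩
  · obtain ⟨⟨C, hC, hcard⟩, hub⟩ := isGreatest_maxCard 7 1 3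
    have h1 := hle C hC
    have h2 := hub ⟨optimalCode, hopt, card_optimalCode⟩
    omega
  · have hcode := (le_minDist_iff C).1 hC.1
    have hcard : C.card = 26 :=
      le_antisymm (hle C hC.1) (card_optimalCode ▸ hC.2 optimalCode hopt)
    obtain ⟨w, hw, x, hx, h3, hb⟩ := exists_binDist_eq hcode (by omega)
    refine ⟨hcard, le_antisymm ?_ hC.1, w, hw, x, hx, h3, hb⟩
    have hne : w ≠ x := by
      rintro rfl
      rw [binDist, hammingDist_self] at hb
      omega
    calc minDist C ≤ (dist w x : ℕ∞) :=
          (iInf₂_le w hw).trans ((iInf₂_le x hx).trans (iInf_le _ hne))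
      _ = 3 := by rw [h3]; rfl
  · rw [card_optimalCode]
    exact hle C hC
  · rw [← dec_zero]
    exact dec_mem_optimalCode (by decide)
  · rw [← dec_one_hundred_twelve]
    exact dec_mem_optimalCode (by decide)

/-! ### Nine words in a subcube -/

/-- The words of the first colour in the corner that are not near the word `0`. -/
def farWords : List ℕ :=
  [7, 11, 13, 14, 15, 19, 21, 22, 23, 25, 26, 27, 28, 29, 30, 31]

/-- The three words of a colour. -/
def tripleCode : List ℕ :=
  [66923720, 66921032, 63781562, 63781448, 66921146, 66923834, 7, 69676232, 66856520, 63760070,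
  63759944, 66856646, 69676358, 7, 69673544, 69609032, 63416012, 63415880, 69609164, 69673676, 7,
  69286538, 69265046, 66168476, 66168542, 69265124, 69286640, 7, 69848264, 66168392, 63416030,
  69848414, 5, 69845576, 69264968, 63760100, 69845732, 5, 69802610, 69609110, 66856604, 69802736,
  5, 69802568, 69286472, 63781616, 4, 69845618, 69673610, 66921116, 4, 69848306, 69676298,
  66923798, 4, 11]

theorem triple_check :
    check (fun _ => true) true isSmall isSmall [[0, 7, 25]] 2 2 [0] farWords
      [] [] (decode tripleCode []) = true := by
  decide +kernel

/-- The words in the corner that are not near the words `0`, `7` and `25`. -/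
def innerWords : List ℕ :=
  [30, 138, 139, 140, 141, 142, 146, 147, 148, 149, 150, 154, 156, 158, 159, 266, 267, 268, 269,
  270, 274, 275, 276, 277, 278, 282, 284, 286, 287]

theorem nine_check :
    check (fun _ => true) false isInner isInner [] 6 6 [0, 7, 25] innerWords [] []
      .leaf = true := by
  decide +kernel

theorem count_le_eight (C : Finset (BTWord 7 1)) (hC : IsCode C) : count C 0 0 ≤ 8 := by
  by_contra! h
  exact isDense_excluded (N := 9) (M := 0) (by norm_num) triple_check
    (triple_excluded (K := IsCode) nine_check (fun _ _ _ _ _ _ _ h => h.pull) (fun C h => h.1)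
      (by simp) (by norm_num)) C ⟨hC, h, Nat.zero_le _⟩

/-! ### Eight words in a subcube -/

def octad0 : Certificate where
  core := [0, 7, 25, 30, 138, 141, 147, 276]
  order :=
    [198, 76, 85, 230, 75, 216, 101, 82, 232, 226, 116, 253, 112, 44, 240, 353, 113, 223, 108, 249,
    106, 119, 110, 124, 102, 120, 122, 227, 239, 125, 251, 184, 225, 357, 296, 43, 244, 369, 302,
    245, 214, 319, 114, 191, 321, 118, 352, 289, 381, 361, 53, 50, 220, 375, 115, 246, 98, 111,
    351, 193, 315, 254, 358, 181, 328, 300, 370, 117, 228, 382, 317, 362, 312, 213, 224, 231, 363,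
    196, 356, 99, 359, 105, 236, 334, 322, 238, 208, 366, 338, 346, 182, 176, 326, 242, 383, 367,
    373, 349, 241, 229, 107, 329, 360, 311, 379, 166, 247, 323, 374, 335, 371, 235, 100, 297, 305,
    255, 248, 364, 188, 127, 104, 343, 233, 306, 354, 293, 355, 378, 303, 376, 164, 331, 314, 97,
    252, 337, 332, 109, 290, 380, 325, 368, 299, 291, 294, 161, 344, 250, 365, 377, 123, 347]
  symmetries := [
    (1751120,30,1,0), (1745688,0,1,0), (1742048,30,1,0)]
  branches := [
    (90, [0, 0, 0, 0, 4, 0, 2, 4, 0, 0, 0, 0, 5, 0, 0, 0, 0, 4, 0, 0, 3, 0, 0, 3, 6, 0, 0, 0, 2, 0,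
    0, 0, 2, 4, 0, 0, 3, 5, 4, 0, 0, 3, 0, 3, 0, 0, 2, 2, 3, 3, 0, 0, 0, 2, 2, 3, 3, 0, 0, 0, 0, 3,
    0, 2, 0, 4, 4, 0, 0, 3, 2, 0, 3, 7]),
    (138, [0, 0, 0, 3, 0, 2, 2, 3, 2, 0, 0, 3, 0, 0, 3, 0, 6]),
    (51, [0]),
    (65, [0]),
    (105, [0, 0, 2, 2, 3]),
    (144, [0, 2])]

def octad1 : Certificate where
  core := [0, 7, 25, 30, 138, 141, 147, 277]
  order :=
    [191, 75, 229, 198, 44, 225, 166, 184, 43, 82, 50, 363, 223, 76, 110, 250, 216, 246, 118, 193,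
    364, 232, 101, 113, 304, 361, 238, 227, 289, 127, 98, 245, 125, 241, 117, 109, 161, 102, 164,
    251, 249, 100, 115, 233, 188, 240, 236, 375, 119, 254, 116, 176, 226, 231, 302, 292, 123, 182,
    114, 52, 358, 294, 247, 352, 244, 214, 314, 104, 376, 296, 306, 383, 312, 180, 290, 319, 357,
    321, 107, 369, 212, 367, 230, 105, 235, 323, 382, 346, 334, 124, 220, 106, 379, 329, 324, 347,
    351, 84, 97, 370, 255, 353, 315, 335, 112, 99, 228, 360, 239, 336, 208, 120, 253, 366, 356,
    374, 344, 300, 122, 196, 371, 108, 331, 326, 248, 252, 328, 111, 381, 338, 299, 297, 380, 291,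
    310, 342, 359, 355, 365, 316, 354, 303, 362, 348, 322, 378, 332, 372, 377, 368, 242, 224]
  symmetries := [
    (1751120,30,1,0), (1745688,0,1,0), (1742048,30,1,0)]
  branches := [
    (66, [0, 0, 46406480, 0, 0, 4, 0, 0, 2, 5, 0, 2, 0, 2, 1, 2, 5, 0, 0, 3, 0, 2, 2, 0, 2, 2, 3,
    0, 2, 4, 0, 0, 2, 2, 3, 2, 0, 0, 2, 2, 3, 2, 6]),
    (139, [0, 2, 0, 2, 41008944, 2, 0, 2, 3, 2, 4, 0, 0, 3, 41008944, 2, 2, 0, 3, 3, 3]),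
    (10, [0]),
    (70, [0]),
    (75, [0, 0, 3, 0, 2, 2, 3]),
    (59, [0, 0, 3, 2]),
    (73, [0, 2, 2, 2])]

def octad2 : Certificate where
  core := [0, 7, 25, 138, 141, 147, 276, 287]
  order :=
    [82, 43, 53, 75, 97, 166, 216, 225, 231, 232, 85, 240, 44, 115, 50, 252, 238, 198, 98, 105,
    122, 228, 111, 99, 226, 161, 76, 118, 249, 102, 112, 58, 123, 193, 296, 242, 251, 120, 246,
    227, 107, 233, 312, 363, 230, 353, 222, 331, 101, 104, 124, 113, 119, 297, 370, 114, 108, 245,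
    322, 184, 109, 78, 208, 235, 62, 239, 362, 100, 125, 117, 94, 196, 236, 116, 381, 110, 248,
    190, 188, 90, 373, 302, 86, 328, 289, 46, 54, 314, 299, 323, 181, 294, 92, 214, 182, 305, 126,
    220, 360, 106, 356, 325, 255, 213, 332, 375, 300, 337, 358, 253, 329, 346, 374, 378, 164, 354,
    361, 127, 371, 334, 176, 247, 355, 377, 321, 60, 364, 254, 376, 352, 366, 379, 293, 359, 357,
    290, 250, 344, 241, 326, 382, 365, 229, 368, 338, 224, 291, 306, 367, 369, 244, 380]
  symmetries := [
    (1745688,0,1,0)]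
  branches := [
    (42, [0, 0, 104502602, 0, 3, 2, 104502602, 0, 3, 2, 104502602, 2, 2, 4, 0, 2, 2, 0, 2, 2, 3,
    104502602, 2, 2, 2, 104502602, 2, 2, 104502602, 0, 3, 2, 3, 104502602, 2, 2, 2, 7, 0, 0, 0, 2,
    2, 0, 2, 2, 3, 0, 0, 2, 2, 2, 0, 2, 2, 0, 2, 0, 2, 3, 3, 7, 0, 2, 2, 2, 0, 2, 2, 2, 1, 1, 1, 6,
    0, 2, 2, 2, 0, 2, 2, 2, 0, 2, 2, 2, 1, 5, 0, 2, 2, 2, 2, 0, 2, 0, 2, 3, 2, 1, 3, 0, 2, 2, 0, 2,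
    2, 3, 1, 3, 0, 2, 2, 2, 0, 2, 2, 2, 3, 0, 2, 2, 2, 2, 1, 12]),
    (53, [0, 2, 0, 3, 0, 2, 2, 1, 0, 2, 0, 2, 3, 4, 0, 2, 0, 2, 3, 2, 0, 2, 0, 2, 3, 0, 3, 1, 0, 7,
    1, 1, 3, 0, 2, 2, 2, 2, 1, 1, 3, 0, 2, 0, 2, 3, 2, 0, 2, 2, 2, 0, 2, 2, 2, 4, 1, 7]),
    (59, [0, 0, 104502602, 2, 2, 38277906, 0, 5, 0, 0, 2, 0, 2, 3, 0, 0, 2, 138941258, 2, 3, 2, 7,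
    41008712, 38278044, 46406418, 3, 3, 41008712, 138941340, 2, 3, 41008712, 138941340, 2, 3,
    41008712, 2, 5, 0, 0, 2, 0, 2, 3, 0, 0, 2, 3, 0, 2, 0, 2, 3, 4, 104502602, 2, 2, 104502602, 0,
    3, 138941340, 2, 3, 104502602, 0, 3, 2, 4, 0, 104502602, 2, 138941340, 2, 3, 0, 4, 0,
    104502602, 2, 2, 3, 7, 0, 0, 0, 2, 3, 0, 2, 0, 2, 3, 3, 1, 0, 2, 2, 1, 3, 0, 0, 3, 0, 2, 0, 2,
    3, 2, 0, 2, 0, 2, 3, 2, 0, 0, 2, 2, 3, 8, 0, 2, 0, 0, 3, 0, 0, 2, 2, 3, 4, 0, 0, 3, 2, 0, 2, 0,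
    2, 3, 0, 3, 0, 2, 0, 2, 3, 2, 0, 2, 2, 2, 4, 0, 0, 3, 0, 2, 2, 2, 0, 2, 2, 0, 2, 2, 3, 3, 0, 2,
    2, 2, 147069770, 2, 2, 0, 2, 2, 3, 3, 0, 12]),
    (78, [104502602, 0, 3, 2, 104502602, 0, 3, 2, 3, 1, 1, 4, 104502602, 2, 2, 104502602, 2, 2, 3,
    0, 2, 2, 0, 2, 2, 3, 1, 1, 5, 0, 2, 0, 2, 3, 2, 2, 4]),
    (114, [0, 0, 2, 2, 3, 0, 2, 2, 0, 2, 2, 3, 3, 0, 2, 0, 2, 3, 0, 2, 0, 2, 3, 3, 0, 2, 2, 2, 3,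
    0, 2, 2, 0, 2, 2, 3, 2, 0, 2, 2, 2, 2, 5]),
    (135, [104502602, 2, 2, 104502602, 2, 2, 3, 2, 104502602, 2, 2, 2, 2, 3]),
    (106, [104502602, 0, 3, 2, 104502602, 0, 3, 2, 3, 0, 0, 2, 3, 0, 0, 2, 3, 3, 3, 0, 2, 2, 2, 2,
    0, 2, 2, 2, 0, 2, 2, 2, 3, 0, 5]),
    (77, [104502602, 0, 3, 2, 2, 2, 0, 0, 2, 3, 2, 2, 3]),
    (88, [1]),
    (90, [0, 2, 2, 2, 2, 0, 2, 2, 2, 2, 3])]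

def octad3 : Certificate where
  core := [0, 7, 25, 138, 148, 159, 268, 274]
  order :=
    [62, 94, 372, 253, 239, 236, 205, 211, 245, 381, 198, 375, 237, 216, 117, 184, 118, 241, 226,
    247, 341, 166, 229, 231, 102, 369, 357, 173, 109, 242, 376, 230, 312, 227, 246, 197, 240, 331,
    289, 43, 250, 254, 169, 358, 232, 356, 252, 238, 366, 363, 161, 177, 251, 368, 83, 344, 51,
    127, 113, 377, 359, 249, 115, 78, 362, 90, 379, 373, 92, 123, 326, 367, 104, 355, 195, 378,
    201, 235, 224, 209, 243, 233, 86, 54, 343, 329, 311, 112, 225, 163, 126, 349, 371, 291, 303,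
    58, 293, 98, 354, 120, 100, 361, 228, 335, 165, 108, 99, 309, 382, 110, 107, 297, 321, 101,
    179, 347, 317, 114, 323, 305, 77, 374, 97, 350, 353, 60, 294, 193, 111, 53, 248, 383, 337, 46,
    119, 315, 318, 45, 380, 352, 106, 85, 125, 122, 124, 360, 116, 75, 325, 299, 105, 365]
  symmetries := [
    (1751120,0,1,0), (1745688,0,1,0), (1742048,0,1,0)]
  branches := [
    (86, [0, 0, 243023496, 0, 3, 4, 38793864, 2, 0, 2, 3, 3, 243023496, 2, 243023496, 2, 3, 2, 0,
    0, 3, 2, 4, 0, 243023496, 2, 243023496, 2, 3, 2, 243023496, 2, 2, 2, 4, 0, 0, 2, 0, 2, 3, 3, 0,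
    0, 3, 0, 0, 3, 2, 0, 0, 2, 3, 2, 3, 6]),
    (93, [0, 2, 2, 0, 2, 2, 3, 2, 0, 104674713, 3, 0, 3, 2, 0, 2, 2, 2, 0, 104674713, 3, 0, 3, 2,
    4, 44556996, 104674713, 3, 44556996, 2, 3, 2, 0, 2, 2, 2, 3, 4]),
    (39, [0]),
    (56, [0]),
    (114, [0, 104674713, 3, 0, 3, 0, 0, 3, 3, 2, 0, 0, 0, 3, 2, 0, 4, 0, 0, 3, 0, 0, 3, 3, 2, 0, 2,
    5]),
    (126, [0, 0, 3, 2, 2, 2]),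
    (149, [0, 104674713, 3, 2, 2, 2, 2])]

def octad4 : Certificate where
  core := [0, 7, 25, 138, 141, 148, 275, 286]
  order :=
    [184, 216, 43, 104, 82, 223, 109, 191, 110, 370, 76, 236, 100, 124, 75, 108, 44, 229, 118, 111,
    193, 105, 112, 99, 98, 115, 232, 198, 241, 166, 252, 85, 53, 97, 296, 122, 50, 123, 242, 224,
    127, 161, 226, 249, 246, 238, 231, 368, 247, 228, 353, 360, 178, 163, 113, 240, 248, 309, 358,
    225, 312, 254, 92, 78, 380, 253, 325, 46, 177, 215, 58, 210, 344, 114, 335, 378, 376, 331, 381,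
    329, 373, 230, 251, 243, 356, 219, 336, 375, 227, 119, 183, 361, 354, 293, 90, 349, 292, 359,
    107, 364, 326, 383, 126, 125, 324, 341, 187, 233, 235, 299, 117, 239, 101, 95, 355, 367, 250,
    54, 297, 352, 289, 63, 290, 303, 116, 106, 195, 374, 209, 362, 363, 321, 255, 328, 120, 86,
    372, 102, 366, 357, 379, 294, 60, 300, 369, 322, 377, 365, 332, 317, 245, 304]
  symmetries := [
    (1754760,13,2,1), (1742048,0,1,0), (1742048,13,2,1)]
  branches := [
    (32, [0, 0, 0, 0, 0, 327881646, 3, 0, 327881646, 3, 0, 4, 0, 0, 0, 7, 0, 0, 0, 0, 2, 0,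
    239604299, 2, 3, 6, 0, 0, 0, 239604299, 2, 2, 45072971, 0, 2, 5, 0, 0, 9, 0, 41008976, 0, 0,
    141672272, 6, 3839090, 0, 0, 4, 0, 3, 3839090, 0, 231252830, 0, 0, 6, 231252830, 0, 0, 5,
    3839090, 0, 0, 4, 0, 2, 3, 0, 0, 0, 7, 0, 231252830, 2, 231252830, 2, 3, 0, 4, 0, 0, 41009052,
    246399639, 231252762, 4, 231252762, 3, 0, 5, 0, 0, 2, 0, 3, 260116506, 2, 4, 1, 0, 3839090,
    231252762, 3, 231252762, 3, 9, 0, 0, 0, 0, 4, 0, 2, 3, 0, 0, 0, 0, 4, 0, 3, 0, 6, 245431999, 2,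
    2, 0, 3, 0, 2, 2, 0, 3, 0, 0, 3, 0, 0, 2, 2, 4, 0, 6, 0, 0, 2, 2, 0, 0, 2, 2, 5, 0, 0, 0, 0, 5,
    0, 0, 3, 0, 2, 3, 0, 246399639, 2, 3, 3, 4, 0, 0, 0, 2, 2, 4, 0, 2, 2, 2, 3, 0, 0, 0, 3, 2, 0,
    2, 4, 0, 2, 0, 2, 2, 3, 0, 1, 3, 1, 5, 0, 0, 2, 2, 0, 4, 0, 0, 2, 4, 0, 0, 2, 3, 0, 2, 3, 0, 2,
    11]),
    (60, [0, 0, 335623023, 0, 247345918, 4, 335623023, 0, 3, 335623023, 247345918, 3, 4, 0, 0, 0,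
    0, 3, 0, 2, 3, 5, 0, 333537119, 0, 3, 3, 0, 245431999, 2, 3, 0, 4, 0, 2, 2, 5, 0, 0, 0, 0, 4,
    335623023, 247345918, 3, 0, 2, 3, 3, 0, 2, 2, 327881646, 0, 3, 2, 3, 4, 0, 0, 0, 2, 0, 2, 2, 4,
    0, 2, 2, 0, 2, 2, 3, 3, 0, 327881646, 0, 2, 3, 239604299, 0, 2, 3, 3, 3, 0, 8]),
    (93, [0, 2, 2, 2, 0, 2, 2, 2, 3, 0, 2, 2, 2, 0, 2, 2, 2, 3, 0, 2, 2, 2, 0, 2, 2, 2, 3, 0, 2, 2,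
    2, 0, 2, 2, 2, 3, 5]),
    (123, [0, 2, 2, 2, 0, 2, 2, 2, 3, 0, 2, 2, 2, 0, 2, 2, 2, 3, 3])]

def octad5 : Certificate where
  core := [0, 7, 25, 138, 148, 269, 275, 286]
  order :=
    [109, 124, 76, 82, 374, 312, 299, 193, 75, 326, 254, 50, 377, 251, 105, 247, 127, 354, 98, 161,
    224, 328, 368, 230, 229, 344, 223, 227, 242, 359, 99, 123, 97, 112, 115, 239, 233, 379, 321,
    235, 336, 53, 331, 175, 90, 241, 126, 104, 362, 95, 238, 116, 375, 43, 294, 163, 253, 290, 46,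
    101, 122, 183, 309, 296, 322, 289, 165, 358, 100, 178, 324, 177, 236, 369, 85, 341, 383, 304,
    353, 231, 106, 118, 191, 352, 184, 357, 113, 249, 204, 86, 364, 221, 111, 376, 225, 195, 198,
    355, 373, 255, 78, 216, 372, 366, 187, 248, 54, 63, 166, 110, 58, 378, 172, 245, 114, 240, 292,
    60, 237, 367, 363, 92, 219, 243, 119, 381, 102, 44, 356, 370, 120, 189, 380, 107, 360, 117,
    169, 125, 246, 215, 226, 209, 207, 252, 250, 108, 201, 197, 361, 232, 210, 228]
  symmetries := [
    (1746696,30,2,2), (1751120,0,1,0), (1750112,30,2,2), (1753752,30,2,2), (1745688,0,1,0),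
    (1743056,30,2,2), (1742048,0,1,0)]
  branches := [
    (58, [0, 333537119, 0, 0, 461443334, 3, 0, 0, 6, 0, 0, 0, 0, 4, 0, 2, 2, 5, 239604299, 2, 2, 0,
    2, 2, 3, 0, 0, 0, 4, 0, 3, 1, 6, 0, 0, 3, 0, 3, 0, 0, 2, 3, 2, 1, 4, 0, 333537119, 0, 0, 4, 0,
    0, 2, 2, 4, 1, 1, 5, 0, 333537119, 2, 245431999, 2, 3, 333537119, 335623023, 2, 3, 0, 2, 2, 3,
    333537119, 0, 0, 4, 0, 3, 1, 6, 327881646, 2, 2, 2, 2, 0, 0, 2, 2, 2, 0, 0, 2, 3, 0, 3, 4, 0,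
    2, 453701839, 2, 2, 3, 2, 8]),
    (54, [0, 0, 246399563, 449059445, 46406219, 4, 246399563, 2, 246399563, 2, 4, 0, 0, 5, 0, 0, 0,
    0, 0, 0, 0, 0, 409588993, 2, 409588993, 2, 4, 3, 6, 0, 0, 0, 9]),
    (108, [0])]

def octad6 : Certificate where
  core := [0, 7, 25, 30, 138, 148, 268, 275]
  order :=
    [106, 82, 116, 363, 224, 184, 53, 43, 247, 223, 125, 325, 225, 107, 50, 117, 297, 99, 293, 75,
    254, 370, 378, 123, 335, 166, 344, 113, 115, 119, 229, 161, 377, 251, 227, 77, 191, 127, 349,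
    248, 246, 193, 226, 232, 253, 124, 228, 112, 98, 231, 198, 249, 100, 118, 353, 85, 303, 111,
    114, 289, 238, 210, 368, 120, 233, 360, 255, 216, 205, 183, 173, 379, 374, 240, 321, 243, 250,
    312, 175, 365, 294, 45, 336, 366, 241, 380, 97, 329, 239, 326, 355, 359, 201, 317, 104, 108,
    215, 169, 165, 110, 105, 319, 362, 178, 356, 314, 372, 304, 310, 290, 221, 189, 177, 373, 245,
    163, 197, 309, 299, 346, 322, 367, 357, 375, 235, 383, 354, 236, 358, 219, 376, 187, 369, 352,
    382, 242, 252, 122, 237, 195, 351, 230, 361, 331, 341, 101, 209, 381, 102, 109, 342, 207]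
  symmetries := [
    (1751120,30,1,0), (1745688,30,1,0), (1742048,0,1,0)]
  branches := [
    (97, [206477684, 2, 307205266, 308753557, 3, 3, 206477684, 2, 2, 307205266, 308753557, 3, 2,
    206477684, 2, 2, 5, 1, 3]),
    (112, [41008754, 206477684, 443662076, 4, 0, 242335346, 2, 4, 206477684, 0, 2, 3, 443662076, 2,
    2, 4, 335816562, 0, 0, 2, 4, 0, 335816562, 0, 3, 2, 4, 547422031, 2, 2, 2, 4, 206477684, 0, 2,
    3, 206477684, 0, 2, 3, 206477684, 2, 206477684, 2, 2, 5, 307205266, 0, 2, 3, 307205266, 2,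
    307205266, 2, 2, 4, 247732991, 0, 2, 3, 247732991, 0, 2, 3, 3, 1, 5, 0, 2, 2, 0, 2, 2, 3,
    41008895, 2, 2, 2, 3, 1, 5]),
    (31, [0, 0, 0, 0, 447726152, 0, 7, 0, 0, 0, 0, 0, 0, 4, 3, 4, 0, 2, 0, 2, 5, 0, 0, 0, 0, 0, 5,
    0, 0, 0, 0, 2, 3, 0, 2, 7, 0, 0, 548389448, 0, 5, 0, 308753557, 2, 3, 0, 0, 2, 5, 0, 2,
    541981557, 2, 2, 239604446, 327881494, 3, 2, 2, 4, 0, 0, 3, 2, 2, 6]),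
    (59, [0]),
    (117, [0, 2, 0, 0, 3, 3, 0, 0, 0, 3, 3, 2, 3]),
    (70, [0, 2, 0, 0, 3, 3])]

def octad7 : Certificate where
  core := [0, 7, 25, 30, 138, 148, 268, 274]
  order :=
    [369, 356, 326, 354, 166, 75, 191, 117, 291, 240, 305, 315, 216, 378, 120, 224, 53, 101, 105,
    99, 303, 311, 299, 111, 312, 123, 184, 119, 233, 85, 373, 161, 297, 45, 366, 173, 349, 227,
    250, 169, 116, 239, 109, 229, 189, 383, 232, 374, 183, 251, 193, 353, 108, 225, 98, 175, 344,
    254, 236, 241, 118, 335, 177, 107, 337, 365, 329, 125, 102, 223, 248, 114, 235, 343, 362, 165,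
    245, 319, 43, 211, 381, 106, 97, 357, 127, 231, 124, 242, 253, 110, 355, 198, 243, 323, 77,
    163, 375, 376, 228, 83, 371, 321, 219, 379, 341, 380, 104, 358, 195, 51, 317, 187, 293, 230,
    363, 359, 252, 201, 361, 352, 309, 249, 247, 382, 255, 205, 221, 207, 197, 289, 325, 368, 115,
    331, 238, 377, 179, 112, 294, 360, 100, 351, 113, 246, 215, 209, 237, 347, 122, 372, 226, 367]
  symmetries := [
    (1754760,30,1,0), (1751176,0,2,0), (1751176,30,2,0), (1754704,0,2,0), (1754704,30,2,0),
    (1751120,0,1,0), (1751120,30,1,0), (1745688,0,1,0), (1745688,30,1,0), (1745632,0,2,0),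
    (1745632,30,2,0), (1742104,0,2,0), (1742104,30,2,0), (1742048,0,1,0), (1742048,30,1,0)]
  branches := [
    (62, [0, 0, 0, 2, 3, 3, 2, 0, 2, 2, 0, 2, 0, 3, 0, 2, 2, 4, 1, 3, 0, 2, 2, 0, 3, 2, 1, 2, 5]),
    (31, [0]),
    (109, [0, 2]),
    (136, [0])]

def octad8 : Certificate where
  core := [0, 7, 25, 30, 138, 141, 275, 276]
  order :=
    [109, 43, 98, 75, 115, 110, 50, 85, 118, 82, 235, 191, 108, 123, 44, 122, 76, 99, 106, 161,
    224, 193, 251, 100, 233, 223, 198, 107, 105, 246, 53, 112, 236, 101, 104, 119, 369, 125, 239,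
    227, 114, 124, 97, 373, 247, 370, 353, 102, 358, 117, 113, 357, 321, 375, 331, 214, 166, 253,
    177, 252, 241, 346, 364, 250, 296, 184, 356, 334, 355, 216, 238, 240, 232, 219, 319, 354, 365,
    332, 226, 290, 209, 377, 127, 314, 293, 349, 367, 366, 196, 188, 378, 229, 182, 176, 116, 382,
    195, 297, 208, 322, 329, 220, 299, 303, 376, 245, 249, 335, 178, 213, 380, 300, 181, 317, 312,
    164, 289, 381, 326, 242, 163, 254, 230, 302, 351, 363, 374, 183, 325, 360, 215, 187, 328, 255,
    111, 362, 243, 368, 352, 231, 359, 248, 383, 210, 379, 228, 344, 294, 225, 361, 120, 244]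
  symmetries := [
    (1754760,7,1,0), (1754760,25,2,0), (1754760,30,2,0), (1751120,0,2,0), (1751120,7,2,0),
    (1751120,25,1,0), (1751120,30,1,0)]
  branches := [
    (56, [0, 38277884, 0, 0, 0, 0, 642257522, 644988491, 5, 644988491, 0, 642257522, 3, 4, 0, 0, 0,
    8, 0, 0, 0, 0, 0, 3, 2, 5, 0, 327881652, 0, 0, 2, 0, 3, 4, 242335346, 0, 440930930, 257385461,
    5, 0, 257385461, 3, 257385461, 4, 440930930, 541981525, 257385461, 4, 257385461, 4, 0, 0, 0, 9,
    41008754, 239604476, 0, 443662076, 260116607, 6, 242335346, 239604476, 0, 4, 239604476, 0, 5,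
    0, 147069770, 260116488, 0, 4, 147069770, 2, 147069770, 260116488, 3, 4, 0, 0, 2, 3, 0, 6, 0,
    0, 0, 458137003, 3, 458137003, 3, 0, 0, 3, 2, 0, 2, 2, 6, 41008754, 443662076, 260116607, 4,
    242335346, 2, 0, 4, 0, 0, 0, 3, 0, 2, 3, 642257633, 0, 3, 2, 5, 0, 2, 2, 41008754, 443662076,
    3, 242335346, 2, 3, 0, 3, 0, 7, 0, 0, 0, 0, 406492296, 457744597, 3, 0, 5, 0, 0, 6, 239604476,
    327881512, 147069770, 2, 2, 0, 5, 41008754, 2, 0, 2, 3, 0, 0, 0, 3, 2, 4, 0, 2, 242335346, 2,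
    2, 2, 0, 6, 0, 0, 2, 0, 2, 3, 2, 3, 242335346, 0, 0, 4, 0, 46406474, 260116424, 3, 4,
    242335346, 0, 3, 461443058, 2, 3, 0, 0, 2, 3, 4, 0, 0, 0, 260116424, 2, 5, 0, 0, 3, 1, 4, 1, 4,
    0, 0, 458712011, 46406474, 260116424, 3, 260116424, 2, 4, 458712011, 461443058, 2, 3,
    458712011, 2, 2, 4, 0, 2, 2, 0, 2, 0, 2, 3, 3, 5, 0, 0, 1, 12]),
    (89, [458137003, 0, 2, 2, 3, 0, 2, 2, 0, 2, 2, 3, 3, 0, 2, 2, 2, 0, 2, 2, 2, 3, 0, 2, 2, 2, 0,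
    2, 2, 2, 3, 4])]

def octad9 : Certificate where
  core := [0, 7, 25, 30, 138, 148, 269, 275]
  order :=
    [241, 223, 193, 247, 245, 238, 85, 191, 227, 224, 184, 43, 309, 177, 125, 377, 237, 115, 374,
    252, 183, 356, 239, 368, 232, 381, 242, 114, 122, 231, 380, 197, 292, 375, 326, 124, 363, 172,
    104, 351, 372, 352, 76, 346, 312, 123, 75, 110, 166, 324, 367, 373, 230, 50, 328, 334, 108,
    341, 253, 204, 163, 119, 251, 370, 101, 111, 362, 246, 216, 336, 120, 290, 240, 100, 383, 207,
    294, 243, 322, 255, 376, 254, 215, 225, 344, 82, 364, 348, 342, 53, 331, 102, 250, 233, 354,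
    175, 127, 210, 98, 195, 299, 229, 219, 353, 99, 117, 358, 355, 112, 316, 249, 178, 369, 118,
    116, 310, 109, 106, 235, 236, 226, 314, 165, 44, 209, 296, 357, 378, 107, 248, 321, 360, 169,
    201, 97, 221, 289, 361, 359, 304, 189, 105, 319, 382, 302, 187, 161, 198, 113, 228, 366, 379]
  symmetries := [
    (1754760,7,2,0), (1754760,25,2,0), (1754760,30,1,0), (1751120,0,1,0), (1751120,7,2,0),
    (1751120,25,2,0), (1751120,30,1,0), (1745688,0,1,0), (1745688,7,2,0), (1745688,25,2,0),
    (1745688,30,1,0), (1742048,0,1,0), (1742048,7,2,0), (1742048,25,2,0), (1742048,30,1,0)]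
  branches := [
    (71, [0, 0, 0, 2, 0, 0, 2, 327881494, 2, 6, 0, 0, 3, 3, 0, 2, 2, 2, 0, 443661896, 2, 3, 0,
    41008862, 2, 3, 45073118, 833103713, 3, 2, 2, 650385992, 2, 5, 0, 2, 0, 2, 3, 6]),
    (48, [0]),
    (53, [0]),
    (100, [0])]

def octad10 : Certificate where
  core := [0, 7, 25, 138, 141, 148, 274, 287]
  order :=
    [43, 106, 211, 105, 53, 75, 166, 296, 99, 76, 44, 292, 85, 184, 161, 107, 109, 238, 236, 289,
    54, 198, 111, 62, 183, 248, 101, 187, 117, 124, 226, 245, 309, 373, 113, 230, 125, 120, 190,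
    246, 291, 231, 228, 293, 312, 250, 83, 300, 232, 299, 252, 119, 215, 209, 195, 216, 240, 249,
    239, 100, 376, 122, 222, 364, 104, 115, 112, 193, 362, 224, 381, 325, 60, 357, 321, 78, 243,
    102, 348, 253, 51, 374, 46, 98, 331, 329, 354, 92, 294, 297, 219, 177, 254, 359, 341, 247, 86,
    323, 377, 367, 242, 332, 358, 366, 225, 123, 305, 360, 118, 235, 127, 368, 378, 241, 379, 328,
    126, 255, 90, 372, 114, 110, 302, 108, 352, 316, 179, 353, 229, 324, 356, 363, 371, 361, 326,
    94, 163, 365, 382, 344, 334, 97, 58, 375, 227, 233, 251, 116, 369, 337, 355, 380]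
  symmetries := [
    (1754760,13,2,1), (1742048,0,1,0), (1742048,13,2,1)]
  branches := [
    (32, [41008914, 0, 846315159, 0, 448328452, 5, 846315159, 448328452, 0, 5, 846315159, 0, 0, 0,
    4, 2, 0, 2, 2, 6, 147069744, 0, 0, 4, 260116466, 0, 0, 4, 3, 0, 649655044, 0, 45675190, 5,
    45675190, 0, 649655044, 0, 4, 4, 46406448, 0, 851712645, 0, 5, 0, 2, 3, 447102724, 44449462, 3,
    2, 5, 454647752, 0, 838415161, 0, 0, 5, 838415161, 2, 3, 0, 2, 0, 0, 3, 2, 5, 147069744, 0, 0,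
    4, 260116466, 0, 0, 4, 3, 0, 2, 3, 46406418, 0, 461443016, 4, 851712645, 0, 3, 832652089, 2, 4,
    0, 0, 3, 2, 3, 260116466, 2, 46406480, 461443016, 3, 3, 461443016, 2, 2, 3, 46406418, 2,
    851712645, 2, 3, 2, 8, 0, 2, 649655044, 0, 2, 4, 0, 2, 2, 3, 0, 448328452, 549034908, 4,
    447102724, 2, 2, 455164080, 547766020, 3, 2, 4, 448328452, 45675190, 3, 448328452, 2, 3,
    549034908, 2, 0, 2, 2, 3, 455164080, 2, 547765945, 2, 3, 549034908, 951644857, 4, 6, 0, 0, 3,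
    832748857, 2, 3, 2, 0, 2, 2, 2, 3, 0, 0, 2, 3, 0, 838415161, 0, 4, 832652089, 2, 3, 832652089,
    2, 4, 838415161, 2, 231252804, 2, 0, 2, 3, 3, 231252804, 2, 2, 4, 0, 45675271, 3, 0, 3,
    231252804, 2, 0, 2, 0, 2, 4, 231252804, 2, 0, 2, 0, 2, 4, 3, 0, 447102649, 2, 447102649,
    44449543, 3, 3, 0, 2, 2, 648429241, 2, 5, 4, 0, 2, 2, 0, 2, 2, 3, 231252804, 2, 0, 2, 2, 3,
    231252804, 2, 2, 2, 4, 0, 0, 0, 3, 0, 2, 2, 4, 0, 649654969, 45675271, 4, 649654969, 2, 3, 0,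
    2, 2, 2, 0, 2, 0, 2, 3, 2, 5, 8]),
    (40, [0, 2, 2, 0, 2, 2, 3, 0, 2, 2, 2, 3, 1, 1, 1, 5]),
    (43, [0, 2, 2, 2, 455164080, 2, 2, 455164080, 2, 2, 3, 3, 1, 455040324, 2, 2, 147069770, 2, 0,
    2, 3, 2, 0, 2, 2, 2, 3, 5]),
    (142, [0, 2, 2, 0, 2, 2, 3, 2, 2]),
    (14, [0, 2, 2, 0, 46406448, 0, 3, 3, 41009052, 2, 3, 41009052, 2, 2, 4, 46406448, 2, 2, 2, 2,
    3]),
    (23, [0, 0, 460927238, 3, 455164080, 2, 3, 460927238, 2, 3, 455164080, 2, 2, 2, 3, 460927238,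
    2, 2, 2, 4]),
    (47, [454647876, 2, 2, 2, 2])]

def octad11 : Certificate where
  core := [0, 7, 25, 138, 149, 269, 275, 286]
  order :=
    [326, 193, 247, 76, 223, 100, 124, 44, 251, 110, 191, 109, 229, 108, 118, 122, 241, 377, 104,
    115, 374, 239, 227, 175, 161, 370, 82, 242, 233, 236, 321, 328, 336, 230, 354, 360, 358, 359,
    366, 102, 352, 112, 95, 322, 364, 90, 92, 356, 78, 331, 304, 63, 166, 375, 188, 308, 255, 84,
    224, 107, 294, 43, 97, 54, 50, 182, 176, 376, 52, 378, 164, 232, 101, 225, 299, 86, 60, 344,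
    114, 250, 195, 290, 220, 289, 187, 201, 169, 249, 113, 381, 46, 178, 253, 198, 292, 111, 312,
    240, 353, 235, 357, 163, 340, 368, 379, 125, 383, 219, 58, 244, 123, 228, 214, 296, 98, 226,
    172, 254, 196, 117, 355, 207, 127, 324, 238, 184, 210, 120, 369, 106, 119, 216, 105, 363, 246,
    380, 237, 231, 362, 75, 208, 373, 367, 248, 243, 361, 204, 252, 116, 99, 126, 372]
  symmetries := [
    (1750112,30,2,2), (1745688,0,1,0), (1743056,30,2,2)]
  branches := [
    (64, [0, 454647984, 838544072, 831189704, 3, 205165704, 2, 4, 547421884, 446758588, 205165704,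
    2, 4, 0, 0, 205165704, 2, 205165704, 2, 3, 7, 307205322, 38277854, 3, 205165901, 831189704, 3,
    458712266, 2, 2, 4, 308753607, 206864716, 440930888, 4, 548389788, 333537119, 3, 444629656, 2,
    3, 3, 0, 1058603550, 2, 3, 2, 0, 0, 0, 1058603550, 3, 0, 2, 3, 4, 6, 307205322, 944247368,
    642257480, 38277854, 5, 205165901, 38277707, 831189704, 4, 0, 454647984, 2, 2, 0, 6, 307205322,
    944247368, 642257480, 38277854, 5, 205165901, 38277707, 831189704, 4, 0, 547421953, 2, 2, 0, 6,
    205165901, 2, 2, 307205322, 2, 2, 642257480, 0, 2, 3, 4, 944247368, 2, 38277854, 2, 3,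
    944247368, 38277707, 3, 1, 38277854, 831189704, 3, 8, 308753607, 206864716, 541981519,
    440930888, 5, 547421884, 446758588, 3, 547421884, 446758588, 3, 4, 308753607, 206864716,
    541981519, 440930888, 5, 950075068, 44105470, 3, 950075068, 44105470, 3, 4, 308753607, 2, 2, 2,
    308753607, 0, 541981519, 440930888, 5, 333537119, 2, 333537119, 2, 4, 541981519, 333537119, 2,
    3, 440930888, 333537119, 2, 3, 4, 206864716, 2, 2, 541981519, 2, 440930888, 2, 4, 541981519, 2,
    440930888, 2, 8, 1, 1, 333537051, 2, 0, 2, 3, 2, 0, 2, 0, 1065033277, 0, 4, 2, 3, 5, 0, 2,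
    327881646, 2, 3, 0, 2, 0, 2, 1058603550, 2, 4, 0, 2, 1058603550, 2, 3, 4, 2, 0, 0, 0, 2,
    239604299, 4, 332956479, 2, 243303166, 2, 3, 4, 0, 0, 247732811, 2, 0, 239604299, 5, 0,
    243303166, 2, 3, 333537051, 245432062, 3, 5, 0, 239604299, 3, 2, 0, 2, 2, 1058603550, 2, 2, 4,
    4, 0, 2, 0, 2, 3, 1065033277, 0, 0, 4, 245432062, 2, 3, 0, 2, 2, 4, 247757042, 2, 2, 3, 0, 0,
    0, 2, 3, 3, 0, 0, 247732811, 2, 0, 2, 4, 333537051, 245432062, 3, 4, 0, 2, 2, 1058603550, 2, 2,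
    3, 4, 9]),
    (81, [307205322, 2, 0, 2, 3, 239604446, 0, 2, 3, 3, 1, 3, 1, 2, 1, 1, 0, 2, 2, 0, 2, 2, 3, 4,
    1, 0, 2, 2, 0, 2, 2, 3, 3, 307205322, 2, 2, 307205322, 2, 2, 3, 2, 239604446, 2, 239604446, 2,
    3, 2, 7]),
    (86, [1, 1, 3]),
    (61, [307205322, 2, 2, 205165901, 2, 2, 3, 205165901, 2, 2, 307205322, 2, 2, 3, 3, 205165901,
    2, 2, 205165901, 2, 205165901, 2, 3, 3, 205165901, 2, 2, 205165901, 2, 2, 205165901, 2, 2, 4,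
    3, 307205322, 2, 2, 2, 307205322, 2, 2, 307205322, 2, 2, 3, 3, 307205322, 2, 2, 2, 307205322,
    2, 2, 2, 307205322, 2, 2, 2, 4, 5]),
    (83, [1])]

def octad12 : Certificate where
  core := [0, 7, 25, 138, 141, 150, 275, 284]
  order :=
    [100, 191, 223, 85, 294, 124, 44, 354, 76, 297, 195, 53, 326, 240, 109, 163, 119, 254, 377,
    374, 329, 255, 290, 104, 108, 314, 236, 361, 248, 58, 233, 125, 360, 113, 251, 230, 319, 292,
    296, 299, 105, 231, 302, 352, 359, 243, 102, 120, 225, 46, 176, 365, 213, 78, 309, 227, 193,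
    52, 245, 353, 358, 115, 322, 346, 216, 242, 372, 328, 82, 381, 303, 226, 63, 116, 101, 98, 75,
    232, 351, 373, 247, 370, 249, 95, 43, 324, 196, 375, 181, 229, 369, 250, 252, 161, 208, 366,
    383, 62, 325, 99, 382, 122, 341, 184, 289, 331, 376, 123, 224, 111, 239, 367, 164, 126, 355,
    50, 127, 241, 293, 378, 94, 219, 117, 118, 304, 235, 244, 363, 97, 107, 321, 238, 228, 112,
    114, 364, 253, 84, 209, 106, 177, 368, 379, 356, 362, 90, 187, 110, 335, 357, 336, 334]
  symmetries := [
    (1754634,10,2,1)]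
  branches := [
    (15, [0, 0, 635526939, 1160863684, 557510043, 434826593, 5, 0, 1051681815, 557510043,
    864144648, 434826593, 5, 557510043, 0, 434826593, 7, 461491442, 0, 660062871, 1138262980,
    342998750, 0, 5, 58838298, 130662342, 242263004, 3, 0, 7, 358072946, 0, 0, 2, 4, 0, 355557089,
    156746691, 342998750, 0, 4, 342998750, 0, 6, 864144648, 156746630, 1038131681, 4, 760726130,
    660062834, 633978654, 2, 4, 347062901, 0, 2, 3, 10, 132210627, 434705613, 3, 410997453, 0, 3,
    3, 407900786, 0, 3, 410997453, 2, 5247696, 2, 4, 358072946, 410997453, 0, 3, 3, 4, 635526939,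
    1160863684, 557389139, 456725843, 5, 512047841, 411384545, 0, 4, 411209825, 8731378, 0, 4, 4,
    635526939, 1160863684, 346428733, 4, 1139469665, 0, 4, 358072946, 512047841, 411384545, 0, 4,
    512047841, 2, 4, 809169690, 1051681778, 3, 1051681778, 3, 347062901, 411209825, 2, 3, 6,
    407900786, 508951285, 3, 0, 3, 407900786, 508951285, 428512392, 4, 5247696, 409274354,
    25859484, 4, 130662342, 242263004, 3, 4, 159501594, 156746630, 1051681778, 4, 660062834,
    130662342, 242263004, 3, 3, 5, 358072946, 2, 358072946, 0, 2, 3, 0, 2, 2, 4, 0, 0, 3, 0,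
    1051681778, 3, 3, 2, 0, 809169690, 831165576, 3, 156746630, 3, 760726130, 660062834, 633978654,
    2, 4, 4, 156746630, 1051681778, 3, 760726130, 2, 760726130, 2, 3, 347062901, 2, 2, 11,
    132210627, 434705613, 0, 240714793, 0, 6, 456846747, 358072983, 255861670, 3, 255861670, 2, 5,
    461491442, 456846747, 0, 58838298, 3, 0, 2, 58838298, 6, 456846747, 132210627, 240714793, 3, 0,
    3, 132210627, 240714793, 3, 2, 240714793, 0, 3, 2, 7, 434705613, 8344255, 0, 813814588, 4, 0,
    0, 3, 4, 0, 2, 8344255, 2, 0, 2, 4, 255861609, 2, 4, 132210627, 240714793, 3, 2, 810554007, 2,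
    2, 3, 0, 2, 2, 2, 1, 240714793, 2, 2, 3, 6, 635526939, 1160863684, 557389139, 0, 0, 456725843,
    7, 557510043, 347062938, 2, 233841575, 240763114, 3, 434826593, 6, 557510043, 635526939, 2,
    1051681815, 864144648, 3, 0, 2, 4, 635526939, 1160863684, 3, 1051681815, 2, 3, 1160863684, 0,
    434826593, 4, 434826593, 3, 864144648, 434826593, 3, 434826593, 8, 557389139, 411336141, 0, 3,
    0, 4, 1139469665, 255861609, 411336141, 2, 3, 0, 2, 2, 5, 635526939, 2, 2, 635526939, 2, 0, 0,
    3, 3, 5247639, 2, 2, 4, 1062081850, 0, 3, 0, 2, 2, 3, 1160863684, 814037695, 3, 1160863684, 2,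
    814037695, 4, 0, 2, 2, 456725843, 2, 2, 4, 0, 2, 2, 2, 0, 0, 2, 3, 2, 456725843, 2, 2, 9,
    461491442, 2, 0, 2, 0, 2, 3, 1065471218, 2, 4, 409661557, 256442149, 428512392, 3, 1138262919,
    4, 1138262980, 242263004, 3, 0, 2, 3, 242263004, 2, 0, 2, 2, 5, 461491442, 428512392, 3,
    660062871, 231325473, 0, 4, 810554007, 25859484, 3, 130662342, 2, 4, 660062871, 1138262980, 3,
    0, 3, 58838298, 25859484, 3, 130662342, 242263004, 3, 130662342, 242263004, 3, 3, 6, 58838298,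
    159501594, 246375588, 4, 58838298, 239507664, 3, 58838298, 2, 4, 461491442, 2, 130662342, 2,
    130662342, 2, 3, 1065471218, 2, 4, 1065471218, 2, 2, 7, 0, 0, 1138843531, 0, 5, 1138843531, 3,
    255861609, 0, 3, 3, 255861609, 2, 255861609, 0, 2, 3, 1, 4, 1, 2, 1, 5, 0, 0, 156746691,
    246375649, 231325473, 0, 5, 231325473, 0, 5, 864144648, 246375588, 3, 736190157, 0, 3,
    633978654, 1162411973, 3, 3, 5, 0, 0, 3, 2, 2, 0, 5247639, 407900917, 831165576, 4, 246375588,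
    3, 736190157, 0, 3, 633978654, 1162411973, 3, 3, 4, 246375588, 2, 736190157, 0, 3, 2,
    736190157, 0, 3, 2, 3, 6, 0, 156746691, 246375649, 3, 3, 0, 0, 3, 2, 3, 1, 3, 0, 0, 0, 2, 0, 2,
    3, 233841517, 2, 2, 5, 0, 0, 256442149, 246375649, 0, 5, 0, 1138262919, 1162411973, 4,
    233841517, 0, 3, 5, 0, 0, 1138262919, 1162411973, 4, 3, 0, 2, 0, 2, 3, 233841517, 2, 2, 5, 0,
    2, 2, 0, 256442149, 3, 2, 233841517, 2, 2, 4, 0, 0, 256442149, 0, 4, 3, 0, 1138262919, 3, 2, 0,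
    2, 2, 4, 0, 2, 2, 1, 3, 240763114, 2, 2, 7, 1, 1, 2, 3, 0, 864144648, 0, 3, 0, 0, 633978654,
    1162411973, 3, 4, 4, 0, 0, 3, 831165576, 2, 633978654, 1162411973, 3, 2, 4, 1, 4, 864144648, 2,
    2, 864144648, 2, 2, 3, 0, 2, 2, 1, 3, 0, 2, 2, 1, 3, 14]),
    (49, [407900786, 0, 3, 407900786, 2, 407900786, 2, 4, 0, 2, 2, 0, 2, 2, 4, 407900786,
    508951285, 0, 4, 407900786, 2, 3, 2, 0, 1047641822, 428512392, 3, 407900786, 508951285, 0, 4,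
    2, 4, 355557089, 407900786, 428512392, 3, 428512392, 4, 409661557, 428512392, 3, 428512392, 4,
    407900786, 508951285, 0, 4, 1036631760, 2, 3, 409661557, 0, 2, 3, 0, 1036631760, 2, 3, 4, 6, 0,
    0, 1062202777, 4, 2, 0, 1062202777, 3, 2, 3, 410997453, 2, 410997453, 2, 3, 8344255, 2, 2, 3,
    3, 0, 0, 2, 0, 4, 406492314, 440930888, 3, 510252220, 440930888, 3, 0, 2, 440930888, 5, 0, 4,
    0, 406492314, 2, 510252220, 2, 3, 3, 406492314, 2, 2, 2, 4, 660062871, 1138262980, 629838984,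
    4, 629838984, 3, 660062871, 629838984, 3, 629838984, 3, 660062871, 1138262980, 3, 0, 3,
    1138262980, 2, 2, 629838984, 6, 342998750, 5247696, 25859484, 3, 5247696, 409274354, 25859484,
    4, 25859484, 5, 231325473, 810554007, 25859484, 3, 25859484, 4, 25859484, 4, 660062871,
    1138262980, 3, 1036631760, 2, 0, 4, 660062871, 2, 1036631760, 2, 3, 1138262980, 0, 3, 2,
    1036631760, 2, 2, 5, 0, 2, 2, 2, 5, 260164890, 2, 260164890, 2, 260164890, 2, 4, 5247696, 2,
    5247696, 2, 3, 810554007, 2, 2, 0, 2, 2, 4, 5247696, 409274354, 0, 4, 239507664, 1036631760, 2,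
    5247696, 409274354, 0, 4, 5, 810554007, 0, 3, 239507664, 1036631760, 2, 4, 0, 239507664,
    1036631760, 2, 4, 4, 1038131681, 5247696, 2, 3, 2, 5, 0, 0, 1036631760, 2, 3, 3, 2, 0, 2, 0, 2,
    2, 3, 2, 8]),
    (50, [410997453, 2, 410997453, 2, 3, 1038180045, 1051705973, 3, 410997453, 2, 809145458, 2, 4,
    1051705973, 2, 4, 8344255, 813814588, 3, 2, 1038180045, 2, 2, 3, 1038180045, 2, 2, 2, 4,
    512047841, 411384545, 3, 346549654, 512047841, 411384545, 3, 1051681815, 2, 5, 346428733, 2,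
    512047841, 2, 512047841, 2, 3, 1051705973, 512047841, 2, 3, 5, 411336141, 2, 346549654,
    1051681815, 2, 4, 346428733, 2, 411336141, 2, 2, 4, 1, 4, 0, 2, 0, 0, 3, 2, 3, 1051705973,
    809145458, 2, 3, 2, 3, 0, 2, 0, 1062202777, 0, 4, 0, 2, 1051705973, 2, 4, 0, 1062202777, 3, 0,
    2, 3, 1, 4, 3, 1, 2, 6]),
    (84, [809145458, 2, 809145458, 2, 3, 1038180045, 2, 2, 3, 809145458, 3839201, 0, 831189704, 5,
    809145458, 0, 831189704, 4, 809145458, 3839201, 0, 831189704, 5, 831189704, 5, 0, 0, 2, 3,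
    406492348, 0, 2, 831189704, 4, 0, 831165576, 3, 831189704, 3, 831189704, 6, 0, 809145458,
    3839201, 3, 2, 3, 145736267, 809145458, 2, 3, 406492348, 2, 3, 5, 0, 809169690, 831165576, 3,
    5247639, 831165576, 3, 831165576, 4, 0, 0, 2, 3, 4, 0, 0, 2, 0, 4, 809169690, 2, 5247639, 2, 0,
    2, 4, 3, 809169690, 2, 2, 2, 4, 331988688, 231252941, 3, 2, 331988688, 2, 2, 231252941, 2, 2,
    331988688, 231252941, 3, 0, 3, 5, 331988688, 231252941, 3, 0, 0, 2, 4, 331988688, 2, 0, 2, 3,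
    231252941, 0, 3, 2, 0, 2, 2, 5, 0, 2, 2, 2, 4, 0, 0, 2, 3, 2, 0, 2, 3, 1038180045, 2, 2, 0, 2,
    3, 2, 6]),
    (103, [1, 2, 0, 355557089, 156746691, 2, 4, 333536973, 2, 0, 2, 3, 145736267, 0, 2, 3, 4, 0, 0,
    3, 156746691, 246375649, 3, 3, 333536973, 256417996, 3, 2, 3, 0, 256442149, 3, 246399760, 2, 3,
    0, 256442149, 246375649, 4, 256417996, 0, 3, 246399760, 0, 3, 4, 1, 4, 1, 5, 1, 4]),
    (118, [1]),
    (140, [0, 2, 2, 2, 2])]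

def octad13 : Certificate where
  core := [0, 7, 25, 30, 138, 141, 274, 277]
  order :=
    [198, 235, 226, 231, 43, 312, 166, 326, 51, 377, 296, 163, 238, 106, 243, 367, 360, 98, 239,
    351, 378, 122, 212, 302, 84, 380, 193, 244, 316, 101, 292, 319, 344, 366, 246, 254, 115, 381,
    224, 52, 382, 182, 253, 368, 83, 228, 99, 177, 354, 125, 220, 188, 359, 379, 223, 369, 180,
    334, 164, 187, 299, 44, 352, 357, 233, 297, 208, 112, 76, 229, 184, 329, 191, 195, 179, 196,
    120, 209, 161, 249, 358, 216, 356, 123, 324, 353, 247, 294, 230, 375, 361, 236, 111, 215, 347,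
    332, 383, 252, 225, 321, 100, 113, 75, 110, 232, 255, 116, 376, 300, 242, 315, 219, 183, 118,
    114, 104, 250, 372, 362, 124, 374, 328, 335, 107, 240, 245, 251, 363, 214, 291, 331, 364, 105,
    365, 371, 117, 248, 97, 348, 355, 323, 127, 119, 176, 109, 211, 289, 227, 108, 241, 102, 303]
  symmetries := [
    (1754760,7,1,0), (1751176,0,2,0), (1751176,7,2,0), (1754704,25,2,0), (1754704,30,2,0),
    (1751120,25,1,0), (1751120,30,1,0)]
  branches := [
    (47, [147112900, 0, 1264045366, 3, 1227351748, 4, 147112900, 0, 2, 3, 3, 260138111, 0,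
    1264045366, 3, 1248989948, 4, 260138111, 2, 260138111, 0, 2, 3, 4, 3, 0, 861392182, 3, 2,
    850379489, 0, 3, 2, 3, 2, 1264023834, 0, 3, 1264023834, 2, 3, 2, 2, 257385566, 0, 3, 2, 2, 2,
    850379489, 0, 3, 2, 850379489, 2, 2, 3, 45073232, 458712090, 0, 4, 2, 45073232, 458712090, 3,
    2, 3, 3, 6]),
    (72, [1248968496, 1227351706, 1248989918, 1224491566, 0, 5, 1224491566, 850379397, 2, 5, 0,
    850379397, 2, 4, 1248968496, 458712090, 0, 1224491566, 4, 1227351706, 1248989918, 1224491566,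
    4, 1224491566, 5, 46406418, 1227244050, 1224599238, 3, 461443016, 4, 1224599238, 2, 4,
    1248968496, 1227351706, 1248989918, 3, 1227351706, 1224491566, 0, 4, 1224491566, 1248989918, 2,
    6, 0, 2, 2, 850379397, 2, 4, 1224491566, 2, 2, 850379397, 2, 6, 0, 850336328, 3, 0, 850336328,
    1248968466, 4, 1248989948, 4, 0, 1248968466, 2, 4, 0, 1227244050, 1224599238, 3, 0, 4, 0,
    458690549, 3, 2, 2, 45073308, 0, 3, 2, 2, 5, 1224599238, 0, 3, 0, 0, 45030190, 3, 2, 3, 3,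
    1248989948, 1224491536, 3, 45073308, 0, 3, 2, 3, 1248989948, 2, 2, 3, 0, 0, 1248968267, 2, 3,
    3, 6])]

def octad14 : Certificate where
  core := [0, 7, 25, 30, 138, 141, 147, 148]
  order :=
    [193, 50, 184, 223, 107, 161, 116, 235, 240, 125, 127, 101, 248, 198, 115, 216, 123, 85, 109,
    104, 254, 239, 53, 119, 353, 106, 166, 226, 241, 118, 251, 76, 43, 117, 113, 376, 358, 249,
    112, 97, 227, 99, 225, 105, 326, 294, 224, 319, 253, 232, 120, 355, 363, 296, 361, 289, 242,
    111, 191, 315, 233, 369, 359, 375, 124, 348, 381, 367, 98, 354, 310, 252, 362, 314, 238, 351,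
    364, 304, 292, 302, 342, 377, 230, 255, 331, 306, 374, 382, 373, 372, 44, 290, 309, 312, 335,
    229, 110, 349, 341, 334, 303, 365, 100, 321, 329, 324, 336, 356, 371, 325, 322, 360, 344, 366,
    347, 332, 323, 291, 300, 343, 328, 114, 122, 245, 250, 75, 378, 352, 246, 305, 370, 380, 228,
    346, 299, 293, 368, 102, 231, 379, 108, 297, 337, 338, 317, 316, 383, 236, 247, 82, 357, 311]
  symmetries := [
    (1754760,7,1,0), (1754760,10,2,1), (1754760,13,2,1), (1754760,19,2,1), (1754760,20,2,1),
    (1754760,25,1,0), (1754760,30,1,0), (1751120,0,1,0), (1751120,7,1,0), (1751120,10,2,1),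
    (1751120,13,2,1), (1751120,19,2,1), (1751120,20,2,1), (1751120,25,1,0), (1751120,30,1,0),
    (1745688,0,1,0), (1745688,7,1,0), (1745688,10,2,1), (1745688,13,2,1), (1745688,19,2,1),
    (1745688,20,2,1), (1745688,25,1,0), (1745688,30,1,0), (1742048,0,1,0), (1742048,7,1,0),
    (1742048,10,2,1), (1742048,13,2,1), (1742048,19,2,1), (1742048,20,2,1), (1742048,25,1,0),
    (1742048,30,1,0)]
  branches := [
    (59, [0, 1057294280, 2, 0, 0, 231252762, 3, 0, 6, 0, 0, 0, 2, 5, 0, 0, 0, 0, 2, 5, 0, 0, 2, 0,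
    3, 5, 0, 1057294280, 2, 0, 0, 5, 0, 0, 4, 0, 0, 4, 0, 138941202, 2, 2, 227209928, 2, 2, 3, 0,
    3, 0, 0, 3, 41009052, 2, 454647876, 2, 3, 846315159, 2, 2, 3, 7]),
    (32, [0])]

def octad15 : Certificate where
  core := [0, 7, 25, 138, 148, 159, 268, 275]
  order :=
    [166, 240, 367, 126, 299, 216, 251, 250, 372, 101, 113, 53, 331, 314, 232, 249, 50, 247, 360,
    94, 119, 341, 85, 376, 246, 184, 344, 361, 309, 43, 111, 123, 252, 99, 100, 368, 379, 312, 362,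
    297, 378, 45, 375, 293, 303, 116, 226, 357, 349, 90, 317, 289, 125, 238, 359, 373, 165, 355,
    54, 197, 198, 78, 354, 310, 104, 356, 209, 325, 322, 304, 86, 106, 112, 195, 178, 46, 205, 381,
    346, 120, 380, 233, 335, 60, 374, 242, 75, 161, 235, 201, 92, 82, 326, 239, 58, 193, 377, 358,
    102, 336, 237, 370, 62, 177, 241, 110, 117, 169, 318, 248, 114, 97, 127, 245, 383, 382, 225,
    321, 231, 173, 108, 118, 243, 77, 294, 210, 366, 230, 228, 365, 98, 353, 115, 124, 224, 105,
    363, 109, 329, 352, 342, 227, 107, 369, 290, 254, 253, 229, 122, 236, 163, 350]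
  symmetries := [
    (1754312,31,2,1), (1742496,31,2,1), (1742048,0,1,0)]
  branches := [
    (29, [831189704, 0, 240120456, 38793864, 4, 0, 831533829, 3, 1312634078, 2, 5, 38277707, 0,
    440931041, 1312634078, 0, 5, 441447174, 1249656650, 2, 4, 1312634078, 1254409006, 3, 440931041,
    2, 5, 1227243912, 1312634078, 3, 1227243912, 2, 3, 1312634078, 2, 3, 1312634078, 1234187142, 3,
    1312634078, 1228813682, 1254409006, 3, 3, 1312634078, 1254409006, 3, 1254409006, 5, 1249656650,
    2, 2, 6, 0, 0, 2, 3, 2, 0, 2, 2, 1235767541, 239604446, 2, 3, 447728885, 2, 4, 3, 38277854, 0,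
    0, 239604446, 4, 0, 0, 239604446, 4, 240120456, 4, 0, 239604446, 3, 0, 239604446, 3, 3, 4,
    944247368, 0, 541981557, 0, 327881494, 5, 0, 541981557, 0, 327881494, 5, 1249656650, 2, 4,
    541981557, 2, 4, 0, 447726152, 548389448, 3, 455615733, 2, 4, 1, 3, 246399602, 334504810, 3, 0,
    3, 1249656650, 2, 3, 1227243912, 2, 1227243912, 2, 3, 246399602, 2, 2, 3, 1, 7, 1249656650, 2,
    441447174, 1249656650, 3, 1249656650, 4, 0, 2, 441447174, 2, 3, 38793864, 441447174, 44556996,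
    447210246, 3, 2, 4, 1235423553, 2, 2, 240120456, 2, 2, 2, 6, 642257633, 2, 0, 2, 1235756744, 2,
    3, 1227243912, 2, 2, 4, 642257633, 2, 1234187142, 0, 3, 1227243912, 2, 2, 4, 3, 1228813958,
    1254065035, 1312633989, 2, 831533829, 5, 831533829, 1, 4, 1227243912, 2, 1227243912, 2, 3,
    832759617, 2, 2, 3, 3, 0, 2, 0, 0, 2, 3, 1234187142, 648536769, 1149100846, 3, 1149100846, 4,
    1, 3, 1, 5, 0, 2, 2, 2, 2, 9]),
    (56, [0, 2, 2, 1235423553, 2, 3, 2, 1, 2, 2, 1, 1223803471, 2, 1235423553, 3, 2, 2, 5]),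
    (83, [1, 548389448, 455615733, 3, 2, 3, 1, 0, 2, 2, 3, 2, 0, 1149272971, 3, 2, 2, 1149100846,
    1, 1, 4, 1, 4, 1, 5]),
    (124, [0, 0, 1224491674, 455271598, 4, 1224491674, 455271598, 5, 541981519, 2, 453701839, 0, 3,
    454045913, 2, 4, 1223803471, 0, 3, 2, 4, 548389448, 455615733, 455271598, 4, 1228899701, 2,
    1223803471, 2, 3, 3, 455271598, 2, 2, 4, 0, 2, 2, 2, 2, 548389448, 455615733, 0, 4, 1223803471,
    2, 2, 3, 0, 2, 2, 455615733, 1223803471, 2, 3, 3, 3, 1229243841, 1223803471, 2, 3, 547873542,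
    2, 3, 547873542, 2, 2, 3, 0, 0, 2, 3, 2, 2, 6])]

def octad16 : Certificate where
  core := [0, 7, 25, 139, 149, 158, 269, 275]
  order :=
    [308, 375, 193, 50, 298, 367, 161, 184, 250, 172, 200, 289, 44, 194, 241, 319, 63, 381, 292,
    302, 351, 208, 304, 196, 328, 314, 312, 95, 316, 290, 255, 239, 252, 253, 362, 356, 379, 166,
    216, 228, 243, 378, 198, 334, 229, 249, 348, 374, 321, 247, 58, 162, 126, 224, 168, 251, 238,
    368, 46, 164, 373, 99, 52, 357, 336, 92, 101, 97, 109, 226, 110, 342, 74, 360, 118, 326, 363,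
    322, 112, 98, 358, 383, 237, 86, 231, 230, 178, 100, 372, 354, 104, 42, 78, 113, 119, 127, 248,
    105, 120, 90, 234, 376, 244, 344, 107, 233, 232, 125, 204, 123, 242, 210, 225, 115, 364, 236,
    84, 377, 240, 117, 102, 294, 340, 310, 369, 380, 76, 370, 359, 330, 122, 106, 324, 114, 176,
    124, 54, 382, 227, 296, 108, 346, 353, 366, 361, 352, 60, 116, 82, 246, 355, 111]
  symmetries := [
    (1754312,30,2,1), (1751120,0,1,0), (1747032,30,2,1), (1749776,30,2,1), (1745688,0,1,0),
    (1742496,30,2,1), (1742048,0,1,0)]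
  branches := [
    (50, [0, 2, 0, 2, 2, 3, 2, 1252516807, 0, 3, 708654235, 3, 708654235, 2, 0, 2, 4, 1, 3,
    708654235, 2, 2, 708654235, 2, 2, 2, 2, 1, 0, 2, 0, 2, 3, 2, 1224599037, 0, 2, 3, 2, 708654235,
    2, 2, 4, 1, 8]),
    (12, [1248989970, 1249850109, 1227867842, 1254408978, 5, 1248968264, 0, 0, 4, 1248968264, 2,
    1248968264, 2, 4, 1248968264, 0, 0, 4, 1248968264, 2, 1248968264, 2, 4, 1248968264, 2, 2, 5,
    1224599056, 708654235, 1227867842, 1228813643, 5, 708654235, 1227244048, 0, 0, 4, 1227244048,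
    2, 3, 1227244048, 2, 2, 5, 1249850109, 1252516807, 2, 2, 3, 1227867842, 1223824896, 2, 2, 3, 0,
    2, 2, 2, 6, 0, 1249656775, 3, 1254408978, 0, 4, 1252516807, 0, 3, 2, 0, 2, 4, 708654235,
    1249656775, 2, 2, 4, 0, 1223803586, 3, 1254408978, 0, 2, 4, 1223824896, 0, 3, 1223824896, 2, 3,
    0, 0, 3, 2, 4, 0, 1223803586, 3, 1228813643, 0, 2, 4, 1223824896, 0, 3, 1223824896, 2, 3, 0, 2,
    4, 1223803586, 2, 2, 4, 1254408978, 2, 1228813643, 2, 3, 5]),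
    (37, [0, 708654235, 3, 0, 2, 3, 0, 0, 2, 2, 3, 1, 2, 4]),
    (121, [1])]

def octad17 : Certificate where
  core := [0, 7, 25, 30, 138, 149, 268, 275]
  order :=
    [220, 336, 322, 358, 43, 303, 370, 82, 226, 231, 253, 214, 293, 351, 216, 198, 106, 173, 252,
    210, 297, 344, 227, 241, 196, 223, 75, 233, 107, 166, 98, 208, 193, 359, 52, 50, 229, 317, 224,
    238, 115, 104, 240, 184, 255, 191, 239, 376, 346, 326, 45, 299, 182, 84, 110, 101, 113, 354,
    188, 119, 205, 365, 108, 312, 178, 161, 249, 356, 377, 118, 368, 357, 228, 120, 304, 382, 105,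
    97, 314, 116, 247, 331, 352, 163, 367, 374, 340, 244, 164, 360, 127, 325, 250, 246, 254, 379,
    248, 375, 124, 349, 195, 242, 230, 219, 335, 122, 176, 361, 236, 207, 99, 201, 321, 77, 372,
    363, 123, 232, 310, 225, 342, 378, 369, 125, 362, 319, 114, 353, 380, 243, 117, 373, 355, 329,
    169, 294, 289, 308, 112, 290, 102, 251, 109, 175, 381, 235, 366, 100, 187, 383, 237, 111]
  symmetries := [
    (1754760,25,2,0), (1751176,7,1,0), (1751176,30,2,0), (1754704,0,2,0), (1754704,25,1,0),
    (1751120,7,2,0), (1751120,30,1,0)]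
  branches := [
    (45, [242356988, 41030396, 0, 3, 0, 38256200, 3, 0, 944225867, 3, 5, 1011848394, 0, 3,
    835318514, 2, 3, 0, 835318514, 3, 2, 0, 38256200, 3, 0, 944225867, 3, 3, 0, 2, 239604446,
    38256200, 3, 3, 6, 41008754, 443662076, 3, 443662076, 41008754, 0, 1010472072, 4, 41008754, 0,
    1010472072, 4, 1010472072, 6, 440930888, 1253032860, 2, 547422031, 1254409158, 5, 1233842888,
    0, 3, 331988766, 1254409158, 4, 946978421, 0, 3, 946978421, 0, 3, 3, 831189704, 327860004, 3,
    1254409158, 3, 1254409158, 7, 1011848394, 0, 2, 3, 1237971698, 2, 2, 1253032860, 2, 4, 0,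
    1237971698, 3, 2, 0, 327860004, 3, 2, 3, 1, 0, 2, 0, 440909534, 3, 239604446, 440909534, 3, 3,
    2, 8, 242356988, 41030396, 0, 4, 1228899836, 1011848394, 0, 3, 835318514, 2, 5, 443662076,
    541981519, 1224685025, 2, 547422031, 5, 1011848394, 457744591, 2, 3, 1224685025, 2, 1237971698,
    2, 3, 457744591, 2, 6, 1011848394, 457744591, 2, 443662076, 2, 2, 4, 1, 457744591, 2,
    443662076, 2, 2, 2, 6, 242356988, 0, 831103691, 3, 0, 38256353, 3, 4, 1228899836, 835318514, 2,
    2, 0, 831103691, 3, 0, 38256353, 3, 3, 0, 1233756875, 3, 327881494, 831103691, 3, 3, 6,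
    41008754, 0, 3, 41008754, 0, 3, 41008754, 0, 3, 4, 0, 2, 331988766, 3, 946978421, 0, 3,
    946978421, 0, 3, 3, 38277707, 239582945, 3, 2, 5, 1237971698, 2, 2, 0, 239582945, 3, 2, 3, 0,
    2, 0, 2, 3, 440931041, 239582945, 3, 2, 2, 6, 242356988, 242335346, 41030396, 3, 242335346,
    41030396, 3, 4, 1060151835, 2, 331988902, 835318514, 3, 331988902, 835318514, 3, 3, 4,
    242335346, 0, 3, 242335346, 0, 3, 3, 1060151835, 2, 331988902, 0, 3, 2, 4, 1, 242335346,
    443683442, 3, 2, 2, 242335346, 443683442, 3, 2, 2, 6, 1, 2, 2, 1224684872, 2, 2, 1253032720, 2,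
    2, 3, 1, 1224770891, 2, 2, 3, 1253032520, 2, 2, 2, 9]),
    (74, [1]),
    (83, [1]),
    (137, [1])]

/-- The certificates for the codes with eight words in the corner. -/
def octads : List Certificate :=
  [octad0, octad1, octad2, octad3, octad4, octad5, octad6, octad7, octad8, octad9, octad10,
  octad11, octad12, octad13, octad14, octad15, octad16, octad17]

theorem octad0_check :
    octad0.check
      ([] ++ (octads.take 0).map Certificate.core) 6 19 = true := by
  decide +kernel

theorem octad1_check :
    octad1.check
      ([] ++ (octads.take 1).map Certificate.core) 6 19 = true := by
  decide +kernel

theorem octad2_check_branch0 :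
    octad2.check
      ([] ++ (octads.take 2).map Certificate.core) 6 19 (Nat.beq 0) = true := by
  decide +kernel

theorem octad2_check_branch1 :
    octad2.check
      ([] ++ (octads.take 2).map Certificate.core) 6 19 (Nat.beq 1) = true := by
  decide +kernel

theorem octad2_check_branch2 :
    octad2.check
      ([] ++ (octads.take 2).map Certificate.core) 6 19 (Nat.beq 2) = true := by
  decide +kernel

theorem octad2_check_branch3 :
    octad2.check
      ([] ++ (octads.take 2).map Certificate.core) 6 19 (Nat.beq 3) = true := by
  decide +kernel

theorem octad2_check_branch4 :
    octad2.check
      ([] ++ (octads.take 2).map Certificate.core) 6 19 (Nat.beq 4) = true := by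
  decide +kernel

theorem octad2_check_branch5 :
    octad2.check
      ([] ++ (octads.take 2).map Certificate.core) 6 19 (Nat.beq 5) = true := by
  decide +kernel

theorem octad2_check_branch6 :
    octad2.check
      ([] ++ (octads.take 2).map Certificate.core) 6 19 (Nat.beq 6) = true := by
  decide +kernel

theorem octad2_check_branch7 :
    octad2.check
      ([] ++ (octads.take 2).map Certificate.core) 6 19 (Nat.beq 7) = true := by
  decide +kernel

theorem octad2_check_branch8 :
    octad2.check
      ([] ++ (octads.take 2).map Certificate.core) 6 19 (Nat.beq 8) = true := by
  decide +kernel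

theorem octad2_check_branch9 :
    octad2.check
      ([] ++ (octads.take 2).map Certificate.core) 6 19 (Nat.beq 9) = true := by
  decide +kernel

theorem octad2_check_branch10 :
    octad2.check
      ([] ++ (octads.take 2).map Certificate.core) 6 19 (Nat.beq 10) = true := by
  decide +kernel

theorem octad2_check :
    octad2.check
      ([] ++ (octads.take 2).map Certificate.core) 6 19 = true := by
  refine Certificate.check_of_parts fun i hi => ?_
  have hi' : i < 11 := hi
  interval_cases i
  exacts
    [octad2_check_branch0, octad2_check_branch1, octad2_check_branch2, octad2_check_branch3,
    octad2_check_branch4, octad2_check_branch5, octad2_check_branch6, octad2_check_branch7,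
    octad2_check_branch8, octad2_check_branch9, octad2_check_branch10]

theorem octad3_check :
    octad3.check
      ([] ++ (octads.take 3).map Certificate.core) 6 19 = true := by
  decide +kernel

theorem octad4_check_branch0 :
    octad4.check
      ([] ++ (octads.take 4).map Certificate.core) 6 19 (Nat.beq 0) = true := by
  decide +kernel

theorem octad4_check_branch1 :
    octad4.check
      ([] ++ (octads.take 4).map Certificate.core) 6 19 (Nat.beq 1) = true := by
  decide +kernel

theorem octad4_check_branch2 :
    octad4.check
      ([] ++ (octads.take 4).map Certificate.core) 6 19 (Nat.beq 2) = true := by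
  decide +kernel

theorem octad4_check_branch3 :
    octad4.check
      ([] ++ (octads.take 4).map Certificate.core) 6 19 (Nat.beq 3) = true := by
  decide +kernel

theorem octad4_check_branch4 :
    octad4.check
      ([] ++ (octads.take 4).map Certificate.core) 6 19 (Nat.beq 4) = true := by
  decide +kernel

theorem octad4_check :
    octad4.check
      ([] ++ (octads.take 4).map Certificate.core) 6 19 = true := by
  refine Certificate.check_of_parts fun i hi => ?_
  have hi' : i < 5 := hi
  interval_cases i
  exacts
    [octad4_check_branch0, octad4_check_branch1, octad4_check_branch2, octad4_check_branch3,
    octad4_check_branch4]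

theorem octad5_check :
    octad5.check
      ([] ++ (octads.take 5).map Certificate.core) 6 19 = true := by
  decide +kernel

theorem octad6_check :
    octad6.check
      ([] ++ (octads.take 6).map Certificate.core) 6 19 = true := by
  decide +kernel

theorem octad7_check :
    octad7.check
      ([] ++ (octads.take 7).map Certificate.core) 6 19 = true := by
  decide +kernel

theorem octad8_check :
    octad8.check
      ([] ++ (octads.take 8).map Certificate.core) 6 19 = true := by
  decide +kernel

theorem octad9_check :
    octad9.check
      ([] ++ (octads.take 9).map Certificate.core) 6 19 = true := by
  decide +kernel

theorem octad10_check_branch0 :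
    octad10.check
      ([] ++ (octads.take 10).map Certificate.core) 6 19 (Nat.beq 0) = true := by
  decide +kernel

theorem octad10_check_branch1 :
    octad10.check
      ([] ++ (octads.take 10).map Certificate.core) 6 19 (Nat.beq 1) = true := by
  decide +kernel

theorem octad10_check_branch2 :
    octad10.check
      ([] ++ (octads.take 10).map Certificate.core) 6 19 (Nat.beq 2) = true := by
  decide +kernel

theorem octad10_check_branch3 :
    octad10.check
      ([] ++ (octads.take 10).map Certificate.core) 6 19 (Nat.beq 3) = true := by
  decide +kernel

theorem octad10_check_branch4 :
    octad10.check
      ([] ++ (octads.take 10).map Certificate.core) 6 19 (Nat.beq 4) = true := by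
  decide +kernel

theorem octad10_check_branch5 :
    octad10.check
      ([] ++ (octads.take 10).map Certificate.core) 6 19 (Nat.beq 5) = true := by
  decide +kernel

theorem octad10_check_branch6 :
    octad10.check
      ([] ++ (octads.take 10).map Certificate.core) 6 19 (Nat.beq 6) = true := by
  decide +kernel

theorem octad10_check_branch7 :
    octad10.check
      ([] ++ (octads.take 10).map Certificate.core) 6 19 (Nat.beq 7) = true := by
  decide +kernel

theorem octad10_check :
    octad10.check
      ([] ++ (octads.take 10).map Certificate.core) 6 19 = true := by
  refine Certificate.check_of_parts fun i hi => ?_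
  have hi' : i < 8 := hi
  interval_cases i
  exacts
    [octad10_check_branch0, octad10_check_branch1, octad10_check_branch2, octad10_check_branch3,
    octad10_check_branch4, octad10_check_branch5, octad10_check_branch6, octad10_check_branch7]

theorem octad11_check :
    octad11.check
      ([] ++ (octads.take 11).map Certificate.core) 6 19 = true := by
  decide +kernel

theorem octad12_check_branch0 :
    octad12.check
      ([] ++ (octads.take 12).map Certificate.core) 6 19 (Nat.beq 0) = true := by
  decide +kernel

theorem octad12_check_branch1 :
    octad12.check
      ([] ++ (octads.take 12).map Certificate.core) 6 19 (Nat.beq 1) = true := by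
  decide +kernel

theorem octad12_check_branch2 :
    octad12.check
      ([] ++ (octads.take 12).map Certificate.core) 6 19 (Nat.beq 2) = true := by
  decide +kernel

theorem octad12_check_branch3 :
    octad12.check
      ([] ++ (octads.take 12).map Certificate.core) 6 19 (Nat.beq 3) = true := by
  decide +kernel

theorem octad12_check_branch4 :
    octad12.check
      ([] ++ (octads.take 12).map Certificate.core) 6 19 (Nat.beq 4) = true := by
  decide +kernel

theorem octad12_check_branch5 :
    octad12.check
      ([] ++ (octads.take 12).map Certificate.core) 6 19 (Nat.beq 5) = true := by
  decide +kernel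

theorem octad12_check_branch6 :
    octad12.check
      ([] ++ (octads.take 12).map Certificate.core) 6 19 (Nat.beq 6) = true := by
  decide +kernel

theorem octad12_check_branch7 :
    octad12.check
      ([] ++ (octads.take 12).map Certificate.core) 6 19 (Nat.beq 7) = true := by
  decide +kernel

theorem octad12_check :
    octad12.check
      ([] ++ (octads.take 12).map Certificate.core) 6 19 = true := by
  refine Certificate.check_of_parts fun i hi => ?_
  have hi' : i < 8 := hi
  interval_cases i
  exacts
    [octad12_check_branch0, octad12_check_branch1, octad12_check_branch2, octad12_check_branch3,
    octad12_check_branch4, octad12_check_branch5, octad12_check_branch6, octad12_check_branch7]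

theorem octad13_check :
    octad13.check
      ([] ++ (octads.take 13).map Certificate.core) 6 19 = true := by
  decide +kernel

theorem octad14_check :
    octad14.check
      ([] ++ (octads.take 14).map Certificate.core) 6 19 = true := by
  decide +kernel

theorem octad15_check :
    octad15.check
      ([] ++ (octads.take 15).map Certificate.core) 6 19 = true := by
  decide +kernel

theorem octad16_check :
    octad16.check
      ([] ++ (octads.take 16).map Certificate.core) 6 19 = true := by
  decide +kernel

theorem octad17_check :
    octad17.check
      ([] ++ (octads.take 17).map Certificate.core) 6 19 = true := by
  decide +kernel

theorem octads_check (i : ℕ) (hi : i < octads.length) :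
    (octads[i]).check
      ([] ++ (octads.take i).map Certificate.core) 6 19 = true := by
  have hi' : i < 18 := hi
  interval_cases i
  exacts
    [octad0_check, octad1_check, octad2_check, octad3_check, octad4_check, octad5_check,
    octad6_check, octad7_check, octad8_check, octad9_check, octad10_check, octad11_check,
    octad12_check, octad13_check, octad14_check, octad15_check, octad16_check, octad17_check]

theorem octads_excluded :
    ∀ A ∈ octads.map Certificate.core, ∀ C, IsBig C → ¬ ∀ a ∈ A, dec a ∈ C :=
  excluded_of_checks (DB := []) (r := 8) octads_check (by simp)
    (fun C hC => count_le_eight C hC.1) (by norm_num) (by norm_num)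

/-- The eight words of a code in the corner. -/
def octadCode : List ℕ :=
  [1479134408, 69848328, 170511624, 4, 69848444, 269777096, 3, 170511740, 269777220, 3, 4,
  170511710, 1075083464, 3, 1378471262, 2, 3, 69848414, 471103688, 3, 875154635, 2, 1276410056, 2,
  4, 1, 5, 1272926408, 2, 2, 2, 170511602, 1076481224, 3, 1374987506, 2, 3, 774491336, 371838152,
  370461899, 4, 672451787, 1578421451, 3, 169135457, 1076459723, 3, 4, 673828220, 1578399944, 3,
  1781124341, 2, 3, 1, 5, 69848306, 472501448, 3, 871670987, 2, 3, 673828040, 1579797704, 3,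
  1777640801, 2, 3, 975817928, 371666310, 573164744, 4, 673828085, 1174048129, 3, 69848267,
  271174859, 3, 4, 4, 1, 1, 7, 1477758152, 68472120, 169135416, 4, 169135346, 1075104968, 3,
  68472050, 471125192, 3, 4, 68472008, 269798600, 3, 873778376, 2, 3, 169135304, 269798712, 3,
  1378471115, 2, 3, 1276431560, 2, 2, 1, 6, 68472188, 271153352, 3, 871649480, 2, 3, 672451967,
  1579776203, 3, 974441675, 571788491, 368913796, 4, 68472161, 472479947, 3, 4, 1777640648, 2,
  672451934, 1175768267, 3, 3, 1272947915, 2, 2, 1, 6, 169135484, 271153428, 3, 1374987467, 2, 3,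
  1781124296, 2, 672451826, 1175424381, 3, 3, 673828193, 1177144520, 3, 774491381, 1680461000,
  1679084747, 4, 170511563, 271174918, 3, 4, 1, 1, 6, 1274302664, 1277786315, 3, 2, 2, 1, 1, 7,
  1276410059, 2, 2, 2, 1272947912, 2, 1276431563, 2, 3, 2, 3, 169135454, 1076459720, 3, 774491339,
  370461896, 371838155, 4, 672451784, 1578421448, 3, 4, 673828223, 1578399947, 3, 170511605,
  1076481227, 3, 3, 1781124338, 2, 2, 1374987509, 2, 2, 1, 6, 69848264, 271174856, 3, 975817931,
  573164747, 371666308, 4, 673828082, 1174048125, 3, 4, 673828043, 1579797707, 3, 69848309,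
  472501451, 3, 3, 1777640798, 2, 2, 871670984, 2, 1272926411, 2, 3, 1, 1, 7, 1378471265, 2,
  170511713, 1075083467, 3, 3, 875154632, 2, 69848417, 471103691, 3, 3, 69848447, 269777099, 3,
  170511743, 269777218, 3, 1479134411, 69848326, 170511622, 4, 4, 4, 1, 1, 6, 68472158, 472479944,
  3, 672451964, 1579776200, 3, 974441672, 368913798, 571788488, 4, 4, 1777640651, 2, 2, 672451937,
  1175768264, 3, 68472191, 271153355, 3, 3, 871649483, 2, 2, 5, 170511560, 271174920, 3, 673828190,
  1177144523, 3, 774491378, 1679084744, 1680461003, 4, 4, 1781124299, 2, 2, 672451829, 1175424385,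
  3, 169135487, 271153426, 3, 3, 1374987464, 2, 2, 1, 6, 873778379, 2, 68472011, 269798603, 3, 3,
  1378471112, 2, 169135307, 269798710, 3, 3, 169135349, 1075104971, 3, 68472053, 471125195, 3,
  1477758155, 68472118, 169135414, 4, 4, 4, 1277786312, 2, 1274302667, 2, 3, 2, 5, 1, 1274324168,
  1277807819, 3, 2, 2, 3, 1, 2, 2, 1, 1277807816, 1274324171, 3, 2, 2, 3, 1, 10]

theorem octad_check :
    check (fun _ => true) false isInner isInner (octads.map Certificate.core) 5 5
      [0, 7, 25] innerWords [] [] (decode octadCode []) = true := by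
  decide +kernel

theorem count_le_seven (C : Finset (BTWord 7 1)) (hC : IsBig C) : count C 0 0 ≤ 7 := by
  by_contra! h
  exact isDense_excluded (N := 8) (M := 27) (by norm_num) triple_check
    (triple_excluded (K := IsBig) octad_check (closed_isBig false) (fun C h => ⟨h.1, h.2.2⟩)
      octads_excluded (by norm_num)) C ⟨hC.1, h, hC.2⟩

/-! ### Seven words in a subcube -/

def heptad0 : Certificate where
  core := [0, 7, 25, 30, 138, 148, 269]
  order :=
    [161, 224, 75, 229, 76, 175, 326, 193, 101, 50, 119, 111, 43, 363, 373, 104, 356, 124, 118,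
    249, 225, 53, 44, 201, 296, 189, 291, 230, 344, 117, 204, 183, 323, 235, 125, 191, 216, 361,
    163, 379, 123, 236, 368, 367, 120, 97, 179, 253, 252, 290, 383, 334, 211, 105, 83, 223, 309,
    108, 360, 112, 366, 85, 355, 375, 352, 331, 378, 116, 98, 209, 305, 250, 109, 351, 245, 381,
    238, 248, 289, 342, 302, 219, 221, 187, 307, 337, 239, 172, 127, 122, 227, 82, 51, 306, 364,
    251, 99, 197, 319, 328, 338, 178, 382, 372, 242, 353, 184, 316, 294, 310, 255, 215, 114, 231,
    177, 292, 106, 380, 107, 165, 299, 346, 243, 113, 321, 232, 336, 304, 369, 339, 237, 311, 207,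
    228, 110, 341, 254, 247, 240, 312, 226, 374, 166, 343, 376, 115, 233, 102, 169, 357, 377, 358,
    370, 354, 347, 246, 210, 314, 241, 195, 315, 348, 362, 359, 324, 100, 371, 198, 322]
  symmetries := [
    (1751120,30,1,0), (1745688,30,1,0), (1742048,0,1,0)]
  branches := [
    (70, [0, 0, 0, 0, 5, 327881514, 1556355701, 2, 1057485351, 4, 239604479, 1556355701, 2, 3, 3,
    3, 1237885640, 246399710, 2, 3, 1237885640, 2, 3, 2, 0, 2, 4]),
    (78, [0, 246399710, 2, 2, 0, 1, 0, 6, 0, 0, 835232456, 2, 2, 2, 0, 6, 0, 0, 0, 642257525,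
    46406219, 3, 1739097677, 2, 3, 0, 3, 1, 3, 5, 1, 0, 41008715, 242335307, 3, 0, 3, 3, 3, 0, 0,
    41008715, 242335307, 3, 2, 4, 38277746, 1, 3, 239604338, 2, 1, 4, 0, 838544072, 2, 1739097677,
    2, 3, 2, 2, 4, 1, 2, 7]),
    (106, [0, 0, 0, 447726332, 0, 6, 246399710, 2, 246399710, 2, 3, 0, 0, 0, 3, 2, 1, 0, 3, 0, 7,
    443661896, 2, 2, 2, 0, 0, 4, 2, 0, 0, 5]),
    (108, [944247413, 541981579, 549722696, 327881514, 3, 2, 2, 0, 1, 6, 0, 0, 2, 3, 0, 327881650,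
    2, 1, 2, 0, 1, 8, 1550958152, 2, 2, 2, 2, 2, 0, 649052897, 1149272911, 3, 0, 0, 1, 6, 0, 3,
    1145961355, 2, 2, 2, 2, 5]),
    (92, [1, 2])]

def heptad1 : Certificate where
  core := [0, 7, 25, 138, 148, 269, 286]
  order :=
    [229, 242, 118, 251, 75, 122, 241, 43, 112, 101, 53, 113, 383, 166, 223, 98, 115, 44, 119, 76,
    198, 105, 125, 50, 184, 161, 358, 246, 111, 254, 106, 243, 343, 337, 99, 82, 338, 323, 231,
    104, 211, 344, 252, 377, 191, 51, 83, 179, 339, 307, 249, 238, 226, 163, 116, 114, 177, 178,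
    85, 380, 183, 228, 100, 86, 250, 232, 366, 225, 370, 187, 236, 124, 379, 197, 289, 359, 294,
    233, 95, 46, 239, 378, 54, 58, 193, 227, 336, 311, 353, 315, 290, 347, 322, 361, 373, 127, 247,
    97, 292, 355, 296, 126, 240, 291, 204, 321, 109, 299, 60, 368, 210, 328, 356, 63, 372, 341,
    371, 92, 326, 216, 369, 207, 362, 120, 102, 376, 165, 169, 224, 221, 172, 201, 312, 235, 90,
    209, 331, 253, 357, 245, 364, 375, 110, 352, 248, 304, 78, 255, 309, 367, 123, 354, 363, 175,
    374, 360, 189, 108, 305, 306, 230, 215, 237, 324, 381, 195, 219, 107, 117]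
  symmetries := [
    (1742048,0,1,0)]
  branches := [
    (76, [406492232, 0, 0, 1857012296, 2, 2, 5, 0, 0, 0, 1238864257, 2, 0, 3, 6, 0, 0, 0,
    441318145, 444629761, 2, 3, 0, 5, 0, 1815778694, 2, 1234786609, 1850604427, 4, 0, 0,
    1850604427, 6, 332956583, 243303067, 0, 4, 1853915983, 549722696, 0, 2, 461056207, 4,
    1850604427, 5, 0, 547422033, 457744593, 3, 3, 0, 1151401809, 2, 3, 1850604427, 8, 0, 409588993,
    6935745, 0, 4, 0, 0, 5, 1262032211, 1233431857, 3, 1550958152, 2, 2, 3, 0, 38664958, 830802712,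
    3, 3, 2, 1, 5, 1263430007, 2, 1238670689, 1065033277, 4, 1, 1736775217, 3, 3, 510252289,
    408191233, 3, 0, 547422033, 2, 3, 409588993, 6935745, 3, 0, 2, 5, 335816550, 1065033277, 3,
    1262032211, 2, 3, 335816550, 1065033277, 3, 335816550, 1065033277, 3, 335816550, 2, 4, 1, 4, 7,
    406492232, 0, 0, 2, 4, 0, 0, 0, 0, 2, 6, 0, 0, 0, 0, 4, 0, 443662049, 2, 3, 4, 1061119554, 2,
    1262032211, 2, 3, 1262032211, 1233431857, 3, 1262032211, 1233431857, 3, 3, 328075047, 2, 2, 2,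
    4, 1853915983, 328075047, 1548614401, 3, 2, 328075047, 1548614401, 3, 328075047, 1548614401, 3,
    3, 4, 1853915983, 1850604427, 4, 1263430007, 2, 1548614401, 642644737, 1263430007, 1234786609,
    3, 5, 642644737, 1548614401, 2, 4, 510252289, 2, 332956479, 2, 409588993, 2, 1850604427, 5,
    1850604427, 3, 510252289, 408191233, 3, 0, 409588993, 6935745, 3, 4, 328075047, 1556355701, 2,
    3, 328075047, 1556355701, 2, 3, 3, 2, 9, 406492232, 0, 2, 2, 3, 835232456, 2, 2, 1238864257, 2,
    2, 4, 510252289, 408191233, 3, 41008715, 242335307, 3, 443662049, 2, 3, 409588993, 6935745, 3,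
    1, 5, 247732811, 2, 2, 247732811, 2, 247732811, 2, 3, 3, 4, 406492232, 2, 2, 1263430007, 2, 2,
    2, 3, 1, 406492232, 2, 2, 836210968, 2, 3, 4, 406492232, 0, 3, 239991550, 2, 1237885640, 2, 4,
    510252289, 2, 239991550, 2, 409588993, 2, 4, 239991550, 2, 2, 239991550, 2, 239991550, 2, 3, 5,
    510252289, 408191233, 3, 2, 0, 38664958, 830802712, 3, 409588993, 6935745, 3, 4, 3, 0, 2,
    406492232, 2, 2, 2, 5, 1262032211, 2, 2, 2, 0, 2, 3, 1262032211, 1233431857, 3, 2, 1, 3, 1, 1,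
    2, 406492232, 2, 2, 2, 2, 7, 510252289, 408191233, 3, 2, 0, 1151401867, 2, 409588993, 2, 4, 3,
    2, 1, 406492232, 2, 2, 2, 2, 406492232, 2, 2, 2, 406492232, 2, 2, 2, 3, 5, 1262032211, 2, 2, 2,
    1, 1, 4, 1262032211, 2, 2, 2, 1, 3, 1, 2, 406492232, 2, 2, 1263430007, 2, 2, 3, 0, 433364321,
    2, 3, 3, 11]),
    (87, [0, 1233818996, 2, 2, 3, 1, 3, 837092632, 2, 2, 1, 1, 4, 1, 1235560820, 2, 2, 1,
    247732850, 2, 2, 2, 5, 1239625040, 1550958152, 3, 0, 2, 3, 1550958152, 2, 3, 0, 2, 1551925912,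
    2, 3, 3, 1, 1239745921, 2, 2, 1550958152, 2, 3, 7, 3839112, 2, 2, 2, 1, 1239745921, 2, 2, 2, 4,
    1, 1, 1235560820, 2, 2, 1, 3, 3, 1, 2, 1551925912, 2, 2, 2, 2, 7]),
    (90, [41008862, 1237883216, 443661896, 4, 0, 2, 2, 0, 4, 328075151, 239991451, 3, 2, 3,
    1237883216, 0, 2, 3, 1057291818, 2, 3, 0, 2, 1237883216, 2, 2, 4, 1237885640, 2, 2, 2, 4,
    1237883216, 2, 2, 1237883216, 2, 2, 3, 1237883216, 2, 2, 1237883216, 2, 2, 3, 3, 443661896, 2,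
    2, 2, 2, 2, 4]),
    (98, [0, 242335454, 0, 2, 3, 1152369564, 1239625081, 3, 0, 242335454, 2, 6, 1241294069, 2, 1,
    2, 4, 1233818996, 1239625081, 3, 2, 1233818996, 2, 449083637, 3, 1152369564, 2, 4, 1, 1, 1, 2,
    6, 1241294069, 1233818996, 2, 2, 2, 3, 1, 3, 1, 1, 1, 3, 1, 1, 1, 8]),
    (103, [3839112, 2, 2, 1, 1, 4, 1241197256, 2, 1145574192, 2, 2, 3, 1061119554, 2, 1, 4, 3, 1,
    0, 441318040, 2, 2, 2, 3, 3, 1, 4]),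
    (107, [0, 0, 0, 0, 2, 5, 0, 0, 0, 2, 3, 2, 1, 5, 0, 1, 0, 0, 5, 1, 1, 4, 1, 0, 2, 3, 1, 1, 1,
    7]),
    (127, [1061119554, 2, 2, 2, 2]),
    (153, [1, 2]),
    (25, [0, 0, 3, 0, 0, 0, 4, 0, 0, 2, 4, 0, 810457221, 2, 2, 5, 0, 0, 2, 0, 2, 4, 3]),
    (44, [0, 0, 3, 0, 0, 0, 2, 3, 810457221, 2, 2, 5, 0, 0, 2, 3, 1, 4]),
    (74, [0, 2, 835232456, 2, 2, 2, 810457221, 2, 2, 4, 2]),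
    (113, [1])]

def heptad2 : Certificate where
  core := [0, 7, 25, 30, 138, 141, 147]
  order :=
    [238, 43, 247, 82, 122, 53, 223, 216, 379, 198, 84, 375, 166, 44, 356, 250, 50, 336, 230, 233,
    184, 119, 226, 366, 254, 253, 367, 224, 124, 161, 245, 191, 113, 326, 228, 381, 106, 164, 115,
    176, 239, 109, 241, 123, 212, 75, 240, 120, 342, 102, 340, 359, 331, 358, 181, 249, 99, 363,
    354, 125, 346, 348, 98, 182, 372, 235, 188, 246, 208, 52, 252, 180, 193, 321, 360, 308, 101,
    289, 319, 108, 76, 110, 229, 380, 362, 244, 127, 251, 294, 369, 312, 290, 296, 351, 220, 105,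
    196, 299, 357, 302, 214, 118, 114, 117, 314, 352, 291, 334, 85, 373, 361, 305, 374, 306, 311,
    376, 315, 364, 293, 370, 349, 368, 297, 378, 300, 382, 344, 303, 371, 322, 317, 100, 365, 292,
    324, 377, 242, 304, 116, 309, 353, 232, 332, 111, 231, 107, 227, 248, 341, 329, 328, 337, 383,
    225, 104, 335, 343, 255, 112, 338, 236, 347, 323, 213, 325, 355, 97, 310, 316]
  symmetries := [
    (1751120,30,1,0), (1745688,0,1,0), (1742048,30,1,0)]
  branches := [
    (91, [0, 0, 138941340, 2, 1815778458, 4, 3, 0, 3, 1057294344, 2, 2, 2, 2, 45073232, 2, 2, 2, 2,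
    1, 5, 138941340, 0, 1359480591, 1065422792, 5, 0, 138941340, 2, 138941340, 1359480591,
    1065422792, 4, 5, 3839306, 0, 3, 0, 3, 138941340, 1359480591, 3, 138941340, 1359480591, 3, 3,
    4, 0, 0, 0, 4, 227210078, 1065422792, 3, 227210078, 1065422792, 3, 3, 2, 4, 1815778418,
    257385596, 3, 1260346686, 2, 1260346686, 2, 4, 0, 1260346686, 2, 3, 3, 0, 1260346686, 2, 3, 2,
    3, 3, 0, 0, 138941340, 2, 3, 3, 0, 3, 1057294344, 2, 2, 2, 2, 850379489, 2, 2, 2, 2, 4,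
    227210078, 2, 2, 2, 2, 138941340, 2, 2, 2, 2, 1, 4, 1, 1, 7]),
    (111, [0, 1450294898, 41009094, 3, 2, 3, 45073308, 850379397, 3, 2, 2, 1, 4, 41009012,
    454647870, 3, 2, 2, 2, 1, 4, 0, 0, 3, 458712072, 2, 2, 2, 3, 0, 1, 1, 5, 1, 1, 1, 6]),
    (133, [0, 1413125234, 3839430, 3, 2, 3, 0, 3, 2, 0, 0, 0, 4, 0, 3839306, 2, 2, 3, 0, 4, 2, 3]),
    (29, [0, 0, 0, 0, 1447563848, 38277906, 138941202, 4, 3, 2, 5, 0, 0, 41008944, 1815778494,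
    307205504, 4, 0, 1815778458, 5, 0, 3, 0, 45073308, 1815778494, 3, 1815778458, 4, 2, 4, 0, 0, 0,
    4, 0, 38278044, 843584133, 147069714, 4, 3, 2, 0, 3, 5, 0, 0, 0, 1815778458, 3, 2, 4, 0, 0,
    1815778458, 3, 2, 0, 3, 4, 0, 0, 0, 4, 0, 2, 5]),
    (77, [0, 0, 1953611486, 38277962, 227209928, 3, 3, 2, 4, 0, 0, 0, 4, 1852948190, 453314568,
    260116424, 3, 3, 2, 0, 3, 4, 0, 0, 0, 0, 5, 0, 4])]

def heptad3 : Certificate where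
  core := [0, 7, 25, 138, 141, 148, 275]
  order :=
    [193, 82, 105, 224, 124, 227, 75, 251, 43, 115, 246, 233, 104, 53, 191, 166, 102, 161, 112, 90,
    117, 76, 353, 226, 236, 127, 44, 239, 229, 118, 46, 242, 184, 238, 230, 113, 50, 54, 86, 63,
    241, 62, 245, 374, 252, 359, 198, 190, 373, 376, 58, 232, 60, 253, 223, 363, 107, 99, 109, 125,
    366, 254, 356, 240, 126, 325, 92, 292, 303, 231, 317, 380, 85, 350, 377, 106, 187, 289, 328,
    116, 255, 293, 316, 122, 235, 243, 250, 114, 297, 108, 111, 300, 318, 372, 120, 209, 247, 178,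
    183, 358, 349, 329, 100, 364, 248, 195, 215, 321, 319, 228, 379, 362, 95, 357, 219, 94, 355,
    299, 119, 110, 222, 354, 344, 249, 302, 177, 334, 314, 336, 375, 312, 361, 341, 368, 210, 78,
    322, 290, 367, 332, 296, 381, 310, 346, 324, 335, 370, 123, 326, 98, 309, 365, 352, 97, 294,
    304, 351, 348, 382, 225, 216, 378, 360, 163, 369, 331, 101, 383, 342]
  symmetries := [
    (1742048,0,1,0)]
  branches := [
    (32, [2054274834, 2017105032, 0, 231252804, 141672326, 1233842888, 3, 141672326, 1233842888, 3,
    1233842888, 4, 1233842888, 4, 0, 2, 0, 3, 1, 0, 0, 4, 0, 1, 1, 3, 8, 0, 0, 0, 4, 1, 2058338952,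
    2, 1367415629, 2, 3, 1367415629, 2, 2, 3, 1, 4, 231252804, 1233819078, 2, 2, 1266797832, 3, 3,
    1, 2, 0, 2, 2, 1, 3, 1, 9, 0, 0, 141672348, 1555022408, 3, 1555022408, 141672348, 2, 440930888,
    6, 0, 0, 440930888, 4, 440930888, 1239624978, 2, 2, 334504854, 4, 440930888, 0, 0, 8, 0, 0, 0,
    3, 1233818896, 2, 2, 246399563, 3, 0, 2, 0, 6, 1058627652, 1233842888, 3, 1058627652,
    1233842888, 3, 1233842888, 4, 1233842888, 3, 1233842888, 2, 1233842888, 4, 0, 0, 0, 4, 0, 1, 2,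
    4, 1976336059, 2, 2, 2, 1, 3, 0, 2, 2, 1, 1, 4, 1739097716, 2, 1739097716, 2, 3, 2, 1, 1, 4, 8,
    1362190095, 2, 1262032143, 2, 2, 3, 1, 3, 1262032143, 2, 2, 2, 2, 1239624978, 2, 2, 2, 2,
    1239624978, 2, 1233818896, 2, 3, 2, 2, 5, 0, 41009052, 846315159, 3, 0, 851712645, 5,
    1919151258, 2, 1918140604, 3, 41009052, 239604446, 1916441754, 3, 1916441754, 4, 41009052,
    239604446, 2, 846315159, 4, 41009052, 239604446, 2, 3, 846315159, 5, 41009052, 2, 2, 846315159,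
    6, 0, 454647876, 2, 0, 4, 0, 2, 3, 1, 2, 0, 2, 2, 2, 1, 3, 1, 6, 1266797810, 2, 2, 1919151258,
    2, 2, 2, 1, 4, 1916441754, 2, 1261645195, 2, 2, 3, 1, 3, 1235767541, 2, 2, 1, 4, 461491442, 2,
    1233819078, 2, 2, 2, 3, 1, 2, 3, 8]),
    (68, [231252830, 2, 1739097716, 2, 3, 2, 327881646, 2, 1237883154, 2, 2, 3, 1951267701, 2, 2,
    4, 2, 41008976, 454647752, 3, 846315083, 2, 0, 4, 2, 1065422792, 2, 2, 3, 327881646, 239604299,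
    3, 2, 1057485337, 0, 2, 3, 1057485337, 2, 1260333451, 2, 2, 4, 1237883154, 2, 1235560720, 2, 3,
    2, 1260333451, 2, 2, 2, 5, 454647752, 2, 2, 2, 2, 4, 1, 1260333451, 2, 2, 2, 2, 3, 1,
    1260333451, 2, 2, 2, 1, 3, 3, 1, 1, 1, 2, 8]),
    (76, [1, 327881646, 2, 2, 2, 454647752, 2, 2, 2, 0, 3, 0, 4, 1, 2, 1260346718, 2, 2, 2, 2, 3,
    1, 2, 5]),
    (117, [1963263944, 0, 1145961295, 3, 2, 3, 541981519, 1145961295, 3, 3, 1266797810, 1971005685,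
    2, 2, 3, 453701839, 2, 3, 1951267663, 2, 2, 4, 1963263944, 1263430083, 2, 2, 3, 1, 0, 4,
    1919151258, 2, 2, 1954579317, 2, 3, 1, 0, 5, 1145961295, 1968666869, 1260346692, 1263430083, 2,
    3, 4, 0, 3, 1263430083, 2, 2, 2, 2, 3, 541981519, 1, 0, 0, 5, 541981519, 2, 0, 0, 5, 453701839,
    1, 0, 1918140789, 5, 453701839, 2, 0, 0, 5, 1951267663, 1, 3, 1951267663, 2, 3, 0, 0, 6, 0, 2,
    1919151258, 2, 2, 3, 2, 0, 2, 0, 1240132961, 2, 1240132961, 2, 3, 2, 9]),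
    (125, [1, 2, 1, 2, 1, 4, 1235560902, 2, 2, 2, 1235560902, 2, 2, 1968666869, 3, 3, 2, 1,
    1968666869, 2, 3, 1260346692, 2, 1968666869, 1260346692, 2, 1260346692, 2, 5, 1548227297, 2,
    1548227297, 2, 3, 2, 2, 0, 4, 447728885, 2, 2, 455040324, 2, 1737355853, 2, 1737355853, 2, 3,
    2, 2, 3, 7]),
    (130, [0, 0, 0, 4, 0, 0, 231252830, 2, 4, 2, 0, 0, 2, 3, 0, 5, 1951267701, 0, 1918140789, 4,
    1951267701, 2, 1951267701, 1971005685, 2, 2, 3, 0, 5, 0, 41008976, 2, 41008976, 327881494, 2,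
    3, 4, 1367415629, 2, 1367415629, 2, 3, 2, 3, 2, 0, 0, 3, 2, 0, 6])]

def heptad4 : Certificate where
  core := [0, 7, 25, 138, 148, 269, 275]
  order :=
    [198, 108, 95, 358, 357, 361, 76, 43, 376, 117, 231, 242, 53, 86, 94, 383, 166, 125, 239, 44,
    114, 253, 254, 250, 193, 50, 113, 224, 321, 368, 184, 363, 46, 360, 322, 240, 54, 251, 230,
    104, 227, 120, 183, 100, 105, 372, 187, 197, 189, 207, 249, 362, 334, 210, 247, 190, 380, 115,
    233, 191, 355, 319, 111, 107, 369, 109, 226, 175, 209, 324, 351, 382, 60, 127, 346, 374, 75,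
    62, 341, 356, 225, 336, 110, 289, 119, 373, 222, 82, 352, 292, 304, 309, 221, 353, 236, 163,
    232, 58, 98, 122, 294, 99, 112, 216, 381, 248, 312, 348, 359, 204, 326, 178, 85, 165, 102, 92,
    106, 116, 237, 201, 367, 255, 364, 354, 126, 350, 169, 235, 161, 101, 172, 215, 290, 296, 377,
    229, 97, 318, 331, 378, 63, 366, 252, 245, 243, 219, 370, 228, 177, 328, 223, 375, 78, 238,
    124, 344, 299, 302, 342, 241, 314, 123, 379, 195, 310, 316, 118, 90, 246]
  symmetries := [
    (1751120,0,1,0), (1745688,0,1,0), (1742048,0,1,0)]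
  branches := [
    (89, [1, 1739097716, 2, 2, 1739097716, 2, 2, 3, 2, 1739097716, 2, 2, 1739097716, 2, 2, 3, 2, 1,
    2, 4, 1550958305, 2, 2, 1550958305, 2, 2, 3, 1951267701, 1971005685, 2, 2, 2, 4, 1550958305, 2,
    2, 2, 1550958305, 2, 2, 2, 3, 327881646, 2, 2, 1060151845, 331988770, 2, 2, 331988770,
    541981519, 3, 1951267663, 3, 331988770, 2, 2, 1951267663, 7, 1145961295, 2, 2, 2, 2, 1, 0, 2,
    2, 3, 6, 1241294069, 2, 2, 2, 2, 1, 2152206920, 1241294069, 2, 3, 0, 3, 2152206920, 2, 2,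
    2152206920, 2, 2, 1241294069, 2, 5, 1, 0, 2, 9]),
    (95, [1149272971, 2, 1149272971, 2, 3, 1149272971, 2, 1919538513, 2, 2, 1149272971, 2, 4,
    1149272971, 2, 2, 4, 1, 2, 1, 1, 5, 2117768264, 2, 2, 1852948307, 2, 1919538513, 3, 2, 3, 0, 0,
    3, 307205568, 2, 2, 1, 3, 4, 1, 2, 1, 5]),
    (157, [2172719366, 2, 2, 0, 2154938081, 2, 3, 3, 1, 2, 3, 2152206920, 510252427, 2, 3,
    1968661448, 510252427, 2, 3, 1956708235, 4, 2, 2, 1, 0, 1951267701, 3, 3, 2, 2152206920, 2, 2,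
    2, 5]),
    (91, [1971392796, 443661896, 912905368, 3, 1818875068, 4, 2120477768, 1850217335, 547422091,
    1818875068, 4, 547422091, 4, 1956708235, 1919538513, 2, 1818875068, 5, 2172332299, 1956708235,
    1818875068, 5, 1968661448, 455615733, 912905368, 3, 912905368, 4, 1818875068, 5, 307205568,
    1956708235, 3, 1956708235, 3, 1956708235, 1818875217, 2020201864, 2, 3, 2020201864, 2, 5,
    1954579339, 2020201864, 2, 4, 1956708235, 1, 3, 1956708235, 2020201864, 2, 2, 2020201864, 2, 5,
    2152206920, 443661896, 2, 1818875032, 4, 1, 1968661448, 2, 3, 1, 1818875032, 3, 1968661448, 2,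
    1818875032, 6, 1, 2, 104502408, 2, 2, 2, 2, 2020201864, 2, 8]),
    (100, [0, 0, 0, 2, 0, 0, 0, 2, 5, 0, 2152206920, 2, 0, 1958622033, 4, 6]),
    (130, [1, 2]),
    (59, [0]),
    (61, [0]),
    (83, [2017105032, 835232456, 831189704, 2, 3, 3, 0, 2, 3, 835232456, 2, 2, 2, 3, 833103560, 2,
    2, 2, 2, 2, 838544072, 2, 2, 2, 2, 2, 0, 2, 2, 2, 5]),
    (128, [2152206920, 2154937928, 2, 3, 2159002184, 2, 2, 2, 2, 2159002184, 2, 2, 2, 2,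
    2159002184, 2, 2, 2, 5]),
    (137, [104502408, 2, 2, 2, 2])]

def heptad5 : Certificate where
  core := [0, 7, 25, 138, 141, 147, 278]
  order :=
    [82, 43, 53, 198, 102, 110, 166, 248, 75, 232, 114, 120, 44, 119, 85, 249, 50, 184, 364, 238,
    125, 99, 161, 191, 252, 216, 309, 246, 113, 124, 250, 109, 316, 76, 98, 46, 240, 236, 118, 106,
    58, 101, 242, 226, 60, 63, 108, 383, 105, 164, 176, 181, 115, 100, 188, 373, 231, 251, 358,
    235, 228, 122, 193, 97, 372, 208, 230, 104, 367, 123, 196, 341, 357, 247, 84, 222, 370, 369,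
    380, 322, 95, 126, 52, 116, 180, 289, 112, 90, 78, 254, 213, 319, 290, 296, 223, 324, 361, 346,
    332, 111, 336, 255, 381, 299, 107, 253, 376, 331, 302, 375, 227, 241, 239, 360, 328, 351, 382,
    355, 354, 314, 362, 62, 329, 334, 347, 190, 293, 220, 337, 297, 368, 379, 349, 300, 353, 356,
    303, 317, 291, 312, 92, 352, 229, 212, 366, 377, 323, 225, 292, 304, 245, 371, 305, 224, 127,
    359, 365, 321, 233, 378, 363, 335, 348, 244, 315, 325, 344, 94, 117]
  symmetries := [
    (1745688,10,2,1)]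
  branches := [
    (22, [2051543826, 0, 1815778494, 0, 2017105350, 1815778458, 2017105170, 2, 4, 3, 4, 2059672338,
    2054274632, 2, 3, 2154938130, 2051543964, 2, 3, 2154938130, 138941340, 2, 3, 3, 3, 510252485,
    851712645, 2, 2, 3, 0, 1, 2, 1, 5, 2154938130, 0, 3, 2154938130, 138941340, 1359480591, 3, 3,
    3, 2, 1, 1359480591, 1, 3, 8, 2059672338, 2164590536, 3, 2017105350, 2, 1815778494, 3,
    1815778458, 2017105170, 2, 2, 3, 2017105350, 1815778458, 3, 2, 1815778494, 0, 2164590536, 8,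
    1815778458, 2, 2, 1815778494, 2059672338, 2, 1815778458, 2, 2017105350, 1815778458, 2017105170,
    2, 4, 2, 4, 2059672338, 2017105350, 1815778458, 2017105170, 2, 4, 3, 2, 2059672338, 2,
    2017105350, 2, 2, 3, 7, 2059672338, 2164590536, 3, 145736264, 242335562, 2, 3, 3839306, 0, 3,
    2, 1336444277, 2, 4, 145736264, 242335562, 2, 3, 2, 0, 2, 2164590536, 6, 3839306, 0, 3, 2, 2,
    2, 2059672338, 3839306, 2, 227210078, 2, 3, 3, 2, 2059672338, 2, 1051705970, 2, 2, 1051705970,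
    2, 2, 4, 5, 246399762, 2, 2, 2, 145736264, 246399762, 3, 1057294280, 3, 1367415567, 2, 2, 1, 4,
    1, 1, 1, 6, 510252485, 1, 453314504, 2, 4, 1261765982, 851712645, 2, 3, 2, 1, 1, 1261765982, 2,
    4, 453314504, 1, 3, 1266797810, 2, 2, 1261765982, 2, 7, 1, 2164590536, 2017105226, 1065422792,
    3, 227210078, 1065422792, 3, 3, 2, 3, 3, 1051705970, 2, 2, 2, 2, 2164590536, 2, 147069714, 2,
    1051705970, 2, 2, 3, 2, 3, 1, 2, 2164590536, 2, 1336444277, 2, 2, 2, 2, 2, 12]),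
    (49, [1767359093, 2, 2, 205189874, 2, 2, 2240451959, 2, 4, 2218431881, 2, 2, 2240451959, 2, 3,
    227209928, 2, 1767359093, 2, 2, 3, 4, 1767359093, 2, 2, 1963578721, 2, 3, 227209928, 2, 2, 3,
    1767359093, 2, 2, 2, 2, 4, 260164890, 0, 2, 2, 2, 3, 1, 2, 1, 1, 5, 1, 260164850, 1138262923,
    2, 2, 2, 3, 1, 4, 1561944126, 2, 1561944126, 2, 2240451959, 2, 4, 2, 1, 1, 4, 0, 2, 205189874,
    2, 2, 3, 0, 2, 2, 2, 3, 0, 2, 1112931022, 2, 0, 2, 2, 4, 0, 2, 2, 2, 1, 4, 1, 4, 342998718, 2,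
    342998718, 2, 2240451959, 2, 4, 231325535, 2, 2240451959, 2, 3, 3, 355557051, 2, 1112931022, 2,
    1963578721, 2, 1565065057, 2, 5, 256442206, 2, 1963578721, 2, 3, 2, 1, 4, 1, 1, 5, 1, 1, 2,
    9]),
    (85, [0, 0, 3, 2, 1566008306, 2, 2, 2168001837, 2, 3, 2, 0, 2, 2, 2, 4, 1152369227, 2,
    1152369227, 2, 3, 2, 1152369227, 2, 2, 2, 3, 2221528455, 227209928, 0, 2, 3, 2, 2, 1152369227,
    2, 2, 2, 1152369227, 0, 3, 2, 2, 3, 227209928, 2, 2, 6, 0, 0, 3, 2, 0, 2, 2, 2, 3, 1,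
    260116424, 2, 2, 2, 3, 1953611486, 2, 2, 1566008306, 2, 2, 3, 2, 227209928, 2, 2, 3, 260116424,
    2, 2, 2, 260116424, 0, 2, 3, 2, 2, 3, 1, 2, 227209928, 2, 2, 9]),
    (126, [1, 1, 3, 1, 2, 2, 1, 1, 2, 5]),
    (133, [0, 2, 2168001837, 2, 2, 3, 1665728450, 2, 2, 2168001837, 2, 2, 3, 1665728450, 2, 2, 2,
    3, 1651621509, 2, 2, 2, 1, 5, 1, 2, 3]),
    (148, [0, 2, 2, 2, 231325535, 2, 2, 2, 3, 0, 2, 2, 206574197, 2, 2, 3, 2, 231325535, 2,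
    231325535, 2, 3, 2, 1, 5, 0, 2, 2, 2, 2, 1038131643, 2, 2, 2, 3, 0, 2, 2, 2, 2, 1, 3, 1, 2,
    342998718, 2, 2, 2, 1, 3, 1, 7]),
    (152, [1, 2]),
    (92, [0, 2, 2, 2, 2, 2, 1, 3]),
    (129, [0, 2, 2, 2, 0, 2, 2, 2, 2, 0, 2, 2, 2, 2, 1, 4, 0, 2, 2, 2, 1, 3, 4]),
    (138, [0, 2, 2, 758210235, 2, 233841513, 2, 3, 2, 2, 3, 1665728450, 2, 2, 2, 1665728450, 2, 2,
    2, 3, 1665728450, 2, 2, 2, 2, 1, 4, 1651621509, 2, 2, 2, 1651621509, 2, 2, 2, 2, 1651621509,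
    231325535, 3, 2, 2, 4, 1, 2, 2, 5])]

def heptad6 : Certificate where
  core := [0, 7, 25, 138, 141, 147, 276]
  order :=
    [252, 43, 76, 216, 249, 235, 115, 364, 82, 53, 119, 232, 381, 166, 109, 85, 246, 75, 226, 44,
    236, 50, 244, 255, 107, 184, 117, 231, 98, 124, 104, 95, 101, 118, 176, 191, 113, 60, 198, 116,
    127, 220, 99, 213, 238, 114, 367, 214, 106, 224, 102, 58, 63, 208, 110, 254, 62, 190, 239, 46,
    251, 54, 289, 125, 105, 193, 92, 182, 253, 196, 233, 247, 222, 188, 374, 90, 123, 242, 112,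
    371, 228, 328, 78, 225, 290, 379, 240, 338, 181, 376, 358, 326, 120, 108, 355, 227, 312, 314,
    245, 337, 351, 323, 318, 296, 86, 293, 347, 122, 366, 383, 299, 357, 368, 353, 377, 334, 369,
    352, 248, 291, 97, 356, 300, 346, 382, 111, 94, 350, 321, 360, 380, 306, 319, 354, 161, 302,
    373, 361, 329, 223, 315, 375, 317, 331, 359, 349, 294, 332, 241, 303, 100, 322, 370, 311, 343,
    126, 297, 230, 344, 250, 363, 305, 164, 378, 362, 325, 335, 229, 365]
  symmetries := [
    (1745688,0,1,0)]
  branches := [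
    (84, [2345179475, 2, 2, 2, 0, 2, 2, 2, 2, 0, 1151401863, 3, 2, 2, 1, 3, 1, 1, 1, 7, 2320406858,
    2, 2, 246402293, 2345179475, 2, 4, 1367415629, 2, 2, 246402293, 2345179475, 2, 4, 3,
    1367415629, 2, 2, 1367415629, 2, 2, 3, 2, 1, 4, 1964597342, 138941340, 2, 1057294344, 2, 4,
    1235756786, 2, 3, 443662046, 138941340, 2, 3, 2, 1057294344, 2, 2, 2, 4, 2017105350,
    2017105170, 2, 3, 2, 443662046, 2319095058, 2, 3, 2, 443662046, 2, 2, 4, 2320406982, 2, 2, 2,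
    2, 4, 1852948304, 0, 1057294344, 2, 4, 2154938078, 2, 0, 2, 2, 4, 0, 1235756786, 2, 3,
    1235756786, 2, 2, 0, 2, 2, 2, 1, 6, 41008712, 0, 3, 2, 835232459, 2345179475, 3, 2, 3,
    233499998, 2, 260164890, 2, 3, 1057294344, 2, 1149275635, 3, 2, 1, 3, 5, 2017105350,
    2017105170, 2, 3, 2, 2017105350, 2345179475, 3, 2, 3, 41008712, 242335304, 3, 1359480591, 3,
    835232459, 2, 2, 1, 1065422792, 2, 2, 5, 835232459, 2319095058, 2, 3, 2, 2, 41008712, 2, 2, 2,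
    1, 242335304, 2, 2, 2, 1, 1, 9, 1, 2, 1, 2, 1, 2, 1, 2, 1, 2, 4, 1, 2, 1, 2, 3, 233499998, 2,
    2, 260164890, 2, 3, 2320406982, 2, 1149275635, 3, 2, 2, 1, 3, 1, 2, 13]),
    (105, [0, 1, 3, 1857012378, 2, 2, 0, 4, 2320406858, 1852948158, 3, 2, 1, 3, 1, 3, 2320406858,
    2, 2320406858, 2, 3, 2320406858, 2, 2, 3, 2, 2347429214, 2, 2, 1, 6, 205165640, 2, 2, 2, 2,
    260116488, 2, 2, 260116488, 2, 2, 3, 260116488, 2, 2, 2, 3, 2, 0, 0, 3, 0, 2, 2, 3, 1, 1, 7]),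
    (119, [2341139144, 2, 2369328432, 2, 2319095174, 2, 2, 3, 2, 0, 2319095174, 2, 2319095174, 2,
    3, 3, 2, 2374045640, 2, 2319095174, 2, 2, 3, 2, 5, 2322191754, 2341139144, 2, 2, 2341139144, 2,
    2, 2, 2341139144, 2, 1971392794, 2, 3, 1, 6, 2341139144, 2, 2, 1, 2341139144, 2, 1963651285, 2,
    2, 2, 3, 3, 2341139144, 1, 3, 2369328432, 2, 2, 2, 0, 1739097719, 2, 2, 3, 1, 3, 4, 1, 2, 1, 2,
    8]),
    (122, [0, 1956708181, 0, 0, 2, 5, 0, 0, 1151401813, 1261765950, 2, 3, 3, 0, 2, 0, 5, 0, 2, 0,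
    2, 3, 2347429214, 1815778494, 3, 1815778494, 3, 0, 6, 1956708181, 1151401813, 1059571305, 3, 2,
    0, 4, 1111135368, 0, 3, 0, 3, 443662046, 2319095058, 851712645, 3, 3, 2, 2, 4, 1956708181,
    2221528455, 2, 1151401813, 1059571305, 3, 2, 2, 0, 0, 0, 4, 5, 0, 2, 0, 2, 3, 2, 2, 2260611975,
    2172332295, 3, 2, 3, 38277906, 843584133, 3, 2, 2, 0, 0, 0, 3, 3, 2051543826, 0, 3, 2, 8]),
    (135, [0, 331988772, 2164590686, 2, 3, 3, 1857012617, 843584075, 2, 3, 242335457, 1266797850,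
    2, 3, 3, 649052747, 1266797850, 2, 3, 2, 4, 1, 1060151841, 2, 2, 1060151841, 2, 3, 1555022411,
    2, 1555022411, 2, 1555022411, 2, 4, 2, 331988772, 2, 2, 242335457, 2, 2, 3, 6, 2051543826, 2,
    2164590536, 2, 3, 1, 1, 4, 2017105286, 2, 2, 2, 2017105286, 2, 2, 2, 3, 1, 1, 4, 4]),
    (140, [227209928, 1, 1956708231, 1, 5, 447726155, 2, 2, 2, 2159002187, 644988491, 2, 2, 3, 2,
    1, 5, 1, 2, 138941202, 1, 3, 0, 3, 1, 1, 6]),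
    (142, [331988920, 2, 1060151841, 3, 2159002187, 1550958155, 2, 3, 2, 1, 4, 38277906, 1, 3, 1,
    2164590654, 2, 2, 4, 1, 1, 4, 2051543826, 2, 2172719048, 2, 2, 2, 3, 1, 1, 6]),
    (146, [0, 0, 0, 2347429214, 1815778494, 3, 1815778494, 3, 0, 6, 2159002187, 0, 3, 2159002187,
    644988491, 2, 2, 0, 4, 447726155, 2221528455, 3, 2221528455, 3, 0, 2159002187, 0, 3, 6,
    206477387, 2, 2, 0, 2, 2, 2, 0, 4, 0, 2, 2, 2, 2, 0, 2, 4, 0, 453314504, 2, 2, 0, 0, 5,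
    38277906, 2, 2164590654, 2, 3, 2, 0, 0, 3, 0, 0, 3, 8]),
    (162, [0, 331988772, 2, 2, 2, 0, 4, 2374094106, 2, 3]),
    (35, [0]),
    (62, [2255601227, 0, 0, 4, 1956708231, 0, 0, 5, 1968661451, 2, 2221528455, 3, 0, 0, 5]),
    (88, [205165640, 2, 2, 2, 2, 0, 2, 2, 2, 2, 2, 2260611975, 2, 2, 4]),
    (102, [0]),
    (110, [1, 38277906, 2, 2, 3]),
    (132, [0]),
    (134, [2051543826, 2, 2])]

def heptad7 : Certificate where
  core := [0, 7, 25, 30, 138, 141, 275]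
  order :=
    [233, 227, 104, 370, 43, 236, 101, 340, 383, 196, 53, 75, 109, 85, 111, 166, 353, 229, 44, 98,
    219, 209, 373, 223, 348, 113, 106, 195, 50, 220, 116, 372, 198, 76, 364, 321, 161, 378, 238,
    248, 299, 249, 82, 302, 212, 184, 208, 210, 100, 314, 251, 224, 122, 164, 232, 377, 97, 213,
    176, 360, 326, 368, 358, 181, 123, 188, 115, 254, 214, 105, 180, 308, 182, 52, 375, 361, 187,
    317, 356, 363, 303, 118, 247, 117, 293, 99, 297, 294, 246, 352, 240, 119, 319, 177, 367, 193,
    342, 250, 376, 112, 230, 245, 114, 253, 242, 296, 290, 336, 178, 324, 359, 84, 125, 255, 183,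
    349, 108, 380, 124, 341, 366, 289, 354, 332, 381, 369, 228, 225, 346, 379, 300, 191, 120, 351,
    241, 357, 226, 312, 244, 252, 382, 344, 329, 325, 215, 335, 331, 243, 355, 107, 163, 322, 231,
    309, 362, 110, 310, 316, 365, 292, 216, 127, 102, 235, 374, 304, 334, 239, 328]
  symmetries := [
    (1751120,30,1,0)]
  branches := [
    (45, [2152206920, 2471978108, 810457205, 2154938130, 3, 1237885685, 2, 3, 0, 0, 5, 2054274632,
    239604446, 2, 2456928018, 4, 2154938130, 239604446, 2, 3, 3, 3, 1239624978, 2, 1239624978,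
    1262032143, 3, 1239624978, 2, 4, 2172719048, 2, 1239624978, 2, 2, 4, 2, 2471978108, 0,
    2154938130, 239604446, 2, 3, 3, 3, 1, 2356264722, 2, 239604446, 2, 2, 3, 3, 2058339270,
    2117768582, 2120478026, 1919151258, 3, 1916441754, 4, 2117768582, 2120478026, 2, 1916441754, 4,
    2117768582, 2, 4, 3, 7, 1742774861, 2177536161, 3, 1233818896, 2, 3, 1233818896, 2, 2, 3,
    644988533, 1151401807, 0, 4, 0, 3, 0, 1233818896, 2, 3, 3, 1, 1233818896, 2, 1233818896, 2, 3,
    1233818896, 2, 2, 3, 5, 0, 831189704, 2, 2, 3, 1, 3, 3, 2471978108, 2, 2471978108, 2, 2, 3, 1,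
    2, 2058339270, 2, 2, 4, 2471978108, 0, 2117768328, 2, 1233842888, 2, 5, 2471978108, 1237885685,
    2, 2, 3, 2, 0, 257385596, 1239625156, 2, 3, 257385596, 2, 3, 2, 5, 1, 1742774861, 2, 2, 2,
    831189704, 2371314696, 3, 1742774861, 2, 3, 2, 0, 4, 3, 0, 1, 0, 4, 2058339270, 644988668,
    1364706201, 1550958332, 4, 1550958332, 644988668, 1364706201, 3, 4, 1233842888, 2, 3,
    2117768328, 2, 1233842888, 2, 5, 1364706201, 1233819078, 2, 3, 145736646, 2, 145736646, 2, 4,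
    1, 3, 3, 1, 864144648, 2, 1233842888, 2, 3, 3, 9]),
    (77, [2172719048, 1852948343, 1548227144, 3, 3, 2172719048, 2, 3, 2360328976, 1364706125, 2, 2,
    3, 3, 1964597237, 2, 2, 2, 1239624978, 2, 1239624978, 2, 3, 2, 3, 2172719048, 2, 2172719048,
    1239624978, 2, 3, 2172719048, 2, 4, 1550958197, 0, 3, 1233818896, 2, 3, 1233818896, 2, 2, 3, 0,
    1233818896, 2, 1233818896, 2, 3, 3, 4, 1233843041, 2, 2, 2, 2, 5, 1, 1, 1233818896, 2, 2, 2,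
    1233818896, 2, 2, 2, 3, 3, 1, 5]),
    (80, [850382085, 1, 3, 458136985, 1057485337, 2, 1, 4, 327881646, 1956904491, 1264023816, 2, 4,
    239604299, 1956904491, 1264023816, 1235560720, 2, 3, 4, 3, 1235560720, 2, 2, 2, 2, 1235560720,
    2, 2, 2, 2, 1237883154, 2, 2, 2, 2, 1956904491, 2, 8, 1, 1, 1, 2, 1, 5, 1, 2, 1, 1, 4,
    1956904345, 1, 3, 1, 3, 1, 1, 3, 1, 1, 8]),
    (87, [2456927999, 810457205, 1957675637, 3, 443661941, 2, 3, 1957675637, 443661941, 2, 3, 3, 0,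
    0, 0, 6, 2456927999, 2, 2, 2456927999, 2, 3, 2456927999, 443661941, 2, 2, 3, 2, 0, 0, 6,
    1857012341, 644988533, 2, 1852948343, 1548227144, 3, 4, 1957675637, 1964597237, 2, 3, 3, 2, 1,
    2255601404, 1956708213, 3, 1, 3, 4, 1550958197, 2, 2, 2, 0, 3, 2252870216, 2, 2, 3, 0, 0, 3, 0,
    0, 4, 2255601404, 0, 1956708213, 0, 0, 6, 331988902, 1060151835, 3, 331988902, 1060151835, 3,
    3, 2, 2, 2255601404, 2, 2, 2255601404, 1956708213, 3, 5, 2252870216, 1951267701, 3, 1, 3, 7]),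
    (92, [0, 810457205, 2, 2, 3, 2, 1, 3, 810457205, 2, 2, 810457205, 2, 2, 3, 2, 2, 0, 810457205,
    2, 2, 3, 2, 2, 0, 810457205, 2, 2, 3, 2, 2, 5]),
    (93, [1])]

def heptad8 : Certificate where
  core := [0, 7, 25, 138, 149, 268, 275]
  order :=
    [161, 373, 216, 75, 249, 254, 125, 43, 50, 207, 226, 201, 294, 193, 242, 109, 352, 115, 374,
    214, 344, 113, 326, 319, 119, 377, 244, 224, 46, 251, 367, 111, 220, 190, 331, 321, 250, 354,
    127, 60, 62, 318, 58, 357, 99, 63, 241, 104, 90, 372, 376, 54, 184, 92, 102, 112, 188, 45, 289,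
    359, 107, 166, 95, 308, 238, 351, 310, 228, 322, 229, 356, 353, 355, 208, 86, 290, 379, 110,
    178, 325, 304, 223, 381, 314, 126, 246, 196, 247, 383, 173, 219, 191, 120, 253, 175, 77, 303,
    94, 124, 227, 340, 329, 382, 312, 365, 78, 336, 182, 368, 122, 350, 210, 114, 378, 360, 101,
    233, 248, 240, 52, 380, 164, 123, 97, 108, 225, 362, 237, 369, 346, 236, 361, 106, 82, 176,
    358, 187, 198, 366, 335, 255, 118, 239, 232, 299, 205, 163, 363, 231, 169, 222, 252, 297, 84,
    195, 230, 293, 370, 98, 116, 317, 105, 243, 342, 349, 100, 235, 375, 117]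
  symmetries := [
    (1754704,0,2,0)]
  branches := [
    (57, [1963221086, 1964597424, 1011848394, 2, 3, 2, 3, 1233757022, 2, 1233757022, 2, 3, 2,
    1011848394, 2, 2, 2, 3, 2445931478, 1, 1850195840, 2, 4, 1, 2, 2152185566, 2, 2, 1964597424, 2,
    3, 1964597424, 2, 2, 3, 6, 1, 1, 1, 2, 1, 5, 2542379723, 2169020623, 2, 2, 3, 1, 2165322010,
    2169020623, 2, 3, 2, 4, 1233757022, 0, 3, 2, 1233757022, 2, 2, 3, 2, 1011848394, 2, 2, 2, 2, 1,
    2, 4, 1011848394, 2, 2, 1850195840, 2542379723, 4, 2, 1, 2, 1, 2258698063, 2, 1963221086, 3,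
    2258698063, 2, 2, 3, 5, 2542379723, 2, 2, 1, 2, 541981519, 2, 2, 2, 2, 2, 9]),
    (63, [1, 1, 3, 453615831, 1, 3, 0, 2, 2, 2, 2, 0, 2, 2, 2, 2, 4, 1, 440930888, 2, 2,
    1964597424, 2, 3, 2, 440930888, 2, 2, 2, 2, 3, 1233842888, 2, 1233842888, 2, 3, 2, 2, 2, 6]),
    (80, [1, 2, 1, 1, 1944346027, 2, 5, 1, 2, 1, 1, 1, 3, 1, 2, 2, 1, 434826593, 2, 1, 3, 1, 1, 5,
    1944346027, 1, 3, 1, 1, 10]),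
    (83, [1, 1, 1, 1, 1, 6]),
    (89, [1, 2, 1, 3, 1, 1, 1, 5]),
    (107, [1, 2, 1, 247778728, 2, 2, 2, 2, 1, 2, 5]),
    (119, [1, 1, 1, 1233756875, 2, 4, 1, 2, 4]),
    (121, [1, 1, 2, 2, 1, 2, 1, 5]),
    (136, [1, 2])]

def heptad9 : Certificate where
  core := [0, 7, 25, 30, 138, 141, 274]
  order :=
    [198, 223, 115, 76, 100, 193, 235, 124, 112, 122, 118, 114, 251, 253, 43, 238, 216, 107, 75,
    242, 111, 233, 381, 364, 229, 101, 53, 104, 109, 373, 367, 248, 249, 246, 255, 166, 376, 102,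
    117, 247, 44, 120, 184, 161, 191, 340, 252, 228, 195, 240, 239, 377, 164, 351, 176, 231, 224,
    181, 119, 98, 182, 188, 52, 123, 125, 214, 180, 245, 105, 372, 179, 244, 97, 83, 360, 356, 241,
    232, 85, 250, 163, 365, 243, 177, 363, 208, 110, 308, 220, 348, 326, 353, 127, 325, 51, 84,
    316, 183, 230, 215, 337, 328, 359, 187, 332, 305, 292, 371, 296, 347, 302, 361, 254, 311, 209,
    315, 299, 196, 321, 309, 355, 383, 378, 319, 368, 106, 211, 294, 312, 113, 99, 366, 374, 335,
    293, 324, 352, 344, 334, 382, 212, 219, 227, 297, 375, 379, 341, 300, 357, 358, 213, 303, 362,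
    226, 349, 354, 317, 323, 225, 331, 291, 380, 289, 343, 236, 369, 329, 108, 116]
  symmetries := [
    (1751120,30,1,0)]
  branches := [
    (44, [2058339270, 2561655708, 2561655750, 4, 2169988122, 2, 307205498, 1224491566, 1227351706,
    1248968496, 2, 2, 6, 458712090, 2, 3, 2169988220, 2, 4, 1, 1, 2, 2561655750, 2, 2, 4,
    2561655708, 2, 2561655708, 2169988122, 1248968496, 2, 3, 458712090, 2, 4, 1224491566,
    2561655708, 2169988122, 1248968496, 2, 3, 458712090, 2549884931, 3, 4, 850379397, 2, 2, 6,
    458712090, 0, 2, 3, 2, 1, 3, 1, 4, 257385566, 2, 2, 2, 2169988220, 2356264562, 2, 2, 3, 3, 1,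
    2, 2169988220, 2520421490, 2, 2, 2, 3, 4, 2356264562, 2, 2, 2, 2, 1, 3, 0, 2, 2, 2, 864144648,
    2, 145736646, 2, 1266797832, 2, 3, 4, 145736646, 2, 2, 1364706201, 2, 2, 2, 145736646, 2,
    2454197190, 0, 3, 2, 3, 1, 5, 3, 2058339270, 2520421490, 2, 2, 2, 2561655750, 4, 2474708936,
    2542466054, 2, 3, 2520421490, 2, 2, 2520421490, 2, 2, 3, 2152207302, 2, 2, 4, 3, 8]),
    (105, [1, 1, 1, 2, 1515165056, 2, 2, 2, 2, 1, 2, 6]),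
    (106, [0, 2, 2, 2, 1, 3, 2, 1, 1, 4]),
    (108, [1, 2, 1227244080, 2, 1227244080, 2, 3, 1248968309, 2, 2, 3, 1227244080, 2, 2, 2, 3,
    1264023834, 2, 2, 1065422834, 2, 2, 3, 2, 1, 4, 1, 1, 1, 1, 3, 1, 7]),
    (115, [1, 1, 2, 3]),
    (123, [2471978108, 1959052031, 2, 1950880370, 1515165056, 0, 4, 1953611486, 1959052031, 3, 3,
    607819085, 2, 1957632587, 1227244080, 2, 4, 607819085, 2, 2, 607819085, 2, 2158959406, 3, 4, 5,
    1850217074, 1227244080, 2, 2474708936, 4, 2554860287, 1515164854, 0, 4, 850379489, 2, 2,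
    2557591115, 1248990106, 2, 3, 5, 2160378778, 2, 607819085, 2, 1957632587, 3, 607819085, 2, 2,
    0, 2158959406, 1248968309, 2, 4, 4, 4, 1, 2474708936, 2554860287, 1248968309, 2, 3, 3,
    607819085, 2, 2, 607819085, 2, 2, 3, 1950880370, 1957632587, 3, 2, 4, 5, 850379489, 2,
    850379489, 2, 3, 0, 2, 2, 3, 2, 1, 2474708936, 2557591115, 2, 2557591115, 1919151437,
    2353512053, 3, 1515164854, 4, 4, 2, 4, 1, 257385596, 2, 2, 257385596, 2, 1266797832, 2, 3, 3,
    257385596, 2, 2, 257385596, 2, 2, 2353512053, 4, 3, 2471978108, 1953611486, 1919151437, 0, 3,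
    1515165056, 4, 1953611486, 2, 3, 3, 2474708936, 2554860287, 2, 3, 1950880370, 2, 2, 3, 3, 6]),
    (128, [1, 2, 1, 1, 4]),
    (134, [1, 2]),
    (143, [1]),
    (116, [1])]

def heptad10 : Certificate where
  core := [0, 7, 25, 138, 141, 275, 286]
  order :=
    [364, 193, 76, 75, 43, 223, 82, 99, 100, 53, 166, 241, 85, 105, 109, 97, 124, 122, 229, 98,
    115, 252, 44, 107, 50, 216, 242, 224, 112, 251, 253, 231, 250, 104, 233, 184, 106, 297, 300,
    249, 303, 125, 248, 358, 161, 236, 191, 164, 255, 176, 181, 101, 239, 374, 369, 228, 230, 240,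
    210, 376, 182, 188, 227, 52, 238, 111, 120, 114, 84, 126, 78, 180, 118, 243, 329, 245, 308,
    365, 225, 289, 220, 321, 326, 246, 299, 95, 213, 312, 244, 324, 102, 344, 381, 290, 292, 352,
    46, 353, 254, 219, 123, 209, 375, 378, 368, 195, 54, 247, 331, 380, 336, 373, 226, 208, 349,
    108, 58, 363, 60, 360, 117, 90, 113, 119, 359, 63, 163, 177, 357, 372, 116, 328, 196, 178, 110,
    325, 383, 232, 183, 198, 377, 187, 356, 367, 379, 293, 354, 317, 366, 309, 294, 362, 340, 86,
    235, 341, 296, 304, 335, 361, 322, 127, 332, 214, 355, 212, 370, 215, 92]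
  symmetries := []
  branches := [
    (44, [2152206920, 1857012636, 2544379653, 1919151258, 2, 2, 1916441754, 5, 2054274632,
    239604446, 2, 2456928018, 4, 2370726229, 3, 239604446, 2, 1239624978, 0, 3, 3, 2356264722, 2,
    1239624978, 2, 2, 4, 239604446, 2, 2, 2, 2456928018, 239604446, 2, 3, 2, 5, 1266797810, 1, 3,
    1262032143, 2, 2, 3, 1968661509, 2, 2172719048, 1239624978, 1262032143, 3, 3, 2, 2, 1, 1, 2, 9,
    1953611568, 2252870216, 2258697985, 4, 1953611568, 2, 2252870216, 1919151258, 2, 2, 1916441754,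
    1953611568, 2258697985, 3, 7, 1968661530, 1919151258, 1951267701, 3, 1951267701, 3, 1951267701,
    1916441754, 5, 1919151258, 2059672338, 2172719048, 3, 2562988818, 2, 3, 3, 1919151258, 2, 2,
    1916441754, 2158034689, 4, 1916441754, 1, 2059672338, 2172719048, 3, 2562988818, 2, 3, 8,
    2252870216, 2546508806, 2460220735, 327881494, 1867423105, 2751534088, 4, 4, 2460220735, 3, 1,
    1057485337, 327881494, 2544196924, 3, 2, 2, 5, 1951267663, 0, 2, 2, 3, 2, 409588924, 0, 3,
    2543412028, 2, 3, 1235767557, 2158230913, 2, 1260333451, 4, 1, 3, 0, 2, 1951267701, 1, 3, 8,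
    1266797810, 0, 2, 2, 2, 3, 1, 2, 1, 2544390405, 2, 2, 5, 1, 1, 2, 649055493, 1555025157, 3, 1,
    4, 1, 4, 659463577, 2, 2644860220, 3, 1059571367, 2, 1262032143, 1240132961, 4, 2644075393, 2,
    2644075393, 2, 4, 1240132961, 2, 3, 2644075393, 1240132961, 2, 3, 246402327, 2, 2, 147069714,
    2747835398, 2, 3, 2764315440, 2, 3, 1240132961, 3, 6, 2158034620, 2, 409588924, 2543412028, 4,
    1, 2370339121, 2, 2, 2460024574, 2, 2, 3, 2, 2764315410, 2, 2, 2, 2, 5, 1235574145, 2,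
    2544390405, 1260333451, 1548227144, 5, 2544196993, 1260333451, 2159004933, 147069714,
    2158230913, 3, 2544390405, 3, 6, 2172719048, 1548227144, 3, 2, 1, 3, 1, 3, 1857015345,
    1968666885, 3, 2, 1857015345, 2, 5, 2172719048, 642257480, 2, 3, 2, 2172719048, 1239624978, 2,
    3, 1239624978, 2, 2, 2172719048, 2, 4, 1145961333, 2, 2, 2, 4, 1, 3, 0, 2370339121, 3, 0,
    1145961333, 2, 3, 3, 2, 2764315410, 2, 2, 2764315410, 2, 2, 3, 3, 1148305226, 2, 2, 1148305226,
    2, 2, 3, 2, 1857012341, 2, 2370339121, 3, 2, 3, 2764315410, 2, 2, 2, 13]),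
    (46, [1857012636, 2544379653, 1953611568, 2745706505, 2, 2258697985, 4, 2341115292, 1739097753,
    333537119, 1058603550, 4, 1058603550, 4, 1233842888, 2, 1233842888, 2, 333537051, 4, 6,
    1857012636, 2544379653, 3, 1739097753, 2, 2, 1857012636, 2, 2, 1857012636, 2544379653,
    1235574076, 0, 3, 4, 2, 4, 2072104218, 2172767474, 3, 1261645195, 2, 0, 3, 649052826, 2, 2, 4,
    1, 1, 2, 7, 1953611568, 2454196811, 2258697985, 4, 1953611568, 2, 2454196811, 4, 2474708936, 0,
    2, 3, 809145458, 0, 3, 2, 2, 3, 1968661530, 809145458, 2319119130, 3, 2, 2158034689, 3, 3,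
    2158034689, 2, 5, 1968661530, 333537119, 1058603550, 3, 1953611568, 2, 2, 4, 1968661530,
    1235574076, 2, 2159005078, 4, 1968661530, 1235560902, 0, 3, 3, 3, 1968661530, 2, 1968661530, 2,
    3, 1968661530, 1235574076, 2, 3, 2, 4, 1263430083, 2, 2, 1968661530, 2, 2, 1968661530,
    1235560902, 1263430083, 3, 2, 3, 4, 245431999, 2, 1, 2158034689, 4, 1, 2, 1, 2, 7, 1, 2,
    346549654, 2, 1, 1554509206, 2, 3, 3, 1235574076, 2, 2, 2159005078, 3, 2, 1235574076, 0, 3,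
    1235574076, 2, 3, 2, 1, 3, 5, 2246765921, 334504868, 246399639, 3, 1554054913, 2, 4,
    1554054913, 1, 434826593, 2, 4, 246399639, 1263430083, 3, 2649419105, 3, 1555022490, 2,
    334504868, 2, 3, 1263430083, 2, 4, 334504868, 2, 2, 2, 2146102625, 334504868, 246399639, 3, 3,
    6, 2072104218, 2172767474, 1065471218, 2, 4, 1261645195, 2, 2, 1261645195, 2776747272, 3,
    1261645195, 333537051, 0, 3, 3, 3, 1261645195, 2, 4, 333537051, 1944389019, 1266797832, 2, 4,
    2, 1, 5, 1953611568, 2, 2643129032, 3, 2, 1953611568, 2, 1953611568, 1943313758, 3, 2643129032,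
    4, 1235560902, 2, 2, 1943313758, 3, 3, 2643129032, 2, 2, 4, 1, 1953611568, 2, 2643325638, 2, 3,
    2, 3, 1, 2, 1953611568, 1953611594, 2, 2258697985, 4, 1235756826, 2, 1967693953, 2, 3,
    1235756826, 2, 2158034689, 3, 4, 2, 3, 1, 11]),
    (79, [2419758216, 831189704, 0, 3, 1233818896, 0, 3, 0, 4, 1852948190, 2460992272, 831189704,
    2, 4, 4, 1953611486, 831189704, 0, 3, 3, 2, 1233818896, 2341115292, 3, 1233818896, 2, 3, 2, 4,
    1, 1233818896, 2, 1233818896, 2, 3, 2, 1, 3, 1, 5, 2454196811, 1263429907, 2, 2, 2, 2557591115,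
    440931041, 0, 3, 3, 2, 2, 1, 1235767557, 2, 2, 6, 1, 2, 2369328464, 2, 2, 2644075393, 2, 2, 3,
    2644075393, 2, 3, 1233818896, 2, 2, 1233818896, 2, 2, 3, 2, 2, 1235574145, 2, 2544390405,
    1263429907, 2, 4, 260116424, 2, 2, 3, 1, 2, 2360328976, 2, 2, 2, 4, 2360328976, 2, 2, 2, 8]),
    (93, [1, 1, 1, 2, 4, 1, 2644860220, 3, 1, 2642745026, 2, 2, 2, 2, 1149273029, 2, 2, 2, 2, 3,
    1548227297, 2, 2, 2159005078, 3, 2, 2, 2460220735, 832920892, 2, 832920892, 2, 3, 3,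
    1062202777, 832920892, 3, 2, 2, 3, 1, 2, 1, 9]),
    (94, [2172767474, 1, 1, 1233431946, 2, 2, 5, 1739105835, 2, 2, 1, 3, 1, 1966409275, 2, 3, 4]),
    (96, [2072104218, 1065471218, 2, 1, 4, 1, 2, 2374094106, 2, 2, 2, 1, 1555025157, 2, 1, 4, 1, 1,
    7]),
    (106, [1, 2, 1, 1, 4]),
    (125, [1149273029, 2460024574, 3, 1233431946, 2, 3, 1233431946, 2, 3, 1968661509, 2158034620,
    2543412028, 3, 2543412028, 4, 245432062, 2, 245432062, 2, 3, 2, 4, 1149273029, 2, 2,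
    2374045704, 2, 2, 2, 3, 1968661509, 2158034620, 2, 3, 3, 2361275333, 2, 2, 1, 3, 1240012168, 0,
    0, 245432062, 2, 2, 4, 3, 245432062, 2, 245432062, 2, 3, 245432062, 2, 2, 1, 4, 4, 2158034620,
    1234786636, 3, 0, 2, 2, 2, 3, 1234786636, 2643129032, 2, 2, 3, 3, 1, 2550207496, 2, 2, 3,
    1968661509, 2158034620, 2, 3, 2, 2159948741, 2, 2, 2120865221, 3, 2543412028, 2, 2, 9]),
    (126, [1233842888, 2, 1966409057, 3, 1, 2, 1, 3, 1, 2, 4, 1, 2776747272, 2, 2, 3, 434826593,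
    1554251137, 3, 2, 1, 3, 4]),
    (127, [1, 1, 2649419105, 4, 642257633, 1967693884, 3, 2, 2, 2, 2643129032, 2, 1943313758, 3, 3,
    1, 4]),
    (138, [1148305226, 648085180, 3, 2, 2, 2644075393, 1, 4, 1, 3, 1, 1, 3, 3]),
    (141, [1235767557, 2, 2, 1, 3, 1857015345, 1968666885, 3, 3]),
    (145, [1, 2]),
    (147, [1, 1, 3, 1, 3]),
    (156, [1, 2])]

def heptad11 : Certificate where
  core := [0, 7, 25, 139, 150, 277, 282]
  order :=
    [376, 104, 383, 251, 253, 122, 351, 381, 102, 84, 223, 229, 247, 228, 234, 45, 379, 233, 98,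
    109, 127, 77, 374, 231, 51, 99, 105, 375, 101, 120, 239, 74, 106, 83, 294, 42, 249, 52, 82,
    184, 107, 355, 356, 100, 326, 367, 334, 370, 254, 123, 236, 358, 161, 164, 382, 339, 168, 173,
    194, 197, 117, 174, 188, 44, 361, 348, 119, 172, 108, 248, 364, 300, 289, 115, 319, 193, 357,
    46, 114, 60, 244, 116, 329, 377, 63, 62, 366, 230, 162, 240, 255, 352, 92, 336, 176, 196, 179,
    126, 205, 359, 50, 78, 292, 296, 301, 112, 328, 302, 316, 111, 353, 227, 241, 165, 191, 252,
    297, 290, 211, 97, 250, 76, 371, 225, 232, 226, 242, 209, 206, 243, 368, 322, 304, 380, 307,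
    216, 360, 333, 221, 94, 125, 354, 335, 177, 208, 204, 372, 189, 321, 238, 220, 237, 95, 332,
    363, 118, 245, 365, 323, 200, 291, 124, 110, 224, 362, 324, 369, 113, 303]
  symmetries := [
    (1742048,0,2,0)]
  branches := [
    (52, [141693512, 2554838600, 2, 2856828488, 2120499542, 1917817998, 3, 242357010, 6, 141693512,
    2, 2119144826, 1917817998, 3, 242357010, 5, 649010051, 2, 2824142685, 2844023133, 3,
    2662275656, 4, 2856828488, 2119144826, 1917817998, 3, 2119144826, 1917817998, 3, 2662275656, 4,
    2662275656, 2825486789, 2, 7, 1261723204, 2, 141693512, 2, 3, 2824142685, 0, 2, 3, 2,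
    2119499613, 2, 4, 2119144826, 1917817998, 3, 2, 2, 1919172750, 1, 1918162120, 4, 2119144826,
    1917817998, 3, 2, 2, 1, 2, 2825486789, 2, 8, 1261723204, 2, 2, 649010051, 2, 2824142685, 2, 3,
    2662275656, 4, 1261723204, 2524943047, 3, 2747921246, 2, 2524943047, 4, 810521717, 2, 0, 2, 3,
    2, 2524943047, 4, 1, 1261723204, 2, 2, 2, 5, 1, 2, 2119144826, 1917817998, 3, 2, 2, 1, 3,
    1919172750, 1, 2839512392, 2, 2, 2168023402, 2, 2, 3, 1918162120, 5, 2119144826, 1917817998, 3,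
    2, 2, 2119144826, 1917817998, 3, 2, 2, 2119144826, 2, 2, 2, 4, 1, 2, 1340207585, 2, 2, 2, 1, 3,
    2825486789, 1, 3, 1, 11]),
    (74, [1261723204, 1240047175, 0, 2, 4, 1241262077, 1241616891, 0, 4, 1239689668, 1262053831, 3,
    3, 3, 2164539672, 2820997656, 2, 1239689668, 2, 3, 3, 1239689668, 1262053831, 3, 1239689668,
    1262053831, 2844023133, 4, 1239689668, 1262053831, 1963213184, 4, 1239689668, 1262053831, 3, 5,
    2844023133, 1919524969, 2120851707, 3, 1963213184, 4, 3, 2844023133, 1963213184, 3, 5,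
    2825150616, 2, 1238646727, 1260274372, 3, 2, 3, 1239689668, 2, 2825150616, 3, 2, 1239689668,
    1262053831, 3, 2, 1239689668, 1262053831, 0, 4, 1239689668, 1262053831, 3, 3, 2119499613,
    1918172905, 3, 4, 1, 1, 2, 5, 1918172905, 2, 2, 1918172905, 2, 1260274372, 2, 2, 7, 2825150616,
    2671710919, 2, 2, 3, 1260274372, 2, 2, 1, 4, 2825150616, 1260274372, 2, 1260268887, 2, 3,
    1260274372, 2, 4, 2825150616, 1918172905, 2671710919, 2, 4, 1918172905, 2825150616, 2,
    1260274372, 2, 5, 2825150616, 2, 2, 1260274372, 2, 2, 6, 2827282372, 1, 1239689668, 2, 2,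
    1239689668, 2, 1239689668, 2, 3, 2119499613, 2, 4, 1, 3, 1261723204, 2, 2, 2, 1, 3, 5,
    1241786291, 1253013922, 3, 1237947844, 2, 2, 1260268887, 2, 3, 3, 1, 2, 2, 3, 2524943047,
    1239689668, 2, 2146016746, 4, 2, 2, 1239689668, 1262053831, 3, 2, 2119499613, 2, 3, 1239689668,
    1262053831, 2524943047, 4, 2524943047, 3, 2524943047, 3, 1239689668, 1262053831, 2168023402, 4,
    2146016746, 3, 2119499613, 2, 2146016746, 4, 1, 1239689668, 1262053831, 3, 2, 1239689668,
    1262053831, 3, 2, 3, 6, 1, 2524943047, 2525292484, 3, 1238646727, 2, 2, 2, 2, 6, 1261723204,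
    1240047175, 0, 4, 2, 2, 1261723204, 1240047175, 3, 2, 2, 1, 4, 1, 2, 2524943047, 2525292484, 3,
    1, 2, 5, 1, 2, 2524943047, 2525292484, 3, 1241786291, 1241092785, 1224402874, 3, 1, 4, 1, 2,
    1237947844, 2, 2, 2, 3, 3, 1, 2, 2, 1, 2, 3, 11]),
    (77, [1, 1, 3, 1959054578, 2, 2, 1, 2, 1, 4, 2160381336, 1959054578, 3, 1, 2, 3, 1, 1224402874,
    2, 1, 2, 3, 2, 6]),
    (96, [2119488962, 1, 1266432510, 2, 1, 2827282285, 4, 2822005758, 1266432510, 1233410430, 1, 4,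
    1233410430, 1, 2827282285, 5, 1266432510, 256506649, 3, 1233413186, 2, 2, 2827282285, 3,
    2827276978, 2, 2827282285, 5, 2827276978, 2, 2827282285, 9, 1, 1, 2, 1665792894, 256506649, 3,
    256506649, 3, 1, 2122639213, 2, 4, 1, 3, 1, 1, 3, 1, 1234813465, 2, 2, 1, 4, 1241786235, 2, 2,
    2, 1, 2, 9]),
    (102, [1253013922, 2, 1, 2, 3, 1, 1, 1, 2, 4, 1, 2, 2, 4]),
    (107, [343020254, 2822349717, 3, 2, 2319030477, 2, 3, 1, 3, 1, 2, 3, 1263419230, 1, 3, 2, 3]),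
    (113, [1, 758253281, 0, 3, 2, 2844023133, 2, 3, 0, 2, 2, 2, 1, 4, 2872679989, 2, 1, 2, 4, 1, 0,
    2, 2, 2, 2, 2, 5]),
    (117, [1, 2, 1, 2, 2, 3]),
    (143, [1224402874, 2, 1224402874, 3, 2, 1241780933, 2, 2, 1, 2, 3, 3]),
    (147, [1, 1, 2, 3])]

def heptad12 : Certificate where
  core := [0, 7, 25, 138, 149, 268, 287]
  order :=
    [243, 179, 241, 242, 247, 211, 251, 227, 371, 115, 356, 326, 358, 359, 374, 102, 230, 366, 294,
    354, 90, 378, 250, 122, 120, 123, 58, 126, 114, 106, 304, 112, 370, 372, 376, 352, 336, 368,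
    369, 240, 379, 367, 362, 331, 363, 361, 299, 355, 107, 235, 380, 253, 124, 220, 252, 244, 248,
    188, 254, 236, 365, 105, 109, 237, 108, 45, 111, 125, 77, 101, 233, 229, 193, 224, 353, 161,
    225, 97, 342, 338, 346, 82, 210, 322, 339, 226, 231, 238, 198, 246, 228, 166, 306, 310, 314,
    290, 178, 307, 50, 117, 100, 118, 116, 84, 52, 305, 337, 113, 373, 377, 219, 207, 75, 201, 195,
    99, 51, 291, 43, 163, 375, 127, 382, 381, 255, 190, 54, 60, 46, 62, 94, 92, 222, 78, 86, 184,
    216, 232, 249, 164, 176, 308, 182, 321, 323, 329, 325, 208, 340, 214, 196, 360, 297, 312, 239,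
    173, 175, 104, 98, 110, 357, 289, 293, 83, 119, 169, 187, 205, 344]
  symmetries := []
  branches := [
    (65, [1234144132, 2721877217, 3, 2, 1, 1, 1, 2, 1, 6, 2721683678, 2542379723, 3, 1850195840,
    2542379723, 4, 2542379723, 2, 1850195840, 2542379723, 1, 6, 2721683678, 1, 2, 3, 2721683678,
    2857409369, 2454755986, 3, 1963221086, 2, 4, 1963221086, 2, 1, 1, 3, 5, 1, 1, 3, 1, 1,
    1950880328, 2, 2, 2, 5, 1, 1, 2, 1, 4, 1, 3, 2857409369, 1, 2454755986, 1, 4, 1, 1, 2,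
    2454755986, 1, 7, 1548205790, 2, 1963221086, 3, 1, 2, 1, 3, 1, 1, 2, 1, 2, 1, 2, 13]),
    (116, [2965660922, 2, 2, 1, 2, 1233756875, 247778728, 2, 3, 2, 2, 3, 2952368762, 2, 1, 3, 1, 2,
    1240046942, 2, 2, 2, 1240433941, 2, 2, 837780757, 2, 2, 3, 1, 2949223726, 2, 2, 2, 3, 1, 4, 1,
    2858401260, 2, 1, 2, 4, 8]),
    (125, [1, 2, 2844756757, 1, 2152766101, 1233756875, 2, 2, 1, 6, 1, 2857409469, 2, 3, 1, 1, 6]),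
    (126, [259993059, 2, 2, 2, 2, 1, 1, 3, 3]),
    (128, [1, 2, 2, 1, 2, 1, 1, 4, 1, 1548786325, 2, 1, 5, 1, 1233756875, 1, 3, 1, 3, 3, 1, 5]),
    (135, [2832244298, 2, 2832244298, 2831663703, 1951203205, 4, 2832244380, 1, 1, 6, 1240433941,
    2, 2, 2, 1240433941, 2, 2, 2831663703, 3, 1, 1, 2, 1, 1, 3, 1, 8]),
    (139, [1, 1, 1, 4, 1, 2, 2, 1, 2, 1, 2, 2, 1, 6]),
    (140, [1240046942, 2, 2, 1, 2, 1, 3, 2850659678, 2, 1, 5]),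
    (141, [1951396682, 2, 1, 1, 4, 2831663749, 2, 2, 1, 4]),
    (142, [1, 2, 1, 3, 1, 1, 1, 5]),
    (152, [1, 2146403605, 1, 3, 1, 4]),
    (153, [1963995157, 1, 1, 4, 1, 2, 1, 1, 3, 1, 1, 3, 1, 1, 7]),
    (155, [1, 2965639157, 2, 1, 3, 2965639157, 1, 3, 1, 5]),
    (162, [2836381099, 2, 1, 2836381233, 4, 1, 3, 2])]

def heptad13 : Certificate where
  core := [0, 7, 25, 138, 141, 274, 277]
  order :=
    [43, 75, 99, 105, 106, 111, 123, 107, 235, 363, 54, 86, 102, 114, 116, 119, 126, 118, 246, 374,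
    109, 110, 108, 236, 364, 44, 76, 100, 104, 124, 113, 241, 369, 177, 209, 225, 240, 243, 245,
    249, 120, 248, 376, 312, 344, 360, 368, 377, 378, 380, 191, 223, 239, 247, 251, 253, 254, 127,
    255, 383, 161, 193, 224, 227, 229, 233, 97, 353, 230, 358, 166, 198, 226, 228, 231, 238, 46,
    58, 60, 63, 62, 190, 318, 78, 90, 92, 95, 94, 222, 350, 164, 176, 182, 188, 244, 52, 180, 299,
    331, 355, 361, 362, 367, 379, 196, 208, 214, 220, 84, 212, 292, 324, 163, 183, 187, 83, 211,
    195, 215, 219, 242, 98, 112, 115, 122, 302, 294, 300, 303, 366, 316, 348, 381, 382, 252, 291,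
    323, 352, 357, 372, 356, 51, 179, 354, 335, 184, 216, 232, 250, 101, 359, 371, 334, 326, 332,
    125, 117, 289, 296, 297, 319, 351, 375, 321, 328, 329, 315, 347, 365]
  symmetries := [
    (1751176,0,2,0)]
  branches := [
    (90, [1, 2950965658, 2, 2950965658, 2, 3, 2877410586, 2945267097, 2, 2773992345, 3, 1, 5,
    2877410586, 1, 2950965658, 2, 2945267097, 2, 3, 3, 1, 5, 1, 1, 2371293173, 1264045301, 2,
    1264045301, 2, 3, 2, 1, 5, 1, 6]),
    (97, [1, 2, 2874609718, 2169966646, 2620676546, 2, 4, 1, 3024920957, 2, 4, 3024920957, 2, 2,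
    3075154307, 2, 2561612669, 2945229131, 3, 2945229131, 4, 3024920957, 2, 2, 2, 3, 3024920957, 1,
    1, 4, 3024920957, 2, 1, 3, 1, 4, 1, 2, 2, 7]),
    (112, [1, 2, 2, 1, 3, 1, 2, 1161489819, 2, 3072401744, 2, 3072401744, 2, 3, 2, 3, 1, 4, 1, 1,
    3, 1, 2, 1, 1, 2, 2, 2, 1, 1, 9]),
    (125, [1, 1, 1, 1, 4, 3]),
    (126, [2874609718, 2561612560, 3, 1, 1, 4]),
    (96, [1, 2, 1, 2, 1, 4]),
    (128, [1, 2]),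
    (141, [1, 1, 1, 2, 1, 5])]

def heptad14 : Certificate where
  core := [0, 7, 25, 138, 141, 274, 287]
  order :=
    [43, 75, 99, 105, 106, 111, 123, 107, 235, 363, 53, 85, 101, 113, 116, 119, 125, 117, 245, 373,
    102, 230, 358, 166, 198, 226, 228, 231, 238, 246, 108, 236, 364, 44, 76, 100, 104, 109, 110,
    124, 120, 248, 376, 184, 216, 232, 240, 249, 250, 252, 161, 193, 224, 227, 229, 233, 241, 97,
    225, 353, 164, 176, 181, 182, 188, 244, 52, 180, 308, 126, 254, 382, 62, 94, 118, 122, 127,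
    179, 211, 242, 247, 251, 115, 243, 371, 196, 208, 213, 214, 220, 84, 212, 340, 289, 321, 352,
    355, 357, 361, 369, 294, 326, 354, 356, 359, 366, 374, 312, 344, 360, 368, 377, 378, 380, 46,
    54, 58, 60, 190, 51, 163, 177, 183, 187, 78, 86, 90, 92, 222, 83, 195, 209, 215, 219, 292, 296,
    302, 316, 300, 299, 331, 362, 367, 379, 309, 341, 372, 375, 381, 324, 328, 334, 348, 332, 291,
    293, 297, 305, 323, 325, 329, 337, 114, 98, 112, 239, 253, 255, 365]
  symmetries := []
  branches := [
    (93, [2474708936, 2621257094, 2, 3, 1954299696, 2621257094, 2, 2259041977, 2964284421, 5,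
    2621257094, 2945267097, 3, 2, 2877362184, 2, 5, 2474708936, 2621257094, 3024920761, 2158378681,
    4, 2964262920, 4, 1954299696, 2621257094, 2, 2259041977, 4, 2621257094, 2, 2158378681, 3,
    2621257094, 2950965658, 3, 2, 5, 2158378681, 2, 1, 1954299696, 2, 2, 6, 1, 1, 3, 2945315465, 2,
    2, 2964262920, 2, 3, 2, 2356286177, 2, 1, 1, 3022318973, 2, 2, 5, 1, 1, 1, 1, 5, 1, 1,
    2671318317, 2, 2, 2, 4, 1, 2, 2964284421, 2671318317, 2, 3, 2, 9]),
    (115, [1, 1, 3, 2945267097, 2950965658, 3, 2, 2544024964, 2846014852, 1, 3, 4, 1, 4, 1, 1,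
    2544024964, 1, 5, 1, 1, 3, 1, 1, 1, 4, 5]),
    (118, [2964262920, 2543928121, 3, 2158378681, 1, 2543928121, 5, 2549691400, 2, 1, 3, 1, 4, 1,
    1, 3, 832652089, 2, 2, 2, 2951014027, 2, 2, 2, 2, 1266797832, 2, 2, 2, 3, 5]),
    (119, [1235305348, 2, 2877410546, 3, 1235305348, 2, 2, 1, 2, 1235305348, 2, 4, 1, 1, 3, 1, 5,
    1, 2, 1, 1, 4, 1, 2, 1, 3, 1, 3, 2950820321, 2, 2543928196, 1, 2, 2950820321, 2, 2158378756,
    1013396740, 2, 4, 1013396740, 2, 6, 2964284421, 2, 2, 2, 2, 1, 1, 3, 7]),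
    (122, [1, 2, 1, 3, 1, 1, 3, 1, 2, 1, 1, 1, 4, 1, 2, 1, 2, 2644591492, 3, 7]),
    (123, [2950772125, 2, 2846014777, 2877410546, 4, 2846014777, 1, 1, 1, 6, 1, 2, 1, 3,
    2544024889, 1, 1, 1, 5, 256703019, 2, 256703019, 2, 2, 3, 2671318317, 2, 2, 2, 3, 1, 6]),
    (134, [1, 1266797810, 2, 2, 1, 3, 2877410546, 1, 3, 4]),
    (135, [1, 2, 1, 2, 1, 1, 3, 4]),
    (136, [1, 1, 3, 1, 1, 2, 1, 4, 1, 1, 1, 2, 1, 7]),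
    (138, [2964284421, 2, 2964284421, 2, 1, 4, 1, 2, 1, 2, 4]),
    (139, [1, 1, 1, 4, 1, 2, 1, 4]),
    (154, [1, 2]),
    (155, [1]),
    (156, [1, 2, 1161489819, 2, 1, 3, 2, 3]),
    (157, [1, 2, 2, 2])]

def heptad15 : Certificate where
  core := [0, 7, 25, 138, 141, 275, 276]
  order :=
    [370, 247, 97, 43, 123, 364, 223, 53, 248, 350, 373, 193, 98, 117, 229, 249, 166, 44, 114, 238,
    50, 293, 85, 109, 331, 254, 115, 297, 227, 253, 86, 363, 383, 113, 120, 378, 368, 101, 290,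
    296, 124, 299, 353, 228, 375, 230, 94, 198, 116, 190, 106, 242, 226, 82, 107, 232, 184, 76, 99,
    251, 161, 90, 191, 379, 111, 46, 54, 78, 58, 239, 235, 127, 104, 250, 60, 100, 108, 322, 110,
    216, 367, 63, 329, 196, 209, 220, 62, 289, 362, 164, 178, 118, 122, 222, 219, 126, 365, 244,
    183, 187, 176, 181, 208, 95, 376, 354, 225, 344, 240, 182, 119, 92, 188, 102, 125, 75, 381,
    369, 335, 366, 177, 213, 302, 255, 233, 321, 380, 314, 328, 319, 231, 246, 163, 112, 236, 210,
    300, 195, 382, 326, 346, 332, 303, 357, 352, 360, 241, 355, 317, 351, 361, 252, 245, 374, 349,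
    243, 294, 312, 214, 215, 359, 358, 334, 377, 318, 356, 105, 224, 325]
  symmetries := [
    (1751120,0,2,0)]
  branches := [
    (60, [2471977931, 0, 3, 2252870216, 835232459, 2, 2, 3, 3, 2152206920, 2456927816, 1,
    2859581202, 4, 2456927816, 2154938078, 2859581202, 3, 2859581202, 4, 2456927816, 2859581202, 3,
    3, 2456927816, 2859581202, 3, 2859581202, 2371320053, 2, 2971738383, 3, 2456927816, 2, 8,
    2059672338, 2471977931, 2252870216, 4, 2764315410, 2471977931, 3, 0, 2252870216, 5, 1951267701,
    2, 2, 1919151258, 2, 2059672338, 2172719048, 3, 2562988818, 2, 3, 2874631234, 0, 3, 2059672338,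
    2117768582, 2345179475, 3, 1951267701, 4, 1951267701, 2, 3, 7, 1057485337, 2, 1264023868, 2, 2,
    3, 2, 3057975339, 2, 1237885790, 2, 1237885790, 2, 3, 2, 3, 1, 1, 5, 1, 257385419, 2, 2, 3,
    2971738383, 2370726190, 2, 2, 2252870216, 2, 3, 1, 5, 2546508638, 2, 2848498526, 2, 3, 2,
    3280015386, 2, 3, 2546508638, 327881494, 2, 3, 2848498526, 2, 1264023868, 2, 4, 835232459, 2,
    2, 3, 2972792079, 3280015386, 2, 3, 835232459, 2, 2, 2, 5, 2764315410, 1237885790, 2471977931,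
    3, 3179352090, 2471977931, 5, 2764315410, 1237885790, 2874631234, 3, 1237885790, 2, 4,
    3179352090, 2874631234, 2, 5, 1, 0, 2471977931, 3, 2874631234, 2, 3, 2972792079, 2, 1, 6, 0,
    2764315410, 2471977931, 3, 0, 2252870216, 5, 2874631234, 0, 3, 0, 4, 2972792079, 2252870216, 2,
    3, 1, 2874631234, 2, 3, 2874631234, 2252870216, 2, 3, 2252870216, 2, 2059672338, 2, 2764315410,
    2, 3, 2, 14]),
    (62, [2419758152, 2969996739, 1852948304, 2, 3, 0, 4, 2341115252, 2762982281, 3176621003, 3,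
    3176621003, 4, 2969996739, 2, 2969996739, 2, 2969996739, 2, 4, 0, 5, 2058341800, 2, 3176626421,
    2, 2, 1, 4, 3059286945, 2, 2072104218, 3, 2575420698, 2, 3, 2969996739, 2, 2, 5, 2374094106, 2,
    2, 1263430083, 2, 2, 3, 2072104218, 3139526814, 3, 2374094106, 2, 2, 4, 3280015368, 2974534083,
    3, 1138007390, 2974534083, 4, 2245303646, 3, 2974534083, 0, 1551670692, 3, 2, 2, 3, 2575420698,
    2, 2, 0, 2, 2, 2836402587, 2, 3, 1, 3, 5, 2658182046, 2, 2, 3057975193, 0, 2, 3, 2, 642257633,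
    2, 2, 2, 3, 2575420698, 2, 2762982281, 2, 2839426498, 2, 3, 2, 5, 145739176, 2, 2764315472,
    2836402587, 3, 2, 2836402587, 3, 3277289717, 4, 2246765921, 2369328432, 2877362120, 3,
    2822411654, 2, 2, 3, 3277284418, 2, 4, 2441802758, 147069770, 2, 3, 2836402587, 2520421766,
    1742774867, 3, 2, 4, 2844456006, 2, 2, 2836402587, 2, 4, 3277284418, 2, 5, 2974534083, 1,
    2165924042, 1964597424, 3, 2421069899, 3, 2, 3057975193, 2, 3, 4, 1, 2969996739, 2, 3, 2,
    2969996739, 2421069899, 2, 2, 3, 0, 3, 2546508491, 2165924042, 1964597424, 3, 3, 2, 2,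
    2058341800, 2, 2, 3, 10]),
    (65, [3238641825, 2, 2, 2, 2072104218, 1, 3, 1, 2, 2, 4]),
    (89, [2168122785, 2, 1, 3238641825, 2, 3, 3, 3234534553, 2, 2, 2, 2, 3239034273, 1, 2, 3,
    2575420698, 2, 2776747290, 3059286945, 2, 2, 3, 6]),
    (99, [2974340487, 2, 2, 3064265259, 2, 2, 2647171787, 2, 2, 3, 2561658117, 2, 2, 2975321352, 2,
    2, 2, 2374045704, 2, 2, 2, 2, 6]),
    (100, [2836402587, 2, 2, 3176621122, 2836402587, 3, 3, 3277284418, 2, 3176621122, 2, 4]),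
    (122, [1, 2, 1, 2, 3, 1, 2, 1, 3, 1233431946, 2, 2, 2, 2, 4]),
    (132, [1233431946, 257385538, 2, 3, 1233431946, 257385538, 2, 3, 3, 2926150085, 2, 2, 3,
    1266797832, 2, 2, 206477387, 2, 2, 3, 1233842888, 2, 2, 1, 4, 2546508491, 2848498379, 3, 2, 2,
    2, 2, 1233842888, 2, 2, 2, 5]),
    (101, [2876975426, 2, 2844455624, 2, 3, 2471010508, 2831685199, 3, 2, 2, 2848498379, 2, 2, 2,
    4, 1, 2471978050, 2, 2, 2, 205165640, 2, 2, 2, 2, 5]),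
    (136, [1]),
    (156, [1, 2371314754, 2, 2, 2, 0, 4]),
    (157, [1]),
    (164, [1])]

def heptad16 : Certificate where
  core := [0, 7, 25, 30, 138, 148, 268]
  order :=
    [355, 369, 43, 339, 53, 325, 201, 349, 215, 102, 353, 127, 375, 335, 77, 219, 107, 166, 221,
    85, 238, 195, 347, 338, 50, 184, 323, 246, 161, 122, 191, 379, 360, 377, 231, 198, 112, 354,
    175, 51, 240, 179, 252, 232, 177, 363, 365, 370, 178, 108, 75, 235, 378, 163, 223, 237, 255,
    183, 187, 45, 236, 173, 117, 381, 119, 290, 304, 83, 310, 358, 359, 216, 294, 251, 115, 125,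
    106, 233, 97, 207, 343, 373, 243, 227, 307, 346, 230, 205, 82, 114, 312, 241, 193, 211, 189,
    250, 109, 382, 226, 209, 341, 118, 371, 299, 165, 105, 326, 210, 303, 337, 362, 383, 289, 224,
    254, 293, 315, 368, 113, 123, 124, 314, 239, 306, 309, 225, 342, 249, 253, 361, 372, 110, 245,
    169, 291, 120, 366, 351, 344, 98, 297, 116, 197, 374, 352, 329, 376, 356, 248, 321, 111, 331,
    380, 305, 229, 367, 357, 104, 99, 242, 101, 311, 336, 322, 319, 247, 317, 228, 100]
  symmetries := [
    (1751120,30,1,0), (1745688,30,1,0), (1742048,0,1,0)]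
  branches := [
    (94, [1, 1, 3, 1950880328, 2, 2, 2, 2, 1, 2, 2, 2, 1, 206477684, 2, 2, 206477684, 2, 2, 3, 2,
    6]),
    (108, [1, 1, 2, 2, 206477684, 2, 2, 206477684, 2, 2, 3, 1, 3, 1, 5]),
    (116, [205165940, 2, 2, 2361705077, 3, 2945229281, 205165940, 2, 2, 3, 3, 2945229281, 2, 3,
    205165940, 2, 2, 205165940, 2, 2, 3, 2, 104502684, 2, 2, 2, 2, 4]),
    (30, [104502684, 205165940, 2152207260, 4, 2356264670, 2, 2356264670, 2, 3, 1253032860,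
    3360166812, 0, 4, 607818948, 2, 1248968604, 2, 6, 307205266, 308753557, 0, 1224685025, 0, 3,
    1224491674, 2, 6, 2964263006, 1, 3, 2945229281, 2, 4, 206477684, 1950880328, 3, 2353533554, 2,
    2, 1224685025, 0, 3, 1224491674, 2, 5, 2964263006, 1, 3, 2945229281, 2, 6, 1, 1224685025,
    1227351598, 3, 1224685025, 4, 2964263006, 2361705077, 2, 2950820213, 2, 2950820213, 6, 1, 2,
    205165940, 2, 307205266, 308753557, 3, 3, 3, 1, 2, 104502684, 2, 607818948, 2, 3, 206477684, 2,
    2, 3, 6]),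
    (72, [1, 2, 2361705077, 205165940, 1227244188, 1224771038, 2, 3, 1227244188, 2, 4, 307205266,
    1248968417, 1253032673, 2, 3, 308753557, 1248968417, 2, 5, 2950734302, 2, 2, 2950734302, 2,
    2950734302, 2, 2950734302, 2, 4, 5, 0, 4, 2356286069, 205165940, 1248989998, 2, 3, 1248989998,
    2, 2, 307205266, 1248989998, 2, 308753557, 4, 4, 3, 4]),
    (103, [1, 2]),
    (112, [1, 104502684, 1227244188, 2, 3, 1227244188, 1224771038, 2, 3, 1227244188, 2, 1227244188,
    2, 4, 607818948, 1227244188, 2, 3, 1227244188, 2, 2, 5, 2950734302, 2, 2, 2, 2950734302, 2, 2,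
    2950734302, 2, 2, 2950734302, 2, 2, 4, 4, 0, 0, 607818948, 2, 4, 2, 4])]

def heptad17 : Certificate where
  core := [0, 7, 25, 138, 269, 275, 286]
  order :=
    [353, 193, 43, 97, 53, 113, 85, 75, 120, 224, 249, 44, 50, 208, 341, 233, 161, 127, 359, 255,
    216, 247, 363, 240, 369, 372, 84, 340, 105, 125, 76, 344, 254, 184, 308, 223, 191, 100, 299,
    251, 226, 212, 126, 108, 82, 246, 101, 164, 383, 176, 331, 109, 229, 181, 227, 115, 182, 213,
    356, 245, 102, 98, 107, 188, 52, 196, 119, 78, 124, 238, 358, 110, 118, 252, 374, 180, 380,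
    378, 289, 357, 237, 221, 360, 312, 116, 294, 355, 370, 63, 210, 321, 114, 99, 362, 228, 46,
    375, 231, 368, 236, 248, 244, 215, 250, 95, 220, 376, 242, 326, 58, 163, 361, 379, 292, 373,
    86, 60, 381, 322, 106, 209, 117, 178, 111, 377, 90, 354, 328, 204, 230, 364, 166, 183, 187,
    243, 165, 324, 352, 235, 207, 201, 169, 367, 253, 92, 172, 175, 198, 336, 225, 239, 219, 54,
    104, 112, 189, 122, 290, 309, 177, 241, 214, 296, 304, 123, 232, 366, 197, 195]
  symmetries := [
    (1750112,30,2,2), (1745688,0,1,0), (1743056,30,2,2)]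
  branches := [
    (85, [0, 2258697985, 1957675932, 2, 1, 4, 3347772104, 1, 3, 2421457349, 245432062, 2, 3,
    2320793932, 2, 0, 4, 1, 1, 7, 2258697985, 2256569089, 2158034689, 2155905793, 4, 2221528399,
    2260998728, 1958622033, 3, 3, 2158034689, 2221528459, 2260998728, 1958622033, 3, 7, 2258697985,
    2462325323, 2864978704, 3, 2256569089, 2158034689, 2155905793, 4, 2158034689, 5, 2258697985,
    2158034689, 1, 2155905793, 2, 5, 648085249, 1554054913, 2455769438, 4, 648085249, 2, 2,
    648085249, 2, 2, 2, 648085249, 1554054913, 3354062177, 4, 5, 3065910205, 2, 2258697985,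
    1967693953, 0, 3, 2158034689, 4, 2, 2, 1, 2258697985, 2, 2, 3, 8, 2252870216, 2421457228, 2,
    3348718465, 3352782721, 2422855048, 5, 1951267701, 1958622033, 2, 1, 6, 2454196811, 2856850192,
    2864978704, 2, 1, 5, 2421457349, 245432062, 2, 2460024574, 3348718465, 3, 4, 2543412028,
    245432062, 2, 2460024574, 2, 4, 2320793932, 2, 3352782721, 2020201864, 2322191752, 2322191813,
    4, 2320794053, 2, 7, 1, 2, 1, 1, 1, 2, 8, 2543412028, 2, 3348718465, 2542078984, 3, 2020201864,
    2743405576, 2, 3, 1, 3348718465, 3, 5, 2644075393, 1, 247732811, 2, 2, 3242469565, 335816550,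
    0, 2, 3, 2, 4, 3038245147, 3038234395, 2, 3, 3035718526, 2, 1240132961, 2, 2, 7, 1, 1148305226,
    2, 2, 2, 1148305226, 2, 2, 2, 3, 3, 2845401985, 2, 2, 2, 2, 2, 1857012341, 642257480,
    1548227144, 2768960305, 4, 3, 2370339121, 3, 2, 642257480, 1548227144, 3352793368, 4,
    2871534859, 3, 2, 2, 3, 9]),
    (95, [1152369564, 245431999, 3, 2856850332, 2, 2, 2831685237, 2, 2, 4, 3355223285, 1, 1,
    2851906805, 6, 1, 2650580213, 2, 3040847090, 2, 1, 4, 1, 2, 3036503359, 2, 1, 3, 1, 2648150296,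
    2, 1, 9]),
    (122, [1, 2, 1, 1, 4]),
    (132, [1])]

def heptad18 : Certificate where
  core := [0, 7, 25, 138, 141, 277, 286]
  order :=
    [249, 229, 366, 339, 294, 216, 75, 97, 227, 326, 184, 223, 374, 239, 233, 215, 235, 315, 193,
    120, 161, 107, 247, 111, 254, 112, 372, 378, 363, 50, 126, 76, 362, 124, 105, 183, 44, 43, 248,
    110, 224, 376, 230, 178, 307, 255, 83, 321, 383, 211, 369, 95, 113, 250, 208, 118, 253, 51,
    187, 198, 177, 179, 102, 163, 381, 292, 52, 176, 122, 225, 104, 360, 92, 379, 371, 236, 182,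
    238, 226, 86, 352, 164, 243, 328, 188, 180, 195, 242, 240, 127, 228, 60, 364, 220, 54, 117,
    251, 212, 100, 78, 63, 209, 324, 377, 58, 98, 380, 114, 252, 358, 331, 365, 368, 323, 119, 46,
    232, 106, 231, 191, 329, 296, 82, 335, 90, 99, 219, 354, 306, 312, 336, 367, 196, 304, 338,
    303, 322, 214, 289, 125, 245, 353, 290, 116, 291, 101, 241, 299, 355, 347, 246, 357, 332, 166,
    244, 300, 375, 370, 84, 361, 344, 123, 356, 115, 109, 359, 210, 297, 108]
  symmetries := []
  branches := [
    (36, [2356264520, 2, 2059672400, 2172719130, 4, 2822411336, 2, 2, 2562988880, 3, 3, 3280015304,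
    2, 2971665758, 2, 2, 2, 4, 1555022490, 1, 3, 1, 3, 2, 2159002266, 1252516803, 2, 1555022490, 3,
    334504868, 1555022490, 4, 2950734152, 2259665562, 1252516803, 2, 2, 2, 6, 2950734152, 1,
    3280015304, 3, 1, 1954579397, 2, 1223824894, 2, 2, 2, 3061803047, 3, 7, 2159002266, 334504868,
    2648744493, 1555022490, 3, 1555022490, 4, 1968661530, 1, 2259665562, 1, 649052826, 2, 2, 2, 8,
    3280015304, 2, 1, 3280015304, 3, 260116424, 2, 3280015304, 1235767557, 2, 6, 1, 1, 2374045640,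
    2, 1954579354, 6, 1, 1, 1, 3280015304, 5, 2474708936, 2, 1954579397, 2474709000, 3, 2374045704,
    2, 1149273029, 2, 2, 1, 3, 3061803047, 1, 4, 11]),
    (66, [3223667018, 3568245320, 2863602248, 3, 2, 2, 1224599041, 2, 4, 2845402101, 2, 2, 2,
    3351815085, 2, 2, 2648744493, 2, 2, 4, 3360166812, 2, 2, 2445845421, 2460992151, 4, 3351815085,
    1224599041, 3, 3349686042, 2, 2645042970, 2, 5, 2846369562, 3565192090, 3, 3569320705, 2, 2,
    3565192090, 4, 2877383930, 2, 2645042970, 3, 2, 3349686042, 1248968466, 2, 2, 1, 4, 3,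
    3022125437, 246399639, 2, 2460992151, 4, 1224599041, 2, 3036686103, 2, 9, 3179352072, 2, 2, 1,
    3179352072, 2, 4, 3360166812, 2, 2, 2, 2848498681, 2963596414, 3, 3368295063, 2, 2863645525, 3,
    4, 2963596414, 2, 2474709018, 2877362162, 3, 2, 2, 1, 5, 2353512011, 1, 1, 2838480538, 2, 1, 2,
    6, 1, 2963596414, 3, 2, 3064926155, 2, 2, 1, 2, 3064926155, 2, 2, 1, 5, 1, 2, 2963596414, 2, 3,
    1, 2, 2963596414, 1, 4, 1, 10]),
    (67, [2671009121, 1, 2, 3, 1, 1, 4, 1, 2, 1, 3368295045, 2, 2, 1, 2, 1, 7]),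
    (84, [3248689483, 3265785393, 1, 3, 1, 1, 2, 2645053722, 6, 3565194796, 3460829768, 3, 2,
    2460994839, 3, 2460994839, 0, 2, 2, 2, 2, 1, 5, 3137209729, 1, 2, 1, 1, 3, 4, 1, 1, 2, 2,
    2971665758, 2, 2, 2, 2, 1, 2, 8]),
    (91, [2838488620, 3460829768, 3, 2, 1, 3, 1235756826, 3073662305, 0, 2, 2, 3, 3, 2863648231, 1,
    5, 2661805438, 1, 1, 1, 5, 1, 1, 2, 3022125437, 2, 2, 2, 1, 1, 3, 7]),
    (115, [0, 2, 1266797810, 3, 2, 1266797810, 2, 2, 3, 3380727026, 1149272986, 3, 1266797810, 2,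
    3022125437, 1266797810, 2, 4, 2645042970, 4, 3075275083, 3380727026, 3, 3075275083, 2,
    2877410546, 6, 260164850, 2, 1, 2474757362, 1149272986, 4, 2645042970, 4, 260164850, 2, 1,
    2374094066, 2374094106, 2474757402, 7, 2864677633, 2, 2, 2, 1149272986, 2, 3, 1, 2, 1, 1, 1, 1,
    5, 1, 1, 1, 1, 10]),
    (119, [3223667018, 2, 1, 3, 1, 3065807998, 2, 2, 1, 4, 1, 1, 3223667018, 2, 2923257461, 2, 3,
    6, 3460829768, 2, 3223667018, 3, 2871470335, 2, 2, 2, 3, 1, 3, 2846369562, 3565192090, 3, 1, 3,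
    1, 2460992151, 2, 3349686042, 2648744493, 2, 3, 2, 3036686103, 2, 8]),
    (121, [1, 1, 3, 1, 3]),
    (129, [1, 2, 1, 1, 2838480538, 2, 4, 1, 3280063770, 2, 3, 2, 1, 1, 6]),
    (135, [1, 1, 1, 4, 1, 1, 1, 5]),
    (138, [1, 2]),
    (147, [2863645525, 2, 1, 3]),
    (155, [1]),
    (167, [1, 2, 1, 1, 1, 5])]

def heptad19 : Certificate where
  core := [0, 7, 25, 138, 141, 275, 284]
  order :=
    [43, 107, 95, 106, 53, 355, 111, 101, 104, 90, 78, 198, 116, 232, 225, 110, 105, 235, 166, 76,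
    357, 246, 75, 119, 216, 44, 243, 238, 50, 184, 85, 242, 161, 376, 97, 379, 230, 381, 191, 46,
    54, 228, 254, 229, 240, 100, 58, 247, 118, 363, 127, 253, 63, 321, 62, 190, 326, 252, 226, 164,
    236, 239, 122, 113, 86, 223, 176, 213, 181, 356, 248, 244, 182, 52, 358, 126, 212, 180, 102,
    125, 289, 108, 373, 372, 297, 196, 245, 341, 241, 352, 328, 319, 84, 370, 94, 294, 109, 375,
    290, 195, 322, 98, 334, 296, 115, 382, 114, 222, 336, 123, 231, 299, 215, 208, 227, 302, 378,
    314, 163, 209, 177, 329, 383, 224, 366, 178, 367, 183, 342, 361, 187, 325, 99, 117, 292, 351,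
    304, 309, 249, 233, 310, 360, 82, 193, 120, 346, 124, 324, 112, 353, 374, 219, 251, 255, 359,
    214, 362, 335, 293, 377, 354, 369, 210, 331, 250, 364, 368, 365, 303]
  symmetries := []
  branches := [
    (32, [2152206920, 3467625372, 1919151258, 1916441754, 4, 2059672338, 3327039878, 3662156700, 3,
    2172719048, 3662156700, 5, 3662156700, 3262234386, 4, 3662156700, 2856850332, 1, 3262234386, 1,
    9, 2059672338, 2172719048, 3, 2764315410, 3682668570, 3, 1919151258, 4, 1919151258, 2059672338,
    2172719048, 1916441754, 4, 1916441754, 3, 2172719048, 3682668570, 3, 2, 3139502408, 2,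
    1916441754, 7, 2059672338, 2172719048, 3, 2764315410, 3682668570, 3, 3, 3327039878, 2, 2, 2,
    2172719048, 3682668570, 3, 2, 3139502408, 2, 5, 2172719048, 3682668570, 3, 3641588074, 2, 3,
    3682668570, 2877362202, 1, 5, 3057975339, 3179352090, 2, 3179352090, 4, 1, 1240132961, 2,
    1918140604, 4, 1, 2831685237, 2, 1240132961, 2, 1918140604, 1, 7, 3234534699, 1, 2972792079, 2,
    2972792079, 3, 1260333451, 2, 2972792079, 6, 1, 2, 3280015386, 2, 2, 3280015386, 3139502408, 2,
    2, 3, 11]),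
    (38, [3467625372, 3347772104, 3478635159, 2844455624, 2745730455, 2441778588, 2, 2844431732, 2,
    3, 7, 3467625372, 2745730455, 3051446049, 2, 4, 3478635159, 3467625372, 2821013834, 2, 3, 2,
    3467625372, 2, 2, 3, 1919538364, 1767359127, 2, 2, 1, 4, 2421166743, 2, 2, 2072104218, 2, 2, 3,
    2745730455, 2, 1, 2745730455, 2, 10, 2474708936, 3368294987, 3, 3325728134, 2, 2, 3,
    2658254411, 3325728134, 2, 3325728134, 2, 3, 3, 2474708936, 3368294987, 3, 2, 3368294987, 2,
    3325728134, 2, 2, 3, 1, 6, 2246765921, 1138843531, 2, 2, 2, 1944389161, 2969996739, 1, 1, 7,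
    3064265113, 3653877643, 3, 3064265113, 1, 4, 2969996739, 1, 1, 2, 3, 2146102625, 2, 1, 2, 1, 2,
    8, 2821013834, 2, 2, 2, 2, 3179352008, 2, 2, 2974534083, 3, 3, 3075981975, 1919538364, 1, 1, 5,
    1, 1263430083, 3, 1263430083, 3, 3075981975, 1, 3, 1919538364, 1, 2, 1, 2, 7, 2850237744,
    1966288297, 1820283787, 1051706010, 2836402587, 3, 2, 5, 2836402587, 1820283787, 1, 5, 1, 2, 2,
    2974534083, 2, 1, 1, 6, 3555388769, 2, 2850745697, 2, 3, 2776747272, 1, 3627741938, 3678416401,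
    3, 1139469665, 3, 3280063752, 4, 1, 1, 3280063752, 6, 1, 2, 2575420698, 2, 1, 3, 1, 1,
    3555388769, 2, 3, 1, 8, 1, 2974534083, 3, 1, 2974534083, 4, 1, 2, 1, 3, 1, 2, 1, 1, 3, 12]),
    (59, [3051446049, 2, 2474757402, 3064265113, 2, 2971738567, 4, 2072104218, 2, 1, 5, 3064265113,
    3653877643, 3, 1, 3280063770, 2, 3280063770, 5, 3051446049, 2, 3380727066, 2575420698, 1, 5,
    2575420680, 2776747272, 1, 1, 1, 6, 1, 2, 1, 2, 1, 2, 1, 2, 9]),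
    (68, [3347772104, 1919151292, 3, 1919151292, 2460992272, 2, 2, 1263429907, 2, 1, 6, 1665728394,
    1233431946, 3, 1233431946, 3, 1233431946, 3, 1665728394, 1262032327, 256442149, 4, 1665728394,
    2, 2, 1262032327, 4, 1, 1262032327, 2146102625, 2, 5, 2970190215, 1, 3, 1, 2970190215, 1, 1, 1,
    9, 2319094920, 2823723341, 0, 3, 3, 3650732679, 2, 3, 2823723341, 2, 2, 2, 3650732679, 2, 4, 1,
    2850745697, 2, 2, 3, 3, 1, 2, 3325341122, 1, 3, 0, 2, 2, 2, 1, 3, 4, 3325341122, 1, 1, 4,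
    3179400456, 2, 1, 1, 1, 5, 2974340487, 2, 1, 1, 2, 10]),
    (80, [3347772104, 2474708936, 2120478089, 2, 3368294987, 4, 2, 1, 4, 2474708936, 3368294987, 3,
    2, 2658254411, 2, 3368294987, 2, 2, 4, 3368294987, 2, 2658254411, 2, 3, 1966288297, 2, 1, 3, 1,
    4, 2658254411, 2, 2, 2974533907, 2, 2974533907, 3, 2658254411, 2, 2, 2, 7]),
    (84, [1655685765, 1138262980, 3, 3656393668, 3, 3064265113, 1651621451, 2, 2, 2, 4, 2971738567,
    2877410568, 2858422762, 2971544971, 5, 1, 2, 2877410546, 2, 2, 2146102625, 2, 2, 6, 1655685765,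
    2971738567, 2844431732, 2, 4, 1, 2971738567, 4, 2246765921, 1, 2971738567, 4, 3064265113, 2,
    2971738567, 1, 2146102625, 2, 7, 1944389019, 1944389161, 2, 3, 1233842888, 2971544971, 3,
    1266797832, 2, 2858422762, 3, 2926150085, 2, 2858422762, 2971544971, 6, 1, 1, 1, 1651621451, 2,
    2, 2, 2, 7, 3064265113, 1062202777, 2, 2, 3, 1944389019, 1, 2877410568, 2858422762, 2971544971,
    1, 7, 3046728613, 2, 1, 1, 4, 3046728613, 1, 3, 1651621451, 2, 2, 1944389161, 2, 3, 2, 1, 10]),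
    (91, [2319094920, 3463561040, 2, 3, 2844431732, 2, 2, 3, 3463561040, 3179352008, 3, 2,
    3179352008, 2, 2, 3, 2172767474, 2, 2, 1, 3, 1, 5, 2972792263, 2, 3179352008, 2, 2, 2, 3,
    3555388769, 2, 2850745697, 2, 3, 3280063752, 2, 1, 3280063752, 4, 1, 1, 3, 2850745697, 2, 1, 3,
    1, 6, 2972792263, 2, 2972792263, 3, 1, 2, 6]),
    (95, [3678413707, 2, 2, 1, 1, 3, 1, 4, 1, 2, 1, 1, 2120865221, 2, 5, 3678413707, 2, 1, 0, 2, 2,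
    2, 2, 4, 1, 1, 6]),
    (98, [1, 1, 3237679659, 1, 3, 1, 3, 3237679659, 2, 1, 3, 1, 6]),
    (111, [1, 2, 2974340431, 1, 3, 3, 1, 1, 3, 2120865221, 2, 1, 2974340431, 3, 2, 2844455624, 2,
    1234786636, 3, 1, 2, 3, 6]),
    (118, [3179400456, 2, 3280063752, 3179400456, 3, 3280063752, 3179400456, 5, 3682716936, 2, 1,
    3, 1, 2850745697, 2, 2, 3, 2836402587, 2, 2, 1, 3, 3678416401, 2, 3555388769, 2, 2, 3, 1, 1, 1,
    1, 5, 1, 1, 3, 8]),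
    (120, [1, 1, 3, 1, 3]),
    (130, [2972985739, 2, 1, 2, 1, 1, 3, 3064265259, 2, 1, 3, 5]),
    (134, [1, 2]),
    (137, [1, 2, 2]),
    (158, [1, 2]),
    (168, [1, 2])]

def heptad20 : Certificate where
  core := [0, 7, 25, 30, 138, 149, 268]
  order :=
    [368, 352, 376, 226, 50, 355, 306, 108, 339, 178, 166, 379, 198, 77, 216, 208, 361, 235, 369,
    255, 358, 45, 113, 114, 75, 249, 307, 344, 191, 231, 97, 246, 377, 322, 84, 357, 294, 375, 184,
    241, 232, 229, 52, 116, 342, 111, 314, 237, 336, 290, 304, 381, 242, 223, 230, 310, 312, 122,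
    239, 360, 243, 101, 315, 362, 127, 254, 346, 291, 343, 305, 51, 112, 110, 373, 193, 224, 82,
    179, 337, 351, 117, 311, 297, 123, 119, 299, 365, 201, 169, 205, 253, 363, 347, 374, 120, 289,
    188, 308, 248, 219, 164, 359, 98, 370, 236, 182, 353, 176, 225, 227, 115, 367, 383, 247, 252,
    317, 321, 125, 293, 196, 240, 319, 371, 107, 335, 382, 303, 102, 380, 118, 250, 175, 104, 251,
    43, 331, 173, 99, 238, 211, 163, 378, 228, 207, 349, 187, 124, 220, 354, 372, 109, 325, 326,
    195, 233, 100, 323, 329, 244, 340, 338, 105, 161, 356, 106, 366, 83, 210, 214]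
  symmetries := [
    (1751120,30,1,0)]
  branches := [
    (67, [1, 2, 1963221086, 2, 1963221086, 2831663703, 3, 3, 2, 1, 1, 5]),
    (69, [3769615260, 2, 1145896791, 2975275592, 2, 4, 2975275592, 2, 2, 3351901055, 2, 2,
    1964640383, 2, 2, 1, 6, 3769615260, 2, 2, 2964284513, 3779646807, 3, 2456949365, 2, 3057910689,
    3, 3664909102, 2, 3, 3, 1, 2, 3351900914, 2, 2, 3057910689, 3, 2, 6]),
    (95, [2252848715, 2152185419, 2751211514, 2776744835, 2, 3, 2, 1963220939, 2, 3776851323, 2, 2,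
    3670303871, 2, 2, 1963220939, 3, 7, 1951203205, 3657181022, 2, 3, 2521797746, 2, 1956968865, 3,
    3662135194, 3, 2, 2521797746, 2, 0, 2, 2, 3, 2, 1, 1, 6, 1951203205, 2831663749, 2, 2831663749,
    4, 2964284513, 2, 2, 3776851323, 2, 2, 3234513211, 2, 2, 2965639157, 3, 7]),
    (115, [239582792, 2, 2, 2, 1, 239582792, 2, 2, 4, 239582792, 2776744835, 3, 2859799056, 3, 2,
    1, 239582792, 2, 2, 4, 1, 239582792, 2, 2, 3, 1, 2, 5]),
    (126, [1, 3657772479, 1, 4, 1, 3657772479, 3, 3, 1, 1, 2, 3, 3]),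
    (140, [1, 2]),
    (162, [2454175304, 3347686091, 2751211514, 2, 105878642, 2, 2, 3, 2542379870, 2, 2, 5,
    3769615260, 2856828690, 3, 105878642, 2, 2721683798, 2, 3, 105878642, 2, 2, 105878642, 2, 2, 5,
    2856828690, 3657181022, 2, 3, 3, 3769615260, 2856828690, 3, 3347686238, 2, 2, 2844369758, 2, 2,
    4, 2856828690, 2, 5]),
    (85, [1, 1, 3]),
    (136, [1, 2, 2])]

def heptad21 : Certificate where
  core := [0, 7, 25, 138, 150, 275, 284]
  order :=
    [205, 244, 107, 326, 359, 333, 322, 75, 204, 362, 225, 358, 106, 43, 373, 53, 294, 369, 44,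
    357, 247, 328, 363, 97, 101, 341, 367, 331, 84, 112, 50, 365, 184, 95, 240, 375, 161, 383, 237,
    126, 239, 191, 45, 114, 173, 85, 254, 354, 119, 356, 301, 201, 232, 248, 165, 169, 172, 175,
    196, 189, 289, 109, 105, 319, 102, 379, 113, 221, 197, 241, 77, 216, 321, 290, 296, 329, 223,
    324, 231, 226, 230, 123, 251, 299, 302, 242, 193, 124, 352, 120, 252, 111, 314, 90, 334, 233,
    245, 381, 376, 229, 46, 99, 360, 377, 195, 58, 76, 336, 63, 115, 127, 236, 116, 209, 100, 78,
    118, 346, 62, 164, 353, 235, 227, 253, 219, 176, 208, 249, 104, 335, 255, 181, 224, 52, 361,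
    325, 250, 117, 163, 364, 382, 372, 125, 297, 213, 292, 238, 243, 366, 304, 378, 309, 82, 177,
    228, 108, 94, 207, 368, 351, 374, 187, 122, 110, 293, 303, 355, 370, 98]
  symmetries := []
  branches := [
    (36, [2152206920, 2758917854, 3664887368, 3, 3662156700, 3, 607819142, 2, 3662134856, 3,
    3662156700, 3, 2856850332, 4, 2758917854, 2, 3662156700, 3, 2, 2856850332, 3831926093, 2, 2,
    2643104904, 3, 2, 6, 649053047, 3756328459, 3, 2, 649053047, 2, 2, 649053047, 2369449483, 3, 2,
    649053047, 1152369224, 3, 2, 1963263944, 6, 3071869392, 1, 2836281706, 2, 3555267720, 2, 3,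
    2221528252, 5, 2858301865, 2, 2826916777, 3663608233, 3, 2, 2455648389, 2, 4, 3237558659, 2,
    3756715361, 2826742027, 4, 2836281706, 2, 3050865517, 2, 3555267720, 2, 4, 6, 649053047, 2, 2,
    649053047, 2, 2, 649053047, 2, 2, 4, 3237558659, 2, 3756715361, 3, 2836281706, 2, 3555267720,
    2, 3, 4, 1, 1240132961, 1139348616, 2, 2, 3, 2120864956, 2, 4, 1, 2, 1, 1, 3, 3, 3756715361,
    3050865517, 2, 1139348616, 2945105541, 2, 3, 2927964397, 4, 1, 4, 1, 3057975339, 3776915851, 3,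
    2945105541, 2, 4, 8]),
    (41, [2978052678, 3856703969, 2, 2, 2542441677, 2, 3, 1, 2, 2, 3851236641, 1837798692,
    2542441677, 2, 2542441677, 2, 4, 1, 4, 1, 1548195200, 2, 2, 3, 3454099227, 2, 1963191432, 2, 3,
    1, 3, 1, 8, 145736267, 2, 2, 145736267, 2, 2, 3137373515, 4, 2858301865, 2850624717, 3,
    2455648389, 2548634829, 3, 2122273705, 4, 1920946893, 1, 3, 1966288077, 2, 1843991889, 2, 3, 5,
    3071869392, 2122612363, 3, 2977485510, 1, 3, 3071869392, 2, 1, 2, 1, 1, 3779625295, 4, 6,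
    2747907792, 1240011981, 2, 2, 3754562396, 2, 2, 4, 3866141598, 2827129066, 2826742027, 1, 5,
    3878724045, 2, 3452550942, 2, 2, 3878724045, 3, 3, 3, 2122273705, 1920946893, 1944389019,
    2122612363, 3, 4, 3866141598, 1266575012, 1, 4, 2749456077, 2, 1, 3, 2977485510, 1, 5,
    3452550942, 2749456077, 3866141598, 2858422762, 5, 3866141598, 2, 3452550942, 3866141598, 3, 2,
    2, 4, 2827129066, 2, 1, 2, 11]),
    (60, [3347772104, 3856703969, 3756715591, 3, 2, 3732663364, 3653805124, 2, 3, 2, 3, 2721748301,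
    2, 2, 2, 2, 4, 145736267, 3756715591, 3, 2, 145736267, 2, 2, 145736267, 2347429383, 3, 2, 4,
    2827303876, 3330620356, 1, 4, 1966288077, 2, 3266298640, 2, 1843991889, 2, 4, 4, 2850624717,
    2145981645, 2, 2548634829, 4, 3555267789, 2, 2, 3266298640, 2, 3855881556, 2977703148, 4, 1, 5,
    1, 1, 2, 6]),
    (63, [2927795143, 1, 1548195200, 2, 2, 3, 3778614727, 1, 3, 3476119379, 2, 2, 1837798692, 2,
    1963191432, 2, 4, 1963191432, 2, 4, 1837798692, 2, 2, 5, 3467625335, 2643129032, 3, 3662059892,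
    2, 3, 2826693700, 346428733, 2, 3, 3642843144, 1139469665, 3, 3, 3731897074, 2, 2831811275, 2,
    5, 2827303876, 1, 3, 3237558659, 2, 3642843144, 2, 3733098823, 2322610913, 3, 2, 3, 5,
    3642843144, 1, 1, 4, 2827303876, 1944389019, 2, 3, 1966409057, 2, 2, 2927964484, 1, 2, 4,
    3778614727, 3656393607, 3, 1651621831, 2, 1651621831, 2, 3, 1966409057, 2858422762, 4,
    2850745697, 2, 4, 2525313988, 2, 1, 2, 9]),
    (83, [3650708549, 2, 2, 3650708549, 2, 2, 3733050376, 2, 4, 1, 2, 2964265547, 2, 2, 1963191432,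
    2, 2, 2, 1, 2, 1, 7]),
    (100, [2361686430, 2462349726, 3, 3050792937, 2, 1, 1963191432, 2, 2839498994, 3, 5, 1, 2, 1,
    1, 1, 4, 4]),
    (108, [1944389161, 3330397192, 3, 3330397192, 1, 4, 3641294853, 2, 1241802437, 2, 2,
    2977703234, 4, 3380727195, 3675849355, 2, 3, 2822435701, 2, 3, 1266411018, 0, 2, 2, 3,
    1654718402, 2, 1654718402, 2, 3, 3641294853, 2858422762, 4, 3, 1233842888, 3733050376, 3,
    1654718402, 2, 1654718402, 2, 3, 3641294853, 3, 3, 3733050376, 1654718402, 2, 2, 2, 3, 1, 6,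
    3750425288, 2, 2, 3750425288, 2, 2, 3733050376, 2, 4, 1, 1, 1, 3, 7]),
    (119, [2146102625, 2, 2850745697, 2, 1, 2, 1, 5, 2643104973, 1, 2, 2945105541, 2, 4,
    3380727195, 2, 3627742069, 2, 2, 3, 1, 1, 2, 6]),
    (125, [1139469665, 2827255435, 3, 2246765921, 2827255435, 1, 241176926, 2, 2, 6, 3039371472,
    1944389019, 3733225099, 1, 4, 2977703148, 2, 2977703148, 1, 1, 7, 1944389019, 1, 1, 1, 5,
    1944389161, 2, 1, 2, 1, 3, 1, 1, 8]),
    (133, [1, 1, 3, 1, 1, 2, 2964265547, 2, 1, 1, 7]),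
    (138, [1233842888, 2, 2858422762, 3, 1, 3, 1233842888, 2, 2858422762, 3, 1, 1, 1, 6]),
    (143, [3750425288, 2, 2146102625, 2, 3, 3663729130, 2, 3]),
    (161, [1, 2, 1, 2, 1, 4]),
    (164, [1]),
    (165, [1])]

def heptad22 : Certificate where
  core := [0, 7, 25, 138, 141, 276, 287]
  order :=
    [43, 75, 99, 105, 106, 111, 123, 107, 235, 363, 53, 85, 101, 113, 116, 119, 125, 117, 245, 373,
    102, 230, 358, 166, 198, 226, 228, 231, 238, 246, 108, 236, 364, 44, 76, 100, 104, 109, 110,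
    124, 114, 242, 370, 50, 82, 98, 112, 115, 118, 122, 120, 248, 376, 184, 216, 232, 240, 249,
    250, 252, 161, 193, 224, 227, 229, 233, 241, 97, 225, 353, 51, 179, 307, 163, 177, 178, 183,
    187, 243, 83, 211, 339, 195, 209, 210, 215, 219, 46, 328, 331, 334, 346, 367, 375, 54, 58, 60,
    126, 62, 190, 239, 247, 251, 293, 297, 305, 323, 253, 254, 127, 255, 289, 208, 213, 214, 321,
    352, 355, 357, 361, 369, 294, 326, 354, 356, 359, 366, 374, 312, 344, 360, 368, 377, 378, 380,
    78, 86, 90, 92, 94, 222, 164, 176, 181, 182, 188, 244, 290, 296, 299, 302, 314, 362, 196, 220,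
    322, 379, 381, 382, 291, 325, 329, 337, 300, 332, 365, 306, 338, 371]
  symmetries := []
  branches := [
    (60, [2456927816, 2152207260, 2859581202, 4, 2456927816, 3127283081, 2859581202, 3, 3127283081,
    2, 2859581202, 4, 3127283081, 2, 2, 2859581202, 5, 3953469852, 1, 2859581202, 4, 1, 3,
    2859581202, 2, 2859581202, 3360166812, 3, 2859581202, 2456927816, 2154938078, 2, 2, 3, 8,
    2963596357, 3626320066, 3682668570, 4, 2963596357, 3127283081, 2, 3682668570, 4, 3629029570,
    2877362202, 3, 2877362202, 5, 2421069899, 2, 3351814859, 3127283081, 2, 3, 2823723202,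
    3351815006, 2, 3, 2877362202, 5, 3682668570, 2877362202, 5, 3351814859, 2, 3351814859,
    3127283081, 2, 2, 3127283081, 2, 2, 4, 3351814859, 2, 3754465690, 3272077995, 2, 3, 3, 1, 5,
    3931022106, 2, 3931022106, 1, 1, 5, 1, 2, 1, 2764315410, 2, 2764315410, 2, 3, 4, 3368295063, 2,
    1, 2, 2963402818, 2, 2963402818, 2, 3, 2, 9]),
    (103, [1, 1, 1, 1, 5, 3931022146, 2360331688, 2, 2964262920, 2, 2, 3, 1, 4, 3640332613, 1,
    2835004843, 1, 2745566599, 1, 7, 2360331688, 2, 1, 3, 3280063730, 3553926494, 3280015368, 2, 2,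
    1956904363, 2, 3, 4, 1, 3869765032, 2, 1, 9]),
    (104, [1, 1, 1, 4, 3783380232, 2647171787, 2, 2, 2647171787, 2, 2, 3, 1, 4, 2474757402,
    3038051681, 3059286945, 2, 2, 2575420680, 2, 3, 3380727066, 5, 2647171787, 2, 2, 1, 1, 4, 1, 2,
    2, 2672815495, 2, 2, 3682716914, 1566035223, 3, 1051687191, 2, 3, 1, 2, 9]),
    (105, [3325727816, 2, 2, 2457124193, 2859777520, 3, 1, 4, 1, 3, 3665083888, 2374094106, 3,
    3678416371, 2, 3665083888, 3, 1, 3665083888, 3750401436, 2, 1565519239, 3, 2, 1, 7, 3931414594,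
    2, 2, 2, 2, 2859777520, 2, 1, 1, 7]),
    (111, [2255601227, 3750401436, 2, 1956708181, 4, 2255601227, 2621257094, 1956708181, 3,
    2621257094, 2, 2621257094, 2, 1956708181, 5, 3783380250, 2, 1956708181, 5, 331988772,
    3678413689, 3, 3783380250, 3, 2, 1956708231, 1, 1956708181, 2255601227, 0, 2, 3, 8, 2963596357,
    3626320066, 3, 2963596357, 2621257094, 2, 3, 3629029570, 2, 2963596357, 2, 5, 2421069899, 2,
    2154937931, 2621257094, 2, 3, 2823723202, 2456927969, 2859581338, 3, 3, 4, 3368294987,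
    2621257094, 2, 3, 3951727918, 3176645425, 2, 3, 3, 4, 2154937931, 3664887706, 3, 2154937931,
    2621257094, 2, 3664887706, 3, 3664887706, 4, 3664887706, 2859581338, 5, 3783380250, 2374094066,
    1, 3, 3, 1, 2834416213, 3, 1, 1, 2621257094, 2, 2, 2, 4, 1, 2474708936, 2, 2877362184, 2, 3,
    3756207408, 2, 1, 2877362184, 2, 4, 1, 4, 2963402818, 2, 2963402818, 2, 2963402818, 2, 4, 2,
    10]),
    (121, [3626320066, 3629029570, 2, 3629029570, 2, 3349234636, 2, 2, 5, 1, 2, 3, 1, 2963596357,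
    3741181378, 2, 3, 1, 3, 1, 2359812802, 2, 2, 3, 4, 3075984663, 2, 2, 1, 2, 5]),
    (141, [1, 1, 2461637513, 2, 2, 2839082434, 2, 2, 5, 1, 3248689540, 2877410586, 3, 2474757362,
    1, 3, 5, 1, 1, 3367607177, 2, 2, 2, 4, 3682716954, 2, 1, 3248689540, 2877410586, 3, 1, 1, 8]),
    (142, [1, 1, 3769099145, 2, 2, 2923085445, 2, 2, 3, 3, 2923085445, 2, 2, 2, 2, 2963402818, 2,
    3769572175, 3, 2, 5]),
    (145, [1, 2673331479, 3075984663, 3881291031, 2, 4, 1, 1, 2, 1, 1, 2, 7]),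
    (147, [1, 2, 2964262920, 2, 2, 2, 2964284421, 2, 2, 2, 4]),
    (148, [1, 3693332106, 2, 2, 2, 2, 3, 2]),
    (149, [3740407237, 2, 2, 3769572175, 2, 3]),
    (150, [1, 2, 2]),
    (159, [3327039563, 2, 2, 1, 1, 4, 2, 1, 3]),
    (163, [2964284421, 2, 2964284421, 2, 2964284421, 2, 4, 2])]

def heptad23 : Certificate where
  core := [0, 7, 25, 138, 148, 268, 274]
  order :=
    [43, 75, 99, 105, 106, 111, 123, 107, 235, 363, 53, 85, 101, 113, 116, 119, 125, 117, 245, 373,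
    102, 230, 358, 166, 198, 226, 228, 231, 238, 246, 120, 248, 376, 184, 216, 232, 240, 249, 250,
    252, 126, 254, 382, 62, 94, 110, 118, 122, 124, 127, 161, 193, 224, 227, 229, 233, 241, 97,
    225, 353, 63, 191, 319, 175, 183, 187, 189, 190, 255, 95, 223, 351, 335, 343, 347, 349, 350,
    383, 173, 205, 236, 239, 253, 109, 237, 365, 179, 211, 242, 247, 251, 115, 243, 371, 289, 321,
    352, 355, 357, 361, 369, 294, 326, 354, 356, 359, 366, 374, 312, 344, 360, 368, 377, 378, 380,
    45, 293, 297, 303, 317, 46, 54, 58, 60, 318, 51, 291, 305, 311, 315, 77, 197, 201, 207, 221,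
    78, 86, 90, 92, 222, 83, 195, 209, 215, 219, 299, 331, 362, 367, 379, 309, 341, 372, 375, 381,
    98, 100, 104, 112, 163, 165, 169, 177, 323, 325, 329, 337, 108, 114]
  symmetries := [
    (1751176,0,2,0), (1754704,0,2,0), (1751120,0,1,0), (1745688,0,1,0), (1745632,0,2,0),
    (1742104,0,2,0), (1742048,0,1,0)]
  branches := [
    (118, [3942508188, 3765572506, 3, 2, 1114060186, 2, 2, 2356286177, 3, 1, 4, 1114060186, 2,
    3942400666, 3, 1, 3, 3743546849, 2, 3942400666, 3731894293, 2, 3, 3, 3731894293, 1, 3, 1, 3, 4,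
    2964262898, 1, 3, 2, 1, 1, 2, 6]),
    (126, [1, 1, 3]),
    (86, [607990977, 3945153180, 1111307676, 4, 3939540528, 3769572142, 3762798490, 4, 1114060186,
    610743445, 3, 4, 3426563265, 3945153180, 3966898990, 2, 4, 3939540528, 3769572142, 3762798490,
    4, 3966877409, 2, 3429315733, 3, 4, 3945153180, 3769572142, 3762798490, 3939540528, 2, 5,
    3429315733, 0, 2, 2, 2, 1, 4, 104674713, 2, 2, 3426563265, 2, 0, 2, 3, 2, 2, 1, 8, 3942508188,
    3765572506, 3, 3942508188, 3765572506, 1, 4, 3769572142, 3942508188, 2, 5, 3429315733,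
    2259042094, 2, 2, 2, 1, 4, 3964124894, 2165322010, 3, 3964124894, 2, 3, 2, 2, 1, 6]),
    (101, [3429315733, 1, 3])]

def heptad24 : Certificate where
  core := [0, 7, 25, 139, 149, 269, 286]
  order :=
    [324, 252, 46, 82, 322, 229, 51, 224, 337, 218, 247, 52, 240, 114, 208, 184, 161, 340, 191,
    290, 234, 362, 223, 216, 239, 246, 100, 231, 370, 194, 238, 243, 125, 162, 368, 204, 99, 123,
    176, 249, 179, 182, 244, 241, 97, 227, 336, 113, 383, 101, 186, 98, 50, 376, 105, 110, 178,
    356, 248, 306, 164, 253, 242, 360, 230, 211, 83, 168, 174, 196, 236, 118, 378, 367, 116, 117,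
    328, 193, 210, 188, 44, 172, 308, 166, 220, 206, 228, 42, 369, 120, 106, 315, 74, 232, 289,
    226, 86, 366, 109, 304, 214, 107, 307, 112, 84, 92, 95, 347, 126, 305, 233, 78, 90, 374, 115,
    54, 251, 58, 379, 354, 357, 237, 60, 122, 254, 343, 200, 338, 352, 111, 330, 63, 296, 358, 124,
    127, 326, 108, 255, 380, 355, 339, 104, 119, 321, 225, 298, 373, 375, 250, 363, 102, 76, 377,
    364, 359, 371, 323, 312, 291, 294, 353, 361, 311, 198, 381, 344, 292, 372]
  symmetries := [
    (1742048,0,1,0)]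
  branches := [
    (19, [3427767498, 1, 1, 4, 1, 1, 1, 1, 6]),
    (83, [2951013889, 1, 2965639112, 4, 3427767498, 205101434, 0, 3, 3945153040, 3, 205101434, 2,
    2, 3967845121, 4, 3, 2361705032, 0, 2, 2, 3, 208241022, 2, 2253193157, 4, 3, 1, 609195210, 2,
    2, 2, 3, 1, 1, 3, 3946378768, 2, 1, 4, 1, 3967673086, 1112511759, 2, 2, 4, 1, 3, 3427767498,
    3946378768, 1, 4, 3967673086, 3946378768, 1963221193, 4, 1, 4, 7]),
    (109, [2965660619, 2, 1, 3, 1, 2, 1, 1, 3, 4067737018, 2, 2, 1, 3, 3262430650, 2, 1, 1, 1, 2,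
    9]),
    (115, [1, 2, 2, 2951702014, 3967845121, 2, 3, 2, 2, 1, 4]),
    (122, [1, 2, 205101434, 2, 2, 2, 2, 1, 4, 1, 1, 3879398680, 3, 4]),
    (91, [2965660619, 2, 2, 1, 1, 3879742747, 2, 3, 4]),
    (158, [2951702014, 3967845121, 3737633477, 208241022, 2, 2164891973, 4, 3, 3645163162, 2, 2, 2,
    4, 2356264523, 3765550864, 1, 4, 2353920766, 3737654782, 3, 1, 2, 3, 3427767498, 2, 2, 2, 5]),
    (94, [1, 1, 2, 3, 2]),
    (131, [1, 1, 1, 2, 1, 1, 3, 5])]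

def heptad25 : Certificate where
  core := [0, 7, 25, 138, 141, 148, 274]
  order :=
    [43, 75, 99, 105, 106, 111, 123, 107, 235, 363, 53, 85, 101, 113, 116, 119, 125, 117, 245, 373,
    102, 230, 358, 166, 198, 226, 228, 231, 238, 246, 108, 236, 364, 44, 76, 100, 104, 109, 110,
    124, 120, 248, 376, 184, 216, 232, 240, 249, 250, 252, 126, 254, 382, 318, 350, 366, 374, 378,
    380, 383, 161, 193, 224, 227, 229, 233, 241, 97, 225, 353, 179, 211, 242, 247, 251, 115, 243,
    371, 319, 351, 367, 375, 379, 381, 127, 255, 46, 54, 58, 60, 63, 62, 190, 78, 86, 90, 92, 95,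
    94, 222, 289, 321, 352, 355, 357, 361, 369, 291, 293, 294, 303, 311, 359, 297, 305, 312, 315,
    317, 377, 325, 329, 332, 335, 349, 365, 51, 163, 177, 122, 292, 296, 302, 183, 187, 83, 195,
    209, 215, 219, 114, 316, 300, 191, 223, 239, 253, 324, 328, 334, 348, 323, 337, 343, 347, 354,
    356, 98, 112, 118, 360, 368, 299, 331, 362, 309, 341, 372, 326, 344]
  symmetries := [
    (1742048,0,1,0)]
  branches := [
    (107, [4071586204, 3676265796, 2, 1, 1, 5, 1, 2, 1, 3266279836, 4, 1, 1, 1, 4, 1, 1, 2, 2, 1,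
    2, 1, 2, 8]),
    (108, [3127283097, 2, 2, 2345181896, 2, 3776536520, 2, 2870959454, 2, 4, 1, 2345181896, 2,
    3776536520, 2, 3, 2, 5, 3966898910, 2, 3966898910, 3776536520, 2, 3, 3, 2, 1, 3280063752,
    4085370120, 1, 5, 3776929092, 2870959428, 1, 3780012483, 2, 5, 1, 1, 1, 2, 8]),
    (109, [3629029788, 2, 2165923784, 2, 3, 3629029788, 3942508188, 3, 3769572142, 2557591430, 2,
    2, 4, 3629029788, 2, 3362897483, 2, 3, 1, 1, 6, 3769572142, 1013396665, 2, 3362897483, 2, 3,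
    3675873348, 2, 2, 3629029788, 2, 2, 5, 1013396665, 3945260698, 3, 1013396665, 2, 3349234609, 2,
    2, 4, 2165923784, 3945260698, 3, 3741073966, 2, 2, 3, 1918140869, 2870566856, 2, 3, 2870566938,
    2, 3, 2, 4, 3682668570, 2, 2, 2, 3776929118, 2, 2, 3, 2758918044, 3778614543, 3, 1, 3, 1, 3,
    3629029788, 3762819996, 3, 2877362202, 3939497518, 4, 1, 2, 3741073966, 1, 1, 4, 1, 5,
    2950820321, 2, 2950820321, 2, 3, 1918140869, 3629029788, 2, 2, 3, 2, 3, 1, 9]),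
    (126, [1, 1, 1, 4, 2]),
    (129, [1, 1, 3, 1, 1, 3, 1, 2, 3783380210, 3172556826, 2, 3, 2, 3764392257, 2858422593, 2, 3,
    1, 4, 3783380210, 2, 2, 2, 1, 2, 3783380210, 2, 2, 8]),
    (132, [1, 1, 2, 1, 4]),
    (161, [3762819996, 2950820321, 2, 3, 3368295063, 2, 2950820321, 2, 2950820321, 3368295063,
    3762819996, 2172719130, 2562988848, 2, 3, 2218431642, 4, 1918140869, 2, 8, 3127283097, 2, 2, 1,
    2621257116, 2, 3362897601, 2, 2, 3, 2445845316, 2, 2, 2, 5, 3966898910, 2, 2, 3966898910, 2,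
    2621257116, 2, 2, 3, 3, 1, 2, 1, 6]),
    (60, [3127283097, 2, 2, 2054274834, 2557591314, 3, 1, 3, 1, 2, 2621257116, 2, 2, 2, 2621257116,
    2, 2, 2, 1, 2, 1, 2, 2621257116, 2, 2557591314, 2, 3, 2054274834, 2, 2, 10]),
    (70, [3127283097, 3942508188, 3, 3127110960, 2, 2, 3, 2723059908, 2445845192, 3, 3942508188,
    3829216449, 2, 4, 3939540528, 2, 3939540528, 2, 3, 3, 3942508188, 4085321672, 2648916525, 2, 3,
    2, 1, 2621084973, 2, 2, 5, 1, 1, 2621257116, 2, 2, 7]),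
    (100, [3127283097, 2, 2, 2445845192, 2870566980, 3, 1, 3, 1, 2, 2621257116, 2, 2, 2,
    2621257116, 2, 2, 2, 1, 2, 1, 2, 2621257116, 2, 2870566980, 2, 3, 2445845192, 2, 2, 10]),
    (125, [1]),
    (141, [1])]

def heptad26 : Certificate where
  core := [0, 7, 25, 138, 141, 150, 275]
  order :=
    [43, 75, 99, 105, 106, 111, 123, 107, 235, 363, 53, 85, 101, 113, 116, 119, 125, 117, 245, 373,
    102, 230, 358, 294, 326, 354, 356, 359, 366, 374, 108, 236, 364, 44, 76, 100, 104, 109, 110,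
    124, 114, 242, 50, 82, 98, 112, 115, 118, 122, 120, 248, 376, 184, 216, 232, 240, 249, 250,
    252, 161, 193, 224, 227, 229, 233, 241, 97, 225, 353, 191, 223, 239, 247, 251, 253, 254, 127,
    255, 383, 60, 188, 316, 300, 308, 312, 317, 318, 380, 92, 220, 348, 332, 340, 344, 349, 350,
    289, 321, 352, 355, 357, 361, 369, 319, 351, 367, 375, 379, 381, 382, 290, 296, 299, 302, 314,
    362, 46, 58, 63, 126, 62, 164, 176, 181, 244, 52, 322, 328, 331, 334, 346, 324, 336, 341, 372,
    84, 163, 195, 226, 231, 243, 297, 329, 360, 365, 377, 78, 370, 90, 95, 94, 196, 208, 213, 292,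
    304, 309, 177, 187, 209, 219, 228, 238, 293, 303, 325, 335, 368, 378]
  symmetries := []
  branches := [
    (59, [2152206920, 2172719048, 3662156700, 3, 3662156700, 1919151258, 2, 2, 4, 2172719048,
    3662156700, 3, 3662156700, 3, 3662156700, 1, 2825508293, 3, 1, 7, 4158742221, 2252870216, 3,
    4158742221, 4358520528, 3, 2252870216, 4158742221, 1916441754, 3, 2662318664, 1916441754, 7,
    2172719048, 4387311560, 3, 1919151258, 2, 2, 3, 1916441754, 2, 4360068813, 2, 1916441754, 3,
    1919151258, 3756715361, 3, 3050865517, 2, 2, 1916441754, 8, 2252870216, 2172719048, 4387311560,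
    3, 2, 1, 2825508293, 3978242443, 3, 2972792079, 2, 6, 4259357380, 2, 4259357380, 3327039878, 2,
    2662318664, 4, 4259357380, 2, 4, 1, 3682668570, 2, 2, 3050865517, 2, 3050865517, 2, 3, 5,
    3682668570, 1548227144, 3, 3057975339, 3, 3978255710, 3977855247, 3, 3057975339, 4, 3756715361,
    1, 3, 2825508293, 2, 1266797810, 2662318664, 2, 2, 3, 2972792079, 2, 3, 1, 10]),
    (69, [4158742221, 3347772104, 3750425288, 4, 3347772104, 2542441884, 2039125404, 3750425288, 4,
    3750425288, 2139788660, 2, 6, 3368294987, 2, 3783380250, 2, 3, 4085370138, 2, 1, 3, 2969996739,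
    2, 1, 6, 4158742221, 2454196811, 2974534083, 2, 4, 2454196811, 2832023760, 2454100340, 3,
    3360070004, 2, 2974534083, 2, 6, 3368294987, 2, 3783380250, 2, 3, 1, 2, 2974534083, 2,
    2974534083, 3, 2974534083, 3, 1, 2, 2, 6, 4158742221, 2, 4158742221, 3137373515, 3, 3137373515,
    4, 4360068813, 3929731900, 3, 3929731900, 3, 1, 3266298640, 2, 3266298640, 2, 3, 5, 4085370138,
    2969996739, 2146102625, 4, 3866141598, 2, 3, 346549654, 2, 3071869392, 3866141598, 2246765921,
    5, 2969996739, 2146102625, 1554509206, 1, 3, 4, 3071869392, 3866141598, 3, 2974534083, 2, 2, 1,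
    7, 3251224272, 2747907792, 2474757402, 4, 2969996739, 3979554187, 3380727066, 2, 4, 3832022982,
    2, 1817187267, 3, 2643129032, 2, 2, 3829265094, 2, 3, 5, 3682716914, 3979554187, 3, 1, 1, 4,
    2858301645, 1944389161, 3, 2749456077, 1944389161, 2424263359, 5, 2969996739, 3979554187, 3,
    3632561613, 3976457667, 3, 2, 1, 2, 6, 2969996739, 1, 3, 2969996739, 3979554187, 1, 2, 5,
    4158742221, 2, 2, 3976457667, 3, 2, 2643129032, 2, 2, 2974534083, 2, 2974534083, 2, 4, 1, 2, 2,
    11]),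
    (96, [3347772104, 3368294987, 2, 2, 1, 4, 2454196811, 3368294987, 2, 2, 3662156560, 2,
    3662156560, 5, 4259357380, 2, 4259357380, 2, 1919151292, 4, 3266298640, 2, 2, 1919151292, 4,
    2374094066, 2974533907, 3, 1, 3, 3929731900, 1, 3, 3980951943, 2, 1, 8]),
    (103, [4259357380, 3750425288, 3, 4281377160, 3750425288, 4, 4085370138, 2, 1, 3, 2971738567,
    1, 3, 1, 5, 4259357380, 2972792263, 2, 3, 4281377160, 3, 1, 2, 2972792263, 2, 1, 5, 4259357380,
    4281377160, 2972792263, 2, 4, 1160863684, 2, 2, 3, 4259357380, 2, 2, 3976844679, 3, 2776747272,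
    1139469665, 3280063752, 3, 3280063752, 4, 2643129032, 2, 2, 5, 346549654, 2, 1, 3, 3555388769,
    2971738567, 1, 4, 2246765921, 2, 4, 3976844679, 3979941319, 3, 2971738567, 3642843144, 2,
    2850745697, 1, 3, 1, 5, 2877410546, 1, 3, 2146102625, 2, 1554509206, 2, 2, 4, 1, 9]),
    (117, [2850745697, 2, 3555388769, 2850745697, 1, 5, 2146102625, 1, 3, 1, 1, 1, 6]),
    (118, [2926150085, 1944389161, 2, 3, 3731477957, 2, 1, 4, 3325341122, 1654718402, 1233431946,
    3, 1233431946, 3, 1233431946, 3, 1654718402, 2, 2, 2, 1233431946, 4, 3727994306, 4, 2926150085,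
    3731477957, 3, 2926150085, 3731477957, 4, 1919223969, 2, 1, 3, 3750425288, 2, 2, 3, 2120865221,
    2, 3726596549, 1, 3, 7]),
    (121, [2575420680, 3380727066, 2, 2, 1, 2474757402, 2, 5, 4071580836, 2972985739, 2, 3,
    4071580836, 2972985739, 3, 3, 1, 1, 3, 2776747290, 2945105541, 2, 3, 5]),
    (122, [1, 1, 3, 1944389019, 1062202777, 2, 2, 1062202777, 2, 4, 1, 1, 2, 5]),
    (123, [2970190215, 1, 2, 3, 1, 3]),
    (141, [3929731848, 2877410568, 2971544971, 4, 1, 2877410546, 2, 3, 1, 4]),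
    (154, [1, 2]),
    (156, [1]),
    (157, [1, 2, 1, 2964265547, 2, 2, 1, 5]),
    (163, [1])]

def heptad27 : Certificate where
  core := [0, 7, 25, 138, 149, 269, 286]
  order :=
    [367, 299, 331, 362, 363, 361, 107, 235, 379, 355, 109, 124, 364, 76, 44, 104, 108, 236, 100,
    110, 161, 224, 241, 229, 97, 353, 193, 225, 233, 227, 251, 383, 239, 247, 253, 254, 191, 255,
    127, 223, 244, 372, 340, 308, 356, 374, 373, 116, 380, 368, 370, 210, 250, 246, 242, 178, 240,
    226, 243, 114, 311, 315, 371, 306, 305, 51, 179, 291, 307, 46, 238, 126, 111, 78, 366, 102,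
    106, 248, 360, 378, 376, 120, 377, 344, 312, 83, 323, 343, 211, 339, 338, 347, 337, 112, 98,
    115, 82, 50, 122, 118, 172, 204, 237, 252, 232, 228, 322, 336, 352, 324, 321, 328, 230, 359,
    354, 358, 326, 294, 187, 169, 175, 163, 43, 101, 125, 117, 113, 119, 220, 214, 196, 208, 84,
    201, 219, 75, 207, 195, 304, 289, 296, 290, 292, 52, 176, 188, 164, 182, 375, 369, 357, 381,
    86, 95, 92, 90, 60, 54, 58, 63, 123, 99, 105, 166, 231, 198, 216, 249, 184]
  symmetries := []
  branches := [
    (117, [2820626689, 2421457029, 3625933057, 4, 4033080653, 3625933057, 3, 3625933057, 4,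
    3625933057, 2820626689, 2421457029, 3, 2, 4, 4335091914, 3964533505, 3, 3629416705, 2, 3,
    3527054408, 2824110337, 3, 4033080653, 2, 3, 3527054408, 2824110337, 3, 2, 3, 4046439934, 2,
    3024877901, 3629416705, 2, 3, 2160335477, 3629416705, 2, 4, 4467441227, 2, 3629416705, 2, 8,
    2355106242, 2, 2, 1, 3, 1, 3639722693, 2, 2, 3, 4484268334, 2, 2, 2957897857, 3665105249, 2, 3,
    2, 2822411336, 2, 3639722693, 3, 2, 2, 5, 2160335477, 2957897857, 2845402101, 2, 3024877901, 2,
    3, 3024877901, 2, 2, 4, 4460089624, 2, 3024877901, 2, 1964597450, 2, 3, 5, 4335091914, 2, 2,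
    4483257683, 3951340849, 3, 2, 2, 3, 4445050565, 3670285072, 2, 3, 3670285072, 2, 3670285072, 1,
    3, 4, 2957897857, 3242469565, 3964533505, 2, 2, 3, 3964533505, 2, 2, 4, 2457898267, 2, 2,
    3352793368, 2, 2, 4335091914, 2, 2, 2822411336, 2, 2822411336, 2, 3, 3730088065, 2, 2822411336,
    2, 2822411336, 2, 3, 4, 3, 11]),
    (118, [4479774071, 2, 3152348440, 2, 3, 2, 4044340756, 2, 2945229128, 3, 2, 2, 1, 3568291374,
    2, 4064809547, 2, 2, 2, 2825120840, 2, 4064809547, 3, 2, 3953469812, 2, 3, 1, 3, 7]),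
    (119, [3038234494, 1, 4046439934, 4, 3261054444, 3654073905, 1, 5, 3038234494, 4046439934, 1,
    4, 1, 1, 4, 1, 2, 3038234494, 1, 4046439934, 4, 3047513505, 1, 4, 1, 1, 2, 3, 1, 2, 3933989640,
    4448190147, 2, 2355106242, 3, 3, 2, 3933989640, 2, 2, 2, 3933989640, 2, 2, 10]),
    (120, [1, 1, 3, 1, 1, 4052415176, 2, 2, 4, 3065910243, 2, 2, 2, 1, 4460089729, 3762798354, 2,
    3065910243, 2, 3, 3, 4, 1, 2, 1, 3263032881, 3665858019, 3, 1, 3052072464, 2, 4460089729, 2, 2,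
    10]),
    (121, [1, 3670309278, 2341115292, 2, 2, 3, 1, 3750401396, 2, 1, 3, 2, 5]),
    (122, [3964124747, 3355126517, 3, 1, 3355126517, 2542466036, 2, 5, 2945229128, 2, 3024877901,
    2, 2, 4047385970, 4031682693, 3024877901, 2, 3, 4, 3, 4047385970, 2, 2, 3251936609, 2,
    3234725342, 2, 2, 2, 3, 4460089624, 2, 2, 3024877901, 2, 2923257461, 2, 3, 3024877901, 2,
    2923257461, 2, 3, 3, 3024877901, 3022168397, 2, 3, 3024877901, 2, 3024877901, 2, 4, 2165924016,
    4030370952, 3, 2165924016, 3642819146, 3, 2165924016, 3642819146, 3, 4, 4448190147, 2,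
    3351815085, 2, 3, 4, 3024877901, 2, 2, 2835383964, 2, 2, 2835383964, 2, 2, 4, 9]),
    (139, [3630793154, 4030370952, 2, 3, 2, 1, 3, 3945153040, 2, 4030370952, 2, 3, 2, 1, 1, 3, 4]),
    (140, [2460949266, 2, 2, 2, 2, 2, 1, 2, 2, 1, 3152649566, 2, 4448190147, 2, 2, 2, 3, 5]),
    (141, [2851874810, 2, 2, 2945229128, 3, 2474730822, 2, 2, 2, 3, 1, 1, 3355191366, 2, 2, 2, 5]),
    (142, [3957921181, 4335091914, 2, 3253011736, 3, 4479774071, 4, 1, 3, 3152348440, 2,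
    3957534073, 4335091914, 2, 3253011736, 3, 3750401396, 4, 1, 3, 4]),
    (143, [3971544003, 3737977160, 2, 3, 2851874810, 2, 3, 2945229128, 2851874810, 2, 2, 4,
    2353512008, 2, 2, 2474730822, 2, 3, 4031682693, 2474730822, 2, 3, 3, 3]),
    (145, [3644827159, 2, 2, 2, 2]),
    (146, [2341115292, 2, 2, 2]),
    (159, [3967673086, 2825120840, 2, 2, 2419758216, 2, 2419758216, 2, 3, 4, 3967673086,
    3327039621, 2, 2, 3, 3, 3971888069, 2, 2, 3]),
    (163, [4448190147, 3762798354, 2, 3, 4335091914, 2, 2, 4335091914, 2, 2, 4335091914, 2, 2, 5,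
    4448190147, 4030370952, 3, 2825120840, 2, 2, 2825120840, 2, 2, 3, 2419758216, 2, 2419758216, 2,
    3, 2419758216, 2, 2, 3, 4, 4448190147, 2, 3756207440, 2, 2, 3176602383, 2, 3, 3, 4448190147, 2,
    3327039621, 2, 2, 2, 3, 5]),
    (168, [3355191366, 2, 2, 3745482435, 2, 2, 3])]

def heptad28 : Certificate where
  core := [0, 7, 25, 139, 150, 270, 277]
  order :=
    [45, 77, 101, 105, 108, 111, 125, 109, 237, 365, 51, 83, 99, 113, 114, 119, 123, 115, 243, 371,
    106, 234, 362, 42, 74, 98, 104, 107, 110, 122, 116, 244, 372, 52, 84, 100, 112, 117, 118, 124,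
    120, 248, 376, 184, 216, 232, 240, 249, 250, 252, 161, 193, 224, 227, 229, 233, 241, 97, 225,
    353, 191, 223, 239, 247, 251, 253, 254, 127, 255, 383, 242, 370, 306, 338, 354, 368, 374, 378,
    292, 324, 352, 357, 358, 364, 228, 356, 164, 168, 173, 188, 236, 44, 172, 319, 351, 367, 375,
    379, 381, 382, 196, 200, 205, 220, 76, 204, 361, 297, 329, 360, 363, 377, 58, 60, 63, 126, 62,
    90, 218, 346, 82, 94, 102, 230, 226, 231, 238, 162, 176, 179, 186, 50, 289, 290, 307, 355, 291,
    296, 304, 314, 316, 312, 321, 336, 339, 369, 209, 92, 348, 344, 380, 165, 177, 189, 245, 194,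
    208, 211, 333, 197, 221, 95, 347, 322, 328, 323, 359, 301, 315]
  symmetries := [
    (1751120,0,2,0)]
  branches := [
    (60, [2119144826, 2356286226, 1917817998, 4, 2662275656, 3, 3141502280, 2, 3, 1917817998,
    2119144826, 2, 2662275656, 3, 3141502280, 2, 3, 1919172750, 5, 3979618687, 2970039747, 2,
    2721882507, 2970039747, 3830431440, 2, 6, 4534894498, 2970039747, 3, 2970039747, 2, 3979618687,
    2970039747, 2, 2970039747, 6, 2970039747, 4533822150, 2, 3, 3979618687, 4360609258, 2970039747,
    3, 2, 2970039747, 2, 2970039747, 2924450891, 2, 2, 2, 4534894498, 1965148487, 2, 2, 3,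
    3676438069, 2, 4, 9, 3325663610, 3325663577, 2, 3, 3137287499, 3, 2663694923, 2, 3, 3325663610,
    2, 2, 2721882507, 3, 4335339213, 3325663610, 2, 2, 3, 3325663610, 2, 3137287499, 3, 2663694923,
    2, 3, 5, 4533822150, 2, 2, 1, 4533822150, 3981317571, 3, 3025533784, 2, 5, 3976479171, 2,
    3831979659, 3976479171, 3, 2624020422, 2, 3976479171, 1919516872, 6, 1, 1, 3, 2, 2974491075, 2,
    2974491075, 3980973403, 4, 1, 2, 3980973403, 3, 2974491075, 2, 2974491075, 3, 1, 2974491075,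
    3980973403, 8, 1, 3830431440, 2, 2, 3, 1, 3025533784, 2, 3, 4335339213, 2, 2, 1, 2, 1,
    3981317571, 3, 3025533784, 2, 2, 13]),
    (128, [1, 3731456453, 2, 4058976873, 1, 2, 4, 1, 2, 1, 1, 2, 6]),
    (129, [3023356542, 3656329083, 1, 3, 1, 1, 1, 6, 2822003138, 4029965310, 4432615874, 2,
    3224658942, 1, 4432615874, 7, 1, 2, 1, 3, 1, 1, 4560728955, 1, 5, 1, 3656329083, 1, 4, 1, 1, 1,
    4, 1, 1, 9]),
    (133, [1, 2, 1, 1, 2, 3, 1, 4031513637, 2, 2, 3, 1, 4031513637, 2, 2, 1, 7]),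
    (134, [2622471957, 1, 3, 4532273685, 3026453157, 2825486789, 2, 2, 3731456453, 5, 1, 2, 2,
    4071559320, 2, 1, 2, 6]),
    (139, [3770994072, 4079155605, 3, 1, 2, 1, 3626107797, 2, 5, 1, 2, 1, 2924773826, 2, 3, 1, 1,
    2, 6]),
    (151, [2926171589, 1, 3, 1, 1, 2, 4]),
    (152, [2924450891, 2, 2, 2, 2, 1, 1, 3, 3, 1, 2, 3]),
    (153, [1, 2, 1, 3, 1, 1, 4]),
    (114, [1, 2, 2, 1, 2, 3]),
    (116, [1])]

def heptad29 : Certificate where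
  core := [0, 7, 25, 138, 150, 268, 287]
  order :=
    [43, 75, 99, 105, 106, 111, 123, 107, 235, 363, 53, 85, 101, 113, 116, 119, 220, 84, 321, 331,
    323, 329, 125, 117, 245, 373, 102, 230, 358, 294, 326, 354, 356, 359, 366, 374, 114, 242, 370,
    50, 82, 98, 112, 115, 118, 122, 120, 248, 376, 184, 216, 232, 240, 249, 250, 252, 161, 193,
    224, 227, 229, 233, 241, 97, 225, 353, 126, 254, 382, 62, 94, 110, 124, 127, 173, 205, 236,
    239, 253, 109, 237, 365, 307, 339, 355, 369, 375, 379, 243, 371, 164, 176, 181, 188, 244, 52,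
    308, 208, 336, 337, 338, 340, 344, 368, 367, 175, 207, 231, 238, 255, 51, 179, 163, 177, 187,
    58, 314, 306, 312, 378, 83, 211, 195, 209, 219, 289, 226, 309, 341, 357, 372, 381, 45, 46, 60,
    108, 77, 197, 201, 221, 196, 213, 78, 90, 92, 291, 293, 305, 360, 299, 361, 169, 297, 290, 322,
    352, 362, 377, 380, 247, 251, 100, 104, 165, 189, 304, 346, 228, 325]
  symmetries := []
  branches := [
    (82, [4259529340, 2, 4259529340, 2, 1, 4, 1951396764, 4259529340, 2, 2253429397, 4, 4281549192,
    1, 1, 4, 1, 1, 6, 4547952648, 1, 1, 4584385813, 2, 5, 1, 2, 4550796530, 2, 2, 4052329163, 2, 2,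
    1, 3, 6]),
    (110, [3641982981, 1, 2649720196, 2, 2949911760, 2, 5, 3641982981, 3152340487, 2, 4584385924,
    3856110118, 3, 2424255364, 5, 3641982981, 2851046788, 2549056900, 4, 1, 3856110118, 2,
    3856110019, 3, 2649720196, 2, 7, 4260029322, 2, 2, 3828980057, 2, 1, 2, 4, 4181385991,
    4460721544, 4549328901, 3, 4549328901, 4, 4370326276, 2020029665, 1, 4, 3651224573, 1,
    3632214881, 2, 4, 3981908594, 2, 4286696693, 3, 3981908594, 2, 3, 5, 3651224573, 2721877337, 2,
    3750726532, 2, 4, 2643430276, 2, 3851392669, 3651224573, 2, 3, 1, 5, 4286696693, 2, 4072983976,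
    2, 3, 3929836922, 4549328901, 1, 4, 4550796530, 2649720085, 3, 4563505603, 1, 3, 1, 5,
    4549328901, 3045371266, 2, 2, 4253846938, 3743941906, 3, 2, 1, 2, 5, 3743941906, 2, 2, 1, 10]),
    (111, [1951396764, 2253429397, 4159258317, 2, 4159258317, 2, 5, 3770991406, 2, 4360584909, 2,
    3770991406, 2, 4, 2671436551, 2, 3072213456, 2, 2, 5, 4159258317, 3863386404, 3, 4159258317,
    4543127760, 3, 1, 4, 3866313702, 1, 3, 2354641101, 2, 3758175099, 2, 3, 4366778266, 2, 2, 5,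
    3072213456, 2117897476, 1, 4, 3072213456, 1, 1, 4, 2643430276, 1, 3, 3072213456, 1, 3, 5,
    3644826869, 4286696693, 3, 2670936525, 4261580223, 4072983976, 3, 3, 4447402334, 2, 4,
    3453239142, 3866313702, 2749972173, 3878896077, 2146403605, 2, 6, 3856110118, 1669450997,
    1153748210, 3, 1, 4, 4273966531, 4563505603, 3, 3764392289, 2, 1, 1, 4, 3764392289, 2, 6,
    630011169, 1158100378, 3, 2, 2670936525, 4555836826, 3649673626, 3, 2, 3, 2871467643, 2, 1, 5,
    1, 1, 3, 1, 3866313702, 2, 2, 10]),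
    (113, [1, 2, 1, 1, 3, 4455369604, 1, 3, 1, 2, 2, 3, 3061125470, 2, 1, 1, 1, 5, 1, 2, 2, 6]),
    (117, [2668006533, 2, 1, 3, 2655426765, 1, 3, 1, 2, 4, 3251431300, 2, 1, 4370326276, 2, 4, 2,
    4060382691, 2, 4072962462, 2, 3039814930, 2, 4, 4]),
    (125, [3770991406, 2, 1951396764, 3, 3770991406, 2, 4468914381, 2, 3, 3770991406, 4064713076,
    3, 2253429397, 3, 4, 4040160658, 2, 1, 1, 4, 3033525010, 2, 1, 1, 4, 1, 2, 1, 2, 6]),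
    (132, [1, 1, 4455369604, 1, 5, 1, 1, 4455369604, 4, 3, 1, 1, 3, 2, 3152340487, 4040160658,
    4459366792, 1, 5, 4332490073, 2, 1, 4, 1, 2, 1, 2, 1, 7]),
    (133, [2649720196, 2, 4584385924, 3856110118, 2649720196, 5, 3964052232, 4550775029, 1, 4, 1,
    2, 4286696693, 3, 2, 3644805362, 3039814930, 2649720085, 2, 4, 1, 1, 7]),
    (134, [2949911760, 1, 3, 1, 1, 2, 4, 1, 1, 2549056900, 1, 3, 5]),
    (145, [1, 2, 2]),
    (147, [1, 1, 3, 1, 2, 1, 4]),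
    (153, [3657729475, 4563505603, 2, 1, 4, 1, 2, 3]),
    (163, [1, 2, 1, 3]),
    (164, [4584385813, 3856110019, 3, 1, 3]),
    (165, [2949223629, 2, 2858422625, 2, 2949223629, 2, 4, 2])]

def heptad30 : Certificate where
  core := [0, 7, 25, 138, 148, 268, 275]
  order :=
    [43, 75, 99, 105, 106, 111, 123, 107, 235, 363, 53, 85, 101, 113, 116, 119, 125, 117, 245, 373,
    102, 230, 358, 166, 198, 226, 228, 231, 238, 246, 114, 242, 370, 50, 82, 98, 112, 115, 118,
    122, 120, 248, 376, 184, 216, 232, 240, 249, 250, 252, 126, 254, 382, 318, 350, 366, 374, 378,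
    380, 383, 161, 193, 224, 227, 229, 233, 241, 97, 225, 353, 63, 191, 319, 175, 183, 187, 189,
    190, 255, 95, 223, 351, 207, 215, 219, 221, 222, 173, 205, 236, 239, 253, 109, 237, 365, 289,
    321, 352, 355, 357, 361, 369, 45, 293, 297, 303, 317, 46, 54, 58, 60, 62, 77, 325, 329, 335,
    349, 78, 86, 90, 92, 94, 108, 100, 104, 110, 124, 290, 304, 310, 314, 178, 299, 331, 362, 367,
    379, 309, 341, 372, 375, 381, 322, 336, 342, 346, 210, 294, 326, 354, 356, 359, 312, 344, 360,
    368, 377, 163, 165, 169, 177, 195, 197, 201, 209, 247, 251, 127, 243]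
  symmetries := [
    (1742048,0,1,0)]
  branches := [
    (103, [4734952210, 2, 2, 1, 4769251225, 4734952210, 3, 4072983976, 2863648150, 5, 1, 1,
    3061813741, 4561591723, 5, 4734952210, 2, 3643407710, 2, 3, 1, 1, 4734952210, 4, 1, 1,
    3643407710, 2, 9]),
    (127, [4456993013, 4445717146, 3, 1, 3, 1, 2, 4456993013, 1, 3057975193, 3, 3, 3740974489, 2,
    2, 4773079059, 2, 2, 3, 1, 2, 6]),
    (129, [4658048410, 2, 2, 2856850332, 4658048410, 3, 2, 1, 3, 4658048410, 1, 4, 1, 2, 1, 1, 6]),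
    (132, [2856850332, 2965660658, 3, 2856850332, 2221528252, 1951267663, 4, 2965660658,
    3775518031, 2, 3946421806, 3, 2831685237, 2120864956, 1954579339, 3, 3946421806, 8, 2442146841,
    2, 2838480523, 2831685199, 3, 2831685199, 3, 4335457733, 4332489877, 2, 2, 3, 4332489877,
    4750655730, 3, 1, 3, 4750655730, 2, 6, 3964124894, 2, 3964124894, 3743933998, 4445717146, 4,
    4449738286, 4, 4449738286, 4568513359, 2, 4, 2831685199, 2, 1, 2, 2, 1, 4568513359, 3, 1, 1, 4,
    1, 2, 1, 9]),
    (147, [3627718044, 2, 2252870216, 1951267701, 3, 3, 3627718044, 2, 2454196811, 2856850192, 3,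
    3, 1, 1, 1, 6, 3627718044, 2, 2252870216, 1951267701, 3, 3, 3627718044, 3945153180, 3,
    3770991406, 3966877409, 4750655730, 3, 3966877409, 2, 3, 4751709342, 4047582512, 2, 2, 6,
    3627718044, 2, 2454196811, 2856850192, 3, 3, 1, 1, 1, 7, 3770991406, 2361705077, 3668951824, 2,
    2863645456, 4332489877, 2, 6, 1, 2, 3627718044, 4533859740, 3, 2, 2, 2, 1516885365, 2, 2,
    4332489877, 1, 3, 1, 9]),
    (157, [4045496540, 2, 2, 2, 2, 2]),
    (159, [1, 2]),
    (60, [3124573593, 2, 1, 3, 2152206920, 2, 2, 2152206920, 2, 2, 1, 1, 2, 1, 2, 1, 8]),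
    (87, [3124573593, 3945153180, 3, 3123003696, 2, 2, 3, 2721748104, 3945153180, 3, 3945153180, 3,
    3349685960, 2, 2, 3, 3945153180, 1, 1, 4, 1, 5]),
    (95, [3124573593, 2, 1, 3, 3347772104, 2, 2, 3347772104, 2, 2, 1, 1, 2, 1, 2, 1, 8]),
    (102, [1]),
    (131, [1])]

def heptad31 : Certificate where
  core := [0, 7, 25, 138, 149, 269, 275]
  order :=
    [43, 75, 99, 105, 106, 111, 123, 107, 235, 363, 54, 86, 102, 114, 116, 119, 126, 118, 246, 374,
    108, 236, 364, 44, 76, 100, 104, 109, 110, 124, 120, 248, 376, 184, 216, 232, 240, 249, 250,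
    252, 161, 193, 224, 227, 229, 233, 241, 97, 225, 353, 191, 223, 239, 247, 251, 253, 254, 127,
    255, 383, 290, 322, 352, 355, 358, 362, 370, 98, 226, 354, 302, 310, 314, 316, 319, 382, 62,
    190, 318, 244, 372, 308, 340, 356, 368, 373, 380, 334, 342, 346, 348, 351, 94, 222, 350, 230,
    166, 198, 228, 231, 238, 242, 50, 82, 112, 115, 122, 164, 176, 182, 188, 52, 196, 208, 214,
    220, 84, 289, 296, 299, 361, 169, 331, 195, 201, 207, 219, 357, 369, 375, 381, 117, 312, 344,
    360, 377, 378, 46, 58, 60, 63, 78, 90, 92, 95, 321, 324, 328, 336, 163, 178, 187, 243, 294,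
    326, 359, 366, 101, 113, 125, 367, 175, 237, 292, 304, 172, 204, 379, 210]
  symmetries := [
    (1745688,0,1,0)]
  branches := [
    (60, [4133958855, 1, 1, 1, 5, 4234579396, 1, 1, 1, 5, 1, 1, 3, 1, 1, 1, 1, 3, 1, 2, 8]),
    (96, [4133958855, 2964284360, 4231869712, 4, 4234579396, 2964284360, 3426391192, 4, 2964284360,
    206864716, 2, 2, 5, 4133958855, 4231869712, 3, 4234579396, 3426391192, 3, 4474257992,
    3741353291, 3, 2845402181, 1, 3, 5, 4762055529, 2, 4461358433, 2, 2, 5]),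
    (110, [1, 1, 2, 3, 1, 1, 3, 1, 4]),
    (132, [2454196811, 4133958855, 2, 4234579396, 2, 2252870216, 2, 2471010508, 2, 5, 3561880399,
    2, 2, 4, 2952368838, 2953078469, 3, 2831685199, 2, 2964262859, 2945229128, 5, 2945229128, 3,
    3933989656, 2856850192, 3, 2856850192, 3765550864, 2, 4, 4133958855, 2, 4234579396, 2,
    3348718540, 2, 3942400530, 2, 2, 5, 2831685199, 2, 2, 1, 4, 1, 2, 1, 7]),
    (137, [1, 1, 2851906805, 2, 3355223285, 2, 5]),
    (139, [4783562081, 2, 1, 3]),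
    (165, [1, 2]),
    (117, [1])]

def heptad32 : Certificate where
  core := [0, 7, 25, 138, 150, 269, 275]
  order :=
    [43, 75, 99, 105, 106, 111, 123, 107, 235, 363, 53, 85, 101, 113, 116, 119, 125, 117, 245, 373,
    102, 230, 358, 294, 326, 354, 356, 359, 366, 374, 108, 236, 364, 44, 76, 100, 104, 109, 110,
    124, 114, 242, 370, 50, 82, 98, 216, 232, 240, 249, 250, 252, 161, 193, 224, 227, 229, 233,
    241, 97, 225, 353, 191, 223, 239, 247, 251, 253, 254, 127, 255, 383, 46, 58, 60, 63, 243, 360,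
    368, 377, 378, 126, 62, 238, 213, 318, 92, 220, 348, 340, 344, 350, 380, 164, 176, 181, 188,
    312, 244, 52, 308, 289, 321, 352, 355, 357, 361, 369, 319, 351, 165, 367, 375, 379, 381, 382,
    290, 296, 299, 302, 314, 362, 169, 172, 175, 189, 237, 78, 334, 204, 207, 341, 197, 209, 221,
    292, 304, 309, 316, 372, 163, 195, 226, 231, 322, 324, 328, 336, 90, 95, 94, 196, 208, 84, 331,
    346, 219, 112, 115, 118, 122, 120, 248, 376, 184, 177, 187, 201, 228]
  symmetries := []
  branches := [
    (62, [4158742221, 2252870216, 2152206920, 4, 2252870216, 4870115912, 2221528399, 4158742221, 2,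
    2221528459, 4158742221, 2, 2152206920, 9, 2260998728, 4878244424, 3, 2221528399, 1958622033,
    4575867729, 3, 4, 2221528399, 4360068813, 2, 4360068813, 2, 2221528459, 4, 3050865517, 2,
    3050865517, 2, 3, 2221528459, 2260998728, 3662156700, 3, 2, 8, 4158742221, 2454196811, 3,
    2454196811, 3561880399, 4883808720, 2454100340, 2, 3360070004, 2, 3, 3979553928, 2, 3452550942,
    8, 2462325323, 2, 3933989656, 2, 2864978704, 2, 4, 1, 2, 4769251225, 3057975193, 3, 4568513359,
    2, 1, 1, 1, 4688761542, 2, 3, 9, 4158742221, 3347772104, 3, 4883808720, 4158742221, 2,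
    4158742221, 3137373515, 3, 3347772104, 6, 3266298640, 3929731900, 3, 3929731900, 3266298640, 2,
    3266298640, 2, 5, 4360068813, 2, 4360068813, 2, 3, 2462325323, 2, 3933989656, 2, 3, 5,
    3939543190, 2, 2, 4158742221, 2, 3654589793, 3, 2, 3071869392, 2, 2844455624, 2, 2, 3071869392,
    2, 2844455624, 2, 5, 4481220291, 2, 2, 2858301645, 2, 3632222925, 3, 2, 4433024072, 4662010187,
    3, 2, 2, 7, 4575891903, 3663729090, 1, 1, 5, 1, 2, 1, 4, 3071869392, 1818875068, 3, 3071869392,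
    2, 1818875068, 3251224272, 2, 2, 2844455624, 2, 1, 1, 3071869392, 2, 2, 1, 5, 7, 2858301645, 2,
    2858422722, 2570267985, 2, 2424263359, 2749456077, 6, 1, 2, 2, 2749456077, 2, 2749456077,
    3757659075, 2, 2, 6, 2455769438, 1, 3, 3354062177, 2, 3528463056, 2, 2, 3629126352, 2, 2, 5,
    4789768880, 3632561613, 3, 4071580836, 4570085787, 3, 3, 3528463056, 3878724045, 3, 4071580836,
    4058998377, 3452550942, 2, 4, 3959203395, 2, 5, 3866141598, 2, 3670309278, 2, 3866141598, 2,
    2747907792, 2, 2, 3452550942, 2, 6, 4433024072, 2, 4883808720, 3, 2, 2643129032, 2, 2,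
    4535096016, 2, 2, 1, 4, 13]),
    (97, [2252870216, 2260998728, 4878244424, 3, 1958622033, 4575867729, 3, 3, 1951267663,
    1958622033, 4575867729, 3, 2, 1, 1057485337, 1, 3, 7, 2454196811, 2462325323, 2, 2864978704, 2,
    3, 2864978704, 2, 2, 1, 2, 3662156560, 6, 4259357380, 2, 2454100340, 2, 3360070004, 2, 3,
    3979553928, 2, 4281377160, 5, 1, 4769251225, 3057975193, 3, 1, 1, 4681369543, 2, 2, 2, 7,
    2320793932, 2, 1, 3, 1, 4568513359, 3, 2421457349, 1, 1, 4, 2020201864, 2, 4568513359, 3,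
    4568513359, 2, 2020201864, 2, 4568513359, 7, 4769251225, 3678994315, 3, 4259357003, 2, 2,
    4078502437, 3, 1, 2322191813, 2, 5, 3979553928, 2, 2, 2, 2322191752, 2, 3, 1, 3, 1, 1, 1, 3, 3,
    4071580836, 2, 1654718402, 2, 2, 2, 4560814983, 3, 1, 2322191752, 2, 5, 1, 2, 3234534553, 2, 1,
    3, 12]),
    (101, [4777283043, 2743768476, 2, 3347772104, 2, 3933989656, 4, 2353437044, 2, 2, 2, 4,
    1815778456, 1, 3347772104, 2, 2, 3347772104, 2, 1, 6, 4259357380, 3347772104, 3, 4259357380, 2,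
    4259357380, 2, 3347772104, 5, 3266298640, 2, 3266298640, 2, 3, 2462325323, 2, 2, 4, 3929731900,
    1, 3, 3866310864, 2, 2, 2, 4047385931, 3266298640, 2, 3, 2, 3347772104, 2, 3, 1, 2, 3347772104,
    2, 1, 10]),
    (108, [4259357380, 2152206920, 3, 4259357380, 4870115912, 2662318664, 4, 4870115912,
    4259357380, 2, 2152206920, 6, 2419758473, 2, 2, 2, 3050865517, 2, 3050865517, 2, 3050865517, 2,
    4, 2260998728, 3662156700, 3, 2, 5, 4789575344, 2, 1, 3, 1, 1, 3354062177, 2, 4, 4560814983,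
    3656393607, 4281377160, 2, 4, 3959590407, 2, 5, 3939543190, 2, 2, 4259357380, 2, 3654589793, 3,
    4772108496, 2, 2, 3, 4433024072, 4662010187, 3, 2, 2, 4, 4575891903, 3663729090, 1, 4, 2,
    4772108496, 4281377160, 3, 4547264520, 2, 3, 3670309278, 4570085787, 3, 2643129032, 2, 2, 4,
    2455769438, 2, 3630499864, 2, 2, 3354062177, 2, 4, 4547264520, 2, 3642843144, 2, 3642843144, 2,
    3, 4547264520, 2, 4281377160, 2, 5, 4433024072, 2, 2, 2, 1, 2, 10]),
    (116, [1, 2, 1, 1, 3, 1, 4470293253, 2, 2, 4470293253, 2, 1, 4, 1, 3662156700, 2, 2, 1, 3,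
    3662156700, 2, 2, 1, 1, 10]),
    (117, [4870115912, 3242469603, 3057975339, 4, 1, 2322191752, 2, 2, 1, 5, 3064265259, 2, 1, 3,
    4434731032, 2, 2, 3242517987, 2, 3, 1, 2, 4434731032, 2, 4071580836, 4570085787, 3, 1, 4, 1, 1,
    2, 1, 9]),
    (118, [1, 2421457228, 2320793932, 3, 2, 3, 1, 1, 2320793932, 2, 4, 1, 4461358433, 3932876860,
    2, 3, 2020201864, 2, 4, 4462519541, 2, 4462519541, 2856850332, 2, 3, 3, 4461358433, 2,
    2020201864, 1818875032, 1, 3, 3, 2856850332, 1, 2421457349, 2, 4, 1, 2, 9]),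
    (120, [1, 1, 1, 2858422722, 3, 3, 1, 2, 4071580836, 2836402587, 3, 2, 1, 1, 3, 6]),
    (122, [1, 1, 1, 3, 1, 1, 3, 4]),
    (123, [4561900680, 2, 2, 2, 4058998377, 2, 2, 3]),
    (124, [4777186275, 2, 2, 2, 3756715361, 2, 2, 2152206920, 2, 1, 3, 2, 2152206920, 2, 1, 3, 1,
    6]),
    (125, [1, 2, 1, 2, 3266274468, 2, 2, 4]),
    (135, [4560814983, 2, 2, 3649737864, 2, 2, 2, 3757876469, 2, 2, 2, 4]),
    (137, [4071580836, 4058998377, 2322191752, 2, 4, 2152206920, 2, 1, 3, 1, 4]),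
    (140, [3266274468, 3656393607, 3, 1, 4455068360, 2, 2, 1, 4, 3]),
    (164, [2152206920, 2, 1, 1, 2, 4]),
    (165, [1, 2]),
    (166, [1])]

def heptad33 : Certificate where
  core := [0, 7, 25, 138, 148, 159, 268]
  order :=
    [361, 352, 355, 353, 97, 357, 236, 253, 233, 229, 109, 365, 237, 75, 123, 107, 105, 235, 106,
    99, 363, 43, 111, 251, 179, 211, 115, 371, 242, 247, 227, 241, 243, 228, 166, 226, 198, 230,
    246, 238, 231, 358, 102, 216, 240, 184, 250, 249, 248, 252, 376, 120, 232, 254, 94, 118, 127,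
    122, 126, 110, 382, 62, 124, 119, 125, 85, 101, 117, 53, 113, 82, 346, 336, 116, 373, 245, 342,
    370, 338, 339, 210, 322, 314, 310, 306, 307, 209, 195, 50, 178, 304, 290, 360, 368, 312, 378,
    380, 344, 177, 169, 165, 58, 326, 359, 294, 374, 366, 356, 311, 317, 315, 318, 303, 383, 297,
    305, 161, 293, 291, 112, 224, 98, 100, 104, 193, 197, 201, 379, 331, 362, 299, 377, 354, 323,
    163, 367, 381, 341, 375, 372, 309, 77, 329, 335, 349, 325, 78, 92, 350, 90, 86, 343, 83, 347,
    337, 54, 225, 369, 289, 321, 205, 239, 173, 60, 46, 108, 45, 51, 114]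
  symmetries := [
    (1742048,0,1,0)]
  branches := [
    (108, [4750655730, 3775302999, 2644699014, 4, 2644699014, 4958729094, 3, 4876395270,
    3945153180, 3762798490, 2644699014, 4, 2644699014, 4, 2644699014, 5, 1, 4585224513, 4568685466,
    2, 3, 2, 3932632409, 2965660658, 3, 2, 5]),
    (109, [3058663480, 2, 1, 3, 3752005953, 3349352769, 3, 4456649025, 1, 4769939512, 2846036289,
    3, 5, 2623966620, 2, 2, 4273573956, 2, 2, 3946421806, 2, 3058663480, 4467463068, 3682133885, 3,
    2, 3, 1, 6, 1, 2, 4757217211, 2, 2, 6]),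
    (115, [1, 2, 1, 3124573593, 2, 2, 2857366465, 2, 4, 1, 1, 2, 5]),
    (117, [3643407710, 1, 3, 1, 3643407710, 4, 2]),
    (116, [2623966620, 2, 2, 2623966620, 2945229281, 3, 2945229281, 3, 2965660658, 2, 4,
    2356264670, 5074173665, 3, 2356264670, 2, 3, 1, 3, 5074173665, 3942400666, 3737977313, 4,
    3737977313, 3942400666, 2, 4, 3946421806, 1, 3745482101, 5, 3124573593, 2, 3124573593,
    2945229281, 3, 2857366465, 2, 4, 2945229281, 3830420858, 2, 3, 4835806589, 2, 2, 4, 1, 2,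
    4568685466, 1, 3, 2965660658, 4835806589, 2, 5, 1, 3828980054, 2, 2, 1, 9]),
    (158, [3743482334, 4470193889, 2950734302, 4, 3743482334, 2950734302, 3, 2950734302, 4,
    3945153180, 3762798490, 3, 3945153180, 2, 3952096134, 2, 4, 1, 4]),
    (162, [2158486278, 3349342086, 5084514438, 4456638342, 3, 2846025606, 2, 5, 5059392390,
    4958729094, 3, 1, 1, 4, 2259149574, 2460476163, 3, 2, 4987872390, 5060618118, 3, 1, 3,
    2259149574, 2460476163, 5088535686, 4987872390, 5, 6]),
    (166, [1, 1954407257, 2863129537, 3, 3, 1, 2, 3])]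

def heptad34 : Certificate where
  core := [0, 7, 25, 139, 149, 158, 269]
  order :=
    [238, 364, 204, 95, 126, 237, 108, 236, 98, 118, 82, 370, 50, 112, 122, 115, 114, 242, 330,
    354, 363, 234, 360, 362, 366, 106, 378, 298, 125, 383, 255, 123, 63, 127, 119, 111, 340, 356,
    373, 372, 116, 308, 244, 374, 368, 380, 227, 233, 161, 229, 353, 97, 193, 241, 224, 225, 371,
    51, 305, 311, 315, 307, 179, 306, 291, 358, 231, 246, 166, 226, 339, 83, 347, 323, 337, 198,
    102, 230, 338, 343, 211, 376, 120, 184, 250, 216, 240, 248, 249, 100, 110, 104, 44, 109, 76,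
    124, 367, 382, 351, 319, 355, 321, 369, 375, 381, 379, 357, 361, 352, 289, 346, 52, 316, 304,
    310, 292, 302, 296, 42, 314, 336, 322, 342, 210, 290, 168, 162, 176, 164, 200, 194, 196, 208,
    99, 113, 101, 105, 90, 60, 54, 58, 377, 92, 86, 252, 232, 228, 172, 78, 253, 247, 251, 239,
    324, 348, 328, 359, 107, 334, 46, 312, 344, 326, 294, 74, 178, 243, 84, 117]
  symmetries := [
    (1747032,30,2,1), (1749776,30,2,1), (1742048,0,1,0)]
  branches := [
    (83, [3762798354, 4470193736, 2353512008, 2361705032, 5, 2950734155, 4684078667, 3743482187, 4,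
    3945153040, 5071421003, 5079614027, 4, 5077334781, 1, 3, 5075055357, 2, 6, 4470193736,
    3743482187, 1, 2, 3967759101, 1, 3, 1, 2, 1, 1, 8, 5071421003, 1, 2, 5075055357, 4937717007, 2,
    2, 3, 4761195359, 2, 2, 1, 2, 1, 1, 8, 4757217057, 2, 2, 1, 4757217057, 3075275079, 3, 1, 5,
    5075055357, 1, 3, 1, 3153896693, 3, 1, 1, 5, 1, 2, 3248883018, 2, 1, 4, 4131206299, 4757217057,
    3, 1, 2, 1, 1, 5, 1, 2676083957, 3, 1, 5039742962, 2, 2, 4, 1, 4131206299, 2, 2, 3, 4757217057,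
    2, 4757217057, 2, 3, 1, 1, 1, 14]),
    (114, [1, 2, 2672815434, 3075275079, 1, 4, 1, 2, 1, 1, 6]),
    (125, [1, 2, 2, 1, 1, 2, 4790013173, 3254559989, 3, 1, 6]),
    (126, [1, 2, 1, 3]),
    (163, [1])]

def heptad35 : Certificate where
  core := [0, 7, 25, 138, 141, 150, 277]
  order :=
    [43, 75, 99, 105, 106, 111, 123, 107, 235, 363, 60, 92, 108, 116, 120, 125, 126, 124, 252, 380,
    102, 230, 358, 294, 326, 354, 356, 359, 366, 374, 113, 241, 369, 177, 209, 225, 240, 243, 245,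
    249, 114, 242, 370, 50, 82, 98, 112, 115, 118, 122, 191, 223, 239, 247, 251, 253, 254, 127,
    255, 383, 296, 328, 352, 361, 362, 364, 376, 104, 232, 360, 161, 193, 224, 227, 229, 233, 97,
    353, 51, 179, 307, 291, 306, 315, 371, 90, 346, 338, 344, 347, 350, 378, 302, 314, 316, 319,
    382, 62, 318, 321, 322, 331, 339, 355, 195, 323, 164, 196, 236, 244, 100, 228, 78, 334, 76, 94,
    110, 176, 188, 248, 184, 312, 324, 336, 348, 372, 84, 351, 367, 375, 379, 381, 101, 357, 109,
    117, 289, 290, 292, 304, 297, 300, 303, 365, 46, 58, 63, 83, 95, 119, 208, 220, 216, 299, 163,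
    187, 226, 231, 238, 329, 332, 335, 211, 219, 44, 52, 368, 377, 250]
  symmetries := []
  branches := [
    (60, [4884225374, 2, 3051642273, 3, 3682668570, 2, 3, 4560720895, 2, 3656323711, 2, 3,
    3051642273, 3769590948, 3, 2, 1, 1, 3, 5, 4884225374, 4772108496, 3, 3051642273, 4557463089, 2,
    4, 3682668570, 2, 1, 4, 3051642273, 3769590948, 3, 2, 4387360008, 2, 1, 2, 5, 3179400474, 2,
    3179400456, 2, 4387360008, 1, 3, 1, 1, 2, 1, 1, 1, 11]),
    (92, [3829264845, 3783380250, 3380727066, 4536469665, 5, 3737977163, 2, 2, 1, 4681326155, 2, 3,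
    1, 1, 4467441224, 2, 4064712837, 1, 4, 5071421000, 2, 2, 3, 7]),
    (106, [2474757402, 2, 1, 1, 4, 1, 2, 2374094066, 3, 3280063770, 4253889744, 3, 2474757362,
    2374094106, 3, 1, 5, 1, 2, 2374094066, 3, 2474757402, 4085370138, 2, 3, 3127183524, 2, 1, 1,
    8]),
    (120, [4744454277, 2, 1, 4744454277, 4, 1, 4574897160, 5159687304, 3, 5159687304, 3,
    4272907272, 2, 1, 2, 3, 4681326155, 2, 3259234437, 3, 6, 1, 3783380210, 2172767474, 3, 1,
    2877410568, 2, 5, 2945229131, 2, 2945229131, 3, 1, 3737977163, 4681326155, 3, 3024920957, 2,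
    5184438656, 3, 4681326155, 2, 4, 2, 2356264520, 2, 3024920957, 2, 1, 3, 3, 4488023304, 2, 2,
    2356264520, 5074173515, 1, 4, 4467441224, 2, 3737977163, 4681326155, 3, 1, 4, 10]),
    (121, [4470193739, 2353512011, 3, 2975321352, 2, 2, 3380727026, 3783380210, 3, 4077142403,
    3024920957, 2, 2, 3, 3, 1957675674, 2871534917, 3, 3024920957, 2, 2, 3, 1, 4684078664,
    3743482184, 3, 3743482184, 2, 3, 4684078664, 3743482184, 3, 2, 1, 4, 5071421000, 2, 2, 8]),
    (136, [3266255632, 2, 2, 1, 3, 1, 1, 1, 1, 6]),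
    (138, [3047513509, 2877410546, 3, 1, 3223524657, 3, 1, 1, 1, 1, 7]),
    (140, [3943300961, 2872765851, 1, 4, 3682716914, 2, 4561591861, 5051382113, 3577408923, 3, 3,
    1, 2, 5, 1, 4066360810, 2858422625, 4081018535, 2, 4, 2, 1, 1, 6]),
    (141, [1, 1, 1, 2, 4]),
    (144, [1, 1, 3, 1, 3]),
    (145, [2971665758, 2, 2, 2, 1, 3]),
    (153, [3024920957, 1, 3, 1, 1, 4, 1, 1, 4]),
    (154, [1, 2]),
    (155, [1, 2]),
    (164, [1]),
    (165, [1])]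

def heptad36 : Certificate where
  core := [0, 7, 25, 138, 148, 268, 287]
  order :=
    [43, 75, 99, 105, 106, 111, 123, 107, 235, 363, 53, 85, 101, 113, 116, 119, 125, 117, 245, 373,
    102, 230, 358, 166, 198, 226, 228, 231, 238, 246, 114, 242, 370, 50, 82, 98, 112, 115, 118,
    122, 120, 248, 376, 184, 216, 232, 240, 249, 250, 252, 161, 193, 224, 227, 229, 233, 241, 97,
    225, 353, 51, 179, 307, 163, 177, 178, 183, 187, 243, 83, 211, 339, 195, 209, 210, 215, 219,
    126, 254, 382, 62, 94, 110, 124, 127, 173, 205, 236, 239, 253, 109, 237, 365, 289, 321, 352,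
    355, 357, 361, 369, 294, 326, 354, 356, 359, 366, 374, 312, 344, 360, 368, 377, 378, 380, 45,
    165, 169, 175, 189, 46, 54, 58, 60, 190, 77, 197, 201, 207, 221, 78, 86, 90, 92, 222, 290, 304,
    310, 314, 306, 299, 331, 362, 367, 379, 309, 341, 372, 375, 381, 322, 336, 342, 346, 338, 291,
    293, 297, 305, 323, 325, 329, 337, 108, 100, 104, 247, 251, 255, 371]
  symmetries := [
    (1742048,0,1,0)]
  branches := [
    (100, [4533859740, 4838601877, 3, 2256396949, 4281941884, 2, 4, 2256396949, 4533859740,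
    4838601877, 3, 4838601877, 2457723538, 4962707221, 5, 4838601877, 2457723538, 1, 4962707221,
    5063370517, 5085783061, 1853743918, 4, 5063370517, 5085783061, 1, 1853743918, 5, 10,
    3770991406, 2361705077, 4660499758, 2, 2, 4332489877, 2, 4660499758, 2, 6, 2542766980,
    4445717146, 3, 4455369604, 2, 4449738286, 2, 1, 4449738286, 2546788228, 1, 8, 2851046677,
    2647451413, 3, 2, 3856983601, 2549056789, 3, 3856983601, 4, 4332489877, 5365336369, 2546788117,
    2, 1, 5, 5059349380, 2, 2, 4873642645, 4972330334, 4280245601, 2, 1, 5, 1, 4, 4660499758, 2, 1,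
    1, 5053718062, 2, 4, 5164622739, 2, 2, 10]),
    (117, [4873642756, 3657729475, 3, 3267677608, 3657729475, 4, 1, 2549056789, 2, 1, 5]),
    (119, [5085783172, 5293329653, 3, 5293329653, 3, 1, 2, 3754758532, 2, 3754758532, 2848788868,
    2546798980, 4, 2848788868, 2, 4, 3856110118, 2, 1, 4983894148, 2, 3, 1, 1, 1, 9]),
    (121, [1, 1, 3, 5059349380, 4455369604, 1, 4, 2, 1, 4]),
    (134, [1951396764, 2, 1951396764, 2, 2, 3, 2, 2155733764, 2, 2, 1, 4563505603, 1, 3, 5]),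
    (137, [3946378800, 2, 2, 1, 3, 1, 3]),
    (139, [2253429508, 2152766212, 1, 2623966620, 2, 1, 3, 4335285629, 2, 2, 1, 7, 4332490073, 2,
    2, 1, 1, 5]),
    (154, [1]),
    (80, [3830356164, 2, 2, 1951396764, 2, 3, 1951396764, 1957159728, 2, 3, 3945153180, 2622396717,
    2, 3, 2623966620, 2, 4, 3830356164, 2, 2, 1, 2623966620, 2, 4, 1, 2623966620, 2, 1, 1, 4, 1, 1,
    2, 8]),
    (93, [3945153180, 2, 1, 3]),
    (114, [1])]

def heptad37 : Certificate where
  core := [0, 7, 25, 139, 149, 269, 275]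
  order :=
    [227, 193, 233, 224, 229, 225, 97, 241, 353, 161, 348, 364, 376, 252, 380, 382, 381, 363, 330,
    298, 354, 106, 360, 362, 378, 366, 234, 115, 50, 242, 118, 114, 370, 82, 98, 122, 112, 251,
    247, 191, 127, 253, 254, 239, 255, 223, 383, 198, 230, 246, 231, 238, 102, 228, 226, 166, 358,
    86, 94, 350, 222, 92, 78, 90, 95, 126, 308, 116, 374, 340, 373, 368, 356, 244, 120, 321, 369,
    289, 174, 361, 232, 249, 184, 248, 250, 216, 240, 109, 236, 104, 100, 76, 44, 108, 190, 372,
    60, 54, 318, 63, 62, 46, 58, 352, 355, 357, 42, 186, 168, 124, 316, 162, 74, 328, 322, 346,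
    334, 304, 178, 110, 290, 310, 314, 105, 237, 111, 375, 319, 351, 367, 379, 182, 164, 188, 176,
    194, 326, 206, 119, 99, 113, 123, 243, 218, 125, 101, 344, 200, 220, 52, 214, 196, 208, 336,
    324, 342, 84, 172, 302, 292, 296, 377, 312, 359, 294, 210, 204, 107, 117]
  symmetries := [
    (1751176,0,2,0), (1754704,0,2,0), (1751120,0,1,0), (1745688,0,1,0), (1745632,0,2,0),
    (1742104,0,2,0), (1742048,0,1,0)]
  branches := [
    (107, [1, 2, 1, 2, 1, 2, 1, 1, 6]),
    (108, [1, 2]),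
    (82, [2964284360, 2950734155, 3, 2950734155, 2964284360, 2, 2964284360, 2, 5, 2950734155, 3,
    2945229507, 2, 2, 2963317061, 2, 2, 2950906564, 2, 2, 4, 2, 1, 4]),
    (118, [1, 2, 2])]

def heptad38 : Certificate where
  core := [0, 7, 25, 138, 159, 269, 275]
  order :=
    [43, 75, 99, 105, 106, 111, 123, 107, 235, 363, 53, 85, 373, 102, 230, 358, 166, 198, 226, 228,
    231, 238, 246, 108, 236, 364, 44, 76, 100, 104, 109, 110, 124, 114, 242, 370, 50, 82, 98, 112,
    115, 118, 122, 120, 248, 376, 184, 216, 232, 240, 249, 250, 252, 126, 254, 382, 318, 350, 101,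
    113, 116, 119, 125, 117, 245, 366, 374, 378, 380, 383, 161, 193, 224, 227, 229, 233, 241, 197,
    201, 209, 97, 225, 353, 164, 176, 181, 182, 188, 244, 52, 180, 308, 324, 336, 341, 342, 348,
    372, 84, 212, 340, 289, 321, 352, 355, 357, 361, 369, 290, 296, 299, 302, 314, 362, 46, 54, 58,
    60, 62, 78, 86, 90, 92, 94, 196, 208, 213, 214, 220, 239, 247, 251, 253, 127, 292, 304, 309,
    310, 316, 322, 328, 331, 334, 346, 294, 326, 354, 356, 359, 312, 344, 360, 368, 377, 367, 375,
    379, 381, 163, 165, 169, 177, 195, 172, 204, 237, 178, 210, 243]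
  symmetries := [
    (1745688,0,1,0)]
  branches := [
    (108, [3662156700, 2, 3662156700, 4938039691, 5461903129, 4, 4938039691, 4575867729, 5, 1, 1,
    2, 1, 4588686581, 4044749150, 3, 3057975193, 1, 3, 7]),
    (111, [3933989656, 1, 3, 1, 1, 1, 1, 4, 2658966789, 2, 1, 1, 7]),
    (114, [4462519541, 2, 1, 1, 1, 5]),
    (115, [1, 2]),
    (134, [2152206920, 2, 2, 1951267701, 2, 3, 2]),
    (137, [1]),
    (159, [1]),
    (163, [2864978704, 2951680389, 2957811720, 4, 1958622033, 2864978704, 3, 3, 2951680389, 2, 2,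
    3]),
    (56, [2945487240, 2152206920, 3347772104, 4, 2945487240, 2, 2945487240, 2, 4, 2950906248, 2, 2,
    2, 2950906248, 2, 2, 3355126472, 2, 2, 3, 4]),
    (70, [2152206920, 2, 2252870216, 2, 3]),
    (101, [3347772104, 2, 2454196811, 2, 3])]

def heptad39 : Certificate where
  core := [0, 7, 25, 139, 150, 269, 282]
  order :=
    [46, 78, 102, 106, 108, 111, 126, 110, 238, 366, 51, 83, 99, 113, 114, 119, 123, 115, 243, 371,
    101, 229, 357, 165, 197, 225, 228, 231, 237, 245, 116, 244, 372, 52, 84, 100, 112, 117, 118,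
    124, 120, 248, 376, 184, 216, 232, 240, 249, 250, 252, 162, 194, 224, 227, 230, 234, 242, 98,
    226, 354, 191, 223, 239, 247, 251, 253, 254, 127, 255, 383, 241, 369, 305, 337, 353, 368, 373,
    377, 296, 328, 352, 361, 362, 364, 104, 360, 164, 168, 174, 188, 236, 44, 172, 319, 351, 367,
    375, 379, 381, 382, 196, 200, 206, 220, 76, 204, 358, 294, 326, 356, 359, 374, 53, 60, 63, 125,
    189, 85, 213, 341, 209, 221, 105, 233, 97, 107, 109, 161, 176, 179, 181, 177, 289, 290, 307,
    355, 291, 292, 304, 309, 316, 308, 322, 336, 339, 370, 82, 92, 348, 340, 380, 42, 50, 62, 122,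
    193, 208, 211, 334, 74, 94, 95, 343, 321, 324, 323, 363, 302, 311]
  symmetries := []
  branches := [
    (60, [5360949702, 2360283288, 2521808661, 4, 3051489045, 3, 2521808661, 5360949702, 2,
    3051489045, 3, 4, 3267677592, 2, 2521808661, 3267677592, 2, 4, 2521808661, 2520359829, 5,
    4838408334, 2926010307, 2, 5442388110, 2926010307, 4637286339, 6, 5491288378, 1966696775, 3,
    2926010307, 2, 4435763523, 2926010307, 2, 2926010307, 6, 2926010307, 4637286339, 3, 4435763523,
    4885932394, 2168023402, 3, 2, 2926010307, 2, 2926010307, 4637286339, 9, 4031682953, 2, 2, 1,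
    4031682953, 3726967491, 3, 3223844449, 2, 5, 5360949702, 5049887435, 3, 3262255890, 3,
    3225000314, 2, 5442388110, 3, 5360949702, 2, 3262255890, 3, 4, 3053620665, 2, 5139634827,
    3053620665, 2, 4, 1, 5360949702, 2, 2, 2, 5, 3731120451, 2, 4838408334, 3731120451, 3,
    3026619785, 2, 3731120451, 2120507715, 6, 4634485443, 2, 4657854915, 4634485443, 2, 4431610563,
    3, 2923209411, 2, 2923209411, 3, 4634485443, 2923209411, 4431610563, 8, 1, 5140398222, 2, 2, 3,
    1, 4533324568, 2, 3, 5139634827, 2, 2, 3139566920, 2, 2, 1, 3726967491, 3, 3223844449, 2, 2,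
    13]),
    (93, [2820997656, 4657940935, 3, 3051489045, 3, 3051489045, 3026662778, 2, 2, 2820997656, 2, 2,
    5, 3267677592, 2, 3829412635, 3267677592, 2, 4, 1, 1, 2820997656, 2, 2, 2, 6, 2971622980, 2,
    2971622980, 4030371209, 2, 4, 5491288378, 1966696775, 3, 2971622980, 2, 3, 4436107515,
    4838386840, 4035241702, 2971622980, 3, 2971622980, 4, 2971622980, 4332360856, 2, 3, 4885932394,
    2168023402, 3, 2971622980, 3, 2971622980, 4042950970, 2, 4634522699, 2, 2, 4383992183,
    4876126583, 3, 4, 9, 3127896004, 2, 1, 2, 3, 3225064841, 5442366616, 2120851707, 3330598630,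
    3731464443, 3, 3731464443, 6, 5342488516, 2, 1, 4332360856, 2, 4, 1919524969, 4657940935, 3,
    3262255890, 3, 1919524969, 2, 3262255890, 3, 3, 3053620665, 2, 3053620665, 2, 3, 3, 5361014212,
    2972926660, 2, 2972926660, 3, 2972926660, 2, 2972926660, 4, 4533711640, 2972926660, 3,
    2972926660, 3, 1, 5352586955, 3, 1, 2, 2972926660, 7, 4030371209, 2, 2, 4533711640, 2, 1, 2, 4,
    1, 3139566920, 2, 3, 1, 1, 3, 3829412635, 2, 3730112349, 2, 1, 4, 12]),
    (114, [5367599813, 4533300674, 2, 3, 3627309506, 1, 3, 3627309506, 2, 4533300674, 2, 1, 6,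
    3325322205, 1, 1, 3325322238, 1, 4, 4, 4533279173, 3976831301, 2, 2624181698, 2823798549, 2,
    1919180905, 3, 3976831301, 1919180905, 7, 5338607045, 2, 2974327109, 2, 1, 1, 2974327109, 2,
    2974327109, 5, 1, 5338607045, 2974327109, 2, 2974327109, 8, 1, 4432618494, 2, 1, 4, 1,
    3627331013, 2, 1, 4, 1, 1, 1, 1, 5, 2970222533, 5367599813, 3, 4042950970, 2, 4634522699, 2, 2,
    4582222261, 2, 4, 1, 3980984261, 4, 2822349717, 2, 1, 3, 11]),
    (116, [4475634251, 2, 1, 2, 1, 4, 4660607251, 1, 3, 2, 3]),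
    (128, [1, 4547280584, 4789451654, 2, 3, 1, 2, 1, 2, 5]),
    (129, [3226376585, 3641310923, 4789448966, 3, 1, 1, 1, 6, 1, 1, 4548853067, 1, 5, 1,
    3641310923, 1, 4, 1, 1, 1, 4, 1, 1, 7]),
    (132, [1, 2, 1, 1, 3, 1, 1, 1, 6]),
    (134, [3023910281, 1, 1, 4, 1, 2, 2, 3642883400, 1, 3, 1, 2, 5]),
    (137, [1, 2, 1, 2957513288, 2, 4676523059, 2, 2, 4, 1, 2, 4]),
    (138, [1, 1, 2, 1, 4, 5352586955, 1, 3, 3]),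
    (139, [3745482056, 2, 1, 2, 1, 4, 1, 1, 3, 1, 1, 2, 2, 5]),
    (151, [1, 1, 3]),
    (152, [1, 2, 1, 2, 2957513288, 3, 4676523059, 1, 3, 2, 4]),
    (153, [1, 2, 2, 1, 2, 3]),
    (168, [1, 1, 3, 2])]

def heptad40 : Certificate where
  core := [0, 7, 25, 138, 159, 269, 278]
  order :=
    [43, 75, 99, 105, 106, 111, 123, 107, 235, 363, 53, 85, 101, 113, 116, 119, 125, 117, 245, 373,
    102, 230, 358, 166, 198, 226, 228, 231, 238, 246, 108, 236, 364, 44, 76, 100, 104, 109, 110,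
    124, 114, 242, 370, 50, 82, 98, 112, 115, 118, 122, 120, 248, 376, 184, 216, 232, 240, 249,
    250, 252, 161, 193, 224, 227, 229, 233, 241, 97, 225, 353, 251, 379, 315, 347, 371, 377, 378,
    383, 51, 179, 307, 163, 177, 178, 243, 164, 176, 181, 188, 244, 52, 180, 289, 321, 352, 355,
    357, 361, 369, 324, 336, 341, 348, 372, 84, 212, 83, 211, 339, 195, 209, 210, 126, 254, 382,
    62, 94, 127, 290, 296, 299, 302, 314, 362, 322, 328, 331, 334, 346, 312, 344, 360, 368, 380,
    196, 208, 213, 220, 239, 367, 359, 366, 292, 304, 309, 316, 165, 169, 172, 237, 46, 58, 60, 78,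
    90, 92, 197, 201, 204, 291, 323, 354, 247, 253, 375, 381, 305, 337, 356]
  symmetries := []
  branches := [
    (60, [2319094856, 2, 3347748212, 2, 3, 2160335432, 2, 4281941640, 2621257097, 2, 3, 3,
    4837376152, 3959203061, 3, 4, 3670285104, 3074393478, 3, 3670285104, 2, 3074393478, 4,
    4281941640, 2, 2, 1, 1, 1, 4, 4434731032, 2, 5, 1950880328, 3934038040, 4837376152, 4449093199,
    3959203061, 6, 3934038040, 4837376152, 2839813713, 3959203061, 2971665758, 2, 7, 1, 3731090504,
    2, 2, 2160335432, 2, 4281941640, 2621257097, 2, 2951680389, 4, 3, 4543299874, 2, 3757876469, 3,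
    2951680389, 2, 5, 3757876469, 2, 1, 1, 2, 2, 9]),
    (92, [2319094856, 2, 2844431772, 2, 2441778548, 2, 4, 3355126472, 2, 3464249136, 3127283078, 2,
    3, 3933989656, 2, 4, 3, 3127283078, 2, 4882814325, 3, 2, 3464249136, 2951680389, 3, 2951680389,
    3, 1, 4, 3933989656, 2, 1, 3, 2749579779, 2, 2749579779, 2, 3, 3353554224, 2, 2, 1, 4,
    3731090504, 2, 2, 3355126472, 2, 2, 1, 4, 3024945205, 2, 4033150645, 2, 3, 1, 1, 9]),
    (115, [5488328838, 4575891903, 3, 1, 3945776719, 1, 3, 5790754056, 2, 1, 2, 6, 2647341360, 2,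
    2, 2, 3945776719, 2, 5741284363, 2, 1, 3744406917, 5, 5790754056, 2, 1, 2, 3, 5790754056, 1, 3,
    5790754056, 1, 2, 1, 5, 2951680389, 2, 2, 7]),
    (119, [5695982837, 1, 2, 1, 3074393478, 1, 1, 1, 8, 5340700696, 4359232954, 3, 1, 1, 4, 1, 2,
    1, 1, 3, 5]),
    (120, [1, 1, 3, 1, 1, 1, 1, 4, 4662585679, 2, 1, 1, 1, 3, 2671329027, 2, 2, 1, 9]),
    (121, [2865002910, 2839886271, 2620722145, 1946324449, 5, 5741287006, 1, 3, 3140499717,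
    3643816197, 3, 2, 3828681496, 2, 1, 2, 1, 7]),
    (122, [4469035458, 4655962507, 3, 2659160328, 3, 2659160328, 3375695295, 2, 4, 1, 3]),
    (142, [3355223285, 4033153186, 2851906805, 4, 1, 1, 2, 4]),
    (145, [4575891903, 3024945205, 1946324415, 4, 4549785864, 3642267912, 3, 4033150645,
    5777193351, 3, 4549785864, 1, 6, 3024945205, 1, 2, 4033150645, 1, 5, 1, 2, 1, 5]),
    (147, [4655962507, 2, 2355106242, 2455769538, 3, 3, 5777193351, 2, 5777193351, 3, 1,
    4588686581, 2, 4588686581, 4, 4588686581, 1, 1, 5, 1, 4447402334, 2836789598, 3, 3, 4655962507,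
    2, 4761886049, 2, 4655962507, 4, 1971440885, 2, 1, 3976529864, 2, 2, 9]),
    (148, [1, 2, 2, 2]),
    (150, [2462349554, 4991339765, 4535483275, 4, 1, 4662101852, 2, 1, 1, 1, 7]),
    (152, [1, 1, 3]),
    (159, [1]),
    (166, [1, 2])]

def heptad41 : Certificate where
  core := [0, 7, 25, 138, 149, 269, 278]
  order :=
    [43, 75, 99, 105, 106, 111, 123, 107, 235, 363, 60, 92, 108, 116, 120, 125, 126, 124, 252, 380,
    102, 230, 358, 166, 198, 226, 228, 231, 238, 246, 113, 241, 369, 305, 337, 353, 368, 371, 373,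
    377, 114, 242, 370, 50, 82, 98, 112, 115, 118, 122, 191, 223, 239, 247, 251, 253, 254, 127,
    255, 383, 296, 328, 352, 361, 362, 364, 376, 104, 232, 360, 161, 193, 224, 227, 229, 233, 97,
    225, 51, 179, 307, 163, 178, 187, 243, 90, 346, 210, 216, 219, 222, 250, 302, 314, 316, 319,
    382, 62, 190, 321, 322, 331, 339, 355, 195, 323, 164, 196, 236, 244, 100, 356, 78, 334, 76, 94,
    110, 176, 188, 248, 184, 312, 324, 336, 348, 372, 84, 351, 367, 375, 379, 381, 101, 357, 109,
    117, 289, 290, 292, 304, 169, 172, 175, 237, 46, 58, 63, 83, 95, 119, 208, 220, 344, 299, 291,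
    315, 201, 204, 207, 354, 359, 366, 211, 347, 44, 52, 240, 249, 378]
  symmetries := []
  branches := [
    (60, [5765605067, 3262430650, 3, 5380227656, 2, 3, 4837053642, 4058982249, 2, 3, 3262430650,
    3939521700, 3, 2, 5868491612, 1, 3, 5, 5765605067, 3262430650, 4067737018, 2, 4, 5380227656, 2,
    1, 4, 3262430650, 3939521700, 3, 2, 5167678906, 2, 1, 2, 5, 3242517987, 2, 3242517949, 2,
    5167678906, 1, 3, 1, 1, 2, 1, 1, 1, 11]),
    (92, [5137893063, 3933989656, 2839886271, 4028634718, 5, 4467441227, 2, 2, 1, 4681326152, 2, 3,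
    1, 1, 2353512008, 2, 2, 3737977160, 2, 3636943201, 5362030277, 4, 3, 7]),
    (106, [4757217057, 3066007011, 4278619548, 3, 2462349554, 5066499317, 3, 1, 5, 5882944932, 1,
    1, 4, 4777283043, 2, 5092003061, 3, 3582053621, 4575891903, 2, 3, 3223524661, 2, 1, 1, 8]),
    (120, [3743482187, 5071421003, 3, 2924999301, 2, 2, 3355223285, 4462519541, 3, 4039961987,
    3223645562, 2, 2, 3, 3, 1968661788, 2849466437, 3, 3223645562, 2, 2, 3, 1, 4684078667,
    4470193736, 3, 4837053642, 2, 3, 4684078667, 4470193736, 3, 2, 1, 4, 2353512008, 2, 2, 8]),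
    (121, [2945229128, 2, 1, 2945229128, 4, 1, 4585931716, 4379132182, 3, 4379132182, 3,
    4283941828, 2, 1, 2, 3, 4681326152, 2, 3133992214, 3, 6, 1, 4462519541, 2160359669, 3, 1,
    5857435810, 2, 5, 2945229128, 2, 2945229128, 3, 1, 5340402628, 3223645562, 2, 5486428547, 3,
    4681326152, 2, 4, 2, 5074173512, 2, 3223645562, 2, 1, 3, 3, 3959106248, 2, 2, 5074173512,
    2356264523, 1, 4, 3737977160, 2, 4467441227, 4681326152, 3, 1, 4, 10]),
    (136, [3050779497, 2, 2, 1, 3, 1, 1, 1, 1, 6]),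
    (138, [3261054444, 2851906805, 3, 1, 3127183522, 3, 1, 1, 1, 1, 7]),
    (140, [4469035458, 3375695295, 5374590920, 4, 4588686581, 2, 4066360812, 5374590920, 3,
    5374590920, 5, 1, 4561591857, 2836789598, 4044916004, 2, 4, 2, 1, 1, 6]),
    (141, [1, 1, 1, 2, 4]),
    (144, [1, 1, 3, 1, 3]),
    (145, [2971665758, 2, 2, 2, 1, 3]),
    (153, [3223645562, 1, 3, 1, 1, 4, 1, 1, 4]),
    (154, [1, 2]),
    (155, [1, 2]),
    (164, [1]),
    (165, [1])]

def heptad42 : Certificate where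
  core := [0, 7, 25, 138, 149, 268, 278]
  order :=
    [243, 370, 339, 371, 369, 355, 307, 379, 115, 375, 353, 101, 373, 357, 229, 359, 325, 365, 356,
    293, 127, 95, 123, 119, 125, 111, 383, 63, 255, 126, 166, 226, 102, 246, 198, 228, 231, 230,
    238, 358, 124, 100, 116, 117, 84, 112, 52, 372, 175, 163, 164, 196, 118, 244, 233, 232, 237,
    225, 105, 235, 169, 249, 201, 361, 360, 377, 376, 344, 378, 120, 368, 248, 380, 312, 362, 122,
    107, 98, 106, 110, 104, 187, 190, 178, 314, 250, 58, 184, 251, 239, 191, 223, 253, 254, 247,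
    291, 43, 297, 363, 315, 299, 303, 216, 90, 210, 346, 222, 219, 208, 241, 224, 240, 176, 242,
    323, 335, 331, 329, 75, 347, 367, 351, 382, 319, 381, 114, 51, 99, 113, 83, 205, 109, 236, 173,
    366, 46, 108, 78, 304, 290, 289, 352, 161, 97, 193, 227, 337, 336, 321, 317, 45, 60, 94, 220,
    92, 82, 322, 62, 50, 211, 179, 188, 252, 349, 77, 207, 195, 354, 305]
  symmetries := []
  branches := [
    (73, [3750339275, 4550775029, 2, 4060425703, 2, 3460797718, 2, 5, 5960061173, 2, 5184438418, 2,
    1, 2, 1, 2, 3, 4, 4259443398, 2, 1, 3, 2856850145, 5442366797, 5439657293, 4, 3959181895, 2, 3,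
    2856828826, 3762819809, 3, 5851971041, 2, 5, 3757844474, 2723124566, 3, 3348073501, 2721683798,
    3, 3, 5977971610, 2, 3738171034, 3347686238, 3348073501, 2, 4, 5290531400, 2, 2, 5, 5884342756,
    3863450902, 3, 1, 2, 1, 2, 3, 1, 4, 3460797718, 3347686238, 3863450902, 3, 3, 2856828826,
    5184438418, 2, 2454175457, 4, 3347686238, 2, 9]),
    (84, [1, 1, 2960233678, 2, 2, 4, 4259443398, 5376152782, 3, 4469035458, 3966224322, 4,
    5843697269, 3742888384, 3, 5843697269, 2521797746, 3632021342, 4, 2018481266, 2, 3632021342, 6,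
    2960233678, 2, 2, 1, 1, 2960233678, 2, 6, 1, 1, 2, 1, 4, 3957955934, 1963220939, 2, 3,
    4735014221, 2, 2, 2960233678, 2, 1, 2, 3, 1, 5, 1, 2960233678, 1, 2, 4789448998, 4863925598, 2,
    3, 4, 5290531400, 2, 2354684113, 2, 3, 1, 3, 1, 2, 9]),
    (86, [4747701635, 2, 5050874157, 2, 2836789598, 2, 1, 5, 1, 2542379870, 3750339422, 3,
    5740424033, 2, 3, 1, 5, 4887297817, 2949933262, 2, 3, 2949933262, 1, 3, 1, 4, 2949933262, 2, 2,
    4454982494, 2, 5941559758, 1917818201, 3252815569, 4, 3, 4789790375, 4447402334, 3742931394, 4,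
    5941559758, 3966181312, 3, 2220152010, 2, 4034897607, 5, 2949933262, 2, 1, 6, 5480119867, 2,
    5480119867, 4661308766, 3, 3, 1, 2, 3, 5856688481, 2, 2949933262, 2, 2, 2949933262, 2, 4,
    2949933262, 2, 1, 2, 8]),
    (95, [5960061173, 1, 3, 1, 1, 5480119867, 4676531053, 3, 3, 2, 1, 2, 1, 1, 3, 1, 1, 8]),
    (96, [4737895557, 2, 2542466036, 2743792628, 3, 1, 4, 1, 2, 3943577901, 2, 1, 3, 1, 5,
    5442366797, 1, 5439657293, 1, 5, 5066811387, 2, 2827276753, 2, 2424284871, 2, 4, 4733616461, 1,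
    1, 4, 4, 1, 5140548938, 4735014221, 3, 2, 5140548938, 4735014221, 3, 4, 3662135058, 2,
    5488328906, 2, 2, 1, 2, 4, 1, 1, 2, 3, 1, 2, 1, 1, 3, 8]),
    (97, [5293329653, 4052391284, 2, 4052391284, 2, 3, 3, 4543084750, 2, 4543084750, 2, 3, 2, 1,
    4]),
    (99, [1, 1, 3, 1, 2, 3957955934, 2, 1, 1, 3, 1, 2, 4, 1, 2, 1, 3, 1, 1, 1, 8]),
    (100, [2374067450, 2723124566, 3, 2723124566, 2424411210, 2826714974, 3, 4, 5796624626, 2,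
    3662135058, 4775476795, 2, 3, 1, 4, 2721683798, 1, 3, 1, 5, 1, 2, 4883808860, 2, 2, 3, 1, 2,
    2965660658, 1, 2, 1, 4870094558, 3, 1, 3, 4, 4737895557, 2, 2, 4469000401, 2, 2, 3, 4568448855,
    2, 1, 3, 7]),
    (101, [5884342756, 2, 1, 1, 2, 1, 4, 1, 2, 1, 4863925598, 5796208307, 3, 3, 2, 5]),
    (139, [3726967157, 2320481909, 3148297589, 2, 4, 3729768142, 1, 3, 3251245774, 2, 2, 4,
    3148297589, 2, 4543084750, 2, 4543084750, 2, 3, 3, 4689347189, 2, 5788611790, 2, 2, 1, 6]),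
    (140, [1919172989, 1, 3, 5796646133, 1, 1951203159, 2, 5, 1, 5461860283, 2, 5461860283, 2, 3,
    2, 2521797746, 1817154905, 1, 4, 1917818201, 2, 5058962270, 4, 1, 2, 1, 1, 8]),
    (149, [1, 2, 4487784298, 3758363245, 3, 2, 3]),
    (150, [2152185566, 2, 2520357086, 2, 1, 4, 4870094558, 2, 4870094558, 2, 3, 2, 3]),
    (151, [2146016606, 2, 2827064414, 2, 3, 2826714974, 3531581137, 3, 2827276753, 2, 3,
    3959695280, 4487434948, 3, 2, 1, 1, 3, 5]),
    (157, [1]),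
    (161, [2826938065, 2, 4671703249, 1944346161, 2, 4, 5876652407, 2, 3]),
    (168, [3251245774, 2, 4052391284, 2, 4052391284, 2, 3, 3, 1, 3])]

def heptad43 : Certificate where
  core := [0, 7, 25, 138, 141, 147, 277]
  order :=
    [43, 75, 99, 105, 106, 111, 123, 364, 44, 76, 107, 235, 363, 54, 86, 102, 114, 116, 119, 126,
    118, 246, 104, 109, 110, 124, 120, 248, 376, 184, 216, 232, 240, 249, 250, 252, 161, 193, 224,
    227, 229, 233, 241, 97, 225, 353, 191, 223, 239, 247, 251, 253, 254, 127, 255, 383, 290, 322,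
    352, 355, 358, 362, 370, 78, 90, 92, 95, 304, 306, 312, 354, 302, 310, 314, 316, 319, 382, 62,
    190, 318, 334, 342, 346, 348, 351, 94, 222, 350, 164, 176, 182, 188, 244, 52, 180, 357, 369,
    372, 375, 381, 117, 245, 300, 332, 356, 360, 365, 366, 380, 196, 208, 214, 220, 329, 84, 212,
    230, 166, 374, 108, 236, 100, 198, 228, 231, 238, 242, 50, 82, 112, 115, 122, 379, 315, 347,
    371, 377, 378, 289, 296, 98, 226, 299, 361, 297, 46, 58, 321, 324, 328, 336, 331, 323, 60, 63,
    368, 335, 291, 294, 303, 359, 101, 113, 125, 326, 338, 292, 367, 344]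
  symmetries := [
    (1745688,0,1,0)]
  branches := [
    (56, [3426391194, 1, 1, 1, 1, 6, 4231869714, 1, 1, 1, 1, 6, 1, 1, 3, 1, 2, 1, 1, 1, 2, 8]),
    (91, [1, 2, 1, 1, 1, 1, 1, 7]),
    (102, [3426391194, 2945315523, 4234579398, 4, 4231869714, 2951014084, 4133958859, 4,
    2964262856, 4938039749, 2, 5, 2945315523, 2951014084, 2963403077, 4, 3, 1, 3426391194,
    4234579398, 3, 4231869714, 4133958859, 3, 3769615122, 3939497488, 3, 4938039749, 2, 5,
    3426391194, 4234579398, 3, 4231869714, 4133958859, 3, 4938039749, 2, 4, 2877362184, 3368295045,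
    3783331848, 3, 5, 6067339795, 2, 1, 6]),
    (117, [3426391194, 4234579398, 3, 4231869714, 4133958859, 3, 2360328776, 5078237771, 3,
    4938039749, 2, 5, 4762141545, 2, 3778348382, 2, 1, 1, 4, 4]),
    (127, [2964951363, 2965660996, 2953056965, 2964284363, 5, 2964284363, 3, 6084846536, 1,
    4474257995, 4, 3783380210, 2, 2, 3426391194, 2, 4231869714, 2, 2164590536, 2, 4938039749, 2, 5,
    2, 5]),
    (146, [1, 2]),
    (153, [6092184926, 2, 2, 2]),
    (138, [1])]

def heptad44 : Certificate where
  core := [0, 7, 25, 138, 141, 274, 284]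
  order :=
    [43, 75, 99, 105, 106, 111, 123, 107, 235, 363, 53, 85, 101, 113, 116, 119, 125, 117, 245, 373,
    102, 230, 358, 166, 198, 226, 228, 231, 238, 246, 108, 236, 364, 44, 76, 100, 104, 109, 110,
    124, 120, 248, 376, 184, 216, 232, 240, 249, 250, 252, 161, 193, 224, 227, 229, 233, 241, 97,
    225, 353, 191, 223, 239, 247, 251, 253, 254, 127, 255, 383, 46, 54, 58, 63, 126, 62, 190, 51,
    179, 163, 177, 183, 187, 243, 83, 211, 323, 337, 343, 347, 371, 114, 242, 98, 112, 115, 118,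
    122, 164, 176, 181, 182, 244, 52, 180, 289, 321, 352, 355, 357, 361, 369, 319, 351, 367, 375,
    379, 381, 382, 294, 326, 354, 356, 359, 366, 374, 78, 86, 90, 95, 94, 222, 196, 208, 213, 214,
    84, 212, 299, 291, 297, 303, 315, 296, 328, 362, 360, 309, 293, 305, 311, 195, 209, 215, 219,
    325, 329, 335, 365, 292, 324, 372, 368, 377, 378, 302, 334, 331, 341]
  symmetries := []
  branches := [
    (60, [6181469768, 5373410888, 3762819996, 4067540754, 5, 2877362202, 2, 5790238046, 1,
    2218431642, 4, 4684121825, 2, 4735148530, 3, 5140398458, 2, 1, 7, 4973510219, 5977390667,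
    2745730455, 4, 2658254411, 2, 1, 1, 5, 4182643894, 4561634715, 3, 3783380232, 5035780918,
    4067758576, 3, 4, 4182643894, 5442581885, 2, 3, 4887286966, 2, 2, 5442581885, 2, 4, 4182643894,
    4561395595, 3, 1, 4737938813, 2, 4, 1, 2, 1, 6, 3780012483, 2, 3075981975, 5442581885, 2,
    4733401469, 2, 4, 1, 5442581885, 2, 4733401469, 2, 1, 7, 4557505951, 1, 3, 4280288606, 1, 3,
    3682716954, 1, 3, 2421166743, 2, 2, 5, 2575420680, 4561634715, 3775131075, 2877410568, 5,
    4373570583, 2, 4972351841, 4561395595, 3, 1, 4737938813, 4373570583, 3, 6, 2776747272, 2,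
    4067758576, 2, 3, 4445520826, 2, 6042223093, 2, 6067143613, 2, 1, 6, 1, 2421166743, 2, 1, 3,
    2421166743, 2, 4, 1, 1, 2, 1, 4, 2575420698, 2, 1, 3, 2963523826, 2, 2, 3, 2575420698, 2, 2,
    12]),
    (98, [6065829276, 2, 3051446049, 2, 1, 3783380250, 5, 1, 1, 4, 1, 2, 1, 3682716954, 3,
    3682716954, 3, 4560815044, 2, 2575420680, 5857828260, 4, 3653877643, 3, 3179400474, 1, 1, 4, 1,
    2, 2575420698, 2, 2, 3, 1, 4067758576, 2, 2, 3, 2963523826, 2, 2575420698, 3, 2, 1, 2,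
    2575420698, 2, 3, 10]),
    (99, [5883031086, 2658254411, 2, 4372960441, 2, 5677261139, 2, 2, 5857478956, 6, 4182643894,
    4561634715, 3, 4182643894, 2, 3, 4280288606, 2, 4972351841, 4561634715, 3, 1, 6067143613, 2, 3,
    5, 4561634715, 3654095259, 3466990909, 1, 5, 5769392609, 2, 2, 4561395595, 2, 3466990909, 5,
    4272224671, 1, 1, 4, 4561634715, 4561395595, 3046728613, 4, 4259644827, 1, 3682716936, 4,
    5681704494, 6042223093, 3, 1, 1, 5, 5678951980, 1, 1, 1, 5, 4259644827, 5681704494, 6042223093,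
    6067143613, 5, 1, 2, 1, 2, 2, 1, 12]),
    (100, [5442388349, 2360285998, 4733595005, 4, 4556678151, 2, 1, 1, 1, 6, 4737745277, 2,
    3775518087, 1, 1, 4, 1, 1, 5, 3783380232, 2, 1, 3, 1, 2, 4053385765, 2, 4053385765, 3, 1, 1, 3,
    1, 2, 1, 2, 1, 10]),
    (105, [3942508188, 2474708936, 3368294987, 3, 2, 3248568505, 2, 2, 5791614305, 2, 5,
    4973510219, 5977390667, 3, 1, 3, 1, 1, 1, 2, 1, 2, 7]),
    (112, [6181469768, 5373410888, 3262234386, 4, 1, 4684121825, 2, 2, 4, 4283941512, 6067447449,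
    5763605195, 2, 4, 5957351777, 2, 4445520826, 2, 2, 4, 6042091269, 5980855710, 2877410568, 4, 1,
    2963330293, 2, 4, 1, 2963330293, 2, 3, 2963330293, 2, 2, 1, 2, 5, 3783380232, 5035780918,
    4067758576, 3, 3, 1, 2, 1, 2, 4, 4557505951, 2, 2, 2877410568, 2, 1, 1, 4, 4445520826, 2, 1, 1,
    4, 1, 1, 3, 1, 2, 2, 10]),
    (119, [1, 1918140869, 4838774213, 3, 5439786365, 2, 3, 3, 1, 6046712258, 2, 3783380232, 3, 3,
    2745445558, 3869644093, 2, 3, 1, 5]),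
    (138, [1918140869, 2, 5439786365, 2, 3, 1, 2, 2963330293, 2, 4, 1, 1918140869, 4838774213, 3,
    5439786365, 2, 3, 6043228610, 2, 1, 3, 1, 6]),
    (140, [3932804549, 2, 2, 2877410568, 5882552482, 3, 3, 1, 6046712258, 2, 1, 3, 1, 5]),
    (141, [4474260741, 2353315787, 2, 3769569469, 2, 2, 1, 5, 4735143293, 2, 2, 1, 2, 1, 5]),
    (142, [1, 2, 2963330293, 2, 3, 1, 5049500602, 2, 3, 1, 1, 2, 2, 1, 6]),
    (143, [1, 1, 2, 3, 1, 1, 3, 1, 2, 1, 1, 6]),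
    (147, [1, 2, 2]),
    (148, [1, 2, 2]),
    (149, [1, 1, 2, 3]),
    (159, [3377974687, 2, 2, 2]),
    (165, [1, 2])]

def heptad45 : Certificate where
  core := [0, 7, 25, 139, 150, 270, 275]
  order :=
    [45, 77, 101, 105, 108, 111, 125, 109, 237, 365, 58, 90, 106, 114, 120, 123, 126, 122, 250,
    378, 113, 241, 369, 177, 209, 225, 240, 243, 245, 249, 116, 244, 372, 52, 84, 100, 112, 117,
    118, 124, 162, 194, 224, 227, 230, 234, 242, 98, 226, 354, 191, 223, 239, 247, 251, 253, 254,
    127, 255, 383, 296, 328, 352, 361, 362, 364, 376, 104, 232, 360, 229, 357, 293, 325, 353, 356,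
    359, 373, 60, 188, 316, 172, 184, 189, 252, 92, 220, 348, 340, 344, 349, 380, 319, 351, 367,
    375, 379, 381, 382, 196, 200, 205, 236, 76, 204, 53, 181, 309, 308, 317, 85, 213, 341, 197,
    221, 99, 355, 97, 107, 115, 102, 358, 228, 231, 238, 161, 168, 173, 233, 297, 186, 314, 42, 50,
    62, 218, 346, 74, 82, 94, 176, 208, 248, 368, 289, 290, 292, 304, 321, 322, 324, 336, 63, 95,
    119, 329, 363, 377, 164, 44, 301, 333, 370, 374, 193, 110, 165, 216, 312]
  symmetries := [
    (1751176,0,2,0)]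
  branches := [
    (60, [3429326475, 1, 1, 2, 4, 5238341575, 6144483271, 1, 3, 6144483271, 1, 2, 5, 1, 5641166760,
    2, 6077879243, 2, 2, 6]),
    (81, [3429326475, 5239717827, 5763995334, 2, 4, 5238341575, 3426574015, 5793872452, 2, 4,
    5643919270, 4234412569, 4234436757, 4684982213, 3, 4, 1, 5, 3429326475, 5239717827, 3,
    5238341575, 3426574015, 3, 5643919270, 4234412569, 3, 4, 1, 2, 4751728146, 1, 3, 3743546696, 2,
    2, 6]),
    (127, [3223667081, 3629438402, 3, 6145442713, 2, 1, 2, 1, 1, 6]),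
    (129, [6147235779, 2, 5643919270, 3, 2, 6145442713, 6072863641, 3, 5238341575, 2, 2, 1, 3,
    5366820292, 5845020038, 2, 3, 1, 5970800071, 5946070466, 3, 2965641800, 3, 5777924551, 2, 5, 1,
    5960050376, 2745730418, 2, 4, 6]),
    (130, [1, 2]),
    (132, [1, 2663694923, 3, 3141502280, 2, 3644818760, 4550764232, 3, 4]),
    (144, [1, 2, 2]),
    (145, [1, 6249855649, 4764896697, 4, 1, 3]),
    (146, [1]),
    (147, [1, 2])]

def heptad46 : Certificate where
  core := [0, 7, 25, 139, 149, 269, 278]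
  order :=
    [46, 78, 102, 106, 108, 111, 126, 110, 238, 366, 51, 83, 99, 113, 114, 119, 123, 115, 243, 371,
    116, 244, 372, 52, 84, 100, 112, 117, 118, 124, 120, 248, 376, 184, 216, 232, 240, 249, 250,
    252, 161, 193, 224, 227, 229, 233, 241, 97, 225, 353, 191, 223, 239, 247, 251, 253, 254, 127,
    255, 383, 290, 322, 352, 355, 358, 362, 370, 98, 226, 354, 58, 186, 314, 42, 50, 62, 122, 90,
    218, 346, 330, 344, 347, 378, 164, 168, 174, 188, 236, 44, 172, 319, 351, 367, 375, 379, 381,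
    382, 324, 328, 334, 348, 364, 76, 204, 194, 208, 211, 242, 82, 210, 230, 166, 198, 228, 231,
    246, 369, 305, 337, 368, 373, 377, 101, 105, 125, 109, 237, 60, 316, 312, 380, 92, 95, 94, 222,
    162, 176, 179, 178, 196, 200, 206, 220, 234, 74, 104, 107, 289, 292, 296, 304, 291, 298, 315,
    363, 321, 336, 339, 357, 356, 359, 63, 190, 361, 360, 302, 307, 323]
  symmetries := []
  branches := [
    (60, [3427767498, 1, 1, 1, 5, 4234622226, 6358378948, 5644059003, 4, 2, 4234622226, 2,
    4234622226, 2, 3, 2, 4234622226, 2, 1, 6]),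
    (90, [2964284740, 4131206299, 3, 4131206299, 3, 2958070083, 2951680709, 3, 3765550864, 3, 1,
    4751730840, 3, 4749279468, 4233396674, 3, 1, 1, 2, 1, 1, 9]),
    (91, [4131206299, 3829264849, 6355239367, 2, 4, 4234622226, 4131206299, 3, 4131206299,
    4234622226, 2, 6355239367, 3, 5740101700, 5945952196, 5644059003, 6355239367, 5341972423, 2, 6,
    4234622226, 6358378948, 3, 6, 3829068568, 6358378948, 6355239367, 3, 6355239367, 4, 4131206299,
    1, 3, 1, 4234622226, 2, 2, 1, 2, 8]),
    (112, [3427767498, 4231826886, 3, 4233396674, 4939416005, 3, 3, 1, 5845283506, 2, 2965639112,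
    2, 1, 2, 5, 4764894009, 3050779497, 3946378768, 4233396674, 5, 5884385722, 4939416005, 2,
    4936276419, 2, 2, 4, 3656323707, 5856806890, 2965639112, 5970719430, 2, 3, 4, 1, 5845283506, 2,
    5878783980, 1, 5, 3427767498, 2, 4656010946, 4939416005, 3, 3, 6147375554, 4939416005, 3, 1,
    10]),
    (118, [5186215265, 4359232865, 1, 1, 5, 1, 2, 2, 6066025381, 1, 3, 3051642277, 1, 1, 4, 1, 2,
    1, 2, 1, 2, 2, 1, 9]),
    (128, [3769590946, 2, 1, 1, 4, 6360722707, 1, 2, 1, 4, 3]),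
    (129, [1, 4233396674, 1, 3, 3]),
    (148, [4231826886, 2, 6249852955, 3, 4231826886, 4739296024, 3, 6260064587, 2, 6072866323, 2,
    6360722707, 4233396674, 1, 8]),
    (149, [3267656098, 6286173346, 3769590946, 3, 3, 1, 1, 2, 6147375554, 1, 4939416005, 4, 5]),
    (150, [1, 2, 2]),
    (151, [1, 2, 1, 2, 3]),
    (152, [1, 1, 2, 1, 4]),
    (153, [1]),
    (154, [1]),
    (162, [6147375554, 1, 4939416005, 4]),
    (166, [1, 2])]

/-- The certificates for the codes with seven words in the corner. -/
def heptads : List Certificate :=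
  [heptad0, heptad1, heptad2, heptad3, heptad4, heptad5, heptad6, heptad7, heptad8, heptad9,
  heptad10, heptad11, heptad12, heptad13, heptad14, heptad15, heptad16, heptad17, heptad18,
  heptad19, heptad20, heptad21, heptad22, heptad23, heptad24, heptad25, heptad26, heptad27,
  heptad28, heptad29, heptad30, heptad31, heptad32, heptad33, heptad34, heptad35, heptad36,
  heptad37, heptad38, heptad39, heptad40, heptad41, heptad42, heptad43, heptad44, heptad45,
  heptad46]

theorem heptad0_check :
    heptad0.check
      (octads.map Certificate.core ++ (heptads.take 0).map Certificate.core) 7 20 = true := by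
  decide +kernel

theorem heptad1_check :
    heptad1.check
      (octads.map Certificate.core ++ (heptads.take 1).map Certificate.core) 7 20 = true := by
  decide +kernel

theorem heptad2_check :
    heptad2.check
      (octads.map Certificate.core ++ (heptads.take 2).map Certificate.core) 7 20 = true := by
  decide +kernel

theorem heptad3_check :
    heptad3.check
      (octads.map Certificate.core ++ (heptads.take 3).map Certificate.core) 7 20 = true := by
  decide +kernel

theorem heptad4_check :
    heptad4.check
      (octads.map Certificate.core ++ (heptads.take 4).map Certificate.core) 7 20 = true := by
  decide +kernel

theorem heptad5_check :
    heptad5.check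
      (octads.map Certificate.core ++ (heptads.take 5).map Certificate.core) 7 20 = true := by
  decide +kernel

theorem heptad6_check :
    heptad6.check
      (octads.map Certificate.core ++ (heptads.take 6).map Certificate.core) 7 20 = true := by
  decide +kernel

theorem heptad7_check :
    heptad7.check
      (octads.map Certificate.core ++ (heptads.take 7).map Certificate.core) 7 20 = true := by
  decide +kernel

theorem heptad8_check :
    heptad8.check
      (octads.map Certificate.core ++ (heptads.take 8).map Certificate.core) 7 20 = true := by
  decide +kernel

theorem heptad9_check :
    heptad9.check
      (octads.map Certificate.core ++ (heptads.take 9).map Certificate.core) 7 20 = true := by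
  decide +kernel

theorem heptad10_check :
    heptad10.check
      (octads.map Certificate.core ++ (heptads.take 10).map Certificate.core) 7 20 = true := by
  decide +kernel

theorem heptad11_check :
    heptad11.check
      (octads.map Certificate.core ++ (heptads.take 11).map Certificate.core) 7 20 = true := by
  decide +kernel

theorem heptad12_check :
    heptad12.check
      (octads.map Certificate.core ++ (heptads.take 12).map Certificate.core) 7 20 = true := by
  decide +kernel

theorem heptad13_check :
    heptad13.check
      (octads.map Certificate.core ++ (heptads.take 13).map Certificate.core) 7 20 = true := by
  decide +kernel

theorem heptad14_check :
    heptad14.check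
      (octads.map Certificate.core ++ (heptads.take 14).map Certificate.core) 7 20 = true := by
  decide +kernel

theorem heptad15_check :
    heptad15.check
      (octads.map Certificate.core ++ (heptads.take 15).map Certificate.core) 7 20 = true := by
  decide +kernel

theorem heptad16_check :
    heptad16.check
      (octads.map Certificate.core ++ (heptads.take 16).map Certificate.core) 7 20 = true := by
  decide +kernel

theorem heptad17_check :
    heptad17.check
      (octads.map Certificate.core ++ (heptads.take 17).map Certificate.core) 7 20 = true := by
  decide +kernel

theorem heptad18_check :
    heptad18.check
      (octads.map Certificate.core ++ (heptads.take 18).map Certificate.core) 7 20 = true := by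
  decide +kernel

theorem heptad19_check :
    heptad19.check
      (octads.map Certificate.core ++ (heptads.take 19).map Certificate.core) 7 20 = true := by
  decide +kernel

theorem heptad20_check :
    heptad20.check
      (octads.map Certificate.core ++ (heptads.take 20).map Certificate.core) 7 20 = true := by
  decide +kernel

theorem heptad21_check :
    heptad21.check
      (octads.map Certificate.core ++ (heptads.take 21).map Certificate.core) 7 20 = true := by
  decide +kernel

theorem heptad22_check :
    heptad22.check
      (octads.map Certificate.core ++ (heptads.take 22).map Certificate.core) 7 20 = true := by
  decide +kernel

theorem heptad23_check :
    heptad23.check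
      (octads.map Certificate.core ++ (heptads.take 23).map Certificate.core) 7 20 = true := by
  decide +kernel

theorem heptad24_check :
    heptad24.check
      (octads.map Certificate.core ++ (heptads.take 24).map Certificate.core) 7 20 = true := by
  decide +kernel

theorem heptad25_check :
    heptad25.check
      (octads.map Certificate.core ++ (heptads.take 25).map Certificate.core) 7 20 = true := by
  decide +kernel

theorem heptad26_check :
    heptad26.check
      (octads.map Certificate.core ++ (heptads.take 26).map Certificate.core) 7 20 = true := by
  decide +kernel

theorem heptad27_check :
    heptad27.check
      (octads.map Certificate.core ++ (heptads.take 27).map Certificate.core) 7 20 = true := by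
  decide +kernel

theorem heptad28_check :
    heptad28.check
      (octads.map Certificate.core ++ (heptads.take 28).map Certificate.core) 7 20 = true := by
  decide +kernel

theorem heptad29_check :
    heptad29.check
      (octads.map Certificate.core ++ (heptads.take 29).map Certificate.core) 7 20 = true := by
  decide +kernel

theorem heptad30_check :
    heptad30.check
      (octads.map Certificate.core ++ (heptads.take 30).map Certificate.core) 7 20 = true := by
  decide +kernel

theorem heptad31_check :
    heptad31.check
      (octads.map Certificate.core ++ (heptads.take 31).map Certificate.core) 7 20 = true := by
  decide +kernel

theorem heptad32_check :
    heptad32.check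
      (octads.map Certificate.core ++ (heptads.take 32).map Certificate.core) 7 20 = true := by
  decide +kernel

theorem heptad33_check :
    heptad33.check
      (octads.map Certificate.core ++ (heptads.take 33).map Certificate.core) 7 20 = true := by
  decide +kernel

theorem heptad34_check :
    heptad34.check
      (octads.map Certificate.core ++ (heptads.take 34).map Certificate.core) 7 20 = true := by
  decide +kernel

theorem heptad35_check :
    heptad35.check
      (octads.map Certificate.core ++ (heptads.take 35).map Certificate.core) 7 20 = true := by
  decide +kernel

theorem heptad36_check :
    heptad36.check
      (octads.map Certificate.core ++ (heptads.take 36).map Certificate.core) 7 20 = true := by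
  decide +kernel

theorem heptad37_check :
    heptad37.check
      (octads.map Certificate.core ++ (heptads.take 37).map Certificate.core) 7 20 = true := by
  decide +kernel

theorem heptad38_check :
    heptad38.check
      (octads.map Certificate.core ++ (heptads.take 38).map Certificate.core) 7 20 = true := by
  decide +kernel

theorem heptad39_check :
    heptad39.check
      (octads.map Certificate.core ++ (heptads.take 39).map Certificate.core) 7 20 = true := by
  decide +kernel

theorem heptad40_check :
    heptad40.check
      (octads.map Certificate.core ++ (heptads.take 40).map Certificate.core) 7 20 = true := by
  decide +kernel

theorem heptad41_check :
    heptad41.check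
      (octads.map Certificate.core ++ (heptads.take 41).map Certificate.core) 7 20 = true := by
  decide +kernel

theorem heptad42_check :
    heptad42.check
      (octads.map Certificate.core ++ (heptads.take 42).map Certificate.core) 7 20 = true := by
  decide +kernel

theorem heptad43_check :
    heptad43.check
      (octads.map Certificate.core ++ (heptads.take 43).map Certificate.core) 7 20 = true := by
  decide +kernel

theorem heptad44_check :
    heptad44.check
      (octads.map Certificate.core ++ (heptads.take 44).map Certificate.core) 7 20 = true := by
  decide +kernel

theorem heptad45_check :
    heptad45.check
      (octads.map Certificate.core ++ (heptads.take 45).map Certificate.core) 7 20 = true := by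
  decide +kernel

theorem heptad46_check :
    heptad46.check
      (octads.map Certificate.core ++ (heptads.take 46).map Certificate.core) 7 20 = true := by
  decide +kernel

theorem heptads_check (i : ℕ) (hi : i < heptads.length) :
    (heptads[i]).check
      (octads.map Certificate.core ++ (heptads.take i).map Certificate.core) 7 20 = true := by
  have hi' : i < 47 := hi
  interval_cases i
  exacts
    [heptad0_check, heptad1_check, heptad2_check, heptad3_check, heptad4_check, heptad5_check,
    heptad6_check, heptad7_check, heptad8_check, heptad9_check, heptad10_check, heptad11_check,
    heptad12_check, heptad13_check, heptad14_check, heptad15_check, heptad16_check, heptad17_check,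
    heptad18_check, heptad19_check, heptad20_check, heptad21_check, heptad22_check, heptad23_check,
    heptad24_check, heptad25_check, heptad26_check, heptad27_check, heptad28_check, heptad29_check,
    heptad30_check, heptad31_check, heptad32_check, heptad33_check, heptad34_check, heptad35_check,
    heptad36_check, heptad37_check, heptad38_check, heptad39_check, heptad40_check, heptad41_check,
    heptad42_check, heptad43_check, heptad44_check, heptad45_check, heptad46_check]

theorem heptads_excluded :
    ∀ A ∈ octads.map Certificate.core ++ heptads.map Certificate.core,
      ∀ C, IsBig C → ¬ ∀ a ∈ A, dec a ∈ C :=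
  excluded_of_checks (r := 7) heptads_check octads_excluded count_le_seven (by norm_num)
    (by norm_num)

/-- The seven words of a code in the corner. -/
def heptadCode : List ℕ :=
  [2081738078, 2081738040, 4398348488, 2183755976, 2183756046, 4398348558, 7, 2081737970,
  4396993736, 2182401224, 2182401354, 4396993866, 6, 3491024252, 5203654856, 4197043403,
  4901664968, 5505644744, 6, 1880411516, 5200752006, 4900310216, 2283064520, 1982429384, 6,
  3491024072, 5202300104, 5504289992, 4, 1880411336, 5203461510, 1981074632, 4, 7, 2081737928,
  2484391112, 6208933064, 2383727816, 2383727928, 2484391224, 6208933176, 8, 2786381000,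
  3190410443, 6309596360, 3289697480, 5, 2585054408, 4497657032, 3390360776, 3793013960,
  2887044296, 6, 2585054450, 4095003848, 3, 2786381042, 5403626696, 3692350664, 4, 4497608760, 2,
  5403578424, 2, 8, 3891548540, 4900288715, 2683610315, 6104786120, 3084887240, 6, 2787757259,
  6310972619, 3291073739, 4398369995, 5, 3492400511, 5504268491, 5202278603, 4, 3891569867,
  6106162379, 3086263499, 4, 4797539531, 2, 4796163272, 2, 7, 3895053554, 2685717704, 5000973512,
  6004122824, 4594836680, 6, 2585054561, 4096358603, 2485745867, 4, 3895053695, 6108248267,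
  3088349387, 4, 1880411381, 5101636808, 5098153160, 5705616584, 3591687368, 6, 3994340552,
  5903459528, 3, 6, 2582925554, 3388231883, 4091520200, 4, 2582925665, 4092874955, 3, 3,
  2784252146, 5400143048, 3185550536, 3688867016, 5, 2784273791, 6306091211, 3286192331, 4, 3,
  4493781048, 3990856904, 3, 6306112712, 6108269768, 4799625419, 4, 3789530312, 6007606472,
  5906943176, 4, 4, 2784252284, 3286213832, 3, 3893677256, 3088370888, 3, 4799646920, 2, 4,
  2582925692, 4494173384, 2883560648, 4, 3891569906, 4598320328, 3, 3, 1, 5399750712, 2, 2, 12,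
  2083114184, 2083114248, 2485767368, 6210309320, 2385104072, 2385104136, 2485767432, 6210309384,
  9, 2083114364, 2484369608, 6208911560, 2383706312, 2383706436, 2484369732, 6208911684, 8,
  1881787634, 3593063627, 2284440779, 5002349771, 5103013067, 5099529419, 5706992843, 8,
  3492400370, 5301415296, 5000952011, 5606329547, 6512277704, 6507439304, 4297685192, 8,
  1881787742, 3589967229, 5101615307, 5098131659, 5705595083, 6, 3492400478, 5302963400,
  6510922952, 6508794056, 4296330440, 6, 7, 2083114334, 4396972232, 2182379720, 2182379838,
  4396972350, 6, 2586430814, 3391737035, 4094982344, 4, 2787757406, 5403605192, 3190388939,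
  3692329160, 5, 2787757436, 6309574856, 3289675976, 4, 2586430844, 4497635528, 3792992456,
  2887022792, 5, 4497630276, 2, 5403599940, 2, 8, 3893677436, 4901686475, 2687093963, 6109624520,
  3089725640, 6, 2586430667, 3794390219, 2888420555, 2183777483, 4499033291, 6, 1881787775,
  1981053131, 5203504516, 4, 3893677301, 6005499083, 4596212939, 4, 3995716811, 2, 5904835787, 2,
  7, 3891570014, 2683588808, 5002328264, 6008961224, 4599675080, 6, 2786381153, 3693705419,
  6210287819, 5404981451, 5, 3891548405, 6007584971, 4598298827, 4, 3491024117, 6510901451,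
  6508815563, 4296308939, 5304167806, 6, 6411635915, 5802796232, 3, 5804172491, 2, 7, 2784273608,
  3186926792, 6307488968, 3287590088, 5, 2784252257, 3690221771, 5401497803, 4, 3, 2582947016,
  4495549640, 3388253384, 3790906568, 2884936904, 6, 2582947199, 3789508811, 2883539147,
  4494151883, 5, 4698983624, 2989062347, 3, 2987707592, 4696854731, 3, 5, 2582947166, 4092896456,
  3, 3891548360, 6106140872, 3086241992, 4, 3990835403, 2, 5906921675, 2, 5, 2784273758,
  5401519304, 3690243272, 4, 3895053662, 6005477576, 4596191432, 4, 5806258379, 2, 5806279880,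
  6406776008, 3, 5, 4492404744, 2, 2, 1, 1, 5398374408, 2, 2, 13, 2083114226, 4398369992,
  2183777480, 2183777562, 4398370074, 6, 2582947058, 3388253387, 4091498696, 4, 2784273650,
  5400121544, 3185550539, 3688845512, 5, 4493759556, 6306091208, 3789508808, 4, 2784273788,
  3286192328, 3, 2582947196, 4494151880, 2883539144, 4, 5399729220, 2, 8, 3492400328, 5203676360,
  4197043400, 4901686472, 5505666248, 6, 3891570044, 4900310219, 2683588811, 6104764616,
  3084865736, 6, 2786381183, 6310951115, 3291052235, 4398348491, 5, 3491024075, 5504289995,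
  5202300107, 4, 3891548363, 6106140875, 3086241995, 4, 4797518027, 2, 4796141768, 2, 8,
  1881787592, 5200708998, 4900288712, 2284440776, 1982450888, 6, 3893677406, 2685717707,
  5000952008, 6004101320, 4594815176, 6, 2586430709, 4096380107, 2485767371, 4, 3893677259,
  6108269771, 3088370891, 4, 1881787745, 5101615304, 5098131656, 5705595080, 3589967233, 6,
  3994319048, 5903438024, 3, 7, 6108248264, 4799646923, 3, 6007584968, 3990835400, 5906921672, 4,
  3, 3492400508, 5202278600, 5504268488, 4, 3895053692, 3088349384, 3, 2784252287, 6306112715,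
  3286213835, 4, 4799625416, 2, 5, 1881787772, 5203504518, 1981053128, 4, 3891548402, 4598298824,
  3, 2582947169, 4092896459, 3, 4, 1, 1, 9, 2081738108, 2485745864, 6210287816, 2385082568,
  2385082644, 2485745940, 6210287892, 8, 2784252104, 3186926795, 6307467464, 3287568584, 5,
  2582925512, 4495528136, 3388231880, 3790885064, 2884915400, 6, 2582925662, 4092874952, 3,
  2784252254, 5401497800, 3690221768, 4, 4492383252, 2, 5398352916, 2, 8, 3895053512, 4901664971,
  2687093960, 6109646024, 3089747144, 6, 1880411486, 3591343485, 2283064523, 5002328267,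
  5102991563, 5099507915, 5706971339, 8, 2585054591, 3794368715, 2888399051, 2183755979,
  4499011787, 6, 1880411339, 1981074635, 5203461508, 4, 3895053665, 6005477579, 4596191435, 4,
  3995695307, 2, 5904814283, 2, 8, 3891548510, 2683610312, 5002349768, 6008982728, 4599696584, 6,
  3491024222, 5304339656, 5000973515, 5606329544, 6512299208, 6507417800, 4297706696, 8,
  2787757301, 3693726923, 6210309323, 5405002955, 5, 3891569909, 6007606475, 4598320331, 4,
  3492400481, 6510922955, 6508794059, 4296330443, 5302963403, 6, 6411614411, 5802774728, 3,
  5804150987, 2, 8, 5101636811, 2, 6510901448, 5806279883, 3, 3, 3891569864, 6106162376,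
  3086263496, 4, 1880411378, 3591687371, 5098153163, 5705616587, 5, 2582925695, 3789530315,
  2883560651, 4494173387, 5, 3990856907, 2, 5906943179, 2, 6, 3893677298, 6005499080, 4596212936,
  4, 3491024114, 5304167808, 6508815560, 4296308936, 5, 2784273761, 3690243275, 5401519307, 4,
  5806258376, 6406776011, 3, 5, 4700359883, 2989083851, 3, 2, 1, 2987686088, 4696876235, 3, 2, 1,
  11, 3994340555, 4497608758, 3, 4497657035, 5403626699, 5403578422, 4, 3, 6411635912, 4698983627,
  3, 2987707595, 4497630274, 3, 5804172488, 2, 5403605195, 4497635531, 5403599938, 4, 5,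
  3994319051, 2, 2, 4700359880, 6411614408, 3, 5804150984, 2, 2987686091, 2, 4, 5, 2585054558,
  3390360779, 4096358600, 4, 2582925557, 4091520203, 2484391115, 4, 2585054453, 4095003851, 3, 4,
  2787757256, 3190410440, 6310972616, 3291073736, 5, 2784252149, 3688867019, 6208933067,
  5400143051, 5, 2786381045, 3692350667, 3, 4, 3491024255, 5505644747, 4396993739, 5203654859, 5,
  1880411519, 1982429387, 2182401227, 5200752004, 5, 2081738081, 2183756044, 4398348556,
  2081738038, 5, 2081737973, 2182401352, 4396993864, 4, 5, 3891548543, 6104786123, 3084887243, 4,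
  3895053557, 6004122827, 4594836683, 4, 3, 2786381003, 6309596363, 3289697483, 4, 2585054411,
  3793013963, 2887044299, 4, 2081737931, 2383727819, 2383727926, 2484391222, 6208933174, 6, 4,
  4796163275, 5399750710, 3, 4493781046, 2, 3, 4797539528, 5903459531, 3, 2, 8, 2786381150,
  5404981448, 3190388936, 3693705416, 5, 2784273611, 6307488971, 3287590091, 4396972235, 5,
  2787757439, 6309574859, 3289675979, 4, 4, 2586430664, 4499033288, 3391737032, 3794390216,
  2888420552, 6, 2582947019, 3790906571, 2884936907, 2182379723, 4495549643, 6, 2586430847,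
  3792992459, 2887022795, 4, 2989062344, 4696854728, 3, 5, 3893677439, 6109624523, 3089725643, 4,
  3891570017, 6008961227, 4599675083, 4, 3, 1881787637, 5103013064, 5099529416, 5706992840,
  2484369611, 3593063624, 7, 3492400373, 6512277707, 6507439307, 4297685195, 6208911563,
  5301415294, 7, 2083114187, 2385104075, 2385104134, 2485767430, 6210309382, 2083114246, 7,
  2083114367, 2383706315, 2383706434, 2484369730, 6208911682, 6, 5, 2586430817, 4094982347, 3,
  2787757409, 3692329163, 3, 2083114337, 2182379836, 4396972348, 4, 4, 3995716808, 5802796235,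
  4492404742, 4, 5904835784, 5398374406, 3, 3, 7, 2786381180, 6310951112, 3291052232, 4,
  3492400331, 5505666251, 5203676363, 4, 3891570047, 6104764619, 3084865739, 4, 4796141771, 2,
  4797518024, 2, 6, 2586430706, 4096380104, 3, 1881787595, 1982450891, 5200708996, 4, 3893677409,
  6004101323, 4594815179, 4, 5903438027, 2, 5, 2582947061, 4091498699, 3, 2784273653, 3688845515,
  5400121547, 4, 2083114229, 2183777560, 4398370072, 4, 4493759554, 5399729218, 3, 5, 1, 1, 6,
  2585054588, 4499011784, 3794368712, 2888399048, 5, 3895053515, 6109646027, 3089747147, 4,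
  1880411489, 5102991560, 5099507912, 5706971336, 3591343489, 6, 3995695304, 5904814280, 3, 5,
  2787757298, 5405002952, 3693726920, 4, 3891548513, 6008982731, 4599696587, 4, 3491024225,
  6512299211, 6507417803, 4297706699, 5304339659, 6, 5802774731, 2, 5, 2784252107, 6307467467,
  3287568587, 4, 2582925515, 3790885067, 2884915403, 4495528139, 5, 2081738111, 2385082571,
  2385082642, 2485745938, 6210287890, 6, 4492383250, 5398352914, 3, 5, 2989083848, 2, 4696876232,
  2, 3, 5, 4801023179, 5404954630, 3, 5908297928, 5404976146, 3, 4801001675, 2, 5908319432, 2, 5,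
  3992211656, 5807656139, 4499006482, 4, 2, 3992233160, 5807634635, 4498984966, 4, 2, 4,
  4499006484, 2, 3992211659, 2, 5807656136, 2, 4, 6408152264, 2, 2, 3, 4498984968, 3992233163,
  5807634632, 4, 2, 6408152267, 2, 2, 3, 5404976148, 4801001672, 3, 5404954632, 5908319435, 3,
  4801023176, 5908297931, 3, 4, 2, 14]

theorem heptad_check :
    check (fun _ => true) false isInner isInner
      (octads.map Certificate.core ++ heptads.map Certificate.core) 4 4
      [0, 7, 25] innerWords [] [] (decode heptadCode []) = true := by
  decide +kernel

theorem count_le_six (C : Finset (BTWord 7 1)) (hC : IsBig C) : count C 0 0 ≤ 6 := by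
  by_contra! h
  exact isDense_excluded (N := 7) (M := 27) (by norm_num) triple_check
    (triple_excluded (K := IsBig) heptad_check (closed_isBig false) (fun C h => ⟨h.1, h.2.2⟩)
      heptads_excluded (by norm_num)) C ⟨hC.1, h, hC.2⟩

theorem not_isBig (C : Finset (BTWord 7 1)) : ¬ IsBig C := by
  intro hC
  have h := count_le_of_corner (closed_isBig false) count_le_six C hC
  have h1 := card_eq_sum_count C
  have h2 := hC.2
  have h3 := h 0 0
  have h4 := h 1 0
  have h5 := h 0 1
  have h6 := h 1 1
  omega

end CliqueSearch

theorem mainTheorem1 :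
    BTWord.maxCard 7 1 3 = 26 ∧
    (∀ C : Finset (BTWord 7 1), BTWord.IsHammingPacking 3 C →
      C.card = 26 ∧ BTWord.minDist C = 3 ∧
      ∃ w ∈ C, ∃ x ∈ C, BTWord.dist w x = 3 ∧ BTWord.binDist w x = 3) ∧
    (∃ C : Finset (BTWord 7 1), BTWord.IsHammingPacking 3 C ∧
      ((![0], ![0, 0, 0, 0, 0, 0, 0]) : BTWord 7 1) ∈ C ∧
      ((![0], ![0, 0, 0, 0, 1, 1, 1]) : BTWord 7 1) ∈ C) :=
  CliqueSearch.main_of_not_isBig CliqueSearch.not_isBig
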